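/- Work over $\mathbb{C}$. Let $n\ge 1$, $d\ge 0$, $m\in\{2d,2d+1\}$, and let $\mathfrak{osp}(m|2n)$ be the orthosymplectic Lie superalgebra, with diagonal Cartan subalgebra $\mathfrak h$ and the usual basis $\epsilon_1,\dots,\epsilon_d,\delta_1,\dots,\delta_n$ of $\mathfrak h^*$. Put $\nu_0=0$, $\nu_l=\delta_1+\dots+\delta_l$, $\omega_d=\frac12(\epsilon_1+\dots+\epsilon_d)$ and, for $m=2d$ with $d>1$, $\omega_{d-1}=\frac12(\epsilon_1+\dots+\epsilon_{d-1}-\epsilon_d)$. Let $L_\Lambda^{m|2n}$ be the irreducible representation (on a super vector space) with highest weight $\Lambda$ for the standard positive roots, whose even part is the standard one of $\mathfrak{so}(m)\oplus\mathfrak{sp}(2n)$ and whose odd roots are $\delta_i\pm\epsilon_j$ (and $\delta_i$ if $m$ is odd); let $K_\Lambda^{m|2n}$ be the one for the positive roots in which all $\delta_i-\epsilon_j$ are replaced by $\epsilon_j-\delta_i$. Then the following decompositions of tensor products into direct sums of irreducible subrepresentations hold (irreducible representations being identified up to a shift of parity). Here $L_{\omega_d-\frac12\nu_n}$, $L_{\omega_{d-1}-\frac12\nu_n}$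 (and for $\mathfrak{osp}(2|2n)$, where $\epsilon=\epsilon_1$, $K_{\frac12\epsilon-\frac12\nu_n}$ and $K_{\frac12\epsilon+\nu_{n-1}-\frac32\nu_n}$) are the spinor representations. (1) $D(d|n)=\mathfrak{osp}(2d|2n)$, $d\ge2$. For integers $1\le j\le n$ and $l\ge1$, $$L_{\omega_d-\frac12\nu_n}^{2d|2n}\otimes L_{\nu_j}^{2d|2n}= L_{\nu_j+\omega_d-\frac12\nu_n}^{2d|2n}\oplus L_{\nu_{j-1}+\omega_{d-1}-\frac12\nu_n}^{2d|2n}\quad\text{if } j+d\ne n+1,$$ $$L_{\omega_d-\frac12\nu_n}^{2d|2n}\otimes L_{l\epsilon_1+\nu_n}^{2d|2n}= L_{l\epsilon_1+\omega_d+\frac12\nu_n}^{2d|2n}\oplus L_{(l-1)\epsilon_1+\omega_{d-1}+\frac12\nu_n}^{2d|2n},$$ $$L_{\omega_{d-1}-\frac12\nu_n}^{2d|2n}\otimes L_{\nu_j}^{2d|2n}= L_{\nu_j+\omega_{d-1}-\frac12\nu_n}^{2d|2n}\oplus L_{\nu_{j-1}+\omega_d-\frac12\nu_n}^{2d|2n}\quad\text{if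 } j+d\ne n+1,$$ $$L_{\omega_{d-1}-\frac12\nu_n}^{2d|2n}\otimes L_{l\epsilon_1+\nu_n}^{2d|2n}= L_{l\epsilon_1+\omega_{d-1}+\frac12\nu_n}^{2d|2n}\oplus L_{(l-1)\epsilon_1+\omega_d+\frac12\nu_n}^{2d|2n}.$$ (2) $C(n+1)=\mathfrak{osp}(2|2n)$. For every integer $k\ge1$ with $k\ne n$, $$K_{\frac12\epsilon-\frac12\nu_n}^{2|2n}\otimes K_{k\epsilon}^{2|2n}=K_{(k+\frac12)\epsilon-\frac12\nu_n}^{2|2n}\oplus K_{(k-\frac12)\epsilon+\nu_{n-1}-\frac32\nu_n}^{2|2n},$$ $$K_{\frac12\epsilon+\nu_{n-1}-\frac32\nu_n}^{2|2n}\otimes K_{k\epsilon}^{2|2n}=K_{(k+\frac12)\epsilon+\nu_{n-1}-\frac32\nu_n}^{2|2n}\oplus K_{(k-\frac12)\epsilon-\frac12\nu_n}^{2|2n}.$$ (3) $B(d|n)=\mathfrak{osp}(2d+1|2n)$, $d\ge1$. For integers $1\le j\le n$ and $l\ge1$, $$L_{\omega_d-\frac12\nu_n}^{2d+1|2n}\otimes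 L_{\nu_j}^{2d+1|2n}=L_{\nu_j+\omega_d-\frac12\nu_n}^{2d+1|2n}\oplus L_{\nu_{j-1}+\omega_d-\frac12\nu_n}^{2d+1|2n},$$ $$L_{\omega_d-\frac12\nu_n}^{2d+1|2n}\otimes L_{l\epsilon_1+\nu_n}^{2d+1|2n}=L_{l\epsilon_1+\omega_d+\frac12\nu_n}^{2d+1|2n}\oplus L_{(l-1)\epsilon_1+\omega_d+\frac12\nu_n}^{2d+1|2n}.$$ (4) $B(0|n)=\mathfrak{osp}(1|2n)$. For integers $1\le j<n$, $$L_{-\frac12\nu_n}^{1|2n}\otimes L_{\nu_j}^{1|2n}=L_{\nu_j-\frac12\nu_n}^{1|2n}\oplus L_{\nu_{j-1}-\frac12\nu_n}^{1|2n},$$ and $$L_{-\frac12\nu_n}^{1|2n}\otimes L_{\nu_n}^{1|2n}=L_{\frac12\nu_n}^{1|2n}\oplus L_{\frac12\nu_n-\delta_n}^{1|2n}\oplus L_{\frac12\nu_n-2\delta_n}^{1|2n}.$$ -/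

import Mathlib

open Matrix
open scoped TensorProduct

universe u v

/-- Row and column indices of matrices of `𝔬𝔰𝔭(m|2n)`, `m = 2d + r`: first the `m` indices
`(Fin d ⊕ Fin d) ⊕ Fin r` of the even part of `ℂ^{m|2n}`, then the `2n` indices of its odd part. -/
abbrev OspIdx (d r n : ℕ) : Type := ((Fin d ⊕ Fin d) ⊕ Fin r) ⊕ (Fin n ⊕ Fin n)

/-- The symmetric form `h`, with blocks `(0 I; I 0)` on `ℂ^{2d}` and the identity on `ℂ^r`. -/
def ospSymForm (d r : ℕ) : Matrix ((Fin d ⊕ Fin d) ⊕ Fin r) ((Fin d ⊕ Fin d) ⊕ Fin r) ℂ :=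
  fromBlocks (fromBlocks 0 1 1 0) 0 0 1

/-- The skew form `J = (0 I; -I 0)`. -/
def ospSkewForm (n : ℕ) : Matrix (Fin n ⊕ Fin n) (Fin n ⊕ Fin n) ℂ :=
  fromBlocks 0 1 (-1) 0

/-- The orthosymplectic metric `g = (h 0; 0 J)`. -/
def ospMetric (d r n : ℕ) : Matrix (OspIdx d r n) (OspIdx d r n) ℂ :=
  fromBlocks (ospSymForm d r) 0 0 (ospSkewForm n)

section SuperMatrices

variable {p q : Type}

/-- The supertranspose `(a b; c d) ↦ (aᵀ -cᵀ; bᵀ dᵀ)`. -/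
def superTranspose (A : Matrix (p ⊕ q) (p ⊕ q) ℂ) : Matrix (p ⊕ q) (p ⊕ q) ℂ :=
  fromBlocks A.toBlocks₁₁ᵀ (-A.toBlocks₂₁ᵀ) A.toBlocks₁₂ᵀ A.toBlocks₂₂ᵀ

/-- The even component `(a 0; 0 d)` of `(a b; c d)`. -/
def evenPart (A : Matrix (p ⊕ q) (p ⊕ q) ℂ) : Matrix (p ⊕ q) (p ⊕ q) ℂ :=
  fromBlocks A.toBlocks₁₁ 0 0 A.toBlocks₂₂

/-- The odd component `(0 b; c 0)` of `(a b; c d)`. -/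
def oddPart (A : Matrix (p ⊕ q) (p ⊕ q) ℂ) : Matrix (p ⊕ q) (p ⊕ q) ℂ :=
  fromBlocks 0 A.toBlocks₁₂ A.toBlocks₂₁ 0

/-- The bilinear extension of `[X, Y] = X Y - (-1)^{|X||Y|} Y X`. -/
def superBracket [Fintype p] [Fintype q] (A B : Matrix (p ⊕ q) (p ⊕ q) ℂ) : Matrix (p ⊕ q) (p ⊕ q) ℂ :=
  (evenPart A * evenPart B - evenPart B * evenPart A)
    + (evenPart A * oddPart B - oddPart B * evenPart A)
    + (oddPart A * evenPart B - evenPart B * oddPart A)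
    + (oddPart A * oddPart B + oddPart B * oddPart A)

theorem evenPart_idem (A : Matrix (p ⊕ q) (p ⊕ q) ℂ) : evenPart (evenPart A) = evenPart A := by
  simp [evenPart]

theorem evenPart_oddPart (A : Matrix (p ⊕ q) (p ⊕ q) ℂ) : evenPart (oddPart A) = 0 := by
  simp [evenPart, oddPart]

theorem oddPart_evenPart (A : Matrix (p ⊕ q) (p ⊕ q) ℂ) : oddPart (evenPart A) = 0 := by
  simp [evenPart, oddPart]

theorem oddPart_idem (A : Matrix (p ⊕ q) (p ⊕ q) ℂ) : oddPart (oddPart A) = oddPart A := by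
  simp [oddPart]

theorem evenPart_add_oddPart (A : Matrix (p ⊕ q) (p ⊕ q) ℂ) : evenPart A + oddPart A = A := by
  conv_rhs => rw [← fromBlocks_toBlocks A]
  simp [evenPart, oddPart, fromBlocks_add]

theorem superBracket_blocks [Fintype p] [Fintype q] (a : Matrix p p ℂ) (b : Matrix p q ℂ) (c : Matrix q p ℂ)
    (d : Matrix q q ℂ) (a' : Matrix p p ℂ) (b' : Matrix p q ℂ) (c' : Matrix q p ℂ)
    (d' : Matrix q q ℂ) :
    superBracket (fromBlocks a b c d) (fromBlocks a' b' c' d') =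
      fromBlocks (a * a' - a' * a + (b * c' + b' * c)) (a * b' - b' * d + (b * d' - a' * b))
        (d * c' - c' * a + (c * a' - d' * c)) (d * d' - d' * d + (c * b' + c' * b)) := by
  simp [superBracket, evenPart, oddPart, fromBlocks_multiply, fromBlocks_add, sub_eq_add_neg,
    fromBlocks_neg]

theorem evenPart_superBracket [Fintype p] [Fintype q] (A B : Matrix (p ⊕ q) (p ⊕ q) ℂ) :
    evenPart (superBracket A B) =
      superBracket (evenPart A) (evenPart B) + superBracket (oddPart A) (oddPart B) := by
  rw [← fromBlocks_toBlocks A, ← fromBlocks_toBlocks B]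
  simp [evenPart, oddPart, superBracket_blocks, fromBlocks_add]

theorem oddPart_superBracket [Fintype p] [Fintype q] (A B : Matrix (p ⊕ q) (p ⊕ q) ℂ) :
    oddPart (superBracket A B) =
      superBracket (evenPart A) (oddPart B) + superBracket (oddPart A) (evenPart B) := by
  rw [← fromBlocks_toBlocks A, ← fromBlocks_toBlocks B]
  simp [evenPart, oddPart, superBracket_blocks, fromBlocks_add]

end SuperMatrices

/-- The orthosymplectic Lie superalgebra `𝔬𝔰𝔭(2d+r|2n)` over `ℂ`: the matrices `A` with
`A^{sT} g + g A = 0`. -/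
def osp (d r n : ℕ) : Submodule ℂ (Matrix (OspIdx d r n) (OspIdx d r n) ℂ) where
  carrier := {A | superTranspose A * ospMetric d r n + ospMetric d r n * A = 0}
  zero_mem' := by
    have : superTranspose (0 : Matrix (OspIdx d r n) (OspIdx d r n) ℂ) = 0 := by
      ext (i | i) (j | j) <;> simp [superTranspose, toBlocks₁₁, toBlocks₁₂, toBlocks₂₁, toBlocks₂₂]
    simp [this]
  add_mem' := by
    intro A B hA hB
    have : superTranspose (A + B) = superTranspose A + superTranspose B := by
      ext (i | i) (j | j) <;>
        simp [superTranspose, toBlocks₁₁, toBlocks₁₂, toBlocks₂₁, toBlocks₂₂]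
      ring
    simp only [Set.mem_ofPred_eq] at hA hB ⊢
    rw [this, add_mul, mul_add, add_add_add_comm, hA, hB, add_zero]
  smul_mem' := by
    intro c A hA
    have : superTranspose (c • A) = c • superTranspose A := by
      ext (i | i) (j | j) <;>
        simp [superTranspose, toBlocks₁₁, toBlocks₁₂, toBlocks₂₁, toBlocks₂₂]
    simp only [Set.mem_ofPred_eq] at hA ⊢
    rw [this, smul_mul_assoc, mul_smul_comm, ← smul_add, hA, smul_zero]

theorem mem_osp_blocks {d r n : ℕ} (a : Matrix ((Fin d ⊕ Fin d) ⊕ Fin r) _ ℂ)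
    (b : Matrix ((Fin d ⊕ Fin d) ⊕ Fin r) (Fin n ⊕ Fin n) ℂ) (c) (e) :
    fromBlocks a b c e ∈ osp d r n ↔
      (aᵀ * ospSymForm d r = -(ospSymForm d r * a) ∧ cᵀ * ospSkewForm n = ospSymForm d r * b) ∧
      bᵀ * ospSymForm d r = -(ospSkewForm n * c) ∧ eᵀ * ospSkewForm n = -(ospSkewForm n * e) := by
  change superTranspose _ * ospMetric d r n + ospMetric d r n * _ = 0 ↔ _
  rw [superTranspose, ospMetric, fromBlocks_multiply, fromBlocks_multiply, fromBlocks_add,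
    show (0 : Matrix (OspIdx d r n) (OspIdx d r n) ℂ) = fromBlocks 0 0 0 0 from
      fromBlocks_zero.symm, fromBlocks_inj]
  simp [eq_neg_iff_add_eq_zero, neg_add_eq_zero, and_assoc]

theorem evenPart_mem_osp {d r n : ℕ} {A : Matrix (OspIdx d r n) (OspIdx d r n) ℂ}
    (hA : A ∈ osp d r n) : evenPart A ∈ osp d r n := by
  rw [← fromBlocks_toBlocks A, mem_osp_blocks] at hA
  rw [evenPart, mem_osp_blocks]
  simp [hA.1.1, hA.2.2]

theorem oddPart_mem_osp {d r n : ℕ} {A : Matrix (OspIdx d r n) (OspIdx d r n) ℂ}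
    (hA : A ∈ osp d r n) : oddPart A ∈ osp d r n := by
  rw [← fromBlocks_toBlocks A, mem_osp_blocks] at hA
  rw [oddPart, mem_osp_blocks]
  simp [hA.1.2, hA.2.1]

theorem superBracket_mem_osp {d r n : ℕ} {A B : Matrix (OspIdx d r n) (OspIdx d r n) ℂ}
    (hA : A ∈ osp d r n) (hB : B ∈ osp d r n) : superBracket A B ∈ osp d r n := by
  rw [← fromBlocks_toBlocks A] at hA ⊢
  rw [← fromBlocks_toBlocks B] at hB ⊢
  rw [mem_osp_blocks] at hA hB
  rw [superBracket_blocks, mem_osp_blocks]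
  obtain ⟨⟨h1, h2⟩, h3, h4⟩ := hA
  obtain ⟨⟨k1, k2⟩, k3, k4⟩ := hB
  simp only [transpose_add, transpose_sub, transpose_mul, Matrix.add_mul, Matrix.sub_mul,
    Matrix.mul_add, Matrix.mul_sub, Matrix.mul_assoc, h1, h2, h3, h4, k1, k2, k3, k4,
    Matrix.mul_neg]
  simp only [← Matrix.mul_assoc, h1, h2, h3, h4, k1, k2, k3, k4, Matrix.neg_mul]
  refine ⟨⟨?_, ?_⟩, ?_, ?_⟩ <;> abel

/-- The elements of `𝔬𝔰𝔭(2d+r|2n)`. -/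
abbrev Osp (d r n : ℕ) : Type := ↥(osp d r n)

namespace Osp

variable {d r n : ℕ}

/-- The super Lie bracket of `𝔬𝔰𝔭(2d+r|2n)`. -/
def bracket (X Y : Osp d r n) : Osp d r n :=
  ⟨superBracket X.1 Y.1, superBracket_mem_osp X.2 Y.2⟩

/-- The even component of an element. -/
def even (X : Osp d r n) : Osp d r n := ⟨evenPart X.1, evenPart_mem_osp X.2⟩

/-- The odd component of an element. -/
def odd (X : Osp d r n) : Osp d r n := ⟨oddPart X.1, oddPart_mem_osp X.2⟩

/-- `X` is homogeneous of degree `0`. -/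
def IsEven (X : Osp d r n) : Prop := X.odd = 0

/-- `X` is homogeneous of degree `1`. -/
def IsOdd (X : Osp d r n) : Prop := X.even = 0

/-- `X` lies in the Cartan subalgebra `𝔥` of diagonal matrices. -/
def IsCartan (X : Osp d r n) : Prop := X.1.IsDiag

end Osp

/-- A representation of `𝔬𝔰𝔭(2d+r|2n)` on a super vector space `V`. The `ℤ/2`-grading of `V` is
given by its parity involution, which is `1` on `V_0` and `-1` on `V_1`. -/
structure OspRep (d r n : ℕ) (V : Type*) [AddCommGroup V] [Module ℂ V] where
  /-- the parity involution -/
  parity : V →ₗ[ℂ] V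
  parity_parity : ∀ v, parity (parity v) = v
  /-- the action -/
  act : Osp d r n →ₗ[ℂ] (V →ₗ[ℂ] V)
  /-- even elements preserve the degree -/
  parity_even : ∀ X, X.IsEven → ∀ v, parity (act X v) = act X (parity v)
  /-- odd elements exchange the degrees -/
  parity_odd : ∀ X, X.IsOdd → ∀ v, parity (act X v) = -act X (parity v)
  /-- the bracket acts by the commutator if one of the two elements is even -/
  act_bracket_even : ∀ X Y, X.IsEven ∨ Y.IsEven → ∀ v,
    act (Osp.bracket X Y) v = act X (act Y v) - act Y (act X v)
  /-- the bracket of odd elements acts by the anticommutator -/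
  act_bracket_odd : ∀ X Y, X.IsOdd → Y.IsOdd → ∀ v,
    act (Osp.bracket X Y) v = act X (act Y v) + act Y (act X v)

namespace OspRep

variable {d r n : ℕ}

section Linear

/-- Taking the even component, as a linear map. -/
def evenLin (d r n : ℕ) : Osp d r n →ₗ[ℂ] Osp d r n where
  toFun := Osp.even
  map_add' X Y := Subtype.ext <| by
    ext (i | i) (j | j) <;> simp [Osp.even, evenPart, toBlocks₁₁, toBlocks₂₂]
  map_smul' c X := Subtype.ext <| by
    ext (i | i) (j | j) <;> simp [Osp.even, evenPart, toBlocks₁₁, toBlocks₂₂]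

/-- Taking the odd component, as a linear map. -/
def oddLin (d r n : ℕ) : Osp d r n →ₗ[ℂ] Osp d r n where
  toFun := Osp.odd
  map_add' X Y := Subtype.ext <| by
    ext (i | i) (j | j) <;> simp [Osp.odd, oddPart, toBlocks₁₂, toBlocks₂₁]
  map_smul' c X := Subtype.ext <| by
    ext (i | i) (j | j) <;> simp [Osp.odd, oddPart, toBlocks₁₂, toBlocks₂₁]

theorem even_isEven (X : Osp d r n) : X.even.IsEven :=
  Subtype.ext (oddPart_evenPart X.1)

theorem odd_isOdd (X : Osp d r n) : X.odd.IsOdd :=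
  Subtype.ext (evenPart_oddPart X.1)

theorem even_add_odd (X : Osp d r n) : X.even + X.odd = X :=
  Subtype.ext (evenPart_add_oddPart X.1)

theorem even_eq_self {X : Osp d r n} (h : X.IsEven) : X.even = X := by
  have := even_add_odd X
  rwa [show X.odd = 0 from h, add_zero] at this

theorem odd_eq_self {X : Osp d r n} (h : X.IsOdd) : X.odd = X := by
  have := even_add_odd X
  rwa [show X.even = 0 from h, zero_add] at this

theorem bracket_zero_left (Y : Osp d r n) : Osp.bracket 0 Y = 0 :=
  Subtype.ext <| by
    have e : evenPart (0 : Matrix (OspIdx d r n) (OspIdx d r n) ℂ) = 0 := by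
      ext (i | i) (j | j) <;> simp [evenPart, toBlocks₁₁, toBlocks₂₂]
    have o : oddPart (0 : Matrix (OspIdx d r n) (OspIdx d r n) ℂ) = 0 := by
      ext (i | i) (j | j) <;> simp [oddPart, toBlocks₁₂, toBlocks₂₁]
    simp [Osp.bracket, superBracket, e, o]

theorem bracket_zero_right (X : Osp d r n) : Osp.bracket X 0 = 0 :=
  Subtype.ext <| by
    have e : evenPart (0 : Matrix (OspIdx d r n) (OspIdx d r n) ℂ) = 0 := by
      ext (i | i) (j | j) <;> simp [evenPart, toBlocks₁₁, toBlocks₂₂]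
    have o : oddPart (0 : Matrix (OspIdx d r n) (OspIdx d r n) ℂ) = 0 := by
      ext (i | i) (j | j) <;> simp [oddPart, toBlocks₁₂, toBlocks₂₁]
    simp [Osp.bracket, superBracket, e, o]

theorem even_bracket (X Y : Osp d r n) :
    (Osp.bracket X Y).even = Osp.bracket X.even Y.even + Osp.bracket X.odd Y.odd :=
  Subtype.ext (evenPart_superBracket X.1 Y.1)

theorem odd_bracket (X Y : Osp d r n) :
    (Osp.bracket X Y).odd = Osp.bracket X.even Y.odd + Osp.bracket X.odd Y.even :=
  Subtype.ext (oddPart_superBracket X.1 Y.1)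

end Linear

variable {V W : Type*} [AddCommGroup V] [Module ℂ V] [AddCommGroup W] [Module ℂ W]

/-- The linear map underlying the tensor product action
`X (a ⊗ b) = X a ⊗ b + (-1)^{|X||a|} a ⊗ X b` (the sign is the parity involution of the first
factor if `X` is odd). -/
noncomputable def tensorAct (ρ : OspRep d r n V) (σ : OspRep d r n W) :
    Osp d r n →ₗ[ℂ] (V ⊗[ℂ] W →ₗ[ℂ] V ⊗[ℂ] W) where
  toFun X := TensorProduct.map (ρ.act X) LinearMap.id
    + TensorProduct.map LinearMap.id (σ.act X.even)
    + TensorProduct.map ρ.parity (σ.act X.odd)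
  map_add' X Y := by
    have e : (X + Y).even = X.even + Y.even := (evenLin d r n).map_add X Y
    have o : (X + Y).odd = X.odd + Y.odd := (oddLin d r n).map_add X Y
    ext a b
    simp [e, o, TensorProduct.add_tmul, TensorProduct.tmul_add]
    abel
  map_smul' c X := by
    have e : (c • X).even = c • X.even := (evenLin d r n).map_smul c X
    have o : (c • X).odd = c • X.odd := (oddLin d r n).map_smul c X
    ext a b
    simp [e, o, TensorProduct.smul_tmul']

theorem tensorAct_tmul (ρ : OspRep d r n V) (σ : OspRep d r n W) (X : Osp d r n) (a : V) (b : W) :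
    tensorAct ρ σ X (a ⊗ₜ b) =
      ρ.act X a ⊗ₜ b + a ⊗ₜ σ.act X.even b + ρ.parity a ⊗ₜ σ.act X.odd b := rfl

/-- The tensor product of two representations. -/
noncomputable def tensor (ρ : OspRep d r n V) (σ : OspRep d r n W) : OspRep d r n (V ⊗[ℂ] W) where
  parity := TensorProduct.map ρ.parity σ.parity
  parity_parity v := by
    induction v with
    | zero => simp
    | tmul a b => simp [ρ.parity_parity, σ.parity_parity]
    | add x y hx hy => simp [hx, hy]
  act := tensorAct ρ σ
  parity_even X hX v := by
    induction v with
    | zero => simp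
    | tmul a b =>
      have ho : X.odd = 0 := hX
      simp [tensorAct_tmul, even_eq_self hX, ho, ρ.parity_even X hX, σ.parity_even X hX]
    | add x y hx hy => simp [hx, hy]
  parity_odd X hX v := by
    induction v with
    | zero => simp
    | tmul a b =>
      have he : X.even = 0 := hX
      simp [tensorAct_tmul, odd_eq_self hX, he, ρ.parity_odd X hX, σ.parity_odd X hX,
        TensorProduct.neg_tmul, TensorProduct.tmul_neg]
      abel
    | add x y hx hy =>
      simp only [map_add, hx, hy]
      abel
  act_bracket_even X Y h v := by
    induction v with
    | zero => simp
    | tmul a b =>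
      rcases h with hX | hY
      · have ho : X.odd = 0 := hX
        simp only [tensorAct_tmul, map_add, even_bracket, odd_bracket, even_eq_self hX, ho,
          bracket_zero_left, add_zero, ρ.act_bracket_even X _ (Or.inl hX),
          σ.act_bracket_even X _ (Or.inl hX), ρ.parity_even X hX, map_zero, LinearMap.zero_apply,
          TensorProduct.tmul_zero, TensorProduct.sub_tmul, TensorProduct.tmul_sub]
        abel
      · have ho : Y.odd = 0 := hY
        simp only [tensorAct_tmul, map_add, even_bracket, odd_bracket, even_eq_self hY, ho,
          bracket_zero_right, add_zero, zero_add, ρ.act_bracket_even _ Y (Or.inr hY),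
          σ.act_bracket_even _ Y (Or.inr hY), ρ.parity_even Y hY, map_zero, LinearMap.zero_apply,
          TensorProduct.tmul_zero, TensorProduct.sub_tmul, TensorProduct.tmul_sub]
        abel
    | add x y hx hy =>
      simp only [map_add, hx, hy]
      abel
  act_bracket_odd X Y hX hY v := by
    induction v with
    | zero => simp
    | tmul a b =>
      have hx : X.even = 0 := hX
      have hy : Y.even = 0 := hY
      simp only [tensorAct_tmul, map_add, even_bracket, odd_bracket, odd_eq_self hX,
        odd_eq_self hY, hx, hy, bracket_zero_left, bracket_zero_right, zero_add, add_zero,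
        ρ.act_bracket_odd X Y hX hY, σ.act_bracket_odd X Y hX hY, ρ.parity_odd X hX,
        ρ.parity_odd Y hY, ρ.parity_parity, map_zero, LinearMap.zero_apply,
        TensorProduct.tmul_zero, TensorProduct.add_tmul, TensorProduct.tmul_add,
        TensorProduct.neg_tmul]
      abel
    | add x y hx hy =>
      simp only [map_add, hx, hy]
      abel

/-- `U` is a (graded) subrepresentation. -/
def IsSubrep (ρ : OspRep d r n V) (U : Submodule ℂ V) : Prop :=
  (∀ v ∈ U, ρ.parity v ∈ U) ∧ ∀ X, ∀ v ∈ U, ρ.act X v ∈ U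

/-- The restriction of a representation to a subrepresentation. -/
def restrict (ρ : OspRep d r n V) (U : Submodule ℂ V) (hU : ρ.IsSubrep U) : OspRep d r n U where
  parity := ρ.parity.restrict hU.1
  parity_parity v := Subtype.ext (ρ.parity_parity v)
  act :=
    { toFun := fun X => (ρ.act X).restrict (hU.2 X)
      map_add' := fun X Y => by ext v; simp
      map_smul' := fun c X => by ext v; simp }
  parity_even X hX v := Subtype.ext (ρ.parity_even X hX v)
  parity_odd X hX v := Subtype.ext (ρ.parity_odd X hX v)
  act_bracket_even X Y h v := Subtype.ext (ρ.act_bracket_even X Y h v)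
  act_bracket_odd X Y hX hY v := Subtype.ext (ρ.act_bracket_odd X Y hX hY v)

/-- Irreducibility: `V ≠ 0` and the only graded subrepresentations are `0` and `V`. -/
def IsIrreducible (ρ : OspRep d r n V) : Prop :=
  Nontrivial V ∧ ∀ U : Submodule ℂ V, ρ.IsSubrep U → U = ⊥ ∨ U = ⊤

end OspRep

/-- Weights: the coordinates of an element of `𝔥*` in the basis `ε_1, …, ε_d, δ_1, …, δ_n`. -/
abbrev OspWeight (d n : ℕ) : Type := Fin d ⊕ Fin n → ℂ

namespace OspWeight

variable {d n : ℕ}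

/-- The value of a weight on a matrix (used on diagonal ones): `ε_j` is the `j`-th diagonal entry
and `δ_i` is the `(m+i)`-th diagonal entry. -/
def eval {r : ℕ} (lam : OspWeight d n) (H : Matrix (OspIdx d r n) (OspIdx d r n) ℂ) : ℂ :=
  ∑ j : Fin d, lam (Sum.inl j) * H (Sum.inl (Sum.inl (Sum.inl j))) (Sum.inl (Sum.inl (Sum.inl j)))
    + ∑ i : Fin n, lam (Sum.inr i) * H (Sum.inr (Sum.inl i)) (Sum.inr (Sum.inl i))

/-- `ε_j`, for `1 ≤ j ≤ d` (zero for other `j`). -/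
def eps (j : ℕ) : OspWeight d n :=
  Sum.elim (fun a => if (a : ℕ) + 1 = j then 1 else 0) (fun _ => 0)

/-- `δ_i`, for `1 ≤ i ≤ n` (zero for other `i`). -/
def del (i : ℕ) : OspWeight d n :=
  Sum.elim (fun _ => 0) (fun a => if (a : ℕ) + 1 = i then 1 else 0)

/-- `ω_d = (ε_1 + ⋯ + ε_d) / 2`, for `𝔰𝔬(2d)` and for `𝔰𝔬(2d+1)`. -/
noncomputable def omegaLast (d n : ℕ) : OspWeight d n :=
  (1 / 2 : ℂ) • ∑ j ∈ Finset.Icc 1 d, eps j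

/-- `ω_{d-1} = (ε_1 + ⋯ + ε_{d-1} - ε_d) / 2`, for `𝔰𝔬(2d)`, `d > 1`. -/
noncomputable def omegaPrev (d n : ℕ) : OspWeight d n :=
  (1 / 2 : ℂ) • (∑ j ∈ Finset.Icc 1 (d - 1), eps j - eps d)

/-- `ν_l = δ_1 + ⋯ + δ_l`. -/
def nu (l : ℕ) : OspWeight d n := ∑ i ∈ Finset.Icc 1 l, del i

end OspWeight

open OspWeight in
/-- The positive roots of `𝔬𝔰𝔭(2d+r|2n)`, `r = 0` or `1`, that are common to the two choices of
positive roots. -/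
inductive IsCommonPosRoot (d r n : ℕ) : OspWeight d n → Prop
  | eps_sub (i j : ℕ) (hi : 1 ≤ i) (hij : i < j) (hj : j ≤ d) :
      IsCommonPosRoot d r n (eps i - eps j)
  | eps_add (i j : ℕ) (hi : 1 ≤ i) (hij : i < j) (hj : j ≤ d) :
      IsCommonPosRoot d r n (eps i + eps j)
  | eps_short (j : ℕ) (hr : r = 1) (hi : 1 ≤ j) (hj : j ≤ d) : IsCommonPosRoot d r n (eps j)
  | del_sub (i j : ℕ) (hi : 1 ≤ i) (hij : i < j) (hj : j ≤ n) :
      IsCommonPosRoot d r n (del i - del j)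
  | del_add (i j : ℕ) (hi : 1 ≤ i) (hij : i ≤ j) (hj : j ≤ n) :
      IsCommonPosRoot d r n (del i + del j)
  | odd_add (j i : ℕ) (hj : 1 ≤ j) (hj' : j ≤ d) (hi : 1 ≤ i) (hi' : i ≤ n) :
      IsCommonPosRoot d r n (eps j + del i)
  | odd_short (i : ℕ) (hr : r = 1) (hi : 1 ≤ i) (hi' : i ≤ n) : IsCommonPosRoot d r n (del i)

open OspWeight in
/-- The standard choice of positive roots, which contains the odd roots `δ_i - ε_j`. -/
def standardPosRoots (d r n : ℕ) : Set (OspWeight d n) :=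
  {α | IsCommonPosRoot d r n α ∨
    ∃ i j : ℕ, (1 ≤ i ∧ i ≤ n) ∧ (1 ≤ j ∧ j ≤ d) ∧ α = del i - eps j}

open OspWeight in
/-- The choice of positive roots that contains the odd roots `ε_j - δ_i` instead; for `d = 1`,
`r = 0` it is the distinguished one of `C(n+1) = 𝔬𝔰𝔭(2|2n)`. -/
def reversedPosRoots (d r n : ℕ) : Set (OspWeight d n) :=
  {α | IsCommonPosRoot d r n α ∨
    ∃ i j : ℕ, (1 ≤ i ∧ i ≤ n) ∧ (1 ≤ j ∧ j ≤ d) ∧ α = eps j - del i}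

/-- `X` lies in the root space of `α`: `[H, X] = α(H) X` for all `H ∈ 𝔥`. -/
def Osp.InRootSpace {d r n : ℕ} (X : Osp d r n) (α : OspWeight d n) : Prop :=
  ∀ H : Osp d r n, H.IsCartan → Osp.bracket H X = α.eval H.1 • X

namespace OspRep

variable {d r n : ℕ} {V : Type*} [AddCommGroup V] [Module ℂ V]

/-- `v` is a (nonzero, homogeneous) highest weight vector of weight `lam` with respect to the
positive roots `P`. -/
def IsHighestWeightVector (ρ : OspRep d r n V) (P : Set (OspWeight d n)) (lam : OspWeight d n)
    (v : V) : Prop :=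
  v ≠ 0 ∧ (ρ.parity v = v ∨ ρ.parity v = -v) ∧
    (∀ H : Osp d r n, H.IsCartan → ρ.act H v = lam.eval H.1 • v) ∧
    ∀ α ∈ P, ∀ X : Osp d r n, X.InRootSpace α → ρ.act X v = 0

/-- `ρ` is (a model of) the irreducible representation with highest weight `lam` with respect to
the positive roots `P`. -/
def IsIrrepOfHighestWeight (ρ : OspRep d r n V) (P : Set (OspWeight d n))
    (lam : OspWeight d n) : Prop :=
  ρ.IsIrreducible ∧ ∃ v, ρ.IsHighestWeightVector P lam v

/-- `ρ` is the direct sum of subrepresentations that are the irreducible representations with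
highest weights `mu 0, mu 1, …`. -/
def DecomposesInto {k : ℕ} (ρ : OspRep d r n V) (P : Set (OspWeight d n))
    (mu : Fin k → OspWeight d n) : Prop :=
  ∃ (A : Fin k → Submodule ℂ V) (hA : ∀ i, ρ.IsSubrep (A i)), DirectSum.IsInternal A ∧
    ∀ i, (ρ.restrict (A i) (hA i)).IsIrrepOfHighestWeight P (mu i)

end OspRep

/-- For the irreducible representations `L_lam` and `L_kap` of `𝔬𝔰𝔭(2d+r|2n)` with highest weights
`lam` and `kap` with respect to the positive roots `P`: `L_lam ⊗ L_kap = ⨁ i, L_(mu i)`. -/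
def OspTensorDecomposition {d n k : ℕ} (r : ℕ) (P : Set (OspWeight d n))
    (lam kap : OspWeight d n) (mu : Fin k → OspWeight d n) : Prop :=
  ∀ (V : Type u) [AddCommGroup V] [Module ℂ V] (W : Type v) [AddCommGroup W] [Module ℂ W]
    (ρ : OspRep d r n V) (σ : OspRep d r n W),
    ρ.IsIrrepOfHighestWeight P lam → σ.IsIrrepOfHighestWeight P kap →
      (ρ.tensor σ).DecomposesInto P mu

open OspWeight

noncomputable section

open Submodule (smul_mem span mem_span_singleton subset_span mem_sup mem_iSup_of_mem mem_span_singleton_self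
  span_le mem_bot span_singleton_le_iff_mem mem_sup_left mem_sup_right iSup_induction span_induction)
open Finset (sum_congr sum_sub_distrib sum_add_distrib mem_univ sum_ite_eq' smul_sum sum_eq_single sum_comm
  sum_eq_zero mul_sum sum_neg_distrib sum_ite_eq)
open TensorProduct (smul_tmul' tmul_smul tmul_neg neg_tmul tmul_zero tmul_add)
open LinearMap (ker mem_ker ker_eq_bot ker_eq_bot' rTensor)
open MvPolynomial (pderiv aeval pderiv_C pderiv_X aeval_X aeval_C)
open Function (iterate_succ_apply')
open Set (singleton_subset_iff)

section SuperIndices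

variable {p q : Type}

/-- The sign `(-1)^{|a|}` of an index. -/
def superSign : p ⊕ q → ℂ
  | .inl _ => 1
  | .inr _ => -1

/-- The sign `(-1)^{(|a| + |b|)(|b| + |c|)}`. -/
def braidSign (a b c : p ⊕ q) : ℂ :=
  (1 + superSign a * superSign b + superSign b * superSign c - superSign a * superSign c) / 2

theorem superSign_sq (a : p ⊕ q) : superSign a * superSign a = 1 := by
  rcases a with a | a <;> simp [superSign]

theorem braidSign_sq (a b c : p ⊕ q) : braidSign a b c * braidSign a b c = 1 := by
  rcases a with a | a <;> rcases b with b | b <;> rcases c with c | c <;>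
    norm_num [braidSign, superSign]

theorem superBracket_apply [Fintype p] [Fintype q] (A B : Matrix (p ⊕ q) (p ⊕ q) ℂ) (i j : p ⊕ q) :
    superBracket A B i j = ∑ k, (A i k * B k j - braidSign i k j * (B i k * A k j)) := by
  rcases i with i | i <;> rcases j with j | j <;>
    simp [superBracket, evenPart, oddPart, mul_apply, Fintype.sum_sum_type, braidSign, superSign,
      toBlocks₁₁, toBlocks₁₂, toBlocks₂₁, toBlocks₂₂, sum_sub_distrib] <;>
    norm_num <;> ring

theorem evenPart_apply (A : Matrix (p ⊕ q) (p ⊕ q) ℂ) (i j : p ⊕ q) :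
    evenPart A i j = (1 + superSign i * superSign j) / 2 * A i j := by
  rcases i with i | i <;> rcases j with j | j <;>
    simp [evenPart, superSign, toBlocks₁₁, toBlocks₂₂]

theorem oddPart_apply (A : Matrix (p ⊕ q) (p ⊕ q) ℂ) (i j : p ⊕ q) :
    oddPart A i j = (1 - superSign i * superSign j) / 2 * A i j := by
  rcases i with i | i <;> rcases j with j | j <;>
    simp [oddPart, superSign, toBlocks₁₂, toBlocks₂₁]

end SuperIndices

namespace OspIdx

variable {d r n : ℕ}

/-- The index dual to a given one under the orthosymplectic metric. -/
def dual : OspIdx d r n → OspIdx d r n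
  | .inl (.inl x) => .inl (.inl x.swap)
  | .inl (.inr k) => .inl (.inr k)
  | .inr x => .inr x.swap

/-- The nonzero entry of the orthosymplectic metric in a given row. -/
def metricSign : OspIdx d r n → ℂ
  | .inr (.inr _) => -1
  | _ => 1

/-- Membership in `𝔬𝔰𝔭` relates the entries `(a, b)` and `(b', a')` by the factor
`-reflectSign a b`. -/
def reflectSign (a b : OspIdx d r n) : ℂ :=
  metricSign (dual a) * metricSign (dual b) *
    ((1 - superSign a + superSign b + superSign a * superSign b) / 2)

@[simp] theorem dual_dual (a : OspIdx d r n) : dual (dual a) = a := by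
  rcases a with (a | a) | a <;> simp [dual]

theorem dual_eq_comm {a b : OspIdx d r n} : dual a = b ↔ a = dual b :=
  ⟨fun h => by rw [← h, dual_dual], fun h => by rw [h, dual_dual]⟩

theorem dual_injective : Function.Injective (dual : OspIdx d r n → OspIdx d r n) :=
  fun a b h => by rw [← dual_dual a, h, dual_dual]

@[simp] theorem dual_inj {a b : OspIdx d r n} : dual a = dual b ↔ a = b := dual_injective.eq_iff

/-- Duality as a permutation of the indices. -/
def dualEquiv : OspIdx d r n ≃ OspIdx d r n := ⟨dual, dual, dual_dual, dual_dual⟩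

@[simp] theorem superSign_dual (a : OspIdx d r n) : superSign (dual a) = superSign a := by
  rcases a with (a | a) | a <;> simp [dual, superSign]

theorem metricSign_sq (a : OspIdx d r n) : metricSign a * metricSign a = 1 := by
  rcases a with (a | a) | a | a <;> simp [metricSign]

theorem metricSign_dual (a : OspIdx d r n) : metricSign (dual a) = superSign a * metricSign a := by
  rcases a with ((a | a) | a) | a | a <;> simp [metricSign, dual, superSign]

theorem reflectSign_dual (a b : OspIdx d r n) :
    reflectSign a b * reflectSign (dual b) (dual a) = 1 := by
  rcases a with ((a | a) | a) | a | a <;> rcases b with ((b | b) | b) | b | b <;>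
    norm_num [reflectSign, metricSign, dual, superSign]

theorem reflectSign_self (a : OspIdx d r n) : reflectSign a a = 1 := by
  rcases a with ((a | a) | a) | a | a <;>
    norm_num [reflectSign, metricSign, dual, superSign]

theorem reflectSign_dual_self (a : OspIdx d r n) : reflectSign a (dual a) = superSign a := by
  rcases a with ((a | a) | a) | a | a <;>
    norm_num [reflectSign, metricSign, dual, superSign]

theorem reflectSign_mul (a b c : OspIdx d r n) :
    reflectSign a b * reflectSign b c = braidSign a b c * reflectSign a c := by
  have h := metricSign_sq (dual b)
  rcases a with a | a <;> rcases b with b | b <;> rcases c with c | c <;>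
    simp only [reflectSign, braidSign, superSign] <;> ring_nf <;>
    rw [show metricSign (dual _) ^ 2 = 1 by rw [pow_two]; exact h] <;> ring

end OspIdx

open OspIdx

theorem ospMetric_apply {d r n : ℕ} (a b : OspIdx d r n) :
    ospMetric d r n a b = if b = dual a then metricSign a else 0 := by
  rcases a with ((a | a) | a) | a | a <;> rcases b with ((b | b) | b) | b | b <;>
    simp [ospMetric, ospSymForm, ospSkewForm, dual, metricSign, Matrix.one_apply, eq_comm, Matrix.neg_apply]
  split_ifs <;> simp

theorem mem_osp_iff {d r n : ℕ} {A : Matrix (OspIdx d r n) (OspIdx d r n) ℂ} :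
    A ∈ osp d r n ↔ ∀ a b, A a b = -reflectSign a b * A (dual b) (dual a) := by
  have key : ∀ a b, (superTranspose A * ospMetric d r n + ospMetric d r n * A) (dual a) b =
      metricSign (dual a) * (A a b + reflectSign a b * A (dual b) (dual a)) := by
    intro a b
    have h1 : ∀ k, ospMetric d r n k b = if k = dual b then metricSign (dual b) else 0 := by
      intro k
      rw [ospMetric_apply]
      by_cases h : k = dual b
      · simp [h]
      · rw [if_neg h, if_neg (fun h' => h (by rw [h', dual_dual]))]
    rw [Matrix.add_apply, mul_apply, mul_apply]
    simp only [ospMetric_apply (dual a), h1, dual_dual]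
    simp only [mul_ite, mul_zero, ite_mul, zero_mul, sum_ite_eq',
      mem_univ, if_true]
    rcases a with ((a | a) | a) | a | a <;> rcases b with ((b | b) | b) | b | b <;>
      norm_num [reflectSign, metricSign, dual, superSign, superTranspose, toBlocks₁₁, toBlocks₁₂,
        toBlocks₂₁, toBlocks₂₂] <;> ring
  change superTranspose A * ospMetric d r n + ospMetric d r n * A = 0 ↔ _
  constructor
  · intro h a b
    have h1 := key a b
    rw [h] at h1
    have h2 : metricSign (dual a) ≠ 0 := fun h0 => by
      have := metricSign_sq (dual a); simp [h0] at this
    have h3 := (mul_eq_zero.mp h1.symm).resolve_left h2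
    linear_combination h3
  · intro h
    ext a b
    rw [← dual_dual a, key, h]
    simp

namespace Osp

variable {d r n : ℕ}

/-- The element of `𝔬𝔰𝔭` obtained from the matrix unit `E_{ab}` by antisymmetrization; for `a ≠ b`
it is a root vector or zero. -/
def rootVec (a b : OspIdx d r n) : Osp d r n :=
  ⟨Matrix.of fun i j => (if i = a ∧ j = b then 1 else 0)
      - reflectSign i j * (if dual j = a ∧ dual i = b then 1 else 0), by
    rw [mem_osp_iff]
    intro i j
    have := reflectSign_dual i j
    simp only [Matrix.of_apply, dual_dual]
    linear_combination (-(if i = a ∧ j = b then (1 : ℂ) else 0)) * this⟩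

theorem rootVec_apply (a b i j : OspIdx d r n) :
    (rootVec a b).1 i j = (if i = a ∧ j = b then 1 else 0)
      - reflectSign i j * (if dual j = a ∧ dual i = b then 1 else 0) := rfl

theorem apply_dual (X : Osp d r n) (a b : OspIdx d r n) :
    X.1 a b = -reflectSign a b * X.1 (dual b) (dual a) := mem_osp_iff.1 X.2 a b

theorem sum_rootVec (X : Osp d r n) : (2 : ℂ) • X = ∑ a, ∑ b, X.1 a b • rootVec a b := by
  apply Subtype.ext
  ext i j
  have h := apply_dual X i j
  simp only [Submodule.coe_smul, Matrix.smul_apply, smul_eq_mul, Submodule.coe_sum, Matrix.sum_apply,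
    rootVec_apply, mul_sub, sum_sub_distrib, ite_and, mul_ite, mul_one, mul_zero]
  have e1 : ∑ x, ∑ x_1, (if i = x then if j = x_1 then X.1 x x_1 else 0 else 0) = X.1 i j := by
    rw [sum_comm]; simp
  have e2 : ∑ x, ∑ x_1, (if dual j = x then if dual i = x_1 then X.1 x x_1 * reflectSign i j else 0 else 0)
      = X.1 (dual j) (dual i) * reflectSign i j := by
    rw [sum_comm]; simp
  rw [e1, e2, h]; ring

theorem rootVec_dual (a b : OspIdx d r n) :
    rootVec (dual b) (dual a) = -reflectSign a b • rootVec a b := by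
  apply Subtype.ext
  ext i j
  simp only [Submodule.coe_smul, Matrix.smul_apply, smul_eq_mul, rootVec_apply, dual_inj]
  have e1 : (i = dual b ∧ j = dual a) ↔ (dual j = a ∧ dual i = b) :=
    ⟨fun h => by simp [h.1, h.2], fun h => by simp [← h.1, ← h.2]⟩
  have h1 : reflectSign a b * (if i = a ∧ j = b then (1 : ℂ) else 0)
      = reflectSign i j * (if j = b ∧ i = a then (1 : ℂ) else 0) := by
    by_cases h : i = a ∧ j = b
    · simp [h.1, h.2]
    · rw [if_neg h, if_neg (fun h' => h h'.symm)]; simp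
  have h2 : reflectSign a b * (reflectSign i j * (if dual j = a ∧ dual i = b then (1 : ℂ) else 0))
      = if dual j = a ∧ dual i = b then (1 : ℂ) else 0 := by
    by_cases h : dual j = a ∧ dual i = b
    · rw [if_pos h, ← h.1, ← h.2]; linear_combination reflectSign_dual i j
    · rw [if_neg h]; simp
  rw [if_congr e1 rfl rfl]
  linear_combination h1 - h2

theorem bracket_apply (X Y : Osp d r n) (i j : OspIdx d r n) :
    (bracket X Y).1 i j = ∑ k, (X.1 i k * Y.1 k j - braidSign i k j * (Y.1 i k * X.1 k j)) :=
  superBracket_apply _ _ _ _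

theorem bracket_rootVec (Y : Osp d r n) (a b : OspIdx d r n) :
    bracket Y (rootVec a b) = ∑ e, Y.1 e a • rootVec e b - ∑ e, (braidSign a b e * Y.1 b e) • rootVec a e := by
  apply Subtype.ext
  ext i j
  rw [bracket_apply]
  simp only [Submodule.coe_sub, Submodule.coe_sum, Submodule.coe_smul, Matrix.sub_apply, Matrix.sum_apply,
    Matrix.smul_apply, smul_eq_mul, rootVec_apply, mul_sub, sub_mul, sum_sub_distrib]
  have s1 : ∑ x, Y.1 i x * (if x = a ∧ j = b then 1 else 0) = ∑ x, Y.1 x a * (if i = x ∧ j = b then 1 else 0) := by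
    simp [ite_and]
  have s2 : ∑ x, braidSign i x j * ((if i = a ∧ x = b then 1 else 0) * Y.1 x j)
      = ∑ x, braidSign a b x * Y.1 b x * (if i = a ∧ j = x then 1 else 0) := by
    by_cases h : i = a
    · simp [h, -Fintype.sum_sum_type]
    · simp [h]
  have s3 : ∑ x, Y.1 i x * (reflectSign x j * if dual j = a ∧ dual x = b then 1 else 0)
      = - ∑ x, braidSign a b x * Y.1 b x * (reflectSign i j * if dual j = a ∧ dual i = x then 1 else 0) := by
    by_cases h : dual j = a
    · obtain rfl := dual_eq_comm.1 h
      simp only [dual_eq_comm (b := b), dual_dual, true_and, mul_ite, mul_one, mul_zero,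
        sum_ite_eq', sum_ite_eq, mem_univ, if_true]
      rw [apply_dual Y i (dual b), dual_dual]
      have := reflectSign_mul i (dual b) (dual a)
      rw [show braidSign i (dual b) (dual a) = braidSign a b (dual i) by
        simp only [braidSign, superSign_dual]; ring] at this
      linear_combination -Y.1 b (dual i) * this
    · simp [h]
  have s4 : ∑ x, braidSign i x j * (reflectSign i x * (if dual x = a ∧ dual i = b then 1 else 0) * Y.1 x j)
      = - ∑ x, Y.1 x a * (reflectSign i j * if dual j = x ∧ dual i = b then 1 else 0) := by
    by_cases h : dual i = b
    · simp only [dual_eq_comm (b := a), h, and_true, mul_ite, mul_one, mul_zero, ite_mul, zero_mul,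
        sum_ite_eq', sum_ite_eq, mem_univ, if_true]
      rw [apply_dual Y (dual a) j, dual_dual]
      have := reflectSign_mul i (dual a) j
      linear_combination -Y.1 (dual j) a * braidSign i (dual a) j * this
        - Y.1 (dual j) a * reflectSign i j * braidSign_sq i (dual a) j
    · simp [h]
  rw [s1, s2, s3, s4]
  ring

end Osp

/-- A `ℤ`-grading of the index set, antisymmetric under duality; it induces a grading of
`𝔬𝔰𝔭` in which `rootVec a b` has degree `ht a - ht b`. -/
structure OspHeight (d r n : ℕ) where
  /-- the degree of an index -/
  toFun : OspIdx d r n → ℤ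
  map_dual' : ∀ a, toFun (dual a) = -toFun a

namespace OspHeight

variable {d r n : ℕ}

instance : CoeFun (OspHeight d r n) (fun _ => OspIdx d r n → ℤ) := ⟨toFun⟩

theorem map_dual (ht : OspHeight d r n) (a : OspIdx d r n) : ht (dual a) = -ht a := ht.map_dual' a

end OspHeight

namespace Osp

variable {d r n : ℕ}

theorem rootVec_apply_ne {a b i j : OspIdx d r n} (h : (rootVec a b).1 i j ≠ 0) :
    (i = a ∧ j = b) ∨ (i = dual b ∧ j = dual a) := by
  rw [rootVec_apply] at h
  by_cases h1 : i = a ∧ j = b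
  · exact Or.inl h1
  · by_cases h2 : dual j = a ∧ dual i = b
    · exact Or.inr ⟨by rw [← h2.2, dual_dual], by rw [← h2.1, dual_dual]⟩
    · simp [h1, h2] at h

theorem bracket_apply_ne {X Y : Osp d r n} {i j : OspIdx d r n} (h : (bracket X Y).1 i j ≠ 0) :
    ∃ k, (X.1 i k ≠ 0 ∧ Y.1 k j ≠ 0) ∨ (Y.1 i k ≠ 0 ∧ X.1 k j ≠ 0) := by
  rw [bracket_apply] at h
  obtain ⟨k, -, hk⟩ := Finset.exists_ne_zero_of_sum_ne_zero h
  refine ⟨k, ?_⟩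
  by_contra hc
  push Not at hc
  apply hk
  by_cases h1 : X.1 i k = 0
  · by_cases h2 : Y.1 i k = 0
    · simp [h1, h2]
    · simp [h1, hc.2 h2]
  · by_cases h2 : Y.1 i k = 0
    · simp [hc.1 h1, h2]
    · simp [hc.1 h1, hc.2 h2]

theorem rootVec_isEven {a b : OspIdx d r n} (h : superSign a * superSign b = 1) :
    (rootVec a b).IsEven := by
  apply Subtype.ext
  ext i j
  change oddPart (rootVec a b).1 i j = 0
  rw [oddPart_apply]
  by_cases h0 : (rootVec a b).1 i j = 0
  · simp [h0]
  · rcases rootVec_apply_ne h0 with ⟨rfl, rfl⟩ | ⟨rfl, rfl⟩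
    · simp [h]
    · simp [mul_comm, h]

theorem rootVec_isOdd {a b : OspIdx d r n} (h : superSign a * superSign b = -1) :
    (rootVec a b).IsOdd := by
  apply Subtype.ext
  ext i j
  change evenPart (rootVec a b).1 i j = 0
  rw [evenPart_apply]
  by_cases h0 : (rootVec a b).1 i j = 0
  · simp [h0]
  · rcases rootVec_apply_ne h0 with ⟨rfl, rfl⟩ | ⟨rfl, rfl⟩
    · simp [h]
    · simp [mul_comm, h]

theorem superSign_mul_eq (a b : OspIdx d r n) :
    superSign a * superSign b = 1 ∨ superSign a * superSign b = -1 := by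
  rcases a with a | a <;> rcases b with b | b <;> simp [superSign]

theorem IsCartan.isEven {H : Osp d r n} (hH : H.IsCartan) : H.IsEven := by
  apply Subtype.ext
  ext i j
  change oddPart H.1 i j = 0
  rw [oddPart_apply]
  by_cases h : i = j
  · subst h; simp [superSign_sq]
  · rw [hH h, mul_zero]

/-- The bracket of a diagonal matrix with a root vector. -/
theorem IsCartan.bracket_rootVec {H : Osp d r n} (hH : H.IsCartan) (a b : OspIdx d r n) :
    bracket H (rootVec a b) = (H.1 a a - H.1 b b) • rootVec a b := by
  rw [Osp.bracket_rootVec, sum_eq_single a, sum_eq_single b]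
  · have : braidSign a b b = 1 := by
      rcases a with a | a <;> rcases b with b | b <;> norm_num [braidSign, superSign]
    rw [this, one_mul]
    exact (sub_smul _ _ _).symm
  · intro e _ he; rw [hH (Ne.symm he)]; simp
  · simp
  · intro e _ he; rw [hH he]; simp
  · simp

theorem rootVec_self_isCartan (a : OspIdx d r n) : (rootVec a a).IsCartan := by
  intro i j hij
  by_contra h
  rcases rootVec_apply_ne h with ⟨rfl, rfl⟩ | ⟨rfl, rfl⟩ <;> exact hij rfl

/-- The diagonal matrix in `𝔬𝔰𝔭` whose adjoint action induces a given grading. -/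
def grad (ht : OspHeight d r n) : Osp d r n :=
  ⟨Matrix.diagonal fun a => (ht a : ℂ), by
    rw [mem_osp_iff]
    intro a b
    by_cases h : a = b
    · subst h
      simp [ht.map_dual, reflectSign_self]
    · have h2 : dual b ≠ dual a := fun h' => h (dual_injective h').symm
      simp [h, h2]⟩

theorem grad_isCartan (ht : OspHeight d r n) : (grad ht).IsCartan := by
  intro i j hij
  exact Matrix.diagonal_apply_ne _ hij

theorem grad_apply_self (ht : OspHeight d r n) (a : OspIdx d r n) : (grad ht).1 a a = ht a :=
  Matrix.diagonal_apply_eq _ _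

end Osp

open Osp (grad rootVec grad_isCartan superSign_mul_eq rootVec_apply_ne rootVec_isEven rootVec_isOdd
  grad_apply_self)

namespace OspWeight

variable {d r n : ℕ}

/-- The values of a weight on the diagonal elements `rootVec a a`. -/
def ext (lam : OspWeight d n) : OspIdx d r n → ℂ
  | .inl (.inl (.inl j)) => lam (.inl j)
  | .inl (.inl (.inr j)) => -lam (.inl j)
  | .inl (.inr _) => 0
  | .inr (.inl i) => lam (.inr i)
  | .inr (.inr i) => -lam (.inr i)

theorem eval_eq_sum (lam : OspWeight d n) (X : Osp d r n) :
    lam.eval X.1 = (1 / 2 : ℂ) * ∑ a, X.1 a a * ext lam a := by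
  have h : ∀ a : OspIdx d r n, X.1 (dual a) (dual a) = -X.1 a a := by
    intro a
    have := Osp.apply_dual X a a
    rw [reflectSign_self] at this
    linear_combination this
  simp only [Fintype.sum_sum_type, ext, eval]
  have h1 : ∀ j : Fin d, X.1 (.inl (.inl (.inr j))) (.inl (.inl (.inr j))) =
      -X.1 (.inl (.inl (.inl j))) (.inl (.inl (.inl j))) := fun j => h (.inl (.inl (.inl j)))
  have h2 : ∀ j : Fin n, X.1 (.inr (.inr j)) (.inr (.inr j)) =
      -X.1 (.inr (.inl j)) (.inr (.inl j)) := fun j => h (.inr (.inl j))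
  simp only [h1, h2, neg_mul_neg, mul_zero, Finset.sum_const_zero, add_zero]
  simp only [mul_comm (lam _)]
  ring

theorem eval_rootVec_self (lam : OspWeight d n) (a : OspIdx d r n) :
    lam.eval (rootVec a a).1 = ext lam a := by
  rcases a with ((a | a) | a) | a | a <;>
    simp [eval, Osp.rootVec_apply, reflectSign_self, dual, ext]

theorem ext_dual (lam : OspWeight d n) (a : OspIdx d r n) : ext lam (dual a) = -ext lam a := by
  rcases a with ((a | a) | a) | a | a <;> simp [dual, ext]

theorem ext_add (lam mu : OspWeight d n) (a : OspIdx d r n) :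
    ext (lam + mu) a = ext lam a + ext mu a := by
  rcases a with ((a | a) | a) | a | a <;> simp [ext] <;> ring

theorem ext_neg (lam : OspWeight d n) (a : OspIdx d r n) : ext (-lam) a = -ext lam a := by
  rcases a with ((a | a) | a) | a | a <;> simp [ext]

theorem ext_sub (lam mu : OspWeight d n) (a : OspIdx d r n) :
    ext (lam - mu) a = ext lam a - ext mu a := by
  rw [sub_eq_add_neg, ext_add, ext_neg, sub_eq_add_neg]

theorem ext_smul (c : ℂ) (lam : OspWeight d n) (a : OspIdx d r n) :
    ext (c • lam) a = c * ext lam a := by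
  rcases a with ((a | a) | a) | a | a <;> simp [ext]

end OspWeight

namespace OspRep

variable {d r n : ℕ} {V : Type*} [AddCommGroup V] [Module ℂ V] (ρ : OspRep d r n V)

/-- The action of the root vector `rootVec a b`. -/
def root (a b : OspIdx d r n) : V →ₗ[ℂ] V := ρ.act (rootVec a b)

theorem act_eq_sum (X : Osp d r n) (v : V) :
    ρ.act X v = (1 / 2 : ℂ) • ∑ a, ∑ b, X.1 a b • ρ.root a b v := by
  have h := congrArg (fun Y => ρ.act Y v) (Osp.sum_rootVec X)
  simp only [map_smul, map_sum, LinearMap.smul_apply, LinearMap.sum_apply] at h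
  have h2 : ρ.act X v = (1 / 2 : ℂ) • ((2 : ℂ) • ρ.act X v) := by
    rw [smul_smul]; norm_num
  rw [h2, h]
  rfl

theorem act_mem_of_root_mem {U : Submodule ℂ V} {X : Osp d r n} {v : V}
    (h : ∀ a b, X.1 a b ≠ 0 → ρ.root a b v ∈ U) : ρ.act X v ∈ U := by
  rw [act_eq_sum]
  refine U.smul_mem _ (U.sum_mem fun a _ => U.sum_mem fun b _ => ?_)
  by_cases h0 : X.1 a b = 0
  · simp [h0]
  · exact U.smul_mem _ (h a b h0)

theorem act_eq_zero_of_root {X : Osp d r n} {v : V}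
    (h : ∀ a b, X.1 a b ≠ 0 → ρ.root a b v = 0) : ρ.act X v = 0 := by
  have := ρ.act_mem_of_root_mem (U := ⊥) (X := X) (v := v) (fun a b hab => by simp [h a b hab])
  simpa using this

/-- The sign in the commutation of `rootVec a b` and `rootVec c d`. -/
def commSign (a b c e : OspIdx d r n) : ℂ :=
  (1 + superSign a * superSign b + superSign c * superSign e
    - superSign a * superSign b * (superSign c * superSign e)) / 2

theorem root_root (a b c e : OspIdx d r n) (v : V) :
    ρ.root a b (ρ.root c e v) = ρ.act (Osp.bracket (rootVec a b) (rootVec c e)) v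
      + commSign a b c e • ρ.root c e (ρ.root a b v) := by
  rcases superSign_mul_eq a b with h1 | h1
  · rw [ρ.act_bracket_even _ _ (Or.inl (rootVec_isEven h1))]
    simp [commSign, h1, root]
  · rcases superSign_mul_eq c e with h2 | h2
    · rw [ρ.act_bracket_even _ _ (Or.inr (rootVec_isEven h2))]
      simp [commSign, h1, h2, root]
    · rw [ρ.act_bracket_odd _ _ (rootVec_isOdd h1) (rootVec_isOdd h2)]
      norm_num [commSign, h1, h2, root]

theorem act_root_of_isEven {Y : Osp d r n} (hY : Y.IsEven) (a b : OspIdx d r n) (v : V) :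
    ρ.act Y (ρ.root a b v) = ρ.act (Osp.bracket Y (rootVec a b)) v + ρ.root a b (ρ.act Y v) := by
  rw [ρ.act_bracket_even _ _ (Or.inl hY)]
  simp [root]

theorem act_root_of_isOdd {Y : Osp d r n} (hY : Y.IsOdd) (a b : OspIdx d r n) (v : V) :
    ρ.act Y (ρ.root a b v) = ρ.act (Osp.bracket Y (rootVec a b)) v
      + (superSign a * superSign b) • ρ.root a b (ρ.act Y v) := by
  rcases superSign_mul_eq a b with h1 | h1
  · rw [ρ.act_bracket_even _ _ (Or.inr (rootVec_isEven h1)), h1]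
    simp [root]
  · rw [ρ.act_bracket_odd _ _ hY (rootVec_isOdd h1), h1]
    simp [root]

theorem parity_root (a b : OspIdx d r n) (v : V) :
    ρ.parity (ρ.root a b v) = (superSign a * superSign b) • ρ.root a b (ρ.parity v) := by
  rcases superSign_mul_eq a b with h | h
  · rw [h, one_smul]; exact ρ.parity_even _ (rootVec_isEven h) v
  · rw [h, neg_one_smul]; exact ρ.parity_odd _ (rootVec_isOdd h) v

theorem root_dual (a b : OspIdx d r n) (v : V) :
    ρ.root (dual b) (dual a) v = -reflectSign a b • ρ.root a b v := by
  rw [root, Osp.rootVec_dual]; simp [root]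

theorem act_cartan_root {H : Osp d r n} (hH : H.IsCartan) (a b : OspIdx d r n) (v : V) :
    ρ.act H (ρ.root a b v) = (H.1 a a - H.1 b b) • ρ.root a b v + ρ.root a b (ρ.act H v) := by
  rw [act_root_of_isEven _ hH.isEven, hH.bracket_rootVec]
  simp [root]

theorem isSubrep_of_root {U : Submodule ℂ V} (hp : ∀ v ∈ U, ρ.parity v ∈ U)
    (h : ∀ v ∈ U, ∀ a b, ρ.root a b v ∈ U) : ρ.IsSubrep U :=
  ⟨hp, fun _ v hv => ρ.act_mem_of_root_mem fun a b _ => h v hv a b⟩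

/-- `v` has weight `lam`. -/
def IsWeightVec (lam : OspWeight d n) (v : V) : Prop := ∀ a : OspIdx d r n, ρ.root a a v = lam.ext a • v

variable {ρ} in
theorem IsWeightVec.act {lam : OspWeight d n} {v : V} (hv : ρ.IsWeightVec lam v) {H : Osp d r n}
    (hH : H.IsCartan) : ρ.act H v = lam.eval H.1 • v := by
  rw [act_eq_sum, OspWeight.eval_eq_sum, mul_smul, Finset.sum_smul]
  congr 1
  refine sum_congr rfl fun a _ => ?_
  rw [sum_eq_single a, hv a, smul_smul]
  · intro b _ hb; rw [hH (Ne.symm hb), zero_smul]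
  · simp

theorem isWeightVec_iff {lam : OspWeight d n} {v : V} : ρ.IsWeightVec lam v ↔
    ∀ H : Osp d r n, H.IsCartan → ρ.act H v = lam.eval H.1 • v :=
  ⟨fun h _ hH => h.act hH, fun h a => by
    rw [root, h _ (Osp.rootVec_self_isCartan a), OspWeight.eval_rootVec_self]⟩

/-! ### Generated subrepresentations -/

/-- The subrepresentation generated by a set. -/
def gen (S : Set V) : Submodule ℂ V := sInf {U | ρ.IsSubrep U ∧ S ⊆ U}

theorem gen_isSubrep (S : Set V) : ρ.IsSubrep (ρ.gen S) := by
  refine ⟨fun v hv => ?_, fun X v hv => ?_⟩ <;>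
    simp only [gen, Submodule.mem_sInf] at hv ⊢ <;> intro U hU
  · exact hU.1.1 v (hv U hU)
  · exact hU.1.2 X v (hv U hU)

theorem subset_gen (S : Set V) : S ⊆ ρ.gen S := by
  intro v hv
  simp only [gen, SetLike.mem_coe, Submodule.mem_sInf]
  exact fun U hU => hU.2 hv

theorem gen_le {S : Set V} {U : Submodule ℂ V} (hU : ρ.IsSubrep U) (h : S ⊆ U) : ρ.gen S ≤ U :=
  sInf_le ⟨hU, h⟩

theorem gen_mono {S S' : Set V} (h : S ⊆ S') : ρ.gen S ≤ ρ.gen S' :=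
  ρ.gen_le (ρ.gen_isSubrep S') (h.trans (ρ.subset_gen S'))

/-! ### Gradings -/

/-- The degree `c` part of a representation for the grading `ht`. -/
def eig (ht : OspHeight d r n) (c : ℂ) : Submodule ℂ V :=
  Module.End.eigenspace (ρ.act (grad ht)) c

theorem mem_eig {ht : OspHeight d r n} {c : ℂ} {v : V} :
    v ∈ ρ.eig ht c ↔ ρ.act (grad ht) v = c • v := Module.End.mem_eigenspace_iff

theorem root_mem_eig {ht : OspHeight d r n} {c : ℂ} {v : V} (hv : v ∈ ρ.eig ht c)
    (a b : OspIdx d r n) : ρ.root a b v ∈ ρ.eig ht (c + (ht a - ht b)) := by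
  rw [mem_eig] at hv ⊢
  rw [act_cartan_root _ (grad_isCartan ht), hv, grad_apply_self, grad_apply_self,
    map_smul, ← add_smul, add_comm]

theorem parity_mem_eig {ht : OspHeight d r n} {c : ℂ} {v : V} (hv : v ∈ ρ.eig ht c) :
    ρ.parity v ∈ ρ.eig ht c := by
  rw [mem_eig] at hv ⊢
  rw [← ρ.parity_even _ (grad_isCartan ht).isEven, hv, map_smul]

theorem eig_disjoint {ht : OspHeight d r n} {c c' : ℂ} (h : c ≠ c') :
    Disjoint (ρ.eig ht c) (ρ.eig ht c') :=
  (Module.End.eigenspaces_iSupIndep _).pairwiseDisjoint h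

/-- The sum of the parts of degrees `c - 1, c - 2, …`. -/
def below (ht : OspHeight d r n) (c : ℂ) : Submodule ℂ V :=
  ⨆ k : ℕ, ρ.eig ht (c - (k + 1))

theorem eig_disjoint_below (ht : OspHeight d r n) (c : ℂ) :
    Disjoint (ρ.eig ht c) (ρ.below ht c) := by
  have h := (Module.End.eigenspaces_iSupIndep (ρ.act (grad ht))) c
  refine h.mono_right (iSup_le fun k => ?_)
  refine le_iSup₂_of_le (c - (k + 1)) ?_ le_rfl
  intro h
  have : ((k : ℂ) + 1) = 0 := by linear_combination -h
  exact Nat.cast_add_one_ne_zero k this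

theorem root_mem_below {ht : OspHeight d r n} {c : ℂ} {a b : OspIdx d r n} (h : ht a = ht b) {v : V}
    (hv : v ∈ ρ.below ht c) : ρ.root a b v ∈ ρ.below ht c := by
  refine iSup_induction _ (motive := fun v => ρ.root a b v ∈ ρ.below ht c) hv ?_ ?_ ?_
  · intro k x hx
    have := ρ.root_mem_eig hx a b
    rw [h, sub_self, add_zero] at this
    exact mem_iSup_of_mem k this
  · simp
  · intro x y hx hy; rw [map_add]; exact add_mem hx hy

/-- The vectors obtained from `T` by applying root vectors of negative degree. -/
inductive Descendant (ht : OspHeight d r n) (T : Submodule ℂ V) : V → Prop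
  | base {v : V} (hv : v ∈ T) : Descendant ht T v
  | step {v : V} (hv : Descendant ht T v) (a b : OspIdx d r n) (h : ht a < ht b) :
      Descendant ht T (ρ.root a b v)

/-- The subrepresentation generated by a subspace `T` of degree `c` which is stable under the
degree zero part and killed by the positive part has `T` as its part of degree `c`. -/
theorem gen_le_sup_below {ht : OspHeight d r n} {c : ℂ} {T : Submodule ℂ V} (hT : T ≤ ρ.eig ht c)
    (hp : ∀ v ∈ T, ρ.parity v ∈ T) (h0 : ∀ a b, ht a = ht b → ∀ v ∈ T, ρ.root a b v ∈ T)
    (hpos : ∀ a b, ht b < ht a → ∀ v ∈ T, ρ.root a b v = 0) : ρ.gen T ≤ T ⊔ ρ.below ht c := by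
  set L := span ℂ {v | ρ.Descendant ht T v} with hL
  have hneg : ∀ a b, ht a < ht b → ∀ v ∈ L, ρ.root a b v ∈ L := by
    intro a b hab v hv
    refine span_induction (p := fun v _ => ρ.root a b v ∈ L) ?_ ?_ ?_ ?_ hv
    · intro x hx; exact subset_span (Descendant.step (v := x) hx a b hab)
    · simp
    · intro x y _ _ hx hy; rw [map_add]; exact add_mem hx hy
    · intro t x _ hx; rw [map_smul]; exact L.smul_mem _ hx
  have hroot : ∀ v, ρ.Descendant ht T v → ∀ a b, ρ.root a b v ∈ L := by
    intro v hv
    induction hv with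
    | base hv =>
      intro a b
      rcases lt_trichotomy (ht a) (ht b) with h | h | h
      · exact subset_span ((Descendant.base hv).step a b h)
      · exact subset_span (Descendant.base (h0 a b h _ hv))
      · rw [hpos a b h _ hv]; exact L.zero_mem
    | step hv c e hce ih =>
      intro a b
      rw [root_root]
      exact add_mem (ρ.act_mem_of_root_mem fun _ _ _ => ih _ _) (L.smul_mem _ (hneg _ _ hce _ (ih a b)))
  have hpar : ∀ v, ρ.Descendant ht T v → ρ.parity v ∈ L := by
    intro v hv
    induction hv with
    | base hv => exact subset_span (Descendant.base (hp _ hv))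
    | step hv c e hce ih => rw [parity_root]; exact L.smul_mem _ (hneg _ _ hce _ ih)
  have hsub : ρ.IsSubrep L := by
    refine ρ.isSubrep_of_root (fun v hv => ?_) (fun v hv a b => ?_)
    · refine span_induction (p := fun v _ => ρ.parity v ∈ L) ?_ ?_ ?_ ?_ hv
      · intro x hx; exact hpar x hx
      · simp
      · intro x y _ _ hx hy; rw [map_add]; exact add_mem hx hy
      · intro t x _ hx; rw [map_smul]; exact L.smul_mem _ hx
    · refine span_induction (p := fun v _ => ρ.root a b v ∈ L) ?_ ?_ ?_ ?_ hv
      · intro x hx; exact hroot x hx a b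
      · simp
      · intro x y _ _ hx hy; rw [map_add]; exact add_mem hx hy
      · intro t x _ hx; rw [map_smul]; exact L.smul_mem _ hx
  have hdeg : ∀ v, ρ.Descendant ht T v → v ∈ T ∨ ∃ k : ℕ, v ∈ ρ.eig ht (c - (k + 1)) := by
    intro v hv
    induction hv with
    | base hv => exact Or.inl hv
    | step hv a b hab ih =>
      right
      obtain ⟨m, hm⟩ : ∃ m : ℕ, ht b = ht a + (m + 1) := ⟨(ht b - ht a - 1).toNat, by omega⟩
      rcases ih with ih | ⟨k, ih⟩
      · refine ⟨m, ?_⟩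
        convert ρ.root_mem_eig (hT ih) a b using 1
        rw [hm]; push_cast; ring_nf
      · refine ⟨k + m + 1, ?_⟩
        convert ρ.root_mem_eig ih a b using 1
        rw [hm]; push_cast; ring_nf
  refine (ρ.gen_le hsub fun v hv => subset_span (Descendant.base hv)).trans ?_
  refine span_le.2 fun v hv => ?_
  rcases hdeg v hv with h | ⟨k, h⟩
  · exact mem_sup_left h
  · exact mem_sup_right (mem_iSup_of_mem k h)

/-- All degrees of the representation lie in `c - ℕ`. -/
def IsBddGraded (ht : OspHeight d r n) (c : ℂ) : Prop := ⨆ k : ℕ, ρ.eig ht (c - k) = ⊤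

theorem eig_eq_bot {ht : OspHeight d r n} {c : ℂ} (h : ρ.IsBddGraded ht c) {x : ℂ}
    (hx : ∀ k : ℕ, x ≠ c - k) : ρ.eig ht x = ⊥ := by
  have h1 := (Module.End.eigenspaces_iSupIndep (ρ.act (grad ht))) x
  rw [← disjoint_self]
  refine h1.mono_right ?_
  refine le_trans le_top (h.ge.trans (iSup_le fun k => ?_))
  exact le_iSup₂_of_le (c - k) (hx k).symm le_rfl

/-- A stable subspace contains the homogeneous components of its elements. -/
theorem le_iSup_inf_eig {ht : OspHeight d r n} {c : ℂ} (h : ρ.IsBddGraded ht c) {p : Submodule ℂ V}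
    (hp : ∀ v ∈ p, ρ.act (grad ht) v ∈ p) : p ≤ ⨆ k : ℕ, p ⊓ ρ.eig ht (c - k) := by
  set f := ρ.act (grad ht)
  have key : ∀ (s : Finset ℕ) (x : ℕ → V), (∀ k : ℕ, x k ∈ ρ.eig ht (c - k)) → ∑ k ∈ s, x k ∈ p →
      ∀ k ∈ s, x k ∈ p := by
    intro s
    induction s using Finset.induction_on with
    | empty => simp
    | insert m s hm ih =>
      intro x hx hsum
      have hf : ∀ k : ℕ, f (x k) = (c - (k : ℂ)) • x k := fun k => (ρ.mem_eig).1 (hx k)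
      have h2 := p.sub_mem (hp _ hsum) (p.smul_mem (c - m) hsum)
      rw [Finset.sum_insert hm, map_add, smul_add, hf, add_sub_add_left_eq_sub, map_sum,
        smul_sum, ← sum_sub_distrib] at h2
      have h3 : ∀ k ∈ s, x k ∈ p := by
        have h4 := ih (fun k : ℕ => ((m : ℂ) - (k : ℂ)) • x k) (fun k => smul_mem _ _ (hx k)) (by
          refine (congrArg (· ∈ p) (sum_congr rfl fun k _ => ?_)).mp h2
          rw [hf, ← sub_smul]; congr 1; ring)
        intro k hk
        have hne : ((m : ℂ) - k) ≠ 0 := by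
          rw [sub_ne_zero]; intro h; exact hm (by rwa [Nat.cast_injective h])
        exact (p.smul_mem_iff hne).1 (h4 k hk)
      intro k hk
      rcases Finset.mem_insert.1 hk with rfl | hk
      · rw [Finset.sum_insert hm] at hsum
        exact (p.add_mem_iff_left (p.sum_mem h3)).1 hsum
      · exact h3 k hk
  intro v hv
  have hv' : v ∈ ⨆ k : ℕ, ρ.eig ht (c - k) := by rw [h]; trivial
  obtain ⟨x, hx, rfl⟩ := (Submodule.mem_iSup_iff_exists_finsupp _ _).1 hv'
  refine Submodule.sum_mem _ fun k hk => mem_iSup_of_mem k ⟨?_, hx k⟩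
  exact key x.support x hx hv k hk

/-- `v` is killed by the part of positive degree. -/
def IsSing (ht : OspHeight d r n) (v : V) : Prop := ∀ a b, ht b < ht a → ρ.root a b v = 0

/-- The singular vectors. -/
def sing (ht : OspHeight d r n) : Submodule ℂ V where
  carrier := {v | ρ.IsSing ht v}
  zero_mem' := fun a b _ => map_zero _
  add_mem' := fun hx hy a b h => by rw [map_add, hx a b h, hy a b h, add_zero]
  smul_mem' := fun c x hx a b h => by rw [map_smul, hx a b h, smul_zero]

theorem parity_mem_sing {ht : OspHeight d r n} {v : V} (hv : ρ.IsSing ht v) :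
    ρ.IsSing ht (ρ.parity v) := by
  intro a b h
  have h1 := ρ.parity_root a b v
  rw [hv a b h, map_zero] at h1
  rcases superSign_mul_eq a b with h2 | h2 <;> rw [h2] at h1 <;> simpa using h1.symm

/-- Degree zero elements preserve singular vectors. -/
theorem act_mem_sing {ht : OspHeight d r n} {v : V} (hv : ρ.IsSing ht v) {X : Osp d r n}
    (hX : ∀ a b, X.1 a b ≠ 0 → ht a = ht b) : ρ.IsSing ht (ρ.act X v) := by
  have h1 : ∀ a b, ht a = ht b → ρ.IsSing ht (ρ.root a b v) := by
    intro a b hab e f hef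
    rw [root_root, hv e f hef, map_zero, smul_zero, add_zero]
    refine ρ.act_eq_zero_of_root fun i j hij => hv i j ?_
    obtain ⟨k, ⟨h1, h2⟩ | ⟨h1, h2⟩⟩ := Osp.bracket_apply_ne hij <;>
    rcases rootVec_apply_ne h1 with ⟨h3, h4⟩ | ⟨h3, h4⟩ <;>
    rcases rootVec_apply_ne h2 with ⟨h5, h6⟩ | ⟨h5, h6⟩ <;>
    have := congrArg ht h3 <;> have := congrArg ht h4 <;> have := congrArg ht h5 <;>
    have := congrArg ht h6 <;> try simp only [ht.map_dual] at *
    all_goals omega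
  exact ρ.act_mem_of_root_mem (U := ρ.sing ht) fun a b hab => h1 a b (hX a b hab)

theorem grad_apply_ne {ht ht' : OspHeight d r n} : ∀ a b, (grad ht').1 a b ≠ 0 → ht a = ht b := by
  intro a b h
  by_contra hc
  exact h (grad_isCartan ht' (fun h' => hc (by rw [h'])))

/-- A nonzero subrepresentation contains a homogeneous singular vector. -/
theorem exists_sing {ht : OspHeight d r n} {c : ℂ} (h : ρ.IsBddGraded ht c) {U : Submodule ℂ V}
    (hU : ∀ v ∈ U, ∀ a b, ht b < ht a → ρ.root a b v ∈ U)
    (hU0 : ∀ v ∈ U, ρ.act (grad ht) v ∈ U) (hne : U ≠ ⊥) :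
    ∃ v ∈ U, v ≠ 0 ∧ ρ.IsSing ht v ∧ ∃ k : ℕ, v ∈ ρ.eig ht (c - k) := by
  classical
  have hex : ∃ k : ℕ, U ⊓ ρ.eig ht (c - k) ≠ ⊥ := by
    by_contra hc
    push Not at hc
    have := ρ.le_iSup_inf_eig h hU0
    simp only [hc, iSup_bot, le_bot_iff] at this
    exact hne this
  set k := Nat.find hex with hk
  obtain ⟨v, hv, hv0⟩ := (Submodule.ne_bot_iff _).1 (Nat.find_spec hex)
  refine ⟨v, hv.1, hv0, fun a b hab => ?_, k, hv.2⟩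
  have h1 := ρ.root_mem_eig hv.2 a b
  by_cases hle : ht a - ht b ≤ k
  · have h2 : k - (ht a - ht b).toNat < k := by omega
    have h3 := Nat.find_min hex h2
    push Not at h3
    rw [← mem_bot ℂ, ← h3]
    refine ⟨hU v hv.1 a b hab, ?_⟩
    have h4 : ((k - (ht a - ht b).toNat : ℕ) : ℤ) = k - (ht a - ht b) := by omega
    have h5 : ((k - (ht a - ht b).toNat : ℕ) : ℂ) = k - (ht a - ht b) := by exact_mod_cast congrArg (Int.cast (R := ℂ)) h4
    rw [show c - ((k - (ht a - ht b).toNat : ℕ) : ℂ) = c - k + (ht a - ht b) by rw [h5]; ring]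
    exact h1
  · rw [← mem_bot ℂ, ← ρ.eig_eq_bot h (x := c - k + (ht a - ht b))]
    · exact h1
    · intro m hm
      have : ((ht a - ht b + m : ℤ) : ℂ) = (k : ℤ) := by push_cast; linear_combination hm
      have := Int.cast_injective this
      omega

theorem isBddGraded_of_sup {ht : OspHeight d r n} {c : ℂ} (h : ρ.eig ht c ⊔ ρ.below ht c = ⊤) :
    ρ.IsBddGraded ht c := by
  refine top_le_iff.1 (h.ge.trans (sup_le ?_ (iSup_le fun k => ?_)))
  · refine le_iSup_of_le 0 ?_; simp
  · refine le_iSup_of_le (k + 1) ?_; push_cast; exact le_rfl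

/-- In an irreducible representation every singular vector lies in the top component. -/
theorem IsIrreducible.sing_le {ρ : OspRep d r n V} (hρ : ρ.IsIrreducible) {ht : OspHeight d r n} {c : ℂ}
    {T : Submodule ℂ V} (hT : T ≤ ρ.eig ht c) (hp : ∀ v ∈ T, ρ.parity v ∈ T)
    (h0 : ∀ a b, ht a = ht b → ∀ v ∈ T, ρ.root a b v ∈ T)
    (hpos : ∀ a b, ht b < ht a → ∀ v ∈ T, ρ.root a b v = 0) (hT0 : T ≠ ⊥) :
    T ⊔ ρ.below ht c = ⊤ ∧ ∀ v, ρ.IsSing ht v → v ∈ T := by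
  have htop : ∀ (c' : ℂ) (T' : Submodule ℂ V), T' ≤ ρ.eig ht c' → (∀ v ∈ T', ρ.parity v ∈ T') →
      (∀ a b, ht a = ht b → ∀ v ∈ T', ρ.root a b v ∈ T') →
      (∀ a b, ht b < ht a → ∀ v ∈ T', ρ.root a b v = 0) → T' ≠ ⊥ → T' ⊔ ρ.below ht c' = ⊤ := by
    intro c' T' hT hp h0 hpos hT0
    have h1 := ρ.gen_le_sup_below hT hp h0 hpos
    rcases hρ.2 _ (ρ.gen_isSubrep T') with h2 | h2
    · exact absurd (le_bot_iff.1 (h2 ▸ ρ.subset_gen (T' : Set V) : T' ≤ ⊥)) hT0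
    · exact top_le_iff.1 (h2 ▸ h1)
  have h1 := htop c T hT hp h0 hpos hT0
  refine ⟨h1, ?_⟩
  have hb : ρ.IsBddGraded ht c := ρ.isBddGraded_of_sup
    (top_le_iff.1 (h1.ge.trans (sup_le_sup_right hT _)))
  have h2 := ρ.le_iSup_inf_eig hb (p := ρ.sing ht)
    fun v hv => ρ.act_mem_sing hv grad_apply_ne
  suffices h3 : ρ.sing ht ≤ T from fun v hv => h3 hv
  refine h2.trans (iSup_le fun k => ?_)
  rcases Nat.eq_zero_or_pos k with rfl | hk
  · intro v hv
    have hv2 : v ∈ ρ.eig ht c := by simpa using hv.2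
    have : v ∈ T ⊔ ρ.below ht c := by rw [h1]; trivial
    obtain ⟨x, hx, y, hy, hxy⟩ := mem_sup.1 this
    have hy2 : y ∈ ρ.eig ht c := by
      rw [show y = v - x by rw [← hxy]; abel]; exact sub_mem hv2 (hT hx)
    have : y = 0 := by
      have := (ρ.eig_disjoint_below ht c).le_bot ⟨hy2, hy⟩
      simpa using this
    rw [← hxy, this, add_zero]; exact hx
  · suffices h3 : ρ.sing ht ⊓ ρ.eig ht (c - k) = ⊥ by rw [h3]; exact bot_le
    by_contra hne
    have h4 := htop (c - k) (ρ.sing ht ⊓ ρ.eig ht (c - k)) inf_le_right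
      (fun v hv => ⟨ρ.parity_mem_sing hv.1, ρ.parity_mem_eig hv.2⟩)
      (fun a b hab v hv => ⟨ρ.act_mem_sing hv.1 ?_, ?_⟩) (fun a b hab v hv => hv.1 a b hab) hne
    · apply hT0
      rw [← le_bot_iff]
      have h5 := (Module.End.eigenspaces_iSupIndep (ρ.act (grad ht))) c
      refine le_trans (le_inf hT ?_) h5.le_bot
      refine le_trans le_top (h4.ge.trans (sup_le (inf_le_right.trans ?_) (iSup_le fun m => ?_)))
      · refine le_iSup₂_of_le (c - k) ?_ le_rfl
        intro h; have : (k : ℂ) = 0 := by linear_combination -h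
        have := Nat.cast_eq_zero.1 this
        omega
      · refine le_iSup₂_of_le (c - k - (m + 1)) ?_ le_rfl
        intro h; have : ((k + m + 1 : ℕ) : ℂ) = 0 := by push_cast; linear_combination -h
        exact absurd (Nat.cast_eq_zero.1 this) (by omega)
    · intro e f hef
      rcases rootVec_apply_ne hef with ⟨rfl, rfl⟩ | ⟨rfl, rfl⟩
      · exact hab
      · simp [ht.map_dual, hab]
    · have := ρ.root_mem_eig hv.2 a b
      rwa [hab, sub_self, add_zero] at this

end OspRep

namespace Osp

variable {d r n : ℕ}

theorem bracket_rootVec_swap {a b : OspIdx d r n} (hab : a ≠ b) :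
    bracket (rootVec a b) (rootVec b a) = (1 - if b = dual a then superSign a else 0) •
      (rootVec a a - (superSign a * superSign b) • rootVec b b) := by
  rw [bracket_rootVec, sum_eq_single a, sum_eq_single b]
  · have h1 : (rootVec a b).1 a b = 1 - if b = dual a then superSign a else 0 := by
      rw [rootVec_apply]
      by_cases h : b = dual a
      · subst h; simp [reflectSign_dual_self]
      · have : ¬ (dual b = a) := fun h' => h (dual_eq_comm.1 h'.symm.symm |>.symm ▸ by simp [← h'])
        simp [h, this]
    have h2 : braidSign b a b = superSign a * superSign b := by
      rcases a with a | a <;> rcases b with b | b <;> norm_num [braidSign, superSign]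
    rw [h1, h2, smul_sub, smul_smul, mul_comm (superSign a * superSign b)]
  · intro e _ he
    by_cases h0 : (rootVec a b).1 a e = 0
    · rw [h0]; simp
    · rcases rootVec_apply_ne h0 with ⟨h1, h2⟩ | ⟨h1, h2⟩
      · exact absurd h2 he
      · exact absurd (by rw [h2, h1, dual_dual]) he
  · simp
  · intro e _ he
    by_cases h0 : (rootVec a b).1 e b = 0
    · rw [h0]; simp
    · rcases rootVec_apply_ne h0 with ⟨h1, h2⟩ | ⟨h1, h2⟩
      · exact absurd h1 he
      · exact absurd (by rw [h1, h2, dual_dual]) he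
  · simp

end Osp

namespace OspRep

variable {d r n : ℕ} {V : Type*} [AddCommGroup V] [Module ℂ V] (ρ : OspRep d r n V)

/-- The quadratic Casimir operator. -/
def casimir : V →ₗ[ℂ] V :=
  ∑ a, ∑ b, superSign b • (ρ.root a b ∘ₗ ρ.root b a)

theorem casimir_apply (v : V) :
    ρ.casimir v = ∑ a, ∑ b, superSign b • ρ.root a b (ρ.root b a v) := by
  simp [casimir, LinearMap.sum_apply]

theorem act_bracket_rootVec (Y : Osp d r n) (a b : OspIdx d r n) (v : V) :
    ρ.act (Osp.bracket Y (rootVec a b)) v = ∑ e, Y.1 e a • ρ.root e b v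
      - ∑ e, (braidSign a b e * Y.1 b e) • ρ.root a e v := by
  rw [Osp.bracket_rootVec]
  simp [root, map_sum, LinearMap.sum_apply]

theorem casimir_comm_aux (Y : Osp d r n) (s : OspIdx d r n → OspIdx d r n → ℂ)
    (hs : ∀ a b e, Y.1 a e ≠ 0 → s a b * braidSign b a e = 1)
    (hs' : ∀ a b e, Y.1 b e ≠ 0 → superSign e * s a e = superSign b * braidSign a b e)
    (hY : ∀ a b v, ρ.act Y (ρ.root a b v) = ρ.act (Osp.bracket Y (rootVec a b)) v
      + s a b • ρ.root a b (ρ.act Y v))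
    (hs2 : ∀ a b, s a b * s b a = 1) (v : V) :
    ρ.act Y (ρ.casimir v) = ρ.casimir (ρ.act Y v) := by
  have h1 : ∑ a, ∑ b, ∑ e, (superSign b * Y.1 e a) • ρ.root e b (ρ.root b a v)
      = ∑ a, ∑ b, ∑ e, (superSign b * s a b * (braidSign b a e * Y.1 a e)) •
        ρ.root a b (ρ.root b e v) := by
    calc _ = ∑ e, ∑ b, ∑ a, (superSign b * Y.1 e a) • ρ.root e b (ρ.root b a v) := by
          rw [Finset.sum_comm_cycle]
          refine sum_congr rfl fun e _ => ?_
          rw [sum_comm]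
      _ = _ := by
          refine sum_congr rfl fun a _ => sum_congr rfl fun b _ =>
            sum_congr rfl fun e _ => ?_
          by_cases h : Y.1 a e = 0
          · simp [h]
          · congr 1; linear_combination -superSign b * Y.1 a e * hs a b e h
  have h2 : ∑ a, ∑ b, ∑ e, (superSign b * (braidSign a b e * Y.1 b e)) • ρ.root a e (ρ.root b a v)
      = ∑ a, ∑ b, ∑ e, (superSign b * s a b * Y.1 e b) • ρ.root a b (ρ.root e a v) := by
    refine sum_congr rfl fun a _ => ?_
    rw [sum_comm]
    refine sum_congr rfl fun b _ => sum_congr rfl fun e _ => ?_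
    by_cases h : Y.1 e b = 0
    · simp [h]
    · congr 1; linear_combination -Y.1 e b * hs' a e b h
  have h3 : ∀ a b, ρ.act Y (ρ.root a b (ρ.root b a v)) =
      (∑ e, Y.1 e a • ρ.root e b (ρ.root b a v)
        - ∑ e, (braidSign a b e * Y.1 b e) • ρ.root a e (ρ.root b a v))
      + s a b • (∑ e, Y.1 e b • ρ.root a b (ρ.root e a v)
        - ∑ e, (braidSign b a e * Y.1 a e) • ρ.root a b (ρ.root b e v))
      + ρ.root a b (ρ.root b a (ρ.act Y v)) := by
    intro a b
    rw [hY, act_bracket_rootVec, hY, act_bracket_rootVec, map_add, map_smul, smul_add, smul_smul,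
      hs2, one_smul, ← add_assoc]
    simp [map_sum]
  rw [casimir_apply, casimir_apply]
  simp only [map_sum, map_smul, h3]
  simp only [smul_add, smul_sub, smul_sum, smul_smul, sum_add_distrib,
    sum_sub_distrib, mul_assoc] at h1 h2 ⊢
  rw [h1, h2]
  abel

theorem act_casimir (Y : Osp d r n) (v : V) : ρ.act Y (ρ.casimir v) = ρ.casimir (ρ.act Y v) := by
  have he : ∀ Y : Osp d r n, Y.IsEven → ρ.act Y (ρ.casimir v) = ρ.casimir (ρ.act Y v) := by
    intro Y hY
    have h0 : ∀ a b, Y.1 a b ≠ 0 → superSign a = superSign b := by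
      intro a b h
      by_contra hc
      have h2 : oddPart Y.1 a b = 0 := by
        have := congrArg Subtype.val (show Y.odd = 0 from hY)
        exact congrFun (congrFun this a) b
      rw [oddPart_apply] at h2
      rcases a with a | a <;> rcases b with b | b <;> simp_all [superSign]
    refine ρ.casimir_comm_aux Y (fun _ _ => 1) ?_ ?_ ?_ (by simp) v
    · intro a b e h
      have := h0 a e h
      rcases a with a | a <;> rcases b with b | b <;> rcases e with e | e <;>
        first
        | (exfalso; norm_num [superSign] at this; done)
        | norm_num [braidSign, superSign]
    · intro a b e h
      have := h0 b e h
      rcases a with a | a <;> rcases b with b | b <;> rcases e with e | e <;>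
        first
        | (exfalso; norm_num [superSign] at this; done)
        | norm_num [braidSign, superSign]
    · intro a b v; rw [act_root_of_isEven _ hY, one_smul]
  have ho : ∀ Y : Osp d r n, Y.IsOdd → ρ.act Y (ρ.casimir v) = ρ.casimir (ρ.act Y v) := by
    intro Y hY
    have h0 : ∀ a b, Y.1 a b ≠ 0 → superSign a = -superSign b := by
      intro a b h
      by_contra hc
      have h2 : evenPart Y.1 a b = 0 := by
        have := congrArg Subtype.val (show Y.even = 0 from hY)
        exact congrFun (congrFun this a) b
      rw [evenPart_apply] at h2
      rcases a with a | a <;> rcases b with b | b <;> simp_all [superSign]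
    refine ρ.casimir_comm_aux Y (fun a b => superSign a * superSign b) ?_ ?_ ?_ ?_ v
    · intro a b e h
      have := h0 a e h
      rcases a with a | a <;> rcases b with b | b <;> rcases e with e | e <;>
        first
        | (exfalso; norm_num [superSign] at this; done)
        | norm_num [braidSign, superSign]
    · intro a b e h
      have := h0 b e h
      rcases a with a | a <;> rcases b with b | b <;> rcases e with e | e <;>
        first
        | (exfalso; norm_num [superSign] at this; done)
        | norm_num [braidSign, superSign]
    · intro a b v; rw [act_root_of_isOdd _ hY]
    · intro a b; linear_combination (superSign b * superSign b) * superSign_sq a + superSign_sq b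
  conv_lhs => rw [← even_add_odd Y]
  conv_rhs => rw [← even_add_odd Y]
  simp only [map_add, LinearMap.add_apply, he _ (even_isEven Y), ho _ (odd_isOdd Y)]

theorem parity_casimir (v : V) : ρ.parity (ρ.casimir v) = ρ.casimir (ρ.parity v) := by
  rw [casimir_apply, casimir_apply, map_sum]
  refine sum_congr rfl fun a _ => ?_
  rw [map_sum]
  refine sum_congr rfl fun b _ => ?_
  rw [map_smul, parity_root, parity_root, map_smul, smul_smul]
  rcases superSign_mul_eq a b with h | h <;> simp [h, mul_comm (superSign b)]

theorem root_casimir (a b : OspIdx d r n) (v : V) :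
    ρ.root a b (ρ.casimir v) = ρ.casimir (ρ.root a b v) := ρ.act_casimir _ v

/-- The kernel of a polynomial in the Casimir operator is a subrepresentation. -/
theorem ker_casimir_sub_isSubrep (c : ℂ) :
    ρ.IsSubrep (ker (ρ.casimir - c • LinearMap.id)) := by
  refine ⟨fun v hv => ?_, fun X v hv => ?_⟩ <;>
    simp only [mem_ker, LinearMap.sub_apply, LinearMap.smul_apply, LinearMap.id_apply,
      sub_eq_zero] at hv ⊢
  · rw [← parity_casimir, hv, map_smul]
  · rw [← act_casimir, hv, map_smul]

/-- The coefficients of the linear part of the Casimir eigenvalue. -/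
def casimirCoeff (ht : OspHeight d r n) (a : OspIdx d r n) : ℂ :=
  ∑ b, (if ht b < ht a then superSign b - (if b = dual a then 1 else 0)
    else if ht a < ht b then -(superSign b - (if b = dual a then 1 else 0)) else 0)

/-- The eigenvalue of the Casimir operator on a singular vector of weight `lam`. -/
def casimirValue (ht : OspHeight d r n) (lam : OspWeight d n) : ℂ :=
  ∑ a : OspIdx d r n, superSign a * ext lam a ^ 2 + ∑ a : OspIdx d r n, casimirCoeff ht a * ext lam a

variable {ρ} in
/-- The Casimir operator on a vector which is singular modulo a subrepresentation. -/
theorem casimir_sub_mem {ht : OspHeight d r n} (hht : ∀ a b, ht a = ht b → a = b)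
    {lam : OspWeight d n} {v : V} {N : Submodule ℂ V} (hN : ρ.IsSubrep N) (hv : ρ.IsWeightVec lam v)
    (hs : ∀ a b, ht b < ht a → ρ.root a b v ∈ N) :
    ρ.casimir v - casimirValue ht lam • v ∈ N := by
  have key : ∀ a b, superSign b • ρ.root a b (ρ.root b a v) -
      ((if a = b then superSign a * ext lam a ^ 2 else 0)
        + ((if ht b < ht a then superSign b - (if b = dual a then 1 else 0) else 0) * ext lam a
        - (if ht b < ht a then superSign a - (if a = dual b then 1 else 0) else 0) * ext lam b)) • v ∈ N := by
    intro a b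
    rcases lt_trichotomy (ht a) (ht b) with h | h | h
    · have hne : a ≠ b := fun h' => by rw [h'] at h; exact lt_irrefl _ h
      have : superSign b • ρ.root a b (ρ.root b a v) ∈ N :=
        N.smul_mem (superSign b) (hN.2 (rootVec a b) _ (hs b a h))
      simpa [hne, not_lt.2 h.le] using this
    · obtain rfl := hht a b h
      rw [hv a, map_smul, hv a, smul_smul, smul_smul]
      simp [pow_two, mul_assoc]
    · have hne : a ≠ b := fun h' => by rw [h'] at h; exact lt_irrefl _ h
      have hmem := N.smul_mem (superSign b)
        (N.smul_mem (commSign a b b a) (hN.2 (rootVec b a) _ (hs a b h)))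
      rw [root_root, smul_add, Osp.bracket_rootVec_swap hne, add_sub_right_comm]
      refine N.add_mem ?_ hmem
      have e1 : ρ.act (rootVec a a) v = ext lam a • v := hv a
      have e2 : ρ.act (rootVec b b) v = ext lam b • v := hv b
      simp only [map_smul, LinearMap.smul_apply, map_sub, LinearMap.sub_apply, e1, e2, smul_sub, smul_smul]
      rw [← sub_smul, ← sub_smul]
      convert N.zero_mem
      convert zero_smul ℂ v using 2
      rw [sub_eq_zero]
      have h4 : (a = dual b) ↔ (b = dual a) := by rw [← dual_eq_comm, eq_comm]
      rw [if_neg hne, if_pos h, if_pos h, if_congr h4 rfl rfl]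
      have h5 := superSign_sq b
      by_cases h6 : b = dual a
      · subst h6
        have h7 := superSign_sq a
        simp
        linear_combination (-ext lam a - superSign a * ext lam (dual a) + ext lam (dual a) + superSign a ^ 2 * ext lam (dual a)) * h7
      · simp [h6]; linear_combination superSign a * ext lam b * h5
  have hval : casimirValue ht lam = ∑ a : OspIdx d r n, ∑ b : OspIdx d r n,
      ((if a = b then superSign a * ext lam a ^ 2 else 0)
        + ((if ht b < ht a then superSign b - (if b = dual a then 1 else 0) else 0) * ext lam a
        - (if ht b < ht a then superSign a - (if a = dual b then 1 else 0) else 0) * ext lam b)) := by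
    rw [casimirValue]
    simp only [sum_add_distrib, sum_sub_distrib, sum_ite_eq, mem_univ, if_true]
    congr 1
    rw [sum_comm (f := fun a b => (if ht b < ht a then superSign a - (if a = dual b then 1 else 0) else 0) * ext lam b),
      ← sum_sub_distrib]
    refine sum_congr rfl fun a _ => ?_
    rw [← sum_sub_distrib, casimirCoeff, Finset.sum_mul]
    refine sum_congr rfl fun b _ => ?_
    rcases lt_trichotomy (ht a) (ht b) with h | h | h
    · simp only [h, not_lt.2 h.le, if_true, if_false]; ring
    · simp [h]
    · simp [h, not_lt.2 h.le]
  rw [casimir_apply, hval]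
  simp only [Finset.sum_smul, ← sum_sub_distrib]
  exact N.sum_mem fun a _ => N.sum_mem fun b _ => key a b

variable {ρ} in
theorem casimir_eq_of_isSing {ht : OspHeight d r n} (hht : ∀ a b, ht a = ht b → a = b)
    {lam : OspWeight d n} {v : V} (hv : ρ.IsWeightVec lam v) (hs : ρ.IsSing ht v) :
    ρ.casimir v = casimirValue ht lam • v := by
  have := casimir_sub_mem (N := ⊥) hht ⟨by simp, by simp⟩ hv fun a b h => by simp [hs a b h]
  simpa [sub_eq_zero] using this

/-- The Casimir operator is scalar on a subrepresentation generated by an eigenvector. -/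
theorem gen_le_ker_casimir {S : Set V} {c : ℂ} (hS : ∀ v ∈ S, ρ.casimir v = c • v) :
    ρ.gen S ≤ ker (ρ.casimir - c • LinearMap.id) :=
  ρ.gen_le (ρ.ker_casimir_sub_isSubrep c) fun v hv => by
    simp [hS v hv]

theorem mem_ker_casimir {c : ℂ} {v : V} :
    v ∈ ker (ρ.casimir - c • LinearMap.id) ↔ ρ.casimir v = c • v := by
  simp [sub_eq_zero]

section Tensor

variable {W : Type*} [AddCommGroup W] [Module ℂ W] (σ : OspRep d r n W)

/-- The parity involution if `rootVec a b` is odd, and the identity otherwise. -/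
def braid (a b : OspIdx d r n) : V →ₗ[ℂ] V :=
  ((1 + superSign a * superSign b) / 2) • LinearMap.id + ((1 - superSign a * superSign b) / 2) • ρ.parity

theorem braid_of_eq_one {a b : OspIdx d r n} (h : superSign a * superSign b = 1) (v : V) :
    ρ.braid a b v = v := by
  simp [braid, h]

theorem braid_of_eq_neg_one {a b : OspIdx d r n} (h : superSign a * superSign b = -1) (v : V) :
    ρ.braid a b v = ρ.parity v := by
  norm_num [braid, h]

theorem braid_braid (a b : OspIdx d r n) (v : V) : ρ.braid a b (ρ.braid a b v) = v := by
  rcases superSign_mul_eq a b with h | h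
  · simp [braid_of_eq_one _ h]
  · simp [braid_of_eq_neg_one _ h, ρ.parity_parity]

theorem root_tmul (a b : OspIdx d r n) (v : V) (w : W) :
    (ρ.tensor σ).root a b (v ⊗ₜ w) = ρ.root a b v ⊗ₜ w + ρ.braid a b v ⊗ₜ σ.root a b w := by
  change tensorAct ρ σ _ _ = _
  rw [tensorAct_tmul]
  rcases superSign_mul_eq a b with h | h
  · rw [even_eq_self (rootVec_isEven h), show (rootVec a b).odd = 0 from rootVec_isEven h,
      braid_of_eq_one _ h]
    simp [root]
  · rw [odd_eq_self (rootVec_isOdd h), show (rootVec a b).even = 0 from rootVec_isOdd h,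
      braid_of_eq_neg_one _ h]
    simp [root]

theorem parity_tmul (v : V) (w : W) :
    (ρ.tensor σ).parity (v ⊗ₜ w) = ρ.parity v ⊗ₜ σ.parity w := rfl

theorem act_cartan_tmul {H : Osp d r n} (hH : H.IsCartan) (v : V) (w : W) :
    (ρ.tensor σ).act H (v ⊗ₜ w) = ρ.act H v ⊗ₜ w + v ⊗ₜ σ.act H w := by
  change tensorAct ρ σ _ _ = _
  rw [tensorAct_tmul, even_eq_self hH.isEven, show H.odd = 0 from hH.isEven]
  simp

variable {ρ σ} in
theorem IsWeightVec.tmul {lam mu : OspWeight d n} {v : V} {w : W} (hv : ρ.IsWeightVec lam v)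
    (hw : σ.IsWeightVec mu w) : (ρ.tensor σ).IsWeightVec (lam + mu) (v ⊗ₜ w) := by
  intro a
  rw [root_tmul, hv a, hw a, braid_of_eq_one _ (superSign_sq a), OspWeight.ext_add, add_smul,
    smul_tmul', tmul_smul]

theorem tmul_mem_eig {ht : OspHeight d r n} {c c' : ℂ} {v : V} {w : W} (hv : v ∈ ρ.eig ht c)
    (hw : w ∈ σ.eig ht c') : v ⊗ₜ w ∈ (ρ.tensor σ).eig ht (c + c') := by
  rw [mem_eig] at *
  rw [act_cartan_tmul _ _ (grad_isCartan ht), hv, hw, add_smul, smul_tmul',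
    tmul_smul]

theorem IsBddGraded.tensor {ht : OspHeight d r n} {c c' : ℂ} (hv : ρ.IsBddGraded ht c)
    (hw : σ.IsBddGraded ht c') : (ρ.tensor σ).IsBddGraded ht (c + c') := by
  rw [IsBddGraded, eq_top_iff]
  intro x _
  induction x with
  | zero => exact zero_mem _
  | add x y hx hy => exact add_mem (hx trivial) (hy trivial)
  | tmul v w =>
    have hv' : v ∈ ⨆ k : ℕ, ρ.eig ht (c - k) := by rw [hv]; trivial
    have hw' : w ∈ ⨆ k : ℕ, σ.eig ht (c' - k) := by rw [hw]; trivial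
    refine iSup_induction _ (motive := fun v => v ⊗ₜ[ℂ] w ∈ ⨆ k : ℕ, (ρ.tensor σ).eig ht (c + c' - k)) hv' ?_ ?_ ?_
    · intro k v hv
      refine iSup_induction _ (motive := fun w => v ⊗ₜ[ℂ] w ∈ ⨆ k : ℕ, (ρ.tensor σ).eig ht (c + c' - k)) hw' ?_ ?_ ?_
      · intro m w hw
        refine mem_iSup_of_mem (k + m) ?_
        convert ρ.tmul_mem_eig σ hv hw using 1
        push_cast; ring_nf
      · simp
      · intro x y hx hy; rw [tmul_add]; exact add_mem hx hy
    · simp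
    · intro x y hx hy; rw [TensorProduct.add_tmul]; exact add_mem hx hy

/-- If the Casimir operator is scalar on `V ⊗ W`, and `s` is the highest weight vector of `V`, then
the weights of `W` have the same pairing with the weight of `s`. -/
theorem casimir_tmul_proj {lam mu : OspWeight d n} {s : V} (hs : ρ.IsWeightVec lam s)
    (hsp : ρ.parity s = s ∨ ρ.parity s = -s) {ξ : V →ₗ[ℂ] ℂ} (hξ : ξ s = 1)
    (hξ0 : ∀ a b, a ≠ b → ξ (ρ.root a b s) = 0) {y : W} (hy : σ.IsWeightVec mu y) :
    TensorProduct.lift (LinearMap.toSpanSingleton ℂ _ LinearMap.id ∘ₗ ξ) ((ρ.tensor σ).casimir (s ⊗ₜ y))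
      = ξ (ρ.casimir s) • y + σ.casimir y + (2 * ∑ a : OspIdx d r n, superSign a * (ext lam a * ext mu a)) • y := by
  set Ξ := TensorProduct.lift (LinearMap.toSpanSingleton ℂ (W →ₗ[ℂ] W) LinearMap.id ∘ₗ ξ) with hΞ
  have hΞt : ∀ v w, Ξ (v ⊗ₜ w) = ξ v • w := fun v w => by simp [hΞ]
  have hb1 : ∀ a b c e, c ≠ e → ξ (ρ.braid a b (ρ.root c e s)) = 0 := by
    intro a b c e h
    rcases superSign_mul_eq a b with h1 | h1
    · rw [braid_of_eq_one _ h1, hξ0 _ _ h]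
    · rw [braid_of_eq_neg_one _ h1, parity_root, map_smul]
      rcases hsp with h2 | h2 <;> simp [h2, hξ0 _ _ h]
  have hb2 : ∀ a b c e, c ≠ e → ξ (ρ.root c e (ρ.braid a b s)) = 0 := by
    intro a b c e h
    rcases superSign_mul_eq a b with h1 | h1
    · rw [braid_of_eq_one _ h1, hξ0 _ _ h]
    · rw [braid_of_eq_neg_one _ h1]
      rcases hsp with h2 | h2 <;> simp [h2, hξ0 _ _ h]
  have hbd : ∀ a b : OspIdx d r n, ρ.braid a b (ρ.braid b a s) = s := by
    intro a b
    have : ρ.braid b a = ρ.braid a b := by simp [braid, mul_comm]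
    rw [this, braid_braid]
  have key : ∀ a b, Ξ (superSign b • (ρ.tensor σ).root a b ((ρ.tensor σ).root b a (s ⊗ₜ y))) =
      ξ (superSign b • ρ.root a b (ρ.root b a s)) • y + superSign b • σ.root a b (σ.root b a y)
      + (if a = b then 2 * (superSign a * (ext lam a * ext mu a)) else 0) • y := by
    intro a b
    rw [root_tmul, map_add, root_tmul, root_tmul, map_smul, map_add, map_add, map_add, hΞt, hΞt, hΞt,
      hΞt, hbd, hξ, one_smul, map_smul]
    by_cases h : a = b
    · subst h
      simp only [hs a, hy a, map_smul, braid_of_eq_one _ (superSign_sq a), hξ]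
      simp only [if_true, smul_smul, ← add_smul, smul_eq_mul]
      congr 1
      ring
    · rw [hb1 _ _ _ _ (Ne.symm h), hb2 _ _ _ _ h]
      simp [h, smul_smul]
  rw [casimir_apply, map_sum]
  simp only [map_sum, key, sum_add_distrib, ← Finset.sum_smul]
  rw [casimir_apply ρ, casimir_apply σ]
  simp only [map_sum, mul_sum, sum_ite_eq, mem_univ, if_true]

end Tensor

end OspRep

namespace Osp

variable {d r n : ℕ}

theorem rootVec_degree (h : OspHeight d r n) {a b i j : OspIdx d r n} (hij : (rootVec a b).1 i j ≠ 0) :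
    h i - h j = h a - h b := by
  rcases rootVec_apply_ne hij with ⟨rfl, rfl⟩ | ⟨rfl, rfl⟩
  · rfl
  · simp only [h.map_dual]; ring

theorem bracket_rootVec_degree (h : OspHeight d r n) {a b c e i j : OspIdx d r n}
    (hij : (bracket (rootVec c e) (rootVec a b)).1 i j ≠ 0) :
    h i - h j = (h c - h e) + (h a - h b) := by
  obtain ⟨k, ⟨h1, h2⟩ | ⟨h1, h2⟩⟩ := bracket_apply_ne hij <;>
  have := rootVec_degree h h1 <;> have := rootVec_degree h h2 <;> omega

/-- An invariance property of the supertrace. -/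
theorem sum_superSign_bracket (g : OspHeight d r n) {X Y : Osp d r n}
    (hX : ∀ a b, X.1 a b ≠ 0 → g a = g b) :
    ∑ a, superSign a * g a * (bracket Y X).1 a a = 0 := by
  have h : ∀ a : OspIdx d r n, superSign a * g a * (bracket Y X).1 a a =
      ∑ k, superSign a * g a * (Y.1 a k * X.1 k a) - ∑ k, superSign k * g a * (X.1 a k * Y.1 k a) := by
    intro a
    rw [bracket_apply, mul_sum, ← sum_sub_distrib]
    refine sum_congr rfl fun k _ => ?_
    have : superSign a * braidSign a k a = superSign k := by
      rcases a with a | a <;> rcases k with k | k <;> norm_num [braidSign, superSign]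
    rw [← this]; ring
  simp only [h, sum_sub_distrib]
  rw [sum_comm (f := fun a k => superSign k * g a * (X.1 a k * Y.1 k a)),
    ← sum_sub_distrib]
  refine sum_eq_zero fun a _ => ?_
  rw [← sum_sub_distrib]
  refine sum_eq_zero fun k _ => ?_
  by_cases h0 : X.1 k a = 0
  · simp [h0]
  · rw [hX k a h0]; ring

end Osp

namespace OspRep

variable {d r n : ℕ} {V : Type*} [AddCommGroup V] [Module ℂ V] (ρ : OspRep d r n V)
  {W : Type*} [AddCommGroup W] [Module ℂ W] (σ : OspRep d r n W)

/-- `v` is a homogeneous singular vector of weight `lam` for the order given by `ht`. -/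
structure IsHWVec (ht : OspHeight d r n) (lam : OspWeight d n) (v : V) : Prop where
  ne_zero : v ≠ 0
  parity : ρ.parity v = v ∨ ρ.parity v = -v
  weight : ρ.IsWeightVec lam v
  sing : ρ.IsSing ht v

variable {ρ}

theorem IsWeightVec.mem_eig {lam : OspWeight d n} {v : V} (hv : ρ.IsWeightVec lam v)
    (ht : OspHeight d r n) : v ∈ ρ.eig ht (lam.eval (grad ht).1) :=
  (ρ.mem_eig).2 (hv.act (grad_isCartan ht))

theorem parity_mem_span {v : V} (hv : ρ.parity v = v ∨ ρ.parity v = -v) :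
    ∀ x ∈ ℂ ∙ v, ρ.parity x ∈ ℂ ∙ v := by
  intro x hx
  obtain ⟨t, rfl⟩ := mem_span_singleton.1 hx
  rw [map_smul]
  refine smul_mem _ _ ?_
  rcases hv with h | h <;> rw [h]
  · exact mem_span_singleton_self v
  · exact neg_mem (mem_span_singleton_self v)

theorem root_mem_span {v : V} {a b : OspIdx d r n} (hv : ρ.root a b v ∈ ℂ ∙ v) :
    ∀ x ∈ ℂ ∙ v, ρ.root a b x ∈ ℂ ∙ v := by
  intro x hx
  obtain ⟨t, rfl⟩ := mem_span_singleton.1 hx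
  rw [map_smul]
  exact smul_mem _ _ hv

theorem root_eq_zero_of_mem_span {v : V} {a b : OspIdx d r n} (hv : ρ.root a b v = 0) :
    ∀ x ∈ ℂ ∙ v, ρ.root a b x = 0 := by
  intro x hx
  obtain ⟨t, rfl⟩ := mem_span_singleton.1 hx
  rw [map_smul, hv, smul_zero]

/-- The structure of an irreducible representation with respect to a coarse grading whose degree
zero part preserves the line of the highest weight vector. -/
theorem IsIrreducible.coarse (hρ : ρ.IsIrreducible) {g : OspHeight d r n} {lam : OspWeight d n}
    {v : V} (hv0 : v ≠ 0) (hp : ρ.parity v = v ∨ ρ.parity v = -v) (hw : ρ.IsWeightVec lam v)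
    (hlevi : ∀ a b, a ≠ b → g a = g b → ρ.root a b v = 0) (hs : ρ.IsSing g v) :
    (ℂ ∙ v) ⊔ ρ.below g (lam.eval (grad g).1) = ⊤ ∧ ∀ x, ρ.IsSing g x → x ∈ ℂ ∙ v := by
  refine hρ.sing_le ?_ (parity_mem_span hp) (fun a b hab => root_mem_span ?_)
    (fun a b hab => root_eq_zero_of_mem_span (hs a b hab)) (by simpa using hv0)
  · rw [span_singleton_le_iff_mem]; exact hw.mem_eig g
  · by_cases h : a = b
    · subst h; rw [hw a]; exact smul_mem _ _ (mem_span_singleton_self v)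
    · rw [hlevi a b h hab]; exact zero_mem _

theorem IsIrreducible.hw (hρ : ρ.IsIrreducible) {ht : OspHeight d r n}
    (hht : ∀ a b, ht a = ht b → a = b) {lam : OspWeight d n} {v : V} (hv : ρ.IsHWVec ht lam v) :
    (ℂ ∙ v) ⊔ ρ.below ht (lam.eval (grad ht).1) = ⊤ ∧ ∀ x, ρ.IsSing ht x → x ∈ ℂ ∙ v :=
  hρ.coarse hv.ne_zero hv.parity hv.weight (fun a b h h' => absurd (hht a b h') h) hv.sing

theorem IsIrreducible.gen_eq_top (hρ : ρ.IsIrreducible) {v : V} (hv : v ≠ 0) : ρ.gen {v} = ⊤ := by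
  refine (hρ.2 _ (ρ.gen_isSubrep _)).resolve_left fun h => hv ?_
  have : v ∈ ρ.gen {v} := ρ.subset_gen _ rfl
  rwa [h, mem_bot] at this

/-- If a weight is a supertrace twisted by a grading, the corresponding highest weight vector is
killed by the degree zero root vectors. -/
theorem IsIrreducible.root_eq_zero (hρ : ρ.IsIrreducible) {ht g : OspHeight d r n}
    (hht : ∀ a b, ht a = ht b → a = b) (hg : ∀ a b, g b < g a → ht b < ht a)
    {lam : OspWeight d n} {v : V} (hv : ρ.IsHWVec ht lam v) {t : ℂ}
    (hlam : ∀ a : OspIdx d r n, ext lam a = t * (superSign a * g a)) {a b : OspIdx d r n} (hne : a ≠ b)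
    (hab : g a = g b) : ρ.root a b v = 0 := by
  obtain ⟨htop, hsing⟩ := hρ.hw hht hv
  suffices key : ∀ N : ℕ, ∀ a b : OspIdx d r n, g a = g b → a ≠ b → ht b - ht a = N → ρ.root a b v = 0 by
    rcases lt_trichotomy (ht a) (ht b) with h | h | h
    · exact key (ht b - ht a).toNat a b hab hne (by omega)
    · exact absurd (hht a b h) hne
    · exact hv.sing a b h
  intro N
  induction N using Nat.strong_induction_on with
  | _ N ih =>
  intro a b hab hne hN
  have hs : ρ.IsSing ht (ρ.root a b v) := by
    intro c e hce
    rw [root_root, hv.sing c e hce, map_zero, smul_zero, add_zero]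
    have hge : g e ≤ g c := by
      by_contra h; push Not at h; have := hg e c h; omega
    by_cases hD : ht c - ht e + (ht a - ht b) = 0 ∧ g c = g e
    · have hcart : (Osp.bracket (rootVec c e) (rootVec a b)).IsCartan := by
        intro i j hij
        by_contra h0
        have := Osp.bracket_rootVec_degree ht h0
        exact hij (hht i j (by omega))
      rw [hv.weight.act hcart, OspWeight.eval_eq_sum]
      have := Osp.sum_superSign_bracket g (X := rootVec a b) (Y := rootVec c e)
        (fun i j hij => by have := Osp.rootVec_degree g hij; omega)
      have h2 : ∑ i, (Osp.bracket (rootVec c e) (rootVec a b)).1 i i * ext lam i = 0 := by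
        rw [← mul_zero t, ← this, mul_sum]
        refine sum_congr rfl fun i _ => ?_
        rw [hlam]; ring
      rw [h2, mul_zero, zero_smul]
    · refine ρ.act_eq_zero_of_root fun i j hij => ?_
      have h1 := Osp.bracket_rootVec_degree ht hij
      have h2 := Osp.bracket_rootVec_degree g hij
      rcases lt_trichotomy (ht i) (ht j) with h | h | h
      · refine ih (ht j - ht i).toNat (by omega) i j ?_ (fun h' => by rw [h'] at h; exact lt_irrefl _ h) (by omega)
        by_contra h'
        have := hg i j (by omega)
        omega
      · have := hht i j h; subst this
        exfalso; omega
      · exact hv.sing i j h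
  have h1 := hsing _ hs
  have h2 : ρ.root a b v ∈ ρ.eig ht (lam.eval (grad ht).1) := by
    obtain ⟨x, hx⟩ := mem_span_singleton.1 h1
    rw [← hx]; exact smul_mem _ _ (hv.weight.mem_eig ht)
  have h3 := ρ.root_mem_eig (hv.weight.mem_eig ht) a b
  have h4 : ht a ≠ ht b := fun h => hne (hht a b h)
  have h5 := (ρ.eig_disjoint (ht := ht) (c := lam.eval (grad ht).1)
    (c' := lam.eval (grad ht).1 + (ht a - ht b)) (fun h => h4 (by
      have : (ht a : ℂ) = ht b := by linear_combination -h
      exact_mod_cast this))).le_bot ⟨h2, h3⟩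
  simpa using h5

/-- A functional dual to the highest weight vector. -/
theorem exists_functional {g : OspHeight d r n} {c : ℂ} {v : V} (hv0 : v ≠ 0) (hv : v ∈ ρ.eig g c) :
    ∃ ξ : V →ₗ[ℂ] ℂ, ξ v = 1 ∧ ∀ x ∈ ρ.below g c, ξ x = 0 := by
  have hnm : v ∉ ρ.below g c := fun h => hv0 (by
    have := (ρ.eig_disjoint_below g c).le_bot ⟨hv, h⟩
    simpa using this)
  obtain ⟨f, hf, hf2⟩ := Submodule.exists_le_ker_of_notMem hnm
  refine ⟨(f v)⁻¹ • f, by simp [hf], fun x hx => ?_⟩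
  have : f x = 0 := hf2 hx
  simp [this]

theorem parity_mem_below {g : OspHeight d r n} {c : ℂ} {x : V} (hx : x ∈ ρ.below g c) :
    ρ.parity x ∈ ρ.below g c := by
  refine iSup_induction _ (motive := fun v => ρ.parity v ∈ ρ.below g c) hx ?_ ?_ ?_
  · intro k y hy; exact mem_iSup_of_mem k (ρ.parity_mem_eig hy)
  · simp
  · intro x y hx hy; rw [map_add]; exact add_mem hx hy

/-! ### The leading coefficient of a tensor -/

/-- Contraction of the second factor with a functional. -/
def contractRight (ξ : W →ₗ[ℂ] ℂ) : V ⊗[ℂ] W →ₗ[ℂ] V :=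
  (TensorProduct.rid ℂ V).toLinearMap ∘ₗ LinearMap.lTensor V ξ

@[simp] theorem contractRight_tmul (ξ : W →ₗ[ℂ] ℂ) (v : V) (w : W) :
    contractRight ξ (v ⊗ₜ[ℂ] w) = ξ w • v := by
  simp [contractRight]

theorem contractRight_smul (t : ℂ) (ξ : W →ₗ[ℂ] ℂ) (y : V ⊗[ℂ] W) :
    contractRight (t • ξ) y = t • contractRight ξ y := by
  simp [contractRight, LinearMap.lTensor_smul]

theorem contractRight_zero (y : V ⊗[ℂ] W) : contractRight (0 : W →ₗ[ℂ] ℂ) y = 0 := by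
  simp [contractRight]

theorem contractRight_root (ρ : OspRep d r n V) (σ : OspRep d r n W) (ξ : W →ₗ[ℂ] ℂ)
    (a b : OspIdx d r n) (y : V ⊗[ℂ] W) :
    contractRight ξ ((ρ.tensor σ).root a b y) = ρ.root a b (contractRight ξ y)
      + ρ.braid a b (contractRight (ξ ∘ₗ σ.root a b) y) := by
  induction y with
  | zero => simp
  | add x y hx hy => simp only [map_add, hx, hy]; abel
  | tmul v w => simp [root_tmul]

theorem contractRight_cartan (ρ : OspRep d r n V) (σ : OspRep d r n W) (ξ : W →ₗ[ℂ] ℂ)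
    {H : Osp d r n} (hH : H.IsCartan) (y : V ⊗[ℂ] W) :
    contractRight ξ ((ρ.tensor σ).act H y) = ρ.act H (contractRight ξ y)
      + contractRight (ξ ∘ₗ σ.act H) y := by
  induction y with
  | zero => simp
  | add x y hx hy => simp only [map_add, hx, hy]; abel
  | tmul v w => simp [act_cartan_tmul _ _ hH]

theorem eq_zero_of_forall_contract {y : V ⊗[ℂ] W}
    (h : ∀ φ : V →ₗ[ℂ] ℂ, TensorProduct.lid ℂ W (rTensor W φ y) = 0) : y = 0 := by
  classical
  let b := Module.Basis.ofVectorSpace ℂ V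
  apply (TensorProduct.equivFinsuppOfBasisLeft (N := W) b).injective
  rw [map_zero]
  ext i
  rw [TensorProduct.equivFinsuppOfBasisLeft_apply]
  exact h (b.coord i)

/-- A singular vector of a tensor product is determined by its leading coefficient. -/
theorem eq_zero_of_contract_eq_zero (hσ : σ.IsIrreducible) {ht : OspHeight d r n}
    (hht : ∀ a b, ht a = ht b → a = b) {kap : OspWeight d n} {w : W} (hw : σ.IsHWVec ht kap w)
    {g : OspHeight d r n} {c : ℂ} (hg : (ℂ ∙ w) ⊔ σ.below g c = ⊤) {ξ : W →ₗ[ℂ] ℂ} (hξ : ξ w = 1)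
    (hξ0 : ∀ x ∈ σ.below g c, ξ x = 0)
    {y : V ⊗[ℂ] W} (hy : (ρ.tensor σ).IsSing ht y) (hy0 : contractRight ξ y = 0) : y = 0 := by
  obtain ⟨htop, hsing⟩ := hσ.hw hht hw
  set K : Submodule ℂ (V ⊗[ℂ] W) := (ρ.tensor σ).sing ht ⊓ ker (contractRight ξ) with hK
  have hξg : ξ ∘ₗ σ.act (grad ht) = (kap.eval (grad ht).1) • ξ := by
    ext x
    have hx : x ∈ (ℂ ∙ w) ⊔ σ.below g c := by rw [hg]; trivial
    obtain ⟨p, hp, q, hq, rfl⟩ := mem_sup.1 hx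
    obtain ⟨t, rfl⟩ := mem_span_singleton.1 hp
    have h1 : σ.act (grad ht) q ∈ σ.below g c :=
      σ.act_mem_of_root_mem fun a b hab => σ.root_mem_below (grad_apply_ne a b hab) hq
    simp [hw.weight.act (grad_isCartan ht), hξ0 _ h1, hξ0 _ hq, hξ, mul_comm]
  have hKg : ∀ z ∈ K, (ρ.tensor σ).act (grad ht) z ∈ K := by
    intro z hz
    refine ⟨act_mem_sing _ hz.1 grad_apply_ne, ?_⟩
    have hz2 : contractRight ξ z = 0 := hz.2
    change contractRight ξ _ = 0
    rw [contractRight_cartan _ _ _ (grad_isCartan ht), hz2, map_zero, zero_add, hξg,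
      contractRight_smul, hz2, smul_zero]
  set Z : Submodule ℂ W :=
    { carrier := {x | ∀ η : W →ₗ[ℂ] ℂ, (∀ z ∈ K, contractRight (V := V) η z = 0) → η x = 0}
      zero_mem' := fun η _ => map_zero _
      add_mem' := fun {x y} hx hy η hη => by rw [map_add, hx η hη, hy η hη, add_zero]
      smul_mem' := fun t x hx η hη => by rw [map_smul, hx η hη, smul_zero] } with hZ
  have hZ0 : Z = ⊥ := by
    by_contra hne
    have hb : σ.IsBddGraded ht (kap.eval (grad ht).1) := σ.isBddGraded_of_sup
      (top_le_iff.1 (htop.ge.trans (sup_le_sup_right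
        (by rw [span_singleton_le_iff_mem]; exact hw.weight.mem_eig ht) _)))
    have hZr : ∀ x ∈ Z, ∀ a b, ht b < ht a → σ.root a b x ∈ Z := by
      intro x hx a b hab η hη
      refine hx (η ∘ₗ σ.root a b) fun z hz => ?_
      have h1 := contractRight_root ρ σ η a b z
      rw [hz.1 a b hab, map_zero, hη z hz, map_zero, zero_add] at h1
      rw [← ρ.braid_braid a b (contractRight (η ∘ₗ σ.root a b) z), ← h1, map_zero]
    have hZg : ∀ x ∈ Z, σ.act (grad ht) x ∈ Z := by
      intro x hx η hη
      refine hx (η ∘ₗ σ.act (grad ht)) fun z hz => ?_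
      have h1 := contractRight_cartan ρ σ η (grad_isCartan ht) z
      rw [hη z hz, map_zero, zero_add, hη _ (hKg z hz)] at h1
      exact h1.symm
    obtain ⟨x, hx, hx0, hxs, -⟩ := σ.exists_sing hb hZr hZg hne
    obtain ⟨t, rfl⟩ := mem_span_singleton.1 (hsing x hxs)
    have := hx ξ fun z hz => hz.2
    rw [map_smul, hξ] at this
    have ht0 : t = 0 := by simpa using this
    exact hx0 (by rw [ht0, zero_smul])
  refine eq_zero_of_forall_contract fun φ => ?_
  have hmem : TensorProduct.lid ℂ W (rTensor W φ y) ∈ Z := by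
    intro η hη
    have h1 : ∀ z : V ⊗[ℂ] W, η (TensorProduct.lid ℂ W (rTensor W φ z)) = φ (contractRight η z) := by
      intro z
      induction z with
      | zero => simp
      | add x y hx hy => simp [hx, hy]
      | tmul v w => simp [mul_comm]
    rw [h1, hη y ⟨hy, hy0⟩, map_zero]
  rwa [hZ0, mem_bot] at hmem

section Leading

variable {g : OspHeight d r n} {kap : OspWeight d n} {w : W} {c : ℂ} {ξ : W →ₗ[ℂ] ℂ}

theorem comp_root_eq_zero (hg : (ℂ ∙ w) ⊔ σ.below g c = ⊤) (hξ0 : ∀ x ∈ σ.below g c, ξ x = 0)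
    {a b : OspIdx d r n} (hab : g a = g b) (hw : σ.root a b w = 0) : ξ ∘ₗ σ.root a b = 0 := by
  ext x
  have hx : x ∈ (ℂ ∙ w) ⊔ σ.below g c := by rw [hg]; trivial
  obtain ⟨p, hp, q, hq, rfl⟩ := mem_sup.1 hx
  simp [root_eq_zero_of_mem_span hw p hp, hξ0 _ (σ.root_mem_below hab hq)]

theorem contractRight_root_of_eq (hg : (ℂ ∙ w) ⊔ σ.below g c = ⊤) (hξ0 : ∀ x ∈ σ.below g c, ξ x = 0)
    {a b : OspIdx d r n} (hab : g a = g b) (hw : σ.root a b w = 0) (y : V ⊗[ℂ] W) :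
    contractRight ξ ((ρ.tensor σ).root a b y) = ρ.root a b (contractRight ξ y) := by
  rw [contractRight_root, comp_root_eq_zero σ hg hξ0 hab hw, contractRight_zero, map_zero, add_zero]

end Leading

/-! ### Generation of a tensor product -/

/-- The vectors `v` such that `v ⊗ w` lies in a given subspace. -/
def colon (N : Submodule ℂ (V ⊗[ℂ] W)) (w : W) : Submodule ℂ V :=
  N.comap ((TensorProduct.mk ℂ V W).flip w)

theorem mem_colon {N : Submodule ℂ (V ⊗[ℂ] W)} {w : W} {v : V} : v ∈ colon N w ↔ v ⊗ₜ w ∈ N := Iff.rfl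

theorem parity_mem_colon {N : Submodule ℂ (V ⊗[ℂ] W)} (hN : (ρ.tensor σ).IsSubrep N) {w : W}
    (hw : σ.parity w = w ∨ σ.parity w = -w) {v : V} (hv : v ∈ colon N w) : ρ.parity v ∈ colon N w := by
  have h := hN.1 _ hv
  rw [mem_colon]
  change ρ.parity v ⊗ₜ σ.parity w ∈ N at h
  rcases hw with hw | hw
  · rwa [hw] at h
  · rw [hw, tmul_neg] at h
    exact (neg_mem_iff).1 h

theorem root_mem_colon {N : Submodule ℂ (V ⊗[ℂ] W)} (hN : (ρ.tensor σ).IsSubrep N) {w : W}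
    (hw : σ.parity w = w ∨ σ.parity w = -w) {a b : OspIdx d r n} (hab : σ.root a b w ∈ ℂ ∙ w) {v : V}
    (hv : v ∈ colon N w) : ρ.root a b v ∈ colon N w := by
  have h : (ρ.tensor σ).root a b (v ⊗ₜ w) ∈ N := hN.2 (rootVec a b) _ hv
  rw [root_tmul] at h
  obtain ⟨t, ht⟩ := mem_span_singleton.1 hab
  rw [← ht, tmul_smul] at h
  refine (N.add_mem_iff_left (N.smul_mem t ?_)).1 h
  rcases superSign_mul_eq a b with h1 | h1
  · rw [braid_of_eq_one _ h1]; exact hv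
  · rw [braid_of_eq_neg_one _ h1]; exact parity_mem_colon σ hN hw hv

/-- A subrepresentation containing `v ⊗ w` for all `v` is everything. -/
theorem eq_top_of_colon (hσ : σ.IsIrreducible) {w : W} (hw : w ≠ 0)
    {N : Submodule ℂ (V ⊗[ℂ] W)} (hN : (ρ.tensor σ).IsSubrep N) (h : colon N w = ⊤) : N = ⊤ := by
  set U : Submodule ℂ W :=
    { carrier := {y | ∀ v : V, v ⊗ₜ y ∈ N}
      zero_mem' := fun v => by simp
      add_mem' := fun {x y} hx hy v => by rw [tmul_add]; exact add_mem (hx v) (hy v)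
      smul_mem' := fun t x hx v => by rw [tmul_smul]; exact N.smul_mem t (hx v) } with hU
  have hsub : σ.IsSubrep U := by
    refine σ.isSubrep_of_root (fun y hy v => ?_) (fun y hy a b v => ?_)
    · have := hN.1 _ (hy (ρ.parity v))
      rwa [parity_tmul, ρ.parity_parity] at this
    · have h1 : (ρ.tensor σ).root a b (ρ.braid a b v ⊗ₜ y) ∈ N := hN.2 _ _ (hy _)
      rw [root_tmul, braid_braid] at h1
      exact (N.add_mem_iff_right (hy _)).1 h1
  have hwU : w ∈ U := fun v => by
    have : v ∈ colon N w := by rw [h]; trivial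
    exact this
  have hUtop : U = ⊤ := (hσ.2 U hsub).resolve_left fun h => hw (by rwa [h, mem_bot] at hwU)
  rw [eq_top_iff]
  rintro y -
  induction y with
  | zero => exact zero_mem _
  | add x y hx hy => exact add_mem hx hy
  | tmul v x =>
    have : x ∈ U := by rw [hUtop]; trivial
    exact this v

/-! ### Restriction -/

theorem restrict_isIrreducible {A : Submodule ℂ V} (hA : ρ.IsSubrep A) (hne : A ≠ ⊥)
    (h : ∀ U ≤ A, ρ.IsSubrep U → U ≠ ⊥ → U = A) : (ρ.restrict A hA).IsIrreducible := by
  refine ⟨Submodule.nontrivial_iff_ne_bot.2 hne, fun U hU => ?_⟩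
  by_cases hb : U = ⊥
  · exact Or.inl hb
  · right
    have h1 : ρ.IsSubrep (U.map A.subtype) := by
      refine ⟨?_, ?_⟩
      · rintro _ ⟨x, hx, rfl⟩; exact ⟨_, hU.1 x hx, rfl⟩
      · rintro X _ ⟨x, hx, rfl⟩; exact ⟨_, hU.2 X x hx, rfl⟩
    have h2 := h _ (Submodule.map_subtype_le A U) h1 fun h0 => hb (by
      exact (Submodule.map_injective_of_injective A.injective_subtype) (h0.trans (Submodule.map_bot _).symm))
    rw [eq_top_iff]
    rintro ⟨x, hx⟩ -
    rw [← h2] at hx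
    obtain ⟨y, hy, hyx⟩ := hx
    have : y = ⟨x, h2 ▸ ⟨y, hy, hyx⟩⟩ := Subtype.ext hyx
    rwa [← this]

theorem IsHWVec.restrict {A : Submodule ℂ V} (hA : ρ.IsSubrep A) {ht : OspHeight d r n} {lam : OspWeight d n}
    {v : V} (hv : ρ.IsHWVec ht lam v) (hvA : v ∈ A) : (ρ.restrict A hA).IsHWVec ht lam ⟨v, hvA⟩ where
  ne_zero h := hv.ne_zero (congrArg Subtype.val h)
  parity := hv.parity.imp (fun h => Subtype.ext h) (fun h => Subtype.ext h)
  weight a := Subtype.ext (hv.weight a)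
  sing a b hab := Subtype.ext (hv.sing a b hab)

/-- `A` is an irreducible subrepresentation with highest weight `lam`. -/
def IsIrredSub (ρ : OspRep d r n V) (ht : OspHeight d r n) (lam : OspWeight d n) (A : Submodule ℂ V) : Prop :=
  ∃ hA : ρ.IsSubrep A, (ρ.restrict A hA).IsIrreducible ∧ ∃ v, (ρ.restrict A hA).IsHWVec ht lam v

/-- The subrepresentation generated by a singular vector is irreducible if it contains no
other homogeneous singular vectors. -/
theorem gen_isIrredSub {ht : OspHeight d r n} {c : ℂ} (hb : ρ.IsBddGraded ht c)
    {lam : OspWeight d n} {v : V} (hv : ρ.IsHWVec ht lam v)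
    (hsing : ∀ x ∈ ρ.gen {v}, ∀ k : ℕ, x ∈ ρ.eig ht (c - k) → ρ.IsSing ht x → x ≠ 0 → v ∈ ρ.gen {x}) :
    ρ.IsIrredSub ht lam (ρ.gen {v}) := by
  have hmem : v ∈ ρ.gen {v} := ρ.subset_gen _ rfl
  refine ⟨ρ.gen_isSubrep _, restrict_isIrreducible _ (fun h => hv.ne_zero ?_) fun U hU hUs hU0 => ?_,
    _, hv.restrict _ hmem⟩
  · rwa [h, mem_bot] at hmem
  · obtain ⟨x, hxU, hx0, hxs, k, hk⟩ := ρ.exists_sing hb (fun v hv a b _ => hUs.2 _ v hv)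
      (fun v hv => hUs.2 _ v hv) hU0
    refine le_antisymm hU (ρ.gen_le hUs (singleton_subset_iff.2 ?_))
    exact ρ.gen_le hUs (singleton_subset_iff.2 hxU) (hsing x (hU hxU) k hk hxs hx0)

theorem IsSubrep.sup {A B : Submodule ℂ V} (hA : ρ.IsSubrep A) (hB : ρ.IsSubrep B) : ρ.IsSubrep (A ⊔ B) := by
  refine ⟨fun v hv => ?_, fun X v hv => ?_⟩ <;> obtain ⟨p, hp, q, hq, rfl⟩ := mem_sup.1 hv <;> rw [map_add]
  · exact Submodule.add_mem_sup (hA.1 _ hp) (hB.1 _ hq)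
  · exact Submodule.add_mem_sup (hA.2 _ _ hp) (hB.2 _ _ hq)

/-! ### Separation by the Casimir operator -/

theorem casimir_of_mem_gen {v x : V} {c : ℂ} (hv : ρ.casimir v = c • v) (hx : x ∈ ρ.gen {v}) :
    ρ.casimir x = c • x :=
  (ρ.mem_ker_casimir).1 (ρ.gen_le_ker_casimir (c := c) (by rintro _ rfl; exact hv) hx)

theorem IsWeightVec.smul {lam : OspWeight d n} {v : V} (hv : ρ.IsWeightVec lam v) (t : ℂ) :
    ρ.IsWeightVec lam (t • v) := fun a => by rw [map_smul, hv a, smul_comm]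

theorem IsWeightVec.sub {lam : OspWeight d n} {v v' : V} (hv : ρ.IsWeightVec lam v)
    (hv' : ρ.IsWeightVec lam v') : ρ.IsWeightVec lam (v - v') :=
  fun a => by rw [map_sub, hv a, hv' a, smul_sub]

theorem IsWeightVec.casimir {lam : OspWeight d n} {v : V} (hv : ρ.IsWeightVec lam v) :
    ρ.IsWeightVec lam (ρ.casimir v) := fun a => by rw [root_casimir, hv a, map_smul]

/-- If `y` is singular modulo the subrepresentation generated by `u₁` and the Casimir operator
separates the two, then `y` can be corrected to a singular vector. -/
theorem exists_sing_correction {ht : OspHeight d r n} (hht : ∀ a b, ht a = ht b → a = b)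
    {l₁ l₂ : OspWeight d n} {u₁ y : V} (hu₁ : ρ.IsHWVec ht l₁ u₁)
    (hy : ρ.IsWeightVec l₂ y) (hyp : ρ.parity y = y ∨ ρ.parity y = -y)
    (hys : ∀ a b, ht b < ht a → ρ.root a b y ∈ ρ.gen {u₁})
    (hc : casimirValue ht l₁ ≠ casimirValue ht l₂) :
    ∃ u₂, ρ.IsWeightVec l₂ u₂ ∧ (ρ.parity u₂ = u₂ ∨ ρ.parity u₂ = -u₂) ∧ ρ.IsSing ht u₂ ∧
      y - u₂ ∈ ρ.gen {u₁} := by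
  set c₁ := casimirValue ht l₁
  set c₂ := casimirValue ht l₂
  have hcc : c₁ - c₂ ≠ 0 := sub_ne_zero.2 hc
  have hC₁ : ρ.casimir u₁ = c₁ • u₁ := casimir_eq_of_isSing hht hu₁.weight hu₁.sing
  have hz := casimir_sub_mem hht (ρ.gen_isSubrep {u₁}) hy hys
  set z := ρ.casimir y - c₂ • y with hzdef
  have hzw : ρ.IsWeightVec l₂ z := hy.casimir.sub (hy.smul c₂)
  refine ⟨y - (c₁ - c₂)⁻¹ • z, hy.sub (hzw.smul _), ?_, ?_, ?_⟩
  · have hp : ∀ t : ℂ, ρ.parity y = t • y →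
        ρ.parity (y - (c₁ - c₂)⁻¹ • z) = t • (y - (c₁ - c₂)⁻¹ • z) := by
      intro t h
      simp only [hzdef, map_sub, map_smul, parity_casimir, h, smul_sub, smul_comm t]
    rcases hyp with h | h
    · left; have := hp 1 (by rw [h, one_smul]); rwa [one_smul] at this
    · right; have := hp (-1) (by rw [h, neg_one_smul]); rwa [neg_one_smul] at this
  · intro a b hab
    have h1 : ρ.root a b z = (c₁ - c₂) • ρ.root a b y := by
      rw [hzdef, map_sub, map_smul, root_casimir, casimir_of_mem_gen hC₁ (hys a b hab), sub_smul]
    rw [map_sub, map_smul, h1, smul_smul, inv_mul_cancel₀ hcc, one_smul, sub_self]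
  · rw [sub_sub_cancel]; exact smul_mem _ _ hz

/-- The decomposition of a representation generated by two vectors, the second of which is singular
modulo the first, when the Casimir operator separates the two. -/
theorem decompose_two {ht : OspHeight d r n} (hht : ∀ a b, ht a = ht b → a = b) {c : ℂ}
    (hb : ρ.IsBddGraded ht c) {l₁ l₂ : OspWeight d n} {u₁ y : V} (hu₁ : ρ.IsHWVec ht l₁ u₁)
    (hy : ρ.IsWeightVec l₂ y) (hyp : ρ.parity y = y ∨ ρ.parity y = -y)
    (hys : ∀ a b, ht b < ht a → ρ.root a b y ∈ ρ.gen {u₁})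
    (hc : casimirValue ht l₁ ≠ casimirValue ht l₂)
    (htop : ∀ N, ρ.IsSubrep N → u₁ ∈ N → y ∈ N → N = ⊤)
    (hscal : ∃ x, ρ.casimir x ≠ casimirValue ht l₁ • x)
    {F : Type*} [AddCommGroup F] [Module ℂ F] (L : V →ₗ[ℂ] F) (s₁ s₂ : F)
    (hL : ∀ x, ρ.IsSing ht x → L x ∈ span ℂ {s₁, s₂})
    (hL0 : ∀ x, ρ.IsSing ht x → L x = 0 → x = 0) :
    ∃ A₁ A₂ : Submodule ℂ V, IsCompl A₁ A₂ ∧ ρ.IsIrredSub ht l₁ A₁ ∧ ρ.IsIrredSub ht l₂ A₂ := by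
  obtain ⟨u₂, hu₂w, hu₂p, hu₂s, hyu⟩ := exists_sing_correction hht hu₁ hy hyp hys hc
  set c₁ := casimirValue ht l₁
  set c₂ := casimirValue ht l₂
  have hC₁ : ρ.casimir u₁ = c₁ • u₁ := casimir_eq_of_isSing hht hu₁.weight hu₁.sing
  have hC₂ : ρ.casimir u₂ = c₂ • u₂ := casimir_eq_of_isSing hht hu₂w hu₂s
  have hmem₁ : u₁ ∈ ρ.gen {u₁} := ρ.subset_gen _ rfl
  have hmem₂ : u₂ ∈ ρ.gen {u₂} := ρ.subset_gen _ rfl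
  have hu₂0 : u₂ ≠ 0 := by
    rintro rfl
    obtain ⟨x, hx⟩ := hscal
    rw [sub_zero] at hyu
    have := htop _ (ρ.gen_isSubrep {u₁}) hmem₁ hyu
    exact hx (casimir_of_mem_gen hC₁ (by rw [this]; trivial))
  have hcc : ∀ x, ρ.casimir x = c₁ • x → ρ.casimir x = c₂ • x → x = 0 := by
    intro x h1 h2
    rw [h1, ← sub_eq_zero, ← sub_smul] at h2
    exact (smul_eq_zero.1 h2).resolve_left (sub_ne_zero.2 hc)
  have hspan : ∀ x, ρ.IsSing ht x → ∃ p q : ℂ, x = p • u₁ + q • u₂ := by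
    have hinj : ∀ x ∈ ρ.sing ht, L x = 0 → x = 0 := fun x hx => hL0 x hx
    let f : ρ.sing ht →ₗ[ℂ] span ℂ ({s₁, s₂} : Set F) :=
      (L ∘ₗ (ρ.sing ht).subtype).codRestrict _ fun x => hL x x.2
    have hf : Function.Injective f := by
      rw [← ker_eq_bot, ker_eq_bot']
      intro x hx
      exact Subtype.ext (hL0 x x.2 (congrArg Subtype.val hx))
    have : FiniteDimensional ℂ (span ℂ ({s₁, s₂} : Set F)) :=
      FiniteDimensional.span_of_finite ℂ (Set.toFinite _)
    have : FiniteDimensional ℂ (ρ.sing ht) := Module.Finite.of_injective f hf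
    have hle : Module.finrank ℂ (ρ.sing ht) ≤ 2 := by
      refine (LinearMap.finrank_le_finrank_of_injective hf).trans ?_
      classical
      have := finrank_span_le_card (R := ℂ) ({s₁, s₂} : Set F)
      refine this.trans ?_
      rw [Set.toFinset_insert, Set.toFinset_singleton]
      exact Finset.card_le_two
    have hli : LinearIndependent ℂ ![u₁, u₂] := by
      rw [LinearIndependent.pair_iff]
      intro p q hpq
      have h1 : p • u₁ = -(q • u₂) := eq_neg_of_add_eq_zero_left hpq
      have h2 : p • u₁ = 0 := by
        apply hcc
        · rw [map_smul, hC₁, smul_comm]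
        · rw [h1, map_neg, map_smul, hC₂, smul_neg, smul_comm]
      have h3 : q • u₂ = 0 := by rw [h2] at h1; exact neg_eq_zero.1 h1.symm
      exact ⟨(smul_eq_zero.1 h2).resolve_right hu₁.ne_zero, (smul_eq_zero.1 h3).resolve_right hu₂0⟩
    have hsp : span ℂ ({u₁, u₂} : Set V) = ρ.sing ht := by
      refine Submodule.eq_of_le_of_finrank_le (span_le.2 ?_) ?_
      · rintro x (rfl | rfl)
        · exact hu₁.sing
        · exact hu₂s
      · have := finrank_span_eq_card hli
        rw [Matrix.range_cons, Matrix.range_cons, Matrix.range_empty, Set.union_empty,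
          Set.singleton_union] at this
        rw [this]; simpa using hle
    intro x hx
    have : x ∈ span ℂ ({u₁, u₂} : Set V) := by rw [hsp]; exact hx
    obtain ⟨p, q, h⟩ := Submodule.mem_span_pair.1 this
    exact ⟨p, q, h.symm⟩
  refine ⟨ρ.gen {u₁}, ρ.gen {u₂}, ⟨?_, ?_⟩, gen_isIrredSub hb hu₁ ?_,
    gen_isIrredSub hb ⟨hu₂0, hu₂p, hu₂w, hu₂s⟩ ?_⟩
  · rw [Submodule.disjoint_def]
    intro x h1 h2
    exact hcc x (casimir_of_mem_gen hC₁ h1) (casimir_of_mem_gen hC₂ h2)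
  · rw [codisjoint_iff]
    refine htop _ ((ρ.gen_isSubrep _).sup (ρ.gen_isSubrep _)) (mem_sup_left hmem₁) ?_
    rw [← sub_add_cancel y u₂]
    exact Submodule.add_mem_sup hyu hmem₂
  · intro x hx _ _ hxs hx0
    obtain ⟨p, q, rfl⟩ := hspan x hxs
    have h1 := casimir_of_mem_gen hC₁ hx
    have h2 : q • u₂ = 0 := by
      apply hcc
      · rw [map_add, map_smul, map_smul, hC₁, smul_add, smul_comm p] at h1
        rw [map_smul]; exact add_left_cancel h1
      · rw [map_smul, hC₂, smul_comm]
    rw [h2, add_zero] at hx0 ⊢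
    have hp : p ≠ 0 := fun h => hx0 (by rw [h, zero_smul])
    have := (ρ.gen {p • u₁}).smul_mem p⁻¹ (ρ.subset_gen _ rfl)
    rwa [smul_smul, inv_mul_cancel₀ hp, one_smul] at this
  · intro x hx _ _ hxs hx0
    obtain ⟨p, q, rfl⟩ := hspan x hxs
    have h1 := casimir_of_mem_gen hC₂ hx
    have h2 : p • u₁ = 0 := by
      apply hcc
      · rw [map_smul, hC₁, smul_comm]
      · rw [map_add, map_smul, map_smul, hC₂, smul_add, smul_comm c₂ q] at h1
        rw [map_smul]; exact add_right_cancel h1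
    rw [h2, zero_add] at hx0 ⊢
    have hp : q ≠ 0 := fun h => hx0 (by rw [h, zero_smul])
    have := (ρ.gen {q • u₂}).smul_mem q⁻¹ (ρ.subset_gen _ rfl)
    rwa [smul_smul, inv_mul_cancel₀ hp, one_smul] at this

end OspRep

namespace OspRep

variable {d r n : ℕ} {V : Type*} [AddCommGroup V] [Module ℂ V] {ρ : OspRep d r n V}
  {W : Type*} [AddCommGroup W] [Module ℂ W] {σ : OspRep d r n W}

theorem IsIrreducible.isBddGraded (hρ : ρ.IsIrreducible) {ht : OspHeight d r n}
    (hht : ∀ a b, ht a = ht b → a = b) {lam : OspWeight d n} {v : V} (hv : ρ.IsHWVec ht lam v) :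
    ρ.IsBddGraded ht (lam.eval (grad ht).1) :=
  ρ.isBddGraded_of_sup (top_le_iff.1 ((hρ.hw hht hv).1.ge.trans (sup_le_sup_right
    (by rw [span_singleton_le_iff_mem]; exact hv.weight.mem_eig ht) _)))

theorem root_mem_below_of_lt {g : OspHeight d r n} {c : ℂ} {v : V} (hv : v ∈ ρ.eig g c)
    {a b : OspIdx d r n} (h : g a < g b) : ρ.root a b v ∈ ρ.below g c := by
  obtain ⟨m, hm⟩ : ∃ m : ℕ, g b = g a + (m + 1) := ⟨(g b - g a - 1).toNat, by omega⟩
  refine mem_iSup_of_mem m ?_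
  convert ρ.root_mem_eig hv a b using 1
  rw [hm]; push_cast; ring_nf

/-- A highest weight vector of an irreducible representation is an eigenvector of the Casimir
operator with the eigenvalue of the whole representation. -/
theorem IsIrreducible.casimir_eq (hρ : ρ.IsIrreducible) {ht : OspHeight d r n}
    (hht : ∀ a b, ht a = ht b → a = b) {lam : OspWeight d n} {v : V} (hv : ρ.IsHWVec ht lam v) (x : V) :
    ρ.casimir x = casimirValue ht lam • x :=
  casimir_of_mem_gen (casimir_eq_of_isSing hht hv.weight hv.sing)
    (by rw [hρ.gen_eq_top hv.ne_zero]; trivial)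

theorem IsHWVec.tmul {ht : OspHeight d r n} {lam kap : OspWeight d n} {s : V} {w : W}
    (hs : ρ.IsHWVec ht lam s) (hw : σ.IsHWVec ht kap w) :
    (ρ.tensor σ).IsHWVec ht (lam + kap) (s ⊗ₜ w) where
  ne_zero := by
    intro h
    obtain ⟨ξ, hξ, -⟩ := exists_functional hw.ne_zero (hw.weight.mem_eig ht)
    have := congrArg (contractRight ξ) h
    rw [contractRight_tmul, hξ, one_smul, map_zero] at this
    exact hs.ne_zero this
  parity := by
    rw [parity_tmul]
    rcases hs.parity with h | h <;> rcases hw.parity with h' | h' <;> rw [h, h'] <;>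
      simp [neg_tmul, tmul_neg]
  weight := hs.weight.tmul hw.weight
  sing a b hab := by rw [root_tmul, hs.sing a b hab, hw.sing a b hab]; simp

/-- If the weights of the second factor pair differently with the highest weight of the first
factor, then the Casimir operator is not scalar on the tensor product. -/
theorem exists_casimir_ne (hσ : σ.IsIrreducible) {ht : OspHeight d r n}
    (hht : ∀ a b, ht a = ht b → a = b) {lam kap mu : OspWeight d n} {s : V} {w y : W}
    (hs : ρ.IsHWVec ht lam s) (hw : σ.IsHWVec ht kap w) (hy : σ.IsWeightVec mu y) (hy0 : y ≠ 0)
    (hpair : ∑ a : OspIdx d r n, superSign a * (ext lam a * ext mu a) ≠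
      ∑ a : OspIdx d r n, superSign a * (ext lam a * ext kap a)) (c : ℂ) :
    ∃ x, (ρ.tensor σ).casimir x ≠ c • x := by
  by_contra! hscal
  obtain ⟨ξ, hξ, hξ0⟩ := exists_functional hs.ne_zero (hs.weight.mem_eig ht)
  have hξr : ∀ a b, a ≠ b → ξ (ρ.root a b s) = 0 := by
    intro a b hab
    rcases lt_trichotomy (ht a) (ht b) with h | h | h
    · exact hξ0 _ (root_mem_below_of_lt (hs.weight.mem_eig ht) h)
    · exact absurd (hht a b h) hab
    · rw [hs.sing a b h, map_zero]
  have key : ∀ (mu : OspWeight d n) (y : W), σ.IsWeightVec mu y → y ≠ 0 →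
      c = ξ (ρ.casimir s) + casimirValue ht kap
        + 2 * ∑ a : OspIdx d r n, superSign a * (ext lam a * ext mu a) := by
    intro mu y hy hy0
    have h := casimir_tmul_proj ρ σ hs.weight hs.parity hξ hξr hy
    rw [hscal, hσ.casimir_eq hht hw, ← add_smul, ← add_smul, map_smul, TensorProduct.lift.tmul] at h
    simp only [LinearMap.comp_apply, LinearMap.toSpanSingleton_apply, hξ, one_smul,
      LinearMap.id_apply] at h
    rw [← sub_eq_zero, ← sub_smul] at h
    exact sub_eq_zero.1 ((smul_eq_zero.1 h).resolve_right hy0)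
  have h1 := key mu y hy hy0
  rw [key kap w hw.weight hw.ne_zero] at h1
  apply hpair
  linear_combination -h1 / 2

/-- Elements of the first factor which a positively graded root vector produces from a vector one
degree below the top can be reached from the highest weight vector by degree zero elements. -/
theorem root_mem_colon_of_degree {g : OspHeight d r n} {kap : OspWeight d n} {c : ℂ} {s : V} {w : W}
    (hs : s ∈ ρ.eig g c) (hwp : σ.parity w = w ∨ σ.parity w = -w) (hw : σ.IsWeightVec kap w)
    (hwl : ∀ a b, a ≠ b → g a = g b → σ.root a b w = 0) {R : Set V}
    (hR : ∀ M : Submodule ℂ V, (∀ v ∈ M, ρ.parity v ∈ M) →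
      (∀ v ∈ M, ∀ a b, g a = g b → ρ.root a b v ∈ M) → R ⊆ M → M = ⊤)
    (hRs : ∀ x ∈ R, x = s ∨ x ∈ ρ.below g c) {N : Submodule ℂ (V ⊗[ℂ] W)}
    (hN : (ρ.tensor σ).IsSubrep N) (hsN : s ⊗ₜ w ∈ N) {x : V} (hx : x ∈ ρ.eig g (c - 1))
    {a b : OspIdx d r n} (hab : g b < g a) : ρ.root a b x ∈ colon N w := by
  have hspan : ∀ a b, g a = g b → σ.root a b w ∈ ℂ ∙ w := by
    intro a b h
    by_cases hne : a = b
    · subst hne; rw [hw a]; exact smul_mem _ _ (mem_span_singleton_self w)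
    · rw [hwl a b hne h]; exact zero_mem _
  have htop : (colon N w ⊓ ρ.eig g c) ⊔ ρ.below g c = ⊤ := by
    refine hR _ (fun v hv => ?_) (fun v hv a b hab => ?_) fun v hv => ?_
    · obtain ⟨p, hp, q, hq, rfl⟩ := mem_sup.1 hv
      rw [map_add]
      exact Submodule.add_mem_sup ⟨parity_mem_colon σ hN hwp hp.1, ρ.parity_mem_eig hp.2⟩
        (parity_mem_below hq)
    · obtain ⟨p, hp, q, hq, rfl⟩ := mem_sup.1 hv
      rw [map_add]
      refine Submodule.add_mem_sup ⟨root_mem_colon σ hN hwp (hspan a b hab) hp.1, ?_⟩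
        (ρ.root_mem_below hab hq)
      have := ρ.root_mem_eig hp.2 a b
      rwa [hab, sub_self, add_zero] at this
    · rcases hRs v hv with rfl | h
      · exact mem_sup_left ⟨hsN, hs⟩
      · exact mem_sup_right h
  have hmem : ρ.root a b x ∈ (colon N w ⊓ ρ.eig g c) ⊔ ρ.below g c := by rw [htop]; trivial
  obtain ⟨p, hp, q, hq, hpq⟩ := mem_sup.1 hmem
  have hdeg := ρ.root_mem_eig hx a b
  by_cases h1 : g a = g b + 1
  · have hdeg' : ρ.root a b x ∈ ρ.eig g c := by
      convert hdeg using 1; rw [h1]; push_cast; ring_nf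
    have hq0 : q = 0 := by
      have : q ∈ ρ.eig g c := by
        rw [show q = ρ.root a b x - p by rw [← hpq]; abel]; exact sub_mem hdeg' hp.2
      simpa using (ρ.eig_disjoint_below g c).le_bot ⟨this, hq⟩
    rw [← hpq, hq0, add_zero]; exact hp.1
  · have hb : ρ.IsBddGraded g c := ρ.isBddGraded_of_sup
      (top_le_iff.1 (htop.ge.trans (sup_le_sup_right inf_le_right _)))
    have h2 : ρ.eig g (c - 1 + (g a - g b)) = ⊥ := by
      refine ρ.eig_eq_bot hb fun k hk => h1 ?_
      have h3 : ((g a - g b - 1 + k : ℤ) : ℂ) = (0 : ℤ) := by push_cast; linear_combination hk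
      have := Int.cast_injective h3
      omega
    rw [h2, mem_bot] at hdeg
    rw [hdeg]; exact zero_mem _

/-- The decomposition of a tensor product into two irreducible components, from information on the
leading coefficients of singular vectors and on generators of the first factor. -/
theorem tensor_decompose_two (hρ : ρ.IsIrreducible) (hσ : σ.IsIrreducible) {ht g : OspHeight d r n}
    (hht : ∀ a b, ht a = ht b → a = b) (hg : ∀ a b, g b < g a → ht b < ht a)
    {lam lam' kap mu : OspWeight d n} {s v : V} {w y : W}
    (hs : ρ.IsHWVec ht lam s) (hv : ρ.IsWeightVec lam' v) (hvp : ρ.parity v = v ∨ ρ.parity v = -v)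
    (hvl : ∀ a b, g a = g b → ht b < ht a → ρ.root a b v = 0)
    (hvdeg : lam'.eval (grad g).1 = lam.eval (grad g).1 - 1)
    (hw : σ.IsHWVec ht kap w) {t : ℂ}
    (hkap : ∀ a : OspIdx d r n, ext kap a = t * (superSign a * g a)) {R : Set V}
    (hR : ∀ M : Submodule ℂ V, (∀ v ∈ M, ρ.parity v ∈ M) →
      (∀ v ∈ M, ∀ a b, g a = g b → ρ.root a b v ∈ M) → R ⊆ M → M = ⊤)
    (hRs : ∀ x ∈ R, x = s ∨ x ∈ ρ.below g (lam.eval (grad g).1))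
    (hRN : ∀ N, (ρ.tensor σ).IsSubrep N → s ⊗ₜ w ∈ N → v ⊗ₜ w ∈ N → ∀ x ∈ R, x ⊗ₜ w ∈ N)
    (hlead : ∀ ξ : W →ₗ[ℂ] ℂ, (∀ x ∈ σ.below g (kap.eval (grad g).1), ξ x = 0) →
      ∀ x, (ρ.tensor σ).IsSing ht x → contractRight ξ x ∈ span ℂ {s, v})
    (hc : casimirValue ht (lam + kap) ≠ casimirValue ht (lam' + kap))
    (hy : σ.IsWeightVec mu y) (hy0 : y ≠ 0)
    (hpair : ∑ a : OspIdx d r n, superSign a * (ext lam a * ext mu a) ≠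
      ∑ a : OspIdx d r n, superSign a * (ext lam a * ext kap a)) :
    ∃ A₁ A₂ : Submodule ℂ (V ⊗[ℂ] W), IsCompl A₁ A₂ ∧ (ρ.tensor σ).IsIrredSub ht (lam + kap) A₁ ∧
      (ρ.tensor σ).IsIrredSub ht (lam' + kap) A₂ := by
  have hwl : ∀ a b, a ≠ b → g a = g b → σ.root a b w = 0 :=
    fun a b hne hab => hσ.root_eq_zero hht hg hw hkap hne hab
  have hwg : (ℂ ∙ w) ⊔ σ.below g (kap.eval (grad g).1) = ⊤ :=
    (hσ.coarse hw.ne_zero hw.parity hw.weight hwl fun a b hab => hw.sing a b (hg a b hab)).1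
  obtain ⟨ξ, hξ, hξ0⟩ := exists_functional hw.ne_zero (hw.weight.mem_eig g)
  have hspan : ∀ a b, g a = g b → σ.root a b w ∈ ℂ ∙ w := by
    intro a b h
    by_cases hne : a = b
    · subst hne
      rw [hw.weight a]; exact smul_mem _ _ (mem_span_singleton_self w)
    · rw [hwl a b hne h]; exact zero_mem _
  have hb : (ρ.tensor σ).IsBddGraded ht (lam.eval (grad ht).1 + kap.eval (grad ht).1) :=
    IsBddGraded.tensor ρ σ (hρ.isBddGraded hht hs) (hσ.isBddGraded hht hw)
  refine decompose_two hht hb (hs.tmul hw) (hv.tmul hw.weight) ?_ ?_ hc ?_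
    (exists_casimir_ne hσ hht hs hw hy hy0 hpair _) (contractRight ξ) s v (hlead ξ hξ0) ?_
  · rw [parity_tmul]
    rcases hvp with h | h <;> rcases hw.parity with h' | h' <;> rw [h, h'] <;>
      simp [neg_tmul, tmul_neg]
  · intro a b hab
    rw [root_tmul, hw.sing a b hab, tmul_zero, add_zero]
    rcases lt_trichotomy (g a) (g b) with h | h | h
    · exact absurd (hg b a h) (by omega)
    · rw [hvl a b h hab, TensorProduct.zero_tmul]; exact zero_mem _
    · exact root_mem_colon_of_degree (hs.weight.mem_eig g) hw.parity hw.weight hwl hR hRs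
        (N := (ρ.tensor σ).gen {s ⊗ₜ w}) (gen_isSubrep _ _) (subset_gen _ _ rfl) (hvdeg ▸ hv.mem_eig g) h
  · intro N hN h1 h2
    refine eq_top_of_colon σ hσ hw.ne_zero hN (hR _ (fun v hv => parity_mem_colon σ hN hw.parity hv)
      (fun v hv a b hab => root_mem_colon σ hN hw.parity (hspan a b hab) hv) fun x hx => ?_)
    exact hRN N hN h1 h2 x hx
  · intro x hx hx0
    exact eq_zero_of_contract_eq_zero σ hσ hht hw hwg hξ hξ0 hx hx0

end OspRep

namespace OspIdx

variable {d r n : ℕ}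

/-- The sign in the defining relations of the Clifford–Weyl superalgebra. -/
def cliffSign (a b : OspIdx d r n) : ℂ := (1 + superSign a) * (1 + superSign b) / 2 - 1

theorem cliffSign_sq (a b : OspIdx d r n) : cliffSign a b * cliffSign a b = 1 := by
  rcases a with a | a <;> rcases b with b | b <;> norm_num [cliffSign, superSign]

theorem cliffSign_ne_zero (a b : OspIdx d r n) : cliffSign a b ≠ 0 := fun h => by
  have := cliffSign_sq a b
  simp [h] at this

@[simp] theorem cliffSign_dual_left (a b : OspIdx d r n) : cliffSign (dual a) b = cliffSign a b := by
  simp [cliffSign]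

@[simp] theorem cliffSign_dual_right (a b : OspIdx d r n) : cliffSign a (dual b) = cliffSign a b := by
  simp [cliffSign]

theorem metricSign_ne_zero (a : OspIdx d r n) : metricSign a ≠ 0 := fun h => by
  have := metricSign_sq a
  simp [h] at this

theorem superSign_eq (a : OspIdx d r n) : superSign a = 1 ∨ superSign a = -1 := by
  rcases a with a | a <;> simp [superSign]

theorem metricSign_mul_reflectSign_of_eq (j : OspIdx d r n) {l m : OspIdx d r n}
    (h : superSign l = superSign m) : metricSign (dual l) * 1 * reflectSign (dual m) (dual l)
      = braidSign j l m * metricSign (dual m) := by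
  have h4 := metricSign_sq l
  rw [reflectSign, dual_dual, dual_dual, metricSign_dual, metricSign_dual, superSign_dual,
    superSign_dual, braidSign]
  rcases superSign_eq l with hl | hl <;> rcases superSign_eq j with hj | hj <;> rw [← h, hl, hj]
  · linear_combination metricSign m * h4
  · linear_combination metricSign m * h4
  · linear_combination -metricSign m * h4
  · linear_combination -metricSign m * h4

theorem metricSign_mul_reflectSign_of_eq_neg (j : OspIdx d r n) {l m : OspIdx d r n}
    (h : superSign l = -superSign m) :
    metricSign (dual l) * -superSign j * reflectSign (dual m) (dual l)
      = braidSign j l m * metricSign (dual m) := by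
  have h4 := metricSign_sq l
  have hm : superSign m = -superSign l := by rw [h, neg_neg]
  rw [reflectSign, dual_dual, dual_dual, metricSign_dual, metricSign_dual, superSign_dual,
    superSign_dual, braidSign]
  rcases superSign_eq l with hl | hl <;> rcases superSign_eq j with hj | hj <;> rw [hm, hl, hj]
  · linear_combination -metricSign m * h4
  · linear_combination metricSign m * h4
  · linear_combination -metricSign m * h4
  · linear_combination metricSign m * h4

/-- The indices of `ε_j` and `δ_i`. -/
def IsPos : OspIdx d r n → Prop
  | .inl (.inl (.inl _)) => True
  | .inr (.inl _) => True
  | _ => False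

theorem isPos_trichotomy (a : OspIdx d r n) : IsPos a ∨ IsPos (dual a) ∨ dual a = a := by
  rcases a with ((a | a) | a) | a | a <;> simp [IsPos, dual]

theorem IsPos.dual_ne {a b : OspIdx d r n} (ha : IsPos a) (hb : IsPos b) : dual a ≠ b := by
  rintro rfl
  rcases a with ((a | a) | a) | a | a <;> simp [IsPos, dual] at ha hb

theorem IsPos.metricSign {a : OspIdx d r n} (ha : IsPos a) : metricSign a = 1 := by
  rcases a with ((a | a) | a) | a | a <;> simp [IsPos, OspIdx.metricSign] at ha ⊢

/-- The weight of a basis vector of the natural representation. -/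
def wt : OspIdx d r n → OspWeight d n
  | .inl (.inl (.inl j)) => Pi.single (.inl j) 1
  | .inl (.inl (.inr j)) => -Pi.single (.inl j) 1
  | .inl (.inr _) => 0
  | .inr (.inl i) => Pi.single (.inr i) 1
  | .inr (.inr i) => -Pi.single (.inr i) 1

theorem wt_dual (a : OspIdx d r n) : wt (dual a) = -wt a := by
  rcases a with ((a | a) | a) | a | a <;> simp [wt, dual]

theorem ext_wt (a j : OspIdx d r n) :
    ext (wt j) a = (if a = j then 1 else 0) - (if a = dual j then 1 else 0) := by
  rcases a with ((a | a) | a) | a | a <;> rcases j with ((j | j) | j) | j | j <;>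
    simp [OspWeight.ext, wt, dual, Pi.single_apply]

theorem eval_wt_grad (g : OspHeight d r n) (j : OspIdx d r n) :
    (wt j).eval (grad g).1 = g j := by
  have h : ∀ j : OspIdx d r n, IsPos j → (wt j).eval (grad g).1 = g j := by
    intro j hj
    rcases j with ((j | j) | j) | j | j <;> simp [IsPos] at hj
    all_goals simp [wt, OspWeight.eval, grad_apply_self, Pi.single_apply]
  rcases isPos_trichotomy j with hj | hj | hj
  · exact h j hj
  · have := h _ hj
    rw [wt_dual, g.map_dual] at this
    have h2 : (-wt j).eval (grad g).1 = -(wt j).eval (grad g).1 := by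
      simp [OspWeight.eval, sum_neg_distrib]; ring
    rw [h2] at this
    push_cast at this
    exact neg_injective this
  · have h1 := g.map_dual j
    rw [hj] at h1
    have h2 : g j = 0 := by omega
    rcases j with ((j | j) | j) | j | j <;> simp [dual] at hj <;>
      simp [wt, OspWeight.eval, h2]

end OspIdx

namespace OspWeight

variable {d r n : ℕ}

theorem eval_add (lam mu : OspWeight d n) (H : Matrix (OspIdx d r n) (OspIdx d r n) ℂ) :
    (lam + mu).eval H = lam.eval H + mu.eval H := by
  simp [eval, add_mul, sum_add_distrib]; ring

theorem eval_neg (lam : OspWeight d n) (H : Matrix (OspIdx d r n) (OspIdx d r n) ℂ) :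
    (-lam).eval H = -lam.eval H := by
  simp [eval, sum_neg_distrib]; ring

theorem eval_sub (lam mu : OspWeight d n) (H : Matrix (OspIdx d r n) (OspIdx d r n) ℂ) :
    (lam - mu).eval H = lam.eval H - mu.eval H := by
  rw [sub_eq_add_neg, eval_add, eval_neg, sub_eq_add_neg]

theorem eval_smul (c : ℂ) (lam : OspWeight d n) (H : Matrix (OspIdx d r n) (OspIdx d r n) ℂ) :
    (c • lam).eval H = c * lam.eval H := by
  simp [eval, mul_assoc, mul_sum, mul_add]

end OspWeight

/-- A module over the Clifford–Weyl superalgebra of the orthosymplectic metric. -/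
structure Oscillator (d r n : ℕ) (F : Type*) [AddCommGroup F] [Module ℂ F] where
  /-- the generators -/
  c : OspIdx d r n → F →ₗ[ℂ] F
  /-- the parity -/
  par : F →ₗ[ℂ] F
  /-- the parity of the number of generators -/
  gam : F →ₗ[ℂ] F
  par_par : ∀ v, par (par v) = v
  gam_par : ∀ v, gam (par v) = par (gam v)
  c_c : ∀ a b v, c a (c b v) = (if b = dual a then metricSign a else 0) • v - cliffSign a b • c b (c a v)
  par_c : ∀ a v, par (c a v) = superSign a • c a (par v)
  gam_c : ∀ a, dual a ≠ a → ∀ v, gam (c a v) = -c a (gam v)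

namespace Oscillator

variable {d r n : ℕ} {F : Type*} [AddCommGroup F] [Module ℂ F] (O : Oscillator d r n F)

/-- The quadratic action. -/
def act : Osp d r n →ₗ[ℂ] (F →ₗ[ℂ] F) where
  toFun X := (1 / 2 : ℂ) • ∑ a, ∑ b, (X.1 a b * metricSign (dual b)) • (O.c a ∘ₗ O.c (dual b))
  map_add' X Y := by
    ext v
    simp only [LinearMap.smul_apply, LinearMap.sum_apply, LinearMap.add_apply, Submodule.coe_add,
      Matrix.add_apply, add_mul, add_smul, sum_add_distrib, smul_add]
  map_smul' t X := by
    ext v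
    simp only [LinearMap.smul_apply, LinearMap.sum_apply, Submodule.coe_smul, Matrix.smul_apply,
      smul_eq_mul, mul_assoc, smul_sum, RingHom.id_apply, smul_smul, mul_left_comm t]

theorem act_apply (X : Osp d r n) (v : F) :
    O.act X v = (1 / 2 : ℂ) • ∑ a, ∑ b, (X.1 a b * metricSign (dual b)) • O.c a (O.c (dual b) v) := by
  simp [act, LinearMap.sum_apply]

theorem act_c (X : Osp d r n) (j : OspIdx d r n) (s : ℂ)
    (hs : ∀ a b, X.1 a b ≠ 0 → cliffSign b j * cliffSign a j = s) (v : F) :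
    O.act X (O.c j v) = ∑ i, X.1 i j • O.c i v + s • O.c j (O.act X v) := by
  have h1 : ∀ a b, (X.1 a b * metricSign (dual b)) • O.c a (O.c (dual b) (O.c j v)) =
      (if b = j then X.1 a j • O.c a v else 0)
      - (if a = dual j then (X.1 (dual j) b * metricSign (dual b) * cliffSign b j * metricSign (dual j)) • O.c (dual b) v else 0)
      + s • O.c j ((X.1 a b * metricSign (dual b)) • O.c a (O.c (dual b) v)) := by
    intro a b
    rw [O.c_c (dual b) j, map_sub, map_smul, map_smul, O.c_c a j, dual_dual, cliffSign_dual_left]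
    have e1 : (if j = b then metricSign (dual b) else 0) * (X.1 a b * metricSign (dual b))
        = if b = j then X.1 a j else 0 := by
      by_cases h : b = j
      · subst h; simp; linear_combination X.1 a b * metricSign_sq (dual b)
      · simp [h, Ne.symm h]
    have e2 : (if j = dual a then metricSign a else 0) * (X.1 a b * metricSign (dual b)) * cliffSign b j =
        if a = dual j then (X.1 (dual j) b * metricSign (dual b) * cliffSign b j * metricSign (dual j)) else 0 := by
      by_cases h : a = dual j
      · subst h; simp; ring
      · have : ¬ j = dual a := fun h' => h (by rw [h', dual_dual])
        simp [h, this]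
    have e3 : X.1 a b * metricSign (dual b) * cliffSign b j * cliffSign a j
        = s * (X.1 a b * metricSign (dual b)) := by
      by_cases h : X.1 a b = 0
      · simp [h]
      · rw [← hs a b h]; ring
    have e4 : (if b = j then X.1 a j • O.c a v else 0) = (if b = j then X.1 a j else 0) • O.c a v := by
      split_ifs <;> simp
    have e5 : (if a = dual j then (X.1 (dual j) b * metricSign (dual b) * cliffSign b j * metricSign (dual j)) • O.c (dual b) v else 0)
      = (if a = dual j then (X.1 (dual j) b * metricSign (dual b) * cliffSign b j * metricSign (dual j)) else 0) • O.c (dual b) v := by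
      split_ifs <;> simp
    rw [e4, e5, ← e1, ← e2, map_smul, smul_smul, ← e3]
    simp only [smul_sub, smul_smul]
    module
  have h2 : ∑ a : OspIdx d r n, ∑ b, (if a = dual j then (X.1 (dual j) b * metricSign (dual b) * cliffSign b j * metricSign (dual j)) • O.c (dual b) v else 0)
      = -∑ i, X.1 i j • O.c i v := by
    rw [sum_comm]
    simp only [sum_ite_eq', mem_univ, if_true]
    rw [← sum_neg_distrib]
    refine Fintype.sum_equiv dualEquiv _ _ fun b => ?_
    change _ = -(X.1 (dual b) j • O.c (dual b) v)
    rw [← neg_smul, Osp.apply_dual X (dual j) b, dual_dual]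
    congr 1
    have h3 := metricSign_sq (dual b)
    have h4 := metricSign_sq j
    have h5 : reflectSign (dual j) b * metricSign (dual b) * cliffSign b j * metricSign (dual j) =
      (metricSign (dual b) * metricSign (dual b)) * (metricSign j * metricSign j) := by
      rw [metricSign_dual j, reflectSign, cliffSign, superSign_dual, dual_dual]
      rcases superSign_eq b with hb | hb <;> rcases superSign_eq j with hj | hj <;> rw [hb, hj] <;> ring
    rw [h3, h4] at h5
    linear_combination -X.1 (dual b) j * h5
  rw [act_apply, act_apply]
  simp only [h1, sum_add_distrib, sum_sub_distrib, h2]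
  simp only [sum_ite_eq', mem_univ, if_true, map_smul, map_sum, smul_sum]
  rw [sub_neg_eq_add, smul_add, ← sum_add_distrib]
  simp only [smul_sum, smul_smul, ← add_smul, mul_comm s]
  congr 1
  · refine sum_congr rfl fun a _ => ?_
    congr 1; ring
  · refine sum_congr rfl fun a _ => sum_congr rfl fun b _ => ?_
    congr 1; ring

theorem even_apply {X : Osp d r n} (hX : X.IsEven) {a b : OspIdx d r n} (h : X.1 a b ≠ 0) :
    superSign a = superSign b := by
  by_contra hc
  have h2 : oddPart X.1 a b = 0 := congrFun (congrFun (congrArg Subtype.val (show X.odd = 0 from hX)) a) b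
  rw [oddPart_apply] at h2
  rcases a with a | a <;> rcases b with b | b <;> simp_all [superSign]

theorem odd_apply {X : Osp d r n} (hX : X.IsOdd) {a b : OspIdx d r n} (h : X.1 a b ≠ 0) :
    superSign a = -superSign b := by
  by_contra hc
  have h2 : evenPart X.1 a b = 0 := congrFun (congrFun (congrArg Subtype.val (show X.even = 0 from hX)) a) b
  rw [evenPart_apply] at h2
  rcases a with a | a <;> rcases b with b | b <;> simp_all [superSign]

theorem act_c_even {X : Osp d r n} (hX : X.IsEven) (j : OspIdx d r n) (v : F) :
    O.act X (O.c j v) = ∑ i, X.1 i j • O.c i v + O.c j (O.act X v) := by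
  rw [O.act_c X j 1, one_smul]
  intro a b h
  have := even_apply hX h
  rcases a with a | a <;> rcases b with b | b <;> rcases j with j | j <;>
  first
  | (exfalso; norm_num [superSign] at this; done)
  | norm_num [cliffSign, superSign]

theorem act_c_odd {X : Osp d r n} (hX : X.IsOdd) (j : OspIdx d r n) (v : F) :
    O.act X (O.c j v) = ∑ i, X.1 i j • O.c i v - superSign j • O.c j (O.act X v) := by
  rw [O.act_c X j (-superSign j), neg_smul, sub_eq_add_neg]
  intro a b h
  have := odd_apply hX h
  rcases a with a | a <;> rcases b with b | b <;> rcases j with j | j <;>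
  first
  | (exfalso; norm_num [superSign] at this; done)
  | norm_num [cliffSign, superSign]

/-- The commutator of two elements of the Lie superalgebra in the oscillator module. -/
theorem act_act (X Y : Osp d r n) (ε : ℂ) (s : OspIdx d r n → ℂ)
    (hX : ∀ j v, O.act X (O.c j v) = ∑ i, X.1 i j • O.c i v + s j • O.c j (O.act X v))
    (hs : ∀ j l, Y.1 j l ≠ 0 → s j * s (dual l) = ε)
    (hε : ∀ j l m, Y.1 j l ≠ 0 → X.1 l m ≠ 0 → metricSign (dual l) * s j * reflectSign (dual m) (dual l)
      = braidSign j l m * metricSign (dual m)) (v : F) :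
    O.act X (O.act Y v) = O.act (Osp.bracket X Y) v + ε • O.act Y (O.act X v) := by
  have h1 : ∀ j l, (Y.1 j l * metricSign (dual l)) • O.act X (O.c j (O.c (dual l) v)) =
      ∑ i, (X.1 i j * Y.1 j l * metricSign (dual l)) • O.c i (O.c (dual l) v)
      - ∑ m, (braidSign j l m * (Y.1 j l * X.1 l m) * metricSign (dual m)) • O.c j (O.c (dual m) v)
      + ε • (Y.1 j l * metricSign (dual l)) • O.c j (O.c (dual l) (O.act X v)) := by
    intro j l
    by_cases h0 : Y.1 j l = 0
    · simp [h0]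
    rw [hX, hX, map_add, map_smul, ← hs j l h0, smul_add, smul_add, smul_add, ← add_assoc, map_sum,
      smul_sum, smul_sum, smul_sum]
    have e1 : ∑ m, (Y.1 j l * metricSign (dual l)) • s j • O.c j (X.1 m (dual l) • O.c m v) =
      -∑ m, (braidSign j l m * (Y.1 j l * X.1 l m) * metricSign (dual m)) • O.c j (O.c (dual m) v) := by
      rw [← sum_neg_distrib]
      refine Fintype.sum_equiv dualEquiv _ _ fun m => ?_
      change _ = -((braidSign j l (dual m) * (Y.1 j l * X.1 l (dual m)) * metricSign (dual (dual m))) • O.c j (O.c (dual (dual m)) v))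
      rw [dual_dual, map_smul, smul_smul, smul_smul, ← neg_smul]
      congr 1
      by_cases h2 : X.1 l (dual m) = 0
      · rw [Osp.apply_dual X m (dual l), dual_dual, h2]; simp
      · have h3 := hε j l (dual m) h0 h2
        rw [Osp.apply_dual X m (dual l), dual_dual]
        simp only [dual_dual] at h3
        linear_combination -(Y.1 j l * X.1 l (dual m)) * h3
    rw [e1, sub_eq_add_neg]
    congr 1
    · congr 1
      refine sum_congr rfl fun i _ => ?_
      rw [smul_smul]; congr 1; ring
    · simp only [smul_smul]; congr 1; ring
  rw [act_apply O Y v, map_smul, map_sum]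
  simp only [map_sum, map_smul, h1, sum_add_distrib, sum_sub_distrib]
  rw [act_apply O Y (O.act X v), act_apply O (Osp.bracket X Y) v, smul_comm ε, ← smul_add]
  congr 1
  rw [smul_sum]
  simp only [smul_sum]
  congr 1
  have e2 : ∑ j, ∑ l, ∑ i, (X.1 i j * Y.1 j l * metricSign (dual l)) • O.c i (O.c (dual l) v)
      = ∑ a, ∑ b, ∑ k, (X.1 a k * Y.1 k b * metricSign (dual b)) • O.c a (O.c (dual b) v) := by
    rw [Finset.sum_comm_cycle]
    refine sum_congr rfl fun i _ => ?_
    rw [sum_comm]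
  have e3 : ∑ j, ∑ l, ∑ m, (braidSign j l m * (Y.1 j l * X.1 l m) * metricSign (dual m)) • O.c j (O.c (dual m) v)
      = ∑ a, ∑ b, ∑ k, (braidSign a k b * (Y.1 a k * X.1 k b) * metricSign (dual b)) • O.c a (O.c (dual b) v) := by
    refine sum_congr rfl fun i _ => ?_
    rw [sum_comm]
  rw [e2, e3, ← sum_sub_distrib]
  refine sum_congr rfl fun a _ => ?_
  rw [← sum_sub_distrib]
  refine sum_congr rfl fun b _ => ?_
  rw [← sum_sub_distrib, Osp.bracket_apply, Finset.sum_mul, Finset.sum_smul]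
  refine sum_congr rfl fun k _ => ?_
  rw [sub_mul, sub_smul]

/-- The oscillator representation. -/
def rep : OspRep d r n F where
  parity := O.par
  parity_parity := O.par_par
  act := O.act
  parity_even X hX v := by
    rw [act_apply, act_apply, map_smul, map_sum]
    congr 1
    refine sum_congr rfl fun a _ => ?_
    rw [map_sum]
    refine sum_congr rfl fun b _ => ?_
    by_cases h : X.1 a b = 0
    · simp [h]
    · rw [map_smul, O.par_c, O.par_c, map_smul, smul_smul (superSign a), superSign_dual,
        even_apply hX h, superSign_sq, one_smul]
  parity_odd X hX v := by
    rw [act_apply, act_apply, map_smul, map_sum, ← smul_neg, ← sum_neg_distrib]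
    congr 1
    refine sum_congr rfl fun a _ => ?_
    rw [map_sum, ← sum_neg_distrib]
    refine sum_congr rfl fun b _ => ?_
    by_cases h : X.1 a b = 0
    · simp [h]
    · rw [map_smul, O.par_c, O.par_c, map_smul, smul_smul (superSign a), superSign_dual,
        odd_apply hX h, neg_mul, superSign_sq, neg_one_smul, smul_neg]
  act_bracket_even X Y h v := by
    rcases h with hX | hY
    · rw [O.act_act X Y 1 (fun _ => 1) (fun j v => by rw [O.act_c_even hX, one_smul]) (by simp)
        (fun j l m _ h2 => metricSign_mul_reflectSign_of_eq j (even_apply hX h2)), one_smul,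
        add_sub_cancel_right]
    · have hs : ∀ j l, Y.1 j l ≠ 0 → superSign j * superSign l = 1 := fun j l h => by
        rw [even_apply hY h, superSign_sq]
      have hodd : O.act X.odd (O.act Y v) = O.act (Osp.bracket X.odd Y) v + O.act Y (O.act X.odd v) := by
        rw [O.act_act X.odd Y 1 (fun j => -superSign j)
          (fun j v => by rw [O.act_c_odd (OspRep.odd_isOdd X), neg_smul, sub_eq_add_neg])
          (fun j l h => by rw [superSign_dual, neg_mul_neg, hs j l h])
          (fun j l m _ h2 => metricSign_mul_reflectSign_of_eq_neg j (odd_apply (OspRep.odd_isOdd X) h2)),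
          one_smul]
      have heven : O.act X.even (O.act Y v) = O.act (Osp.bracket X.even Y) v + O.act Y (O.act X.even v) := by
        rw [O.act_act X.even Y 1 (fun _ => 1)
          (fun j v => by rw [O.act_c_even (OspRep.even_isEven X), one_smul]) (by simp)
          (fun j l m _ h2 => metricSign_mul_reflectSign_of_eq j (even_apply (OspRep.even_isEven X) h2)),
          one_smul]
      have hbr : Osp.bracket X Y = Osp.bracket X.even Y + Osp.bracket X.odd Y := by
        have h1 := OspRep.even_add_odd (Osp.bracket X Y)
        rw [OspRep.even_bracket, OspRep.odd_bracket, show Y.odd = 0 from hY, OspRep.even_eq_self hY,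
          OspRep.bracket_zero_right, OspRep.bracket_zero_right, add_zero, zero_add] at h1
        exact h1.symm
      have hX : ∀ w, O.act X w = O.act X.even w + O.act X.odd w := fun w => by
        rw [← LinearMap.add_apply, ← map_add, OspRep.even_add_odd]
      rw [hbr, map_add, LinearMap.add_apply, hX, hX, map_add, heven, hodd]
      abel
  act_bracket_odd X Y hX hY v := by
    rw [O.act_act X Y (-1) (fun j => -superSign j)
      (fun j v => by rw [O.act_c_odd hX, neg_smul, sub_eq_add_neg])
      (fun j l h => by rw [superSign_dual, odd_apply hY h, neg_neg, mul_neg, superSign_sq])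
      (fun j l m _ h2 => metricSign_mul_reflectSign_of_eq_neg j (odd_apply hX h2)),
      neg_one_smul, neg_add_cancel_right]

end Oscillator

namespace Oscillator

variable {d r n : ℕ} {F : Type*} [AddCommGroup F] [Module ℂ F] (O : Oscillator d r n F)

theorem rep_root (a b : OspIdx d r n) (v : F) : O.rep.root a b v =
    metricSign (dual b) • O.c a (O.c (dual b) v) - (if a = b then superSign a / 2 else 0) • v := by
  change O.act _ v = _
  have h1 : ∀ i j, ((rootVec a b).1 i j * metricSign (dual j)) • O.c i (O.c (dual j) v) =
      (if i = a then if j = b then metricSign (dual b) • O.c a (O.c (dual b) v) else 0 else 0)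
      - (if i = dual b then if j = dual a then (reflectSign (dual b) (dual a) * metricSign a) • O.c (dual b) (O.c a v) else 0 else 0) := by
    intro i j
    rw [Osp.rootVec_apply, sub_mul, sub_smul]
    congr 1
    · by_cases hi : i = a
      · by_cases hj : j = b
        · simp [hi, hj]
        · simp [hj]
      · simp [hi]
    · by_cases hi : i = dual b
      · by_cases hj : j = dual a
        · simp [hi, hj]
        · have : ¬ dual j = a := fun h => hj (by rw [← h, dual_dual])
          simp [hj, this]
      · have : ¬ dual i = b := fun h => hi (by rw [← h, dual_dual])
        simp [hi, this]
  rw [act_apply]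
  simp only [h1, sum_sub_distrib, sum_ite_eq', mem_univ, if_true,
    Finset.sum_ite_irrel, Finset.sum_const_zero]
  rw [O.c_c (dual b) a, dual_dual, cliffSign_dual_left, smul_sub, smul_smul, smul_smul]
  have hs := metricSign_sq b
  have e1 : reflectSign (dual b) (dual a) * metricSign a * cliffSign b a = metricSign (dual b) := by
    rw [reflectSign, dual_dual, dual_dual, metricSign_dual, superSign_dual, superSign_dual, cliffSign]
    have hs := metricSign_sq a
    rcases superSign_eq a with ha | ha <;> rcases superSign_eq b with hb | hb <;> rw [ha, hb]
    · linear_combination metricSign b * hs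
    · linear_combination -metricSign b * hs
    · linear_combination metricSign b * hs
    · linear_combination -metricSign b * hs
  rw [smul_sub (1 / 2 * _ : ℂ), smul_smul _ (cliffSign b a), mul_assoc (1 / 2 : ℂ) _ (cliffSign b a), e1, smul_smul]
  by_cases h : a = b
  · subst h
    have e2 : reflectSign (dual a) (dual a) * metricSign a * metricSign (dual a) = superSign a := by
      rw [reflectSign_self, metricSign_dual]; linear_combination superSign a * hs
    simp only [if_true]
    rw [mul_assoc (1 / 2 : ℂ), e2]
    module
  · simp only [h, if_false, mul_zero]
    module

theorem rep_root_of_ne {a b : OspIdx d r n} (h : a ≠ b) (v : F) :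
    O.rep.root a b v = metricSign (dual b) • O.c a (O.c (dual b) v) := by
  rw [rep_root, if_neg h, zero_smul, sub_zero]

theorem c_c_of_ne {a b : OspIdx d r n} (h : b ≠ dual a) (v : F) :
    O.c a (O.c b v) = -(cliffSign a b • O.c b (O.c a v)) := by
  rw [O.c_c, if_neg h, zero_smul, zero_sub]

variable {O} in
theorem c_isWeightVec {lam : OspWeight d n} {v : F} (hv : O.rep.IsWeightVec lam v) (j : OspIdx d r n) :
    O.rep.IsWeightVec (lam + wt j) (O.c j v) := by
  intro a
  change O.act (rootVec a a) _ = _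
  rw [O.act_c_even (rootVec_isEven (superSign_sq a)), OspWeight.ext_add, add_smul,
    show O.act (rootVec a a) v = ext lam a • v from hv a, map_smul, add_comm]
  congr 1
  rw [ext_wt, sum_eq_single j, Osp.rootVec_apply, reflectSign_self]
  · congr 1
    have : (dual j = a ∧ dual j = a) ↔ a = dual j := by rw [and_self, eq_comm]
    rw [if_congr this rfl rfl]
    simp only [and_self, eq_comm, one_mul]
  · intro i _ hij
    have : (rootVec a a).1 i j = 0 := Osp.rootVec_self_isCartan a hij
    rw [this, zero_smul]
  · simp

/-- A cyclic vacuum vector. -/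
structure IsVacuum (vac : F) : Prop where
  ne_zero : vac ≠ 0
  c_pos : ∀ a, IsPos a → O.c a vac = 0
  c_zero : ∀ a, dual a = a → ∃ t : ℂ, O.c a vac = t • vac
  gam : O.gam vac = vac
  par : O.par vac = vac ∨ O.par vac = -vac
  cyclic : ∀ M : Submodule ℂ F, vac ∈ M → (∀ a, IsPos a → ∀ v ∈ M, O.c (dual a) v ∈ M) → M = ⊤

/-- The weight of the vacuum. -/
def vacWeight (d n : ℕ) : OspWeight d n := Sum.elim (fun _ => 1 / 2) (fun _ => -1 / 2)

theorem c_zero_sq {z : OspIdx d r n} (hz : dual z = z) (v : F) : O.c z (O.c z v) = (1 / 2 : ℂ) • v := by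
  have h := O.c_c z z v
  have h1 : metricSign z = 1 ∧ cliffSign z z = 1 := by
    rcases z with ((z | z) | z) | z | z <;> simp [dual] at hz
    norm_num [metricSign, cliffSign, superSign]
  rw [if_pos hz.symm, h1.1, h1.2, one_smul, one_smul] at h
  have h2 : (2 : ℂ) • O.c z (O.c z v) = v := by rw [two_smul]; nth_rw 1 [h]; abel
  rw [← h2, smul_smul]; norm_num [h2]

theorem c_c_dual {a b : OspIdx d r n} (ha : IsPos a) (hb : IsPos b) (v : F) :
    O.c (dual a) (O.c (dual b) v) = -(cliffSign a b • O.c (dual b) (O.c (dual a) v)) := by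
  rw [O.c_c_of_ne (fun h => ?_), cliffSign_dual_left, cliffSign_dual_right]
  rw [dual_dual] at h
  exact hb.dual_ne ha h

theorem c_pos_dual {a b : OspIdx d r n} (ha : IsPos a) (v : F) :
    O.c a (O.c (dual b) v) = (if b = a then (1 : ℂ) else 0) • v - cliffSign a b • O.c (dual b) (O.c a v) := by
  rw [O.c_c, cliffSign_dual_right, ha.metricSign]
  simp only [dual_inj]

/-- The subspaces spanned by the states with `k` creation operators in `T`. -/
def level (T : Finset (OspIdx d r n)) (vac : F) : ℕ → Submodule ℂ F
  | 0 => sInf {M | vac ∈ M ∧ ∀ b, IsPos b → b ∉ T → ∀ v ∈ M, O.c (dual b) v ∈ M}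
  | k + 1 => span ℂ {x | ∃ a ∈ T, ∃ y ∈ level T vac k, x = O.c (dual a) y}

/-- The number operator of the modes in `T`. -/
def num (T : Finset (OspIdx d r n)) : F →ₗ[ℂ] F := ∑ a ∈ T, O.c (dual a) ∘ₗ O.c a

theorem num_apply (T : Finset (OspIdx d r n)) (v : F) : O.num T v = ∑ a ∈ T, O.c (dual a) (O.c a v) := by
  simp [num, LinearMap.sum_apply]

variable {O} {vac : F}

theorem vac_mem_level (T : Finset (OspIdx d r n)) : vac ∈ O.level T vac 0 := by
  simp only [level, Submodule.mem_sInf]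
  exact fun M hM => hM.1

theorem level_zero_stable {T : Finset (OspIdx d r n)} {b : OspIdx d r n} (hb : IsPos b) (hbT : b ∉ T)
    {v : F} (hv : v ∈ O.level T vac 0) : O.c (dual b) v ∈ O.level T vac 0 := by
  simp only [level, Submodule.mem_sInf] at hv ⊢
  exact fun M hM => hM.2 b hb hbT v (hv M hM)

theorem level_zero_le {T : Finset (OspIdx d r n)} {M : Submodule ℂ F} (h : vac ∈ M)
    (hM : ∀ b, IsPos b → b ∉ T → ∀ v ∈ M, O.c (dual b) v ∈ M) : O.level T vac 0 ≤ M := by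
  rw [level]
  exact sInf_le ⟨h, hM⟩

theorem level_stable {T : Finset (OspIdx d r n)} (hT : ∀ a ∈ T, IsPos a) {b : OspIdx d r n} (hb : IsPos b)
    (hbT : b ∉ T) : ∀ (k : ℕ) (v : F), v ∈ O.level T vac k → O.c (dual b) v ∈ O.level T vac k := by
  intro k
  induction k with
  | zero => exact fun v hv => level_zero_stable hb hbT hv
  | succ k ih =>
    intro v hv
    rw [level] at hv ⊢
    refine span_induction (p := fun v _ => O.c (dual b) v ∈ span ℂ _) ?_ ?_ ?_ ?_ hv
    · rintro x ⟨a, ha, y, hy, rfl⟩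
      rw [O.c_c_dual hb (hT a ha)]
      exact neg_mem (smul_mem _ _ (subset_span ⟨a, ha, _, ih y hy, rfl⟩))
    · simp
    · intro x y _ _ hx hy; rw [map_add]; exact add_mem hx hy
    · intro t x _ hx; rw [map_smul]; exact smul_mem _ _ hx

theorem IsVacuum.iSup_level (hvac : O.IsVacuum vac) {T : Finset (OspIdx d r n)} (hT : ∀ a ∈ T, IsPos a) :
    ⨆ k, O.level T vac k = ⊤ := by
  refine hvac.cyclic _ (mem_iSup_of_mem 0 (vac_mem_level T)) fun b hb v hv => ?_
  refine iSup_induction _ (motive := fun v => O.c (dual b) v ∈ ⨆ k, O.level T vac k) hv ?_ ?_ ?_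
  · intro k x hx
    by_cases hbT : b ∈ T
    · refine mem_iSup_of_mem (k + 1) ?_
      rw [level]
      exact subset_span ⟨b, hbT, x, hx, rfl⟩
    · exact mem_iSup_of_mem k (level_stable hT hb hbT k x hx)
  · simp
  · intro x y hx hy; rw [map_add]; exact add_mem hx hy

theorem IsVacuum.c_level_zero (hvac : O.IsVacuum vac) {T : Finset (OspIdx d r n)} (hT : ∀ a ∈ T, IsPos a)
    {a : OspIdx d r n} (ha : a ∈ T) {v : F} (hv : v ∈ O.level T vac 0) : O.c a v = 0 := by
  suffices O.level T vac 0 ≤ ker (O.c a) from this hv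
  refine level_zero_le (hvac.c_pos a (hT a ha)) fun b hb hbT v hv => ?_
  rw [mem_ker] at hv ⊢
  rw [O.c_pos_dual (hT a ha), hv, if_neg (fun h : b = a => hbT (h ▸ ha))]
  simp

theorem IsVacuum.num_level (hvac : O.IsVacuum vac) {T : Finset (OspIdx d r n)} (hT : ∀ a ∈ T, IsPos a) :
    ∀ (k : ℕ) (v : F), v ∈ O.level T vac k → O.num T v = (k : ℂ) • v := by
  intro k
  induction k with
  | zero =>
    intro v hv
    rw [num_apply, Nat.cast_zero, zero_smul]
    exact sum_eq_zero fun a ha => by rw [hvac.c_level_zero hT ha hv, map_zero]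
  | succ k ih =>
    intro v hv
    rw [level] at hv
    refine span_induction (p := fun v _ => O.num T v = ((k + 1 : ℕ) : ℂ) • v) ?_ ?_ ?_ ?_ hv
    · rintro x ⟨a, ha, y, hy, rfl⟩
      have h1 : ∀ b ∈ T, O.c (dual b) (O.c b (O.c (dual a) y)) =
          (if a = b then O.c (dual a) y else 0) + O.c (dual a) (O.c (dual b) (O.c b y)) := by
        intro b hb
        rw [O.c_pos_dual (hT b hb), map_sub, map_smul, map_smul, O.c_c_dual (hT b hb) (hT a ha), smul_neg,
          smul_smul, cliffSign_sq, one_smul, sub_neg_eq_add]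
        congr 1
        split_ifs with h
        · rw [h, one_smul]
        · rw [zero_smul]
      rw [num_apply, sum_congr rfl h1, sum_add_distrib, ← map_sum, ← num_apply, ih y hy,
        map_smul, sum_ite_eq, if_pos ha]
      push_cast
      rw [add_smul, one_smul, add_comm]
    · simp
    · intro x y _ _ hx hy; rw [map_add, hx, hy, smul_add]
    · intro t x _ hx; rw [map_smul, hx, smul_comm]

theorem IsVacuum.eq_zero_of_num (hvac : O.IsVacuum vac) {T : Finset (OspIdx d r n)} (hT : ∀ a ∈ T, IsPos a)
    {v : F} {μ : ℂ} (hv : O.num T v = μ • v) (hμ : ∀ k : ℕ, μ ≠ k) : v = 0 := by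
  have h1 := Module.End.eigenspaces_iSupIndep (O.num T) μ
  have h2 : v ∈ Module.End.eigenspace (O.num T) μ := Module.End.mem_eigenspace_iff.2 hv
  have h3 : (⊤ : Submodule ℂ F) ≤ ⨆ j ≠ μ, Module.End.eigenspace (O.num T) j := by
    rw [← hvac.iSup_level hT]
    refine iSup_le fun k => le_iSup₂_of_le (k : ℂ) (hμ k).symm fun x hx => ?_
    exact Module.End.mem_eigenspace_iff.2 (hvac.num_level hT k x hx)
  simpa using h1.le_bot ⟨h2, h3 trivial⟩

theorem IsVacuum.mem_level_zero (hvac : O.IsVacuum vac) {T : Finset (OspIdx d r n)} (hT : ∀ a ∈ T, IsPos a)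
    {v : F} (hv : ∀ a ∈ T, O.c a v = 0) : v ∈ O.level T vac 0 := by
  have h0 : O.num T v = (0 : ℂ) • v := by
    rw [num_apply, zero_smul]
    exact sum_eq_zero fun a ha => by rw [hv a ha, map_zero]
  have h1 : (⊤ : Submodule ℂ F) ≤ O.level T vac 0 ⊔ ⨆ j ≠ (0 : ℂ), Module.End.eigenspace (O.num T) j := by
    rw [← hvac.iSup_level hT]
    refine iSup_le fun k => ?_
    rcases k with _ | k
    · exact le_sup_left
    · refine le_sup_of_le_right (le_iSup₂_of_le ((k + 1 : ℕ) : ℂ) (Nat.cast_ne_zero.2 (Nat.succ_ne_zero k)) fun x hx => ?_)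
      exact Module.End.mem_eigenspace_iff.2 (hvac.num_level hT _ x hx)
  obtain ⟨x, hx, y, hy, hxy⟩ := mem_sup.1 (h1 (Submodule.mem_top (x := v)))
  have h2 : y ∈ Module.End.eigenspace (O.num T) 0 := by
    rw [Module.End.mem_eigenspace_iff, show y = v - x by rw [← hxy]; abel, map_sub, h0,
      hvac.num_level hT 0 x hx]
    simp
  have h3 : y = 0 := by
    simpa using (Module.End.eigenspaces_iSupIndep (O.num T) 0).le_bot ⟨h2, hy⟩
  rw [← hxy, h3, add_zero]; exact hx

/-- Creation operators of bosonic modes are injective. -/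
theorem IsVacuum.c_dual_injective (hvac : O.IsVacuum vac) {p : OspIdx d r n} (hp : IsPos p)
    (hps : superSign p = -1) {v : F} (hv : O.c (dual p) v = 0) : v = 0 := by
  refine hvac.eq_zero_of_num (T := {p}) (μ := -1) (by simpa using hp) ?_ fun k hk => ?_
  · rw [num_apply, Finset.sum_singleton]
    have := O.c_pos_dual (b := p) hp v
    have hc : cliffSign p p = -1 := by rw [cliffSign, hps]; norm_num
    rw [hv, map_zero, if_pos rfl, hc, one_smul, neg_one_smul, sub_neg_eq_add] at this
    rw [neg_one_smul]
    exact eq_neg_of_add_eq_zero_right this.symm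
  · have : ((k + 1 : ℕ) : ℂ) = 0 := by push_cast; rw [← hk]; ring
    exact Nat.cast_ne_zero.2 (Nat.succ_ne_zero k) this

/-- The state with `i` quanta in the mode `p`. -/
def quanta (O : Oscillator d r n F) (vac : F) (p : OspIdx d r n) (i : ℕ) : F :=
  (O.c (dual p))^[i] vac

theorem quanta_succ (p : OspIdx d r n) (i : ℕ) :
    O.quanta vac p (i + 1) = O.c (dual p) (O.quanta vac p i) := by
  rw [quanta, iterate_succ_apply']; rfl

/-- A vector killed by all annihilation operators except one. -/
theorem IsVacuum.mem_span_quanta (hvac : O.IsVacuum vac) {p : OspIdx d r n} {v : F}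
    (hv : ∀ a, IsPos a → a ≠ p → O.c a v = 0) : v ∈ span ℂ (Set.range (O.quanta vac p)) := by
  classical
  have hT : ∀ a ∈ Finset.univ.filter (fun a : OspIdx d r n => IsPos a ∧ a ≠ p), IsPos a :=
    fun a ha => (Finset.mem_filter.1 ha).2.1
  have h := hvac.mem_level_zero hT (v := v) fun a ha =>
    hv a (Finset.mem_filter.1 ha).2.1 (Finset.mem_filter.1 ha).2.2
  refine level_zero_le (M := span ℂ (Set.range (O.quanta vac p)))
    (subset_span ⟨0, rfl⟩) (fun b hb hbT x hx => ?_) h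
  have hbp : b = p := by
    by_contra hne; exact hbT (Finset.mem_filter.2 ⟨mem_univ _, hb, hne⟩)
  subst hbp
  refine span_induction (p := fun x _ => O.c (dual b) x ∈ span ℂ (Set.range (O.quanta vac b))) ?_ ?_ ?_ ?_ hx
  · rintro _ ⟨i, rfl⟩
    exact subset_span ⟨i + 1, quanta_succ b i⟩
  · simp
  · intro x y _ _ hx hy; rw [map_add]; exact add_mem hx hy
  · intro t x _ hx; rw [map_smul]; exact smul_mem _ _ hx

theorem quanta_fermionic {p : OspIdx d r n} (hp : IsPos p) (hps : superSign p = 1) (i : ℕ) :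
    O.quanta vac p (i + 2) = 0 := by
  rw [quanta_succ, quanta_succ]
  have := O.c_c_dual hp hp (O.quanta vac p i)
  have hc : cliffSign p p = 1 := by rw [cliffSign, hps]; norm_num
  rw [hc, one_smul] at this
  have h2 : (2 : ℂ) • O.c (dual p) (O.c (dual p) (O.quanta vac p i)) = 0 := by
    rw [two_smul]; nth_rw 1 [this]; rw [neg_add_cancel]
  exact (smul_eq_zero.1 h2).resolve_left two_ne_zero

theorem span_quanta_fermionic {p : OspIdx d r n} (hp : IsPos p) (hps : superSign p = 1) :
    span ℂ (Set.range (O.quanta vac p)) ≤ span ℂ {vac, O.c (dual p) vac} := by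
  refine span_le.2 ?_
  rintro _ ⟨i, rfl⟩
  rcases i with _ | _ | i
  · exact subset_span (by simp [quanta])
  · exact subset_span (by simp [quanta])
  · rw [quanta_fermionic hp hps]; exact zero_mem _

/-- A subspace containing the states with quanta in one mode and stable under the other creation
operators is everything. -/
theorem IsVacuum.eq_top_of_quanta (hvac : O.IsVacuum vac) {p : OspIdx d r n} (hp : IsPos p) {Q : Submodule ℂ F}
    (hQ : ∀ i, O.quanta vac p i ∈ Q) (hs : ∀ a, IsPos a → a ≠ p → ∀ v ∈ Q, O.c (dual a) v ∈ Q) : Q = ⊤ := by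
  have h1 : (⨅ i : ℕ, Q.comap (O.c (dual p) ^ i)) = ⊤ := by
    refine hvac.cyclic _ ?_ fun a ha v hv => ?_
    · simp only [Submodule.mem_iInf, Submodule.mem_comap, Module.End.pow_apply]
      exact hQ
    · simp only [Submodule.mem_iInf, Submodule.mem_comap, Module.End.pow_apply] at hv ⊢
      by_cases hap : a = p
      · subst hap
        intro i
        rw [← Function.iterate_succ_apply]; exact hv (i + 1)
      · intro i
        have key : ∀ i : ℕ, ∃ t : ℂ, (O.c (dual p))^[i] (O.c (dual a) v) = t • O.c (dual a) ((O.c (dual p))^[i] v) := by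
          intro i
          induction i with
          | zero => exact ⟨1, by simp⟩
          | succ i ih =>
            obtain ⟨t, ht⟩ := ih
            refine ⟨t * -cliffSign p a, ?_⟩
            rw [iterate_succ_apply', ht, map_smul, O.c_c_dual hp ha, iterate_succ_apply',
              mul_smul, neg_smul]
        obtain ⟨t, ht⟩ := key i
        rw [ht]; exact Q.smul_mem t (hs a ha hap _ (hv i))
  rw [eq_top_iff, ← h1]
  exact iInf_le_of_le 0 (by rw [pow_zero]; exact le_rfl)

/-- The subspaces of even and odd particle number. -/
def sector (O : Oscillator d r n F) (e : ℂ) : Submodule ℂ F := ker (O.gam - e • LinearMap.id)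

theorem mem_sector {e : ℂ} {v : F} : v ∈ O.sector e ↔ O.gam v = e • v := by
  simp [sector, sub_eq_zero]

theorem c_mem_sector {e : ℂ} {v : F} (hv : v ∈ O.sector e) {a : OspIdx d r n} (ha : dual a ≠ a) :
    O.c a v ∈ O.sector (-e) := by
  rw [mem_sector] at *
  rw [O.gam_c a ha, hv, map_smul, neg_smul]

end Oscillator

namespace OspRep

variable {d r n : ℕ} {V : Type*} [AddCommGroup V] [Module ℂ V] (ρ : OspRep d r n V)
  {F : Type*} [AddCommGroup F] [Module ℂ F] (τ : OspRep d r n F)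

/-- The direct sum of two representations. -/
def prod : OspRep d r n (V × F) where
  parity := ρ.parity.prodMap τ.parity
  parity_parity v := Prod.ext (ρ.parity_parity _) (τ.parity_parity _)
  act :=
    { toFun := fun X => (ρ.act X).prodMap (τ.act X)
      map_add' := fun X Y => by ext <;> simp
      map_smul' := fun t X => by ext <;> simp }
  parity_even X hX v := Prod.ext (ρ.parity_even X hX _) (τ.parity_even X hX _)
  parity_odd X hX v := Prod.ext (ρ.parity_odd X hX _) (τ.parity_odd X hX _)
  act_bracket_even X Y h v := Prod.ext (ρ.act_bracket_even X Y h _) (τ.act_bracket_even X Y h _)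
  act_bracket_odd X Y hX hY v := Prod.ext (ρ.act_bracket_odd X Y hX hY _) (τ.act_bracket_odd X Y hX hY _)

variable {ρ τ}

/-- An irreducible representation embeds into any representation with a singular vector of the same
weight and parity which generates a subrepresentation without other singular vectors. -/
theorem exists_embedding (hρ : ρ.IsIrreducible) {ht : OspHeight d r n}
    (hht : ∀ a b, ht a = ht b → a = b) {lam : OspWeight d n} {s : V} {s' : F} (hs : ρ.IsHWVec ht lam s)
    (hs' : τ.IsHWVec ht lam s') (hpar : ∃ t : ℂ, ρ.parity s = t • s ∧ τ.parity s' = t • s')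
    {c : ℂ} (hb : τ.IsBddGraded ht c)
    (hsing : ∀ x ∈ τ.gen {s'}, τ.IsSing ht x → x ∈ ℂ ∙ s') :
    ∃ φ : V →ₗ[ℂ] F, Function.Injective φ ∧ φ s = s' ∧ (∀ a b v, φ (ρ.root a b v) = τ.root a b (φ v)) ∧
      (∀ v, φ (ρ.parity v) = τ.parity (φ v)) ∧ ∀ v, φ v ∈ τ.gen {s'} := by
  obtain ⟨t, ht1, ht2⟩ := hpar
  set π := ρ.prod τ with hπ
  set u : V × F := (s, s') with hu
  have hroot : ∀ a b x, π.root a b x = (ρ.root a b x.1, τ.root a b x.2) := fun _ _ _ => rfl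
  have hact : ∀ X x, π.act X x = (ρ.act X x.1, τ.act X x.2) := fun _ _ => rfl
  have hparity : ∀ x, π.parity x = (ρ.parity x.1, τ.parity x.2) := fun _ => rfl
  have huw : π.IsWeightVec lam u := fun a => by
    rw [hroot, hs.weight a, hs'.weight a]; rfl
  have hus : π.IsSing ht u := fun a b hab => by rw [hroot, hs.sing a b hab, hs'.sing a b hab]; rfl
  have hup : π.parity u = t • u := by rw [hparity, ht1, ht2]; rfl
  set G := π.gen {u} with hG
  have hGs : π.IsSubrep G := π.gen_isSubrep _
  have huG : u ∈ G := π.subset_gen _ rfl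
  have hGle : G ≤ (ℂ ∙ u) ⊔ π.below ht (lam.eval (grad ht).1) := by
    have h1 : G ≤ π.gen ((ℂ ∙ u : Submodule ℂ (V × F)) : Set (V × F)) :=
      π.gen_mono (by simp)
    refine h1.trans (π.gen_le_sup_below ?_ ?_ ?_ ?_)
    · rw [span_singleton_le_iff_mem]; exact huw.mem_eig ht
    · intro x hx
      obtain ⟨q, rfl⟩ := mem_span_singleton.1 hx
      rw [map_smul, hup]
      exact smul_mem _ _ (smul_mem _ _ (mem_span_singleton_self u))
    · intro a b hab
      obtain rfl := hht a b hab
      refine root_mem_span ?_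
      rw [huw a]; exact smul_mem _ _ (mem_span_singleton_self u)
    · exact fun a b hab => root_eq_zero_of_mem_span (hus a b hab)
  have htop : ∀ x ∈ G, x ∈ π.eig ht (lam.eval (grad ht).1) → x ∈ ℂ ∙ u := by
    intro x hx hxe
    obtain ⟨p, hp, q, hq, rfl⟩ := mem_sup.1 (hGle hx)
    have hp' : p ∈ π.eig ht (lam.eval (grad ht).1) := by
      obtain ⟨t, rfl⟩ := mem_span_singleton.1 hp
      exact smul_mem _ _ (huw.mem_eig ht)
    have hq' : q ∈ π.eig ht (lam.eval (grad ht).1) := by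
      have := sub_mem hxe hp'
      rwa [add_sub_cancel_left] at this
    have hq0 : q = 0 := by simpa using (π.eig_disjoint_below ht _).le_bot ⟨hq', hq⟩
    rw [hq0, add_zero]; exact hp
  have hsnd : ∀ x ∈ G, x.2 ∈ τ.gen {s'} := by
    have : G ≤ (τ.gen {s'}).comap (LinearMap.snd ℂ V F) := by
      refine π.gen_le ⟨fun x hx => (τ.gen_isSubrep {s'}).1 _ hx, fun X x hx => (τ.gen_isSubrep {s'}).2 X _ hx⟩ ?_
      rw [singleton_subset_iff]
      exact τ.subset_gen _ rfl
    exact fun x hx => this hx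
  have hK₁ : ∀ f, ((0, f) : V × F) ∈ G → f = 0 := by
    have hsub : ∀ f ∈ G.comap (LinearMap.inr ℂ V F), ∀ X, τ.act X f ∈ G.comap (LinearMap.inr ℂ V F) := by
      intro f hf X
      have := hGs.2 X _ hf
      rw [hact] at this
      simpa using this
    suffices h : G.comap (LinearMap.inr ℂ V F) = ⊥ by
      intro f hf
      have : f ∈ G.comap (LinearMap.inr ℂ V F) := hf
      rwa [h, mem_bot] at this
    by_contra hne
    obtain ⟨f, hf, hf0, hfs, -⟩ := τ.exists_sing hb (U := G.comap (LinearMap.inr ℂ V F))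
      (fun x hx a b _ => hsub x hx _) (fun x hx => hsub x hx _) hne
    have hfG : ((0, f) : V × F) ∈ G := hf
    obtain ⟨q, hq⟩ := mem_span_singleton.1 (hsing f (hsnd _ hfG) hfs)
    have h2 := htop _ hfG (by
      rw [mem_eig, hact, ← hq, map_smul, hs'.weight.act (grad_isCartan ht), smul_comm]; simp)
    obtain ⟨p, hp⟩ := mem_span_singleton.1 h2
    have h3 : p • s = 0 := congrArg Prod.fst hp
    have h4 : p • s' = f := congrArg Prod.snd hp
    rcases smul_eq_zero.1 h3 with h | h
    · rw [h, zero_smul] at h4; exact hf0 h4.symm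
    · exact hs.ne_zero h
  have hK₂ : ∀ x, ((x, 0) : V × F) ∈ G → x = 0 := by
    have hsub : ρ.IsSubrep (G.comap (LinearMap.inl ℂ V F)) := by
      refine ⟨fun x hx => ?_, fun X x hx => ?_⟩
      · have := hGs.1 _ hx
        rw [hparity] at this
        simpa using this
      · have := hGs.2 X _ hx
        rw [hact] at this
        simpa using this
    have h : G.comap (LinearMap.inl ℂ V F) = ⊥ := by
      refine (hρ.2 _ hsub).resolve_right fun h => ?_
      have h1 : s ∈ G.comap (LinearMap.inl ℂ V F) := by rw [h]; trivial
      have h2 := sub_mem huG h1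
      have h3 := hK₁ s' (by simpa [hu] using h2)
      exact hs'.ne_zero h3
    intro x hx
    have : x ∈ G.comap (LinearMap.inl ℂ V F) := hx
    rwa [h, mem_bot] at this
  have hfst : ∀ x : V, ∃ f, ((x, f) : V × F) ∈ G := by
    have hsub : ρ.IsSubrep (G.map (LinearMap.fst ℂ V F)) := by
      refine ⟨?_, ?_⟩
      · rintro _ ⟨x, hx, rfl⟩; exact ⟨_, hGs.1 x hx, rfl⟩
      · rintro X _ ⟨x, hx, rfl⟩; exact ⟨_, hGs.2 X x hx, rfl⟩
    have h : G.map (LinearMap.fst ℂ V F) = ⊤ := (hρ.2 _ hsub).resolve_left fun h => by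
      have : s ∈ G.map (LinearMap.fst ℂ V F) := ⟨u, huG, rfl⟩
      rw [h, mem_bot] at this
      exact hs.ne_zero this
    intro x
    have : x ∈ G.map (LinearMap.fst ℂ V F) := by rw [h]; trivial
    obtain ⟨⟨y, f⟩, hy, rfl⟩ := this
    exact ⟨f, hy⟩
  let e : G ≃ₗ[ℂ] V := LinearEquiv.ofBijective (LinearMap.fst ℂ V F ∘ₗ G.subtype) (by
    refine ⟨?_, fun x => ?_⟩
    · rw [← ker_eq_bot, ker_eq_bot']
      rintro ⟨⟨x, f⟩, hxf⟩ h
      have hx : x = 0 := h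
      subst hx
      have := hK₁ f hxf
      subst this; rfl
    · obtain ⟨f, hf⟩ := hfst x
      exact ⟨⟨(x, f), hf⟩, rfl⟩)
  let φ : V →ₗ[ℂ] F := LinearMap.snd ℂ V F ∘ₗ G.subtype ∘ₗ e.symm.toLinearMap
  have hφ : ∀ x, ((x, φ x) : V × F) ∈ G := by
    intro x
    have h1 : ((e.symm x : G) : V × F).1 = x := e.apply_symm_apply x
    have h2 : ((x, φ x) : V × F) = ((e.symm x : G) : V × F) := Prod.ext h1.symm rfl
    rw [h2]; exact (e.symm x).2
  have huniq : ∀ x f, ((x, f) : V × F) ∈ G → f = φ x := by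
    intro x f hf
    have := sub_mem hf (hφ x)
    have := hK₁ (f - φ x) (by simpa using this)
    exact sub_eq_zero.1 this
  refine ⟨φ, ?_, (huniq s s' huG).symm, fun a b x => ?_, fun x => ?_, fun x => hsnd (x, φ x) (hφ x)⟩
  · rw [← ker_eq_bot, ker_eq_bot']
    intro x hx
    have := hφ x
    rw [hx] at this
    exact hK₂ x this
  · exact (huniq _ _ (hGs.2 (rootVec a b) _ (hφ x))).symm
  · exact (huniq _ _ (hGs.1 _ (hφ x))).symm

theorem IsWeightVec.root {lam : OspWeight d n} {v : V} (hv : ρ.IsWeightVec lam v) (a b : OspIdx d r n) :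
    ρ.IsWeightVec (lam + (wt a - wt b)) (ρ.root a b v) := by
  intro e
  have h := ρ.act_cartan_root (Osp.rootVec_self_isCartan e) a b v
  change ρ.root e e _ = _ at h
  rw [h, show ρ.act (rootVec e e) v = ext lam e • v from hv e, map_smul, ← add_smul, ext_add, ext_sub,
    ext_wt, ext_wt, add_comm]
  have h2 : ∀ j, (rootVec e e).1 j j = (if e = j then 1 else 0) - (if e = dual j then (1 : ℂ) else 0) := by
    intro j
    rw [Osp.rootVec_apply, reflectSign_self, one_mul]
    have : (dual j = e ∧ dual j = e) ↔ e = dual j := by rw [and_self, eq_comm]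
    rw [if_congr this rfl rfl]
    simp only [and_self, eq_comm]
  rw [h2, h2]

theorem parity_root_eq {v : V} (hv : ρ.parity v = v ∨ ρ.parity v = -v) (a b : OspIdx d r n) :
    ρ.parity (ρ.root a b v) = ρ.root a b v ∨ ρ.parity (ρ.root a b v) = -ρ.root a b v := by
  rw [parity_root]
  rcases superSign_mul_eq a b with h | h <;> rcases hv with h' | h' <;> rw [h, h'] <;> simp

theorem root_root_swap {lam : OspWeight d n} {v : V} (hv : ρ.IsWeightVec lam v) {a b : OspIdx d r n}
    (hab : a ≠ b) (h0 : ρ.root a b v = 0) :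
    ρ.root a b (ρ.root b a v) = ((1 - if b = dual a then superSign a else 0) *
      (ext lam a - superSign a * superSign b * ext lam b)) • v := by
  have e1 : ρ.act (rootVec a a) v = ext lam a • v := hv a
  have e2 : ρ.act (rootVec b b) v = ext lam b • v := hv b
  rw [root_root, h0, map_zero, smul_zero, add_zero, Osp.bracket_rootVec_swap hab]
  simp only [map_smul, LinearMap.smul_apply, map_sub, LinearMap.sub_apply, e1, e2, smul_smul,
    ← sub_smul]

/-- The properties of a spinor representation used for the decomposition of tensor products. -/
structure SpinorFacts (ρ : OspRep d r n V) (ht g : OspHeight d r n) (R : Set V) (v : V) : Prop where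
  levi : ∀ a b, g a = g b → ht b < ht a → ρ.root a b v = 0
  lead : ∀ x, (∀ a b, g a = g b → ht b < ht a → ρ.root a b x = 0) → x ∈ span ℂ R
  gen : ∀ M : Submodule ℂ V, (∀ v ∈ M, ρ.parity v ∈ M) →
    (∀ v ∈ M, ∀ a b, g a = g b → ρ.root a b v ∈ M) → R ⊆ M → M = ⊤

theorem SpinorFacts.transport {ht g : OspHeight d r n} {N : Submodule ℂ F} {φ : V →ₗ[ℂ] F}
    (hinj : Function.Injective φ) (hroot : ∀ a b v, φ (ρ.root a b v) = τ.root a b (φ v))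
    (hpar : ∀ v, φ (ρ.parity v) = τ.parity (φ v)) (hN : ∀ v, φ v ∈ N) {R : Set V} {v : V}
    (levi : ∀ a b, g a = g b → ht b < ht a → τ.root a b (φ v) = 0)
    (lead : ∀ x ∈ N, (∀ a b, g a = g b → ht b < ht a → τ.root a b x = 0) → x ∈ span ℂ (φ '' R))
    (gen : ∀ M : Submodule ℂ F, M ≤ N → (∀ v ∈ M, τ.parity v ∈ M) →
      (∀ v ∈ M, ∀ a b, g a = g b → τ.root a b v ∈ M) → φ '' R ⊆ M → N ≤ M) :
    ρ.SpinorFacts ht g R v where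
  levi a b h h' := hinj (by rw [hroot, levi a b h h', map_zero])
  lead x hx := by
    have h := lead (φ x) (hN x) fun a b h h' => by rw [← hroot, hx a b h h', map_zero]
    rw [Submodule.span_image] at h
    obtain ⟨y, hy, hyx⟩ := h
    rwa [← hinj hyx]
  gen M hM hM' hR := by
    have h := gen (M.map φ) ?_ ?_ ?_ ?_
    · rw [eq_top_iff]
      rintro x -
      obtain ⟨y, hy, hyx⟩ := h (hN x)
      rwa [← hinj hyx]
    · rintro _ ⟨x, -, rfl⟩; exact hN x
    · rintro _ ⟨x, hx, rfl⟩; exact ⟨_, hM x hx, hpar x⟩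
    · rintro _ ⟨x, hx, rfl⟩ a b hab; exact ⟨_, hM' x hx a b hab, hroot a b x⟩
    · rintro _ ⟨x, hx, rfl⟩; exact ⟨x, hR hx, rfl⟩

end OspRep

namespace Oscillator

variable {d r n : ℕ} {F : Type*} [AddCommGroup F] [Module ℂ F] {O : Oscillator d r n F} {vac : F}

theorem c_mem_eig {ht : OspHeight d r n} {x : ℂ} {v : F} (hv : v ∈ O.rep.eig ht x) (j : OspIdx d r n) :
    O.c j v ∈ O.rep.eig ht (x + ht j) := by
  rw [OspRep.mem_eig] at hv ⊢
  change O.act _ _ = _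
  rw [O.act_c_even (grad_isCartan ht).isEven, sum_eq_single j, grad_apply_self,
    show O.act (grad ht) v = x • v from hv, map_smul, ← add_smul, add_comm]
  · intro i _ hij; rw [grad_isCartan ht hij, zero_smul]
  · simp

namespace IsVacuum

theorem c_vac (hvac : O.IsVacuum vac) {a : OspIdx d r n} (ha : ¬ IsPos (dual a)) : ∃ t : ℂ, O.c a vac = t • vac := by
  rcases isPos_trichotomy a with h | h | h
  · exact ⟨0, by rw [hvac.c_pos a h, zero_smul]⟩
  · exact absurd h ha
  · exact hvac.c_zero a h

theorem isWeightVec (hvac : O.IsVacuum vac) : O.rep.IsWeightVec (vacWeight d n) vac := by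
  intro a
  rw [O.rep_root, if_pos rfl]
  have hext : ∀ a : OspIdx d r n, IsPos a → ext (vacWeight d n) a = superSign a / 2 := by
    intro a ha
    rcases a with ((a | a) | a) | a | a <;> simp [IsPos] at ha <;> norm_num [OspWeight.ext, vacWeight, superSign]
  rcases isPos_trichotomy a with h | h | h
  · rw [hext a h, O.c_pos_dual h, hvac.c_pos a h, metricSign_dual, h.metricSign, if_pos rfl]
    simp only [map_zero, smul_zero, sub_zero, smul_smul, ← sub_smul]
    congr 1; ring
  · have := hext _ h
    rw [ext_dual, superSign_dual] at this
    rw [hvac.c_pos _ h, map_zero, smul_zero, zero_sub, ← neg_smul]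
    congr 1; linear_combination this
  · have h1 := ext_dual (vacWeight d n) a
    rw [h] at h1
    have h2 : ext (vacWeight d n) a = 0 := by linear_combination h1 / 2
    have h3 : metricSign a = 1 ∧ superSign a = 1 := by
      rcases a with ((z | z) | z) | z | z <;> simp [dual] at h
      simp [metricSign, superSign]
    rw [h, O.c_zero_sq h, h2, h3.1, h3.2]
    simp

theorem isBddGraded (hvac : O.IsVacuum vac) {ht : OspHeight d r n} (hpos : ∀ a, IsPos a → 0 < ht a) :
    O.rep.IsBddGraded ht ((vacWeight d n).eval (grad ht).1) := by
  refine hvac.cyclic _ (mem_iSup_of_mem 0 ?_) fun a ha v hv => ?_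
  · simpa using hvac.isWeightVec.mem_eig ht
  · set c := (vacWeight d n).eval (grad ht).1
    refine iSup_induction _ (motive := fun v => O.c (dual a) v ∈ ⨆ k : ℕ, O.rep.eig ht (c - k)) hv ?_ ?_ ?_
    · intro k x hx
      obtain ⟨m, hm⟩ := Int.eq_ofNat_of_zero_le (hpos a ha).le
      refine mem_iSup_of_mem (k + m) ?_
      convert c_mem_eig hx (dual a) using 1
      rw [ht.map_dual, hm]; push_cast; ring_nf
    · simp
    · intro x y hx hy; rw [map_add]; exact add_mem hx hy

theorem isSing (hvac : O.IsVacuum vac) {ht : OspHeight d r n} (hpos : ∀ a, IsPos a → 0 < ht a) :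
    O.rep.IsSing ht vac := by
  intro a b hab
  have hne : a ≠ b := fun h => by rw [h] at hab; exact lt_irrefl _ hab
  rw [O.rep_root_of_ne hne]
  by_cases ha : IsPos a
  · by_cases hb : IsPos b
    · have : O.c a (O.c (dual b) vac) = 0 := by
        rw [O.c_pos_dual ha, if_neg hne.symm, hvac.c_pos a ha]; simp
      rw [this, smul_zero]
    · obtain ⟨t, h⟩ := hvac.c_vac (a := dual b) (by rwa [dual_dual])
      rw [h, map_smul, hvac.c_pos a ha]; simp
  · have hb : IsPos (dual b) := by
      rcases isPos_trichotomy b with h | h | h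
      · rcases isPos_trichotomy a with h' | h' | h'
        · exact absurd h' ha
        · have := hpos _ h; have := hpos _ h'; rw [ht.map_dual] at this; omega
        · have := hpos _ h; have h1 := ht.map_dual a; rw [h'] at h1; omega
      · exact h
      · rcases isPos_trichotomy a with h' | h' | h'
        · exact absurd h' ha
        · have h1 := ht.map_dual b; rw [h] at h1
          have := hpos _ h'; rw [ht.map_dual] at this; omega
        · have h1 := ht.map_dual b; rw [h] at h1
          have h2 := ht.map_dual a; rw [h'] at h2; omega
    rw [hvac.c_pos _ hb]; simp

theorem isHWVec (hvac : O.IsVacuum vac) {ht : OspHeight d r n} (hpos : ∀ a, IsPos a → 0 < ht a) :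
    O.rep.IsHWVec ht (vacWeight d n) vac :=
  ⟨hvac.ne_zero, hvac.par, hvac.isWeightVec, hvac.isSing hpos⟩

/-- Root vectors on a state with one quantum. -/
theorem root_quantum (hvac : O.IsVacuum vac) {ht : OspHeight d r n} (hpos : ∀ a, IsPos a → 0 < ht a)
    {q : OspIdx d r n} {a b : OspIdx d r n} (hab : ht b < ht a)
    (ha : a = q → IsPos (dual b)) (hb : dual b = q → IsPos a) :
    O.rep.root a b (O.c (dual q) vac) = 0 := by
  have hne : a ≠ b := fun h => by rw [h] at hab; exact lt_irrefl _ hab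
  rw [O.rep_root_of_ne hne]
  suffices O.c a (O.c (dual b) (O.c (dual q) vac)) = 0 by rw [this, smul_zero]
  by_cases hpb : IsPos (dual b)
  · rw [O.c_pos_dual hpb, hvac.c_pos _ hpb, map_zero, smul_zero, sub_zero]
    split_ifs with h
    · rw [one_smul, hvac.c_pos _ (hb h.symm)]
    · rw [zero_smul, map_zero]
  · have haq : a ≠ q := fun h => hpb (ha h)
    have hpa : IsPos a := by
      rcases isPos_trichotomy a with h | h | h
      · exact h
      · have h1 := hpos _ h; rw [ht.map_dual] at h1
        rcases isPos_trichotomy b with h' | h' | h'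
        · have := hpos _ h'; omega
        · exact absurd h' hpb
        · have h2 := ht.map_dual b; rw [h'] at h2; omega
      · have h1 := ht.map_dual a; rw [h] at h1
        rcases isPos_trichotomy b with h' | h' | h'
        · have := hpos _ h'; omega
        · exact absurd h' hpb
        · have h2 := ht.map_dual b; rw [h'] at h2; omega
    rw [O.c_c_of_ne (a := a) (b := dual b) (fun h => hne (dual_injective h).symm), O.c_pos_dual hpa,
      hvac.c_pos a hpa, if_neg haq.symm]
    simp

/-- A degree zero pair of generators preserves subspaces stable under degree zero root vectors. -/
theorem c_c_mem {g : OspHeight d r n} {M : Submodule ℂ F}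
    (hM : ∀ v ∈ M, ∀ a b, g a = g b → O.rep.root a b v ∈ M) {a b : OspIdx d r n} (hab : g a + g b = 0) {v : F}
    (hv : v ∈ M) : O.c a (O.c b v) ∈ M := by
  have h := hM v hv a (dual b) (by rw [g.map_dual]; omega)
  rw [O.rep_root, dual_dual] at h
  have h2 := (M.sub_mem_iff_left (M.smul_mem _ hv)).1 h
  exact (M.smul_mem_iff (metricSign_ne_zero b)).1 h2

theorem height_zero (g : OspHeight d r n) {z : OspIdx d r n} (hz : dual z = z) : g z = 0 := by
  have := g.map_dual z
  rw [hz] at this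
  omega

theorem c_eq_zero_of_root {a b : OspIdx d r n} (hab : a ≠ b) {x : F} (h : O.rep.root a b x = 0) :
    O.c a (O.c (dual b) x) = 0 := by
  rw [O.rep_root_of_ne hab] at h
  exact (smul_eq_zero.1 h).resolve_left (metricSign_ne_zero _)

/-- Vectors killed by the positive degree zero root vectors, for `r = 1`. -/
theorem mem_span_of_odd (hvac : O.IsVacuum vac) {ht g : OspHeight d r n} (hpos : ∀ a, IsPos a → 0 < ht a)
    {z p : OspIdx d r n} (hz : dual z = z) (hp : IsPos p)
    (hg : ∀ a, IsPos a → a ≠ p → g a = 0 ∨ (g a = g p ∧ ht p < ht a ∧ superSign p = -1)) {x : F}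
    (hx : ∀ a b, g a = g b → ht b < ht a → O.rep.root a b x = 0) :
    x ∈ span ℂ (Set.range (O.quanta vac p)) := by
  refine hvac.mem_span_quanta fun a ha hap => ?_
  have hza : z ≠ a := fun h => (ha.dual_ne ha) (by rw [← h, hz])
  rcases hg a ha hap with h | ⟨h1, h2, h3⟩
  · have h1 := c_eq_zero_of_root hza.symm (hx a z (by rw [h, height_zero g hz])
      (by rw [height_zero ht hz]; exact hpos a ha))
    rw [hz, O.c_c_of_ne (fun h => hza (by rw [← dual_dual a, ← h, hz])), neg_eq_zero] at h1
    have h2 := (smul_eq_zero.1 h1).resolve_left (cliffSign_ne_zero _ _)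
    have h3 := O.c_zero_sq hz (O.c a x)
    rw [h2, map_zero] at h3
    exact (smul_eq_zero.1 h3.symm).resolve_left (by norm_num)
  · have h4 := c_eq_zero_of_root hap (hx a p h1 h2)
    rw [O.c_pos_dual ha, if_neg (Ne.symm hap), zero_smul, zero_sub, neg_eq_zero] at h4
    have h5 := (smul_eq_zero.1 h4).resolve_left (cliffSign_ne_zero _ _)
    exact hvac.c_dual_injective hp h3 h5

theorem quanta_c_zero (hvac : O.IsVacuum vac) {z p : OspIdx d r n} (hz : dual z = z) (hp : IsPos p) (i : ℕ) :
    ∃ t : ℂ, O.c z (O.quanta vac p i) = t • O.quanta vac p i := by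
  induction i with
  | zero => exact hvac.c_zero z hz
  | succ i ih =>
    obtain ⟨t, ht⟩ := ih
    refine ⟨-(cliffSign z p * t), ?_⟩
    have hzp : dual p ≠ dual z := fun h => by
      rw [dual_inj.1 h] at hp; exact hp.dual_ne hp hz
    rw [quanta_succ, O.c_c_of_ne hzp, ht, map_smul, cliffSign_dual_right, smul_smul, neg_smul]

/-- Generation by degree zero elements, for `r = 1` and a single fermionic mode of nonzero degree. -/
theorem eq_top_of_odd_fermionic (hvac : O.IsVacuum vac) {g : OspHeight d r n}
    {z p : OspIdx d r n} (hz : dual z = z) (hp : IsPos p) (hg : ∀ a, IsPos a → a ≠ p → g a = 0)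
    {M : Submodule ℂ F} (hM : ∀ v ∈ M, ∀ a b, g a = g b → O.rep.root a b v ∈ M)
    (hq : ∀ i, O.quanta vac p i ∈ M) : M = ⊤ := by
  have hgz := height_zero g hz
  have h : M ⊓ M.comap (O.c z) = ⊤ := by
    refine hvac.eq_top_of_quanta hp (fun i => ⟨hq i, ?_⟩) fun a ha hap v hv => ⟨?_, ?_⟩
    · obtain ⟨t, ht⟩ := hvac.quanta_c_zero hz hp i
      rw [SetLike.mem_coe, Submodule.mem_comap, ht]
      exact M.smul_mem _ (hq i)
    · have h1 := c_c_mem hM (a := dual a) (b := z) (by rw [g.map_dual, hg a ha hap, hgz]; rfl) hv.2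
      rw [O.c_zero_sq hz, map_smul] at h1
      exact (M.smul_mem_iff (by norm_num)).1 h1
    · exact c_c_mem hM (by rw [g.map_dual, hg a ha hap, hgz]; rfl) hv.1
  exact eq_top_iff.2 (h.ge.trans inf_le_left)

theorem c_quanta (p : OspIdx d r n) (hp : IsPos p) (hps : superSign p = -1) {v : F} (hv : O.c p v = 0) (i : ℕ) :
    O.c p ((O.c (dual p))^[i + 1] v) = ((i + 1 : ℕ) : ℂ) • (O.c (dual p))^[i] v := by
  have hc : cliffSign p p = -1 := by rw [cliffSign, hps]; norm_num
  induction i with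
  | zero => simp [O.c_pos_dual hp, hv]
  | succ i ih =>
    rw [iterate_succ_apply', O.c_pos_dual hp, ih, if_pos rfl, hc, map_smul,
      ← iterate_succ_apply' (f := O.c (dual p))]
    push_cast; module

theorem iterate_c_dual {p a : OspIdx d r n} (hp : IsPos p) (ha : IsPos a) (v : F) (i : ℕ) :
    ∃ t : ℂ, t ≠ 0 ∧ (O.c (dual p))^[i] (O.c (dual a) v) = t • O.c (dual a) ((O.c (dual p))^[i] v) := by
  induction i with
  | zero => exact ⟨1, one_ne_zero, by simp⟩
  | succ i ih =>
    obtain ⟨t, ht0, ht⟩ := ih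
    refine ⟨t * -cliffSign p a, mul_ne_zero ht0 (neg_ne_zero.2 (cliffSign_ne_zero _ _)), ?_⟩
    rw [iterate_succ_apply', ht, map_smul, O.c_c_dual hp ha, iterate_succ_apply',
      mul_smul, neg_smul]

/-- Generation by degree zero elements, for `r = 1` and bosonic modes of degree one. -/
theorem eq_top_of_odd_bosonic (hvac : O.IsVacuum vac) {g : OspHeight d r n}
    {z p : OspIdx d r n} (hz : dual z = z) (hp : IsPos p) (hps : superSign p = -1) (hgp : g p = 1)
    (hg : ∀ a, IsPos a → g a = 0 ∨ g a = 1)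
    {M : Submodule ℂ F} (hM : ∀ v ∈ M, ∀ a b, g a = g b → O.rep.root a b v ∈ M)
    (hq : ∀ i, O.quanta vac p i ∈ M) : M = ⊤ := by
  have hgz := height_zero g hz
  set M' := M ⊓ M.comap (O.c z) with hM'
  have hqM' : ∀ i, O.quanta vac p i ∈ M' := fun i => ⟨hq i, by
    obtain ⟨t, ht⟩ := hvac.quanta_c_zero hz hp i
    rw [SetLike.mem_coe, Submodule.mem_comap, ht]
    exact M.smul_mem _ (hq i)⟩
  have h0 : ∀ a, IsPos a → g a = 0 → ∀ v ∈ M', O.c (dual a) v ∈ M' := by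
    intro a ha hga v hv
    refine ⟨?_, c_c_mem hM (by rw [g.map_dual, hga, hgz]; rfl) hv.1⟩
    have h1 := c_c_mem hM (a := dual a) (b := z) (by rw [g.map_dual, hga, hgz]; rfl) hv.2
    rw [O.c_zero_sq hz, map_smul] at h1
    exact (M.smul_mem_iff (by norm_num)).1 h1
  have h1 : ∀ a, IsPos a → g a = 1 → ∀ v ∈ M', O.c (dual a) (O.c p v) ∈ M' := by
    intro a ha hga v hv
    have hd : g (dual a) + g p = 0 := by rw [g.map_dual, hga, hgp]; rfl
    refine ⟨c_c_mem hM hd hv.1, ?_⟩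
    have hza : dual a ≠ dual z := fun h => by rw [dual_inj.1 h] at ha; exact ha.dual_ne ha hz
    have hzp : p ≠ dual z := fun h => by rw [h, hz] at hp; exact hp.dual_ne hp hz
    rw [SetLike.mem_coe, Submodule.mem_comap, O.c_c_of_ne hza, O.c_c_of_ne hzp, map_neg, map_smul]
    exact neg_mem (M.smul_mem _ (neg_mem (M.smul_mem _ (c_c_mem hM hd hv.2))))
  set Q : Submodule ℂ F := ker (O.c p) ⊓ ⨅ i : ℕ, M'.comap (O.c (dual p) ^ i) with hQ
  have hQmem : ∀ v, v ∈ Q ↔ O.c p v = 0 ∧ ∀ i : ℕ, (O.c (dual p))^[i] v ∈ M' := by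
    intro v
    simp only [hQ, Submodule.mem_inf, mem_ker, Submodule.mem_iInf, Submodule.mem_comap,
      Module.End.pow_apply]
  have hQs : ∀ a, IsPos a → a ≠ p → ∀ v ∈ Q, O.c (dual a) v ∈ Q := by
    intro a ha hap v hv
    rw [hQmem] at hv ⊢
    refine ⟨by rw [O.c_pos_dual hp, hv.1, if_neg hap]; simp, fun i => ?_⟩
    obtain ⟨t, ht0, ht⟩ := iterate_c_dual (O := O) hp ha v i
    rw [ht]
    refine M'.smul_mem t ?_
    rcases hg a ha with h | h
    · exact h0 a ha h _ (hv.2 i)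
    · have := h1 a ha h _ (hv.2 (i + 1))
      rw [c_quanta p hp hps hv.1, map_smul] at this
      exact (M'.smul_mem_iff (Nat.cast_ne_zero.2 (Nat.succ_ne_zero i))).1 this
  have htop : (⨆ i : ℕ, Q.map (O.c (dual p) ^ i)) = ⊤ := by
    refine hvac.cyclic _ (mem_iSup_of_mem 0 ⟨vac, ?_, rfl⟩) fun a ha v hv => ?_
    · rw [SetLike.mem_coe, hQmem]; exact ⟨hvac.c_pos p hp, hqM'⟩
    · refine iSup_induction _ (motive := fun v => O.c (dual a) v ∈ ⨆ i : ℕ, Q.map (O.c (dual p) ^ i)) hv ?_ ?_ ?_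
      · rintro i _ ⟨x, hx, rfl⟩
        rw [Module.End.pow_apply]
        by_cases hap : a = p
        · subst hap
          refine mem_iSup_of_mem (i + 1) ⟨x, hx, ?_⟩
          rw [Module.End.pow_apply, iterate_succ_apply']
        · obtain ⟨t, ht0, ht⟩ := iterate_c_dual (O := O) hp ha x i
          refine mem_iSup_of_mem i ⟨t⁻¹ • O.c (dual a) x, Q.smul_mem _ (hQs a ha hap x hx), ?_⟩
          rw [map_smul, Module.End.pow_apply, ht, smul_smul, inv_mul_cancel₀ ht0, one_smul]
      · simp
      · intro x y hx hy; rw [map_add]; exact add_mem hx hy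
  rw [eq_top_iff, ← htop]
  refine iSup_le fun i => ?_
  rintro _ ⟨x, hx, rfl⟩
  rw [SetLike.mem_coe, hQmem] at hx
  rw [Module.End.pow_apply]; exact (hx.2 i).1

/-- Vectors killed by the positive degree zero root vectors, for `r = 0`. -/
theorem exists_of_even (hvac : O.IsVacuum vac) {ht g : OspHeight d r n} (hpos : ∀ a, IsPos a → 0 < ht a)
    {q p : OspIdx d r n} (hp : IsPos p) (hps : superSign p = 1) (hq : IsPos q) (hqs : superSign q = -1)
    (hqp : q ≠ p) (hg : ∀ a, IsPos a → a ≠ p → g a = 0) (hqm : ∀ a, IsPos a → a ≠ p → a ≠ q → ht q < ht a)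
    {x : F} (hx : ∀ a b, g a = g b → ht b < ht a → O.rep.root a b x = 0) :
    ∃ t₁ t₂ t₃ t₄ : ℂ, x = t₁ • vac + t₂ • O.c (dual p) vac + t₃ • O.c (dual q) vac
      + t₄ • O.c (dual p) (O.c (dual q) vac) := by
  have hpair : ∀ y, (∀ a, IsPos a → a ≠ p → O.c a y = 0) → ∃ s t : ℂ, s • vac + t • O.c (dual p) vac = y :=
    fun y hy => Submodule.mem_span_pair.1 (span_quanta_fermionic hp hps (hvac.mem_span_quanta hy))
  have h1 : ∀ a b, IsPos a → IsPos b → a ≠ p → b ≠ p → O.c b (O.c a x) = 0 := by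
    intro a b ha hb hap hbp
    have h := c_eq_zero_of_root (a := b) (b := dual a) (fun h => ha.dual_ne hb h.symm)
      (hx b (dual a) (by rw [g.map_dual, hg a ha hap, hg b hb hbp]; rfl)
        (by rw [ht.map_dual]; have := hpos a ha; have := hpos b hb; omega))
    rwa [dual_dual] at h
  have h2 : ∀ a, IsPos a → a ≠ p → a ≠ q → O.c a x = 0 := by
    intro a ha hap haq
    have h := c_eq_zero_of_root haq (hx a q (by rw [hg a ha hap, hg q hq hqp]) (hqm a ha hap haq))
    rw [O.c_pos_dual ha, if_neg (Ne.symm haq), zero_smul, zero_sub, neg_eq_zero] at h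
    exact hvac.c_dual_injective hq hqs ((smul_eq_zero.1 h).resolve_left (cliffSign_ne_zero _ _))
  obtain ⟨s, t, hst⟩ := hpair (O.c q x) fun a ha hap => h1 q a hq ha hqp hap
  obtain ⟨s', t', hst'⟩ := hpair (x - O.c (dual q) (O.c q x)) fun a ha hap => by
    rw [map_sub, O.c_pos_dual ha, h1 q a hq ha hqp hap, map_zero, smul_zero, sub_zero]
    by_cases haq : a = q
    · subst haq; rw [if_pos rfl, one_smul, sub_self]
    · rw [h2 a ha hap haq, if_neg (Ne.symm haq), zero_smul, sub_self]
  refine ⟨s', t', s, t * -cliffSign q p, ?_⟩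
  have h3 : x = (x - O.c (dual q) (O.c q x)) + O.c (dual q) (O.c q x) := by abel
  rw [h3, ← hst', ← hst, map_add, map_smul, map_smul, O.c_c_dual hq hp, mul_smul, neg_smul, ← add_assoc]

theorem mem_sector_vac (hvac : O.IsVacuum vac) : vac ∈ O.sector 1 := by
  rw [mem_sector, hvac.gam, one_smul]

/-- Generation of a sector by degree zero elements, for `r = 0`. -/
theorem sector_le (hvac : O.IsVacuum vac) {g : OspHeight d r n} (hnz : ∀ a : OspIdx d r n, dual a ≠ a)
    {p : OspIdx d r n} (hp : IsPos p) (hps : superSign p = 1) (hg : ∀ a, IsPos a → a ≠ p → g a = 0)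
    {M : Submodule ℂ F} (hM : ∀ v ∈ M, ∀ a b, g a = g b → O.rep.root a b v ∈ M) {e : ℂ} (he : e ≠ 0)
    (hMe : M ≤ O.sector e)
    (h0 : vac ∈ M ∨ ∃ a, g a = 0 ∧ ∃ y ∈ M, vac = O.c a y)
    (h1 : O.c (dual p) vac ∈ M ∨ ∃ a, g a = 0 ∧ ∃ y ∈ M, O.c (dual p) vac = O.c a y) :
    O.sector e ≤ M := by
  set M₁ : Submodule ℂ F := span ℂ {x | ∃ a, g a = 0 ∧ ∃ y ∈ M, x = O.c a y} with hM₁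
  have hsub : ∀ x, (x ∈ M ∨ ∃ a, g a = 0 ∧ ∃ y ∈ M, x = O.c a y) → x ∈ M ⊔ M₁ := by
    rintro x (h | h)
    · exact mem_sup_left h
    · exact mem_sup_right (subset_span h)
  have htop : M ⊔ M₁ = ⊤ := by
    refine hvac.eq_top_of_quanta hp (fun i => ?_) fun a ha hap v hv => ?_
    · rcases i with _ | _ | i
      · exact hsub _ h0
      · exact hsub _ h1
      · rw [quanta_fermionic hp hps]; exact zero_mem _
    · have hga : g (dual a) = 0 := by rw [g.map_dual, hg a ha hap]; rfl
      obtain ⟨x, hx, y, hy, rfl⟩ := mem_sup.1 hv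
      rw [map_add]
      refine add_mem (mem_sup_right (subset_span ⟨_, hga, x, hx, rfl⟩)) ?_
      refine mem_sup_left ?_
      refine span_induction (p := fun y _ => O.c (dual a) y ∈ M) ?_ ?_ ?_ ?_ hy
      · rintro _ ⟨b, hb, w, hw, rfl⟩
        exact c_c_mem hM (by rw [hga, hb]; rfl) hw
      · simp
      · intro x y _ _ hx hy; rw [map_add]; exact add_mem hx hy
      · intro t x _ hx; rw [map_smul]; exact M.smul_mem _ hx
  have hM₁e : M₁ ≤ O.sector (-e) := by
    refine span_le.2 ?_
    rintro _ ⟨a, -, y, hy, rfl⟩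
    exact c_mem_sector (hMe hy) (hnz a)
  intro v hv
  obtain ⟨x, hx, y, hy, rfl⟩ := mem_sup.1 (htop.ge (Submodule.mem_top (x := v)))
  have hy1 : y ∈ O.sector e := by
    have := sub_mem hv (hMe hx)
    rwa [add_sub_cancel_left] at this
  have hy2 := hM₁e hy
  rw [mem_sector] at hy1 hy2
  rw [hy1, ← sub_eq_zero, ← sub_smul] at hy2
  have hy0 : y = 0 := (smul_eq_zero.1 hy2).resolve_left (by
    rw [sub_neg_eq_add, ← two_mul]; exact mul_ne_zero two_ne_zero he)
  rw [hy0, add_zero]; exact hx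

end IsVacuum

end Oscillator

namespace Fock

/-- The exterior algebra of `ℂ^d`. -/
abbrev Fermions (d : ℕ) := ExteriorAlgebra ℂ (Fin d → ℂ)

/-- Polynomials in `n` variables. -/
abbrev Bosons (n : ℕ) := MvPolynomial (Fin n) ℂ

/-- The fermionic generators on the exterior algebra. -/
def fermi (d r : ℕ) (t : ℂ) : (Fin d ⊕ Fin d) ⊕ Fin r →
    Fermions d →ₗ[ℂ] Fermions d
  | .inl (.inl j) => CliffordAlgebra.contractLeft (LinearMap.proj j)
  | .inl (.inr j) => LinearMap.mulLeft ℂ (ExteriorAlgebra.ι ℂ (Pi.single j 1))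
  | .inr _ => t • (CliffordAlgebra.involute (Q := (0 : QuadraticForm ℂ (Fin d → ℂ)))).toLinearMap

/-- The bosonic generators on the polynomial algebra. -/
def bose (n : ℕ) : Fin n ⊕ Fin n → Bosons n →ₗ[ℂ] Bosons n
  | .inl i => (pderiv i).toLinearMap
  | .inr i => LinearMap.mulLeft ℂ (MvPolynomial.X i)

/-- The sign involution of the exterior algebra. -/
def fermiSign (d : ℕ) : Fermions d →ₗ[ℂ] Fermions d :=
  (CliffordAlgebra.involute (Q := (0 : QuadraticForm ℂ (Fin d → ℂ)))).toLinearMap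

/-- The sign involution of the polynomial algebra. -/
def boseSign (n : ℕ) : Bosons n →ₗ[ℂ] Bosons n :=
  (aeval fun i => -MvPolynomial.X i : Bosons n →ₐ[ℂ] Bosons n).toLinearMap

variable {d r n : ℕ}

theorem fermiSign_fermiSign (x : Fermions d) : fermiSign d (fermiSign d x) = x :=
  CliffordAlgebra.involute_involute x

theorem boseSign_boseSign (x : Bosons n) : boseSign n (boseSign n x) = x := by
  change aeval _ (aeval _ x) = x
  induction x using MvPolynomial.induction_on with
  | C a => simp
  | add p q hp hq => simp only [map_add, hp, hq]
  | mul_X p i hp => simp only [map_mul, hp, aeval_X, map_neg, neg_neg]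

theorem fermiSign_contract (j : Fin d) (x : Fermions d) :
    fermiSign d (CliffordAlgebra.contractLeft (LinearMap.proj j) x)
      = -CliffordAlgebra.contractLeft (LinearMap.proj j) (fermiSign d x) := by
  change CliffordAlgebra.involute _ = -CliffordAlgebra.contractLeft _ (CliffordAlgebra.involute x)
  induction x using CliffordAlgebra.left_induction with
  | algebraMap t => simp
  | add x y hx hy => simp only [map_add, hx, hy, neg_add]
  | ι_mul x m hx =>
    rw [CliffordAlgebra.contractLeft_ι_mul, map_sub, map_smul, map_mul, hx, map_mul,
      CliffordAlgebra.involute_ι, neg_mul (CliffordAlgebra.ι _ m) (CliffordAlgebra.involute x),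
      (CliffordAlgebra.contractLeft _).map_neg, CliffordAlgebra.contractLeft_ι_mul]
    simp only [neg_mul, mul_neg]
    abel

theorem fermi_sign (t : ℂ) (x : Fin d ⊕ Fin d) (v : Fermions d) :
    fermiSign d (fermi d r t (.inl x) v) = -fermi d r t (.inl x) (fermiSign d v) := by
  rcases x with j | j
  · exact fermiSign_contract j v
  · change CliffordAlgebra.involute (CliffordAlgebra.ι _ _ * v) = -(CliffordAlgebra.ι _ _ * CliffordAlgebra.involute v)
    rw [map_mul, CliffordAlgebra.involute_ι, neg_mul]

theorem boseSign_one : boseSign n 1 = 1 :=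
  map_one (aeval fun i => -MvPolynomial.X i : Bosons n →ₐ[ℂ] Bosons n)

theorem boseSign_X_mul (i : Fin n) (v : Bosons n) :
    boseSign n (MvPolynomial.X i * v) = -(MvPolynomial.X i * boseSign n v) := by
  have h := map_mul (aeval fun i => -MvPolynomial.X i :
    Bosons n →ₐ[ℂ] Bosons n) (MvPolynomial.X i) v
  rw [aeval_X, neg_mul] at h
  exact h

theorem boseSign_C (a : ℂ) : boseSign n (MvPolynomial.C a) = MvPolynomial.C a :=
  aeval_C _ a

theorem bose_inl (i : Fin n) (v : Bosons n) : bose n (.inl i) v = pderiv i v := rfl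

theorem bose_inr (i : Fin n) (v : Bosons n) : bose n (.inr i) v = MvPolynomial.X i * v := rfl

theorem pderiv_X_mul (i j : Fin n) (v : Bosons n) :
    pderiv i (MvPolynomial.X j * v) =
      (if i = j then (1 : ℂ) else 0) • v + MvPolynomial.X j * pderiv i v := by
  rw [Derivation.leibniz, pderiv_X, Pi.single_apply, smul_eq_mul, smul_eq_mul, add_comm]
  by_cases h : i = j
  · rw [if_pos h.symm, if_pos h, mul_one, one_smul]
  · rw [if_neg (Ne.symm h), if_neg h, mul_zero, zero_smul]

theorem pderiv_comm (i j : Fin n) (v : Bosons n) :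
    pderiv i (pderiv j v) = pderiv j (pderiv i v) := by
  induction v using MvPolynomial.induction_on with
  | C a => simp only [pderiv_C, map_zero]
  | add p q hp hq => simp only [map_add, hp, hq]
  | mul_X p k hp =>
    rw [mul_comm]
    simp only [pderiv_X_mul, map_add, Derivation.map_smul, hp]
    abel

theorem bose_sign (x : Fin n ⊕ Fin n) (v : Bosons n) :
    boseSign n (bose n x v) = -bose n x (boseSign n v) := by
  rcases x with i | i
  · simp only [bose_inl]
    induction v using MvPolynomial.induction_on with
    | C a => rw [pderiv_C, boseSign_C, pderiv_C, map_zero, neg_zero]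
    | add p q hp hq => simp only [map_add, hp, hq, neg_add]
    | mul_X p j hp =>
      rw [mul_comm, pderiv_X_mul, map_add, map_smul, boseSign_X_mul, hp, boseSign_X_mul, map_neg,
        pderiv_X_mul, mul_neg]
      abel
  · exact boseSign_X_mul i v

theorem bose_bose (x y : Fin n ⊕ Fin n) (v : Bosons n) :
    bose n x (bose n y v) = (if y = x.swap then (if x.isLeft then 1 else -1 : ℂ) else 0) • v
      + bose n y (bose n x v) := by
  rcases x with i | i <;> rcases y with j | j
  · rw [bose_inl, bose_inl, bose_inl, bose_inl, pderiv_comm, if_neg (by simp), zero_smul, zero_add]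
  · rw [bose_inl, bose_inr, bose_inl, bose_inr, pderiv_X_mul]
    by_cases h : i = j
    · rw [if_pos h, if_pos (by simp [h]), if_pos (by simp)]
    · rw [if_neg h, if_neg (by simpa using Ne.symm h)]
  · rw [bose_inl, bose_inr, bose_inl, bose_inr, pderiv_X_mul]
    by_cases h : j = i
    · rw [if_pos h, if_pos (by simp [h]), if_neg (by simp), one_smul, neg_one_smul, neg_add_cancel_left]
    · rw [if_neg h, if_neg (by simpa using h), zero_smul, zero_add, zero_add]
  · rw [bose_inr, bose_inr, bose_inr, bose_inr, if_neg (by simp), zero_smul, zero_add, mul_left_comm]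

theorem fermi_fermi (hr : r ≤ 1) {t : ℂ} (ht : t * t = 1 / 2) (x y : (Fin d ⊕ Fin d) ⊕ Fin r)
    (v : Fermions d) :
    fermi d r t x (fermi d r t y v) = (if (Sum.inl y : OspIdx d r n) = dual (Sum.inl x) then 1 else 0 : ℂ) • v
      - fermi d r t y (fermi d r t x v) := by
  have hs : ∀ (x : Fin d ⊕ Fin d) (k : Fin r) v, fermi d r t (.inr k) (fermi d r t (.inl x) v) =
      -fermi d r t (.inl x) (fermi d r t (.inr k) v) := by
    intro x k v
    change t • fermiSign d (fermi d r t (.inl x) v) = -fermi d r t (.inl x) (t • fermiSign d v)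
    rw [fermi_sign, map_smul, smul_neg]
  rcases x with (i | i) | k <;> rcases y with (j | j) | l
  · change CliffordAlgebra.contractLeft _ (CliffordAlgebra.contractLeft _ v) =
      _ - CliffordAlgebra.contractLeft _ (CliffordAlgebra.contractLeft _ v)
    rw [CliffordAlgebra.contractLeft_comm]
    simp [dual]
  · change CliffordAlgebra.contractLeft _ (CliffordAlgebra.ι _ _ * v) =
      _ - CliffordAlgebra.ι _ _ * CliffordAlgebra.contractLeft _ v
    rw [CliffordAlgebra.contractLeft_ι_mul]
    simp [dual, Pi.single_apply, eq_comm]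
  · have := hs (.inl i) l v
    rw [this]; simp [dual]
  · change CliffordAlgebra.ι _ _ * CliffordAlgebra.contractLeft _ v =
      _ - CliffordAlgebra.contractLeft _ (CliffordAlgebra.ι _ _ * v)
    rw [CliffordAlgebra.contractLeft_ι_mul]
    simp [dual, Pi.single_apply, eq_comm]
  · change ExteriorAlgebra.ι ℂ _ * (ExteriorAlgebra.ι ℂ _ * v) = _ - ExteriorAlgebra.ι ℂ _ * (ExteriorAlgebra.ι ℂ _ * v)
    have := ExteriorAlgebra.ι_add_mul_swap (R := ℂ) (Pi.single i (1 : ℂ) : Fin d → ℂ) (Pi.single j 1)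
    rw [← mul_assoc, ← mul_assoc, eq_neg_of_add_eq_zero_left this]
    simp [dual]
  · have := hs (.inr i) l v
    rw [this]; simp [dual]
  · have := hs (.inl j) k v
    rw [this]; simp [dual]
  · have := hs (.inr j) k v
    rw [this]; simp [dual]
  · have hkl : l = k := by
      have := k.2; have := l.2; exact Fin.ext (by omega)
    subst hkl
    have h : fermi d r t (.inr l) (fermi d r t (.inr l) v) = (1 / 2 : ℂ) • v := by
      change t • fermiSign d (t • fermiSign d v) = _
      rw [map_smul, fermiSign_fermiSign, smul_smul, ht]
    rw [h, if_pos (by simp [dual])]; module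

/-- The oscillator module on the tensor product of an exterior and a polynomial algebra. -/
def oscillator (hr : r ≤ 1) {t : ℂ} (ht : t * t = 1 / 2) {p : ℂ} (hp : p * p = 1) :
    Oscillator d r n (Fermions d ⊗[ℂ] Bosons n) where
  c := Sum.elim (fun x => (fermi d r t x).rTensor _) (fun y => (bose n y).lTensor _)
  par := p • (boseSign n).lTensor _
  gam := TensorProduct.map (fermiSign d) (boseSign n)
  par_par v := by
    induction v with
    | zero => simp
    | add x y hx hy => rw [map_add, map_add, hx, hy]
    | tmul x y => simp [boseSign_boseSign, smul_smul, hp]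
  gam_par v := by
    induction v with
    | zero => simp
    | add x y hx hy => simp only [map_add, hx, hy]
    | tmul x y => simp
  c_c a b v := by
    induction v with
    | zero => simp
    | add x y hx hy => simp only [map_add, hx, hy, smul_add]; abel
    | tmul x y =>
      rcases a with a | a <;> rcases b with b | b
      · have h := fermi_fermi (n := n) hr ht a b x
        simp only [Sum.elim_inl, LinearMap.rTensor_tmul, h, TensorProduct.sub_tmul]
        norm_num [cliffSign, superSign, metricSign, smul_tmul']
        split_ifs <;> simp
      · norm_num [cliffSign, superSign]
        rcases a with (a | a) | a <;> simp [dual]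
      · norm_num [cliffSign, superSign]
        rcases b with (b | b) | b <;> simp [dual]
      · have h := bose_bose a b y
        simp only [Sum.elim_inr, LinearMap.lTensor_tmul, h, tmul_add]
        norm_num [cliffSign, superSign, tmul_smul]
        rcases a with a | a <;> simp [dual, metricSign] <;> split_ifs <;> simp [tmul_neg]
  par_c a v := by
    induction v with
    | zero => simp
    | add x y hx hy => simp only [map_add, hx, hy, smul_add]
    | tmul x y =>
      rcases a with a | a
      · simp [superSign]
      · simp [superSign, bose_sign, tmul_neg]
  gam_c a ha v := by
    induction v with
    | zero => simp
    | add x y hx hy => simp only [map_add, hx, hy, neg_add]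
    | tmul x y =>
      rcases a with (a | a) | a
      · simp [fermi_sign, neg_tmul]
      · simp [dual] at ha
      · simp [bose_sign, tmul_neg]

theorem isVacuum_oscillator (hr : r ≤ 1) {t : ℂ} (ht : t * t = 1 / 2) {p : ℂ} (hp : p * p = 1) :
    (oscillator (d := d) (n := n) hr ht hp).IsVacuum (1 ⊗ₜ 1) where
  ne_zero h := by
    have h1 := congrArg (OspRep.contractRight (V := Fermions d)
      (aeval (fun _ => 0) : Bosons n →ₐ[ℂ] ℂ).toLinearMap) h
    have h2 := congrArg ExteriorAlgebra.algebraMapInv h1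
    simp at h2
  c_pos a ha := by
    rcases a with ((a | a) | a) | a | a <;> simp [IsPos] at ha
    · change CliffordAlgebra.contractLeft _ 1 ⊗ₜ 1 = 0
      simp
    · change 1 ⊗ₜ pderiv a 1 = 0
      simp
  c_zero a ha := by
    rcases a with ((a | a) | a) | a | a <;> simp [dual] at ha
    refine ⟨t, ?_⟩
    change (t • CliffordAlgebra.involute 1) ⊗ₜ 1 = _
    simp [smul_tmul']
  gam := by
    change CliffordAlgebra.involute 1 ⊗ₜ boseSign n 1 = _
    rw [map_one, boseSign_one]
  par := by
    have h : (oscillator (d := d) (n := n) hr ht hp).par (1 ⊗ₜ 1) = p • (1 ⊗ₜ 1) := by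
      change p • ((1 : Fermions d) ⊗ₜ[ℂ] boseSign n 1) = _
      rw [boseSign_one]
    rw [h]
    rcases mul_self_eq_one_iff.1 hp with h | h
    · left; rw [h, one_smul]
    · right; rw [h]; exact neg_one_smul ℂ ((1 : Fermions d) ⊗ₜ[ℂ] (1 : Bosons n))
  cyclic M h1 hM := by
    have hι : ∀ (m : Fin d → ℂ) (x) (y : Bosons n), x ⊗ₜ y ∈ M →
        (CliffordAlgebra.ι (0 : QuadraticForm ℂ (Fin d → ℂ)) m * x) ⊗ₜ y ∈ M := by
      intro m x y hxy
      have hm : m = ∑ j, m j • Pi.single j (1 : ℂ) := by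
        ext i; simp [Finset.sum_apply, Pi.single_apply]
      rw [hm]
      simp only [map_sum, map_smul, Finset.sum_mul, TensorProduct.sum_tmul, smul_mul_assoc]
      refine M.sum_mem fun j _ => ?_
      rw [← smul_tmul']
      exact M.smul_mem _ (hM (.inl (.inl (.inl j))) trivial _ hxy)
    have hx : ∀ x : Fermions d, x ⊗ₜ (1 : Bosons n) ∈ M := by
      intro x
      induction x using CliffordAlgebra.left_induction with
      | algebraMap s => rw [Algebra.algebraMap_eq_smul_one, ← smul_tmul']; exact M.smul_mem _ h1
      | add x y hx hy => rw [TensorProduct.add_tmul]; exact add_mem hx hy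
      | ι_mul x m hx => exact hι m x 1 hx
    rw [eq_top_iff]
    rintro v -
    induction v with
    | zero => exact zero_mem _
    | add x y hx hy => exact add_mem hx hy
    | tmul x y =>
      induction y using MvPolynomial.induction_on with
      | C a => rw [MvPolynomial.C_eq_smul_one, tmul_smul]; exact M.smul_mem _ (hx x)
      | add p q hp hq => rw [tmul_add]; exact add_mem hp hq
      | mul_X p i hp =>
        rw [mul_comm]
        exact hM (.inr (.inl i)) trivial _ hp

end Fock

/-- Existence of oscillator modules with a prescribed parity of the vacuum. -/
theorem Oscillator.exists_vacuum (d n : ℕ) {r : ℕ} (hr : r ≤ 1) {p : ℂ} (hp : p * p = 1) :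
    ∃ (O : Oscillator d r n (Fock.Fermions d ⊗[ℂ] Fock.Bosons n)) (vac : _),
      O.IsVacuum vac ∧ O.par vac = p • vac := by
  obtain ⟨t, ht⟩ := IsAlgClosed.exists_eq_mul_self (1 / 2 : ℂ)
  refine ⟨Fock.oscillator hr ht.symm hp, _, Fock.isVacuum_oscillator hr ht.symm hp, ?_⟩
  change p • ((1 : Fock.Fermions d) ⊗ₜ[ℂ] Fock.boseSign n 1) = _
  rw [Fock.boseSign_one]

namespace OspHeight

variable {d r n : ℕ}

/-- The height with prescribed values on the indices of `ε_j` and `δ_i`. -/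
def ofPos (r : ℕ) (e : Fin d → ℤ) (f : Fin n → ℤ) : OspHeight d r n where
  toFun
    | .inl (.inl (.inl j)) => e j
    | .inl (.inl (.inr j)) => -e j
    | .inl (.inr _) => 0
    | .inr (.inl i) => f i
    | .inr (.inr i) => -f i
  map_dual' a := by rcases a with ((a | a) | a) | a | a <;> simp [dual]

theorem ofPos_injective (hr : r ≤ 1) {e : Fin d → ℤ} {f : Fin n → ℤ} (he : ∀ j, 0 < e j) (hf : ∀ i, 0 < f i)
    (hei : Function.Injective e) (hfi : Function.Injective f) (hef : ∀ j i, e j ≠ f i) (a b : OspIdx d r n)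
    (h : ofPos r e f a = ofPos r e f b) : a = b := by
  rcases a with ((a | a) | a) | a | a <;> rcases b with ((b | b) | b) | b | b <;> simp only [ofPos] at h
  all_goals
    try have ha := he a
    try have ha := hf a
    try have hb := he b
    try have hb := hf b
    try (exfalso; omega)
  · rw [hei h]
  · exact absurd h (hef _ _)
  · rw [hei (neg_injective h)]
  · exact absurd (neg_injective h) (hef _ _)
  · have := a.2; have := b.2
    rw [show a = b from Fin.ext (by omega)]
  · exact absurd h.symm (hef _ _)
  · rw [hfi h]
  · exact absurd (neg_injective h).symm (hef _ _)
  · rw [hfi (neg_injective h)]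

theorem ofPos_pos {e : Fin d → ℤ} {f : Fin n → ℤ} (he : ∀ j, 0 < e j) (hf : ∀ i, 0 < f i) (a : OspIdx d r n)
    (ha : IsPos a) : 0 < ofPos r e f a := by
  rcases a with ((a | a) | a) | a | a <;> simp [IsPos] at ha
  · exact he a
  · exact hf a

end OspHeight

namespace Oscillator

variable {d r n : ℕ} {F : Type*} [AddCommGroup F] [Module ℂ F] {O : Oscillator d r n F} {vac : F}

theorem root_mem_sector (hnz : ∀ a : OspIdx d r n, dual a ≠ a) {e : ℂ} {v : F} (hv : v ∈ O.sector e)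
    (a b : OspIdx d r n) : O.rep.root a b v ∈ O.sector e := by
  rw [rep_root]
  refine sub_mem ((O.sector e).smul_mem _ ?_) ((O.sector e).smul_mem _ hv)
  have := c_mem_sector (c_mem_sector hv (hnz (dual b))) (hnz a)
  rwa [neg_neg] at this

theorem gen_le_sector (hnz : ∀ a : OspIdx d r n, dual a ≠ a) {e : ℂ} {v : F} (hv : v ∈ O.sector e) :
    O.rep.gen {v} ≤ O.sector e := by
  refine O.rep.gen_le (O.rep.isSubrep_of_root (fun x hx => ?_) fun x hx a b => root_mem_sector hnz hx a b)
    (by simpa using hv)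
  rw [mem_sector] at hx ⊢
  change O.gam (O.par x) = e • O.par x
  rw [O.gam_par, hx, map_smul]

theorem sector_disjoint {x : F} (h : x ∈ O.sector 1) (h' : x ∈ O.sector (-1)) : x = 0 := by
  rw [mem_sector] at h h'
  rw [h] at h'
  rw [one_smul] at h'
  have : (2 : ℂ) • x = 0 := by rw [two_smul]; nth_rewrite 1 [h']; module
  simpa using this

namespace IsVacuum

theorem mem_span_of_c (hvac : O.IsVacuum vac) {x : F} (hx : ∀ a, IsPos a → O.c a x = 0) : x ∈ ℂ ∙ vac := by
  classical
  refine level_zero_le (T := Finset.univ.filter IsPos) (mem_span_singleton_self vac) ?_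
    (hvac.mem_level_zero (by simp) fun a ha => hx a (by simpa using ha))
  intro b hb hbT
  simp [hb] at hbT

theorem c_c_quantum (hvac : O.IsVacuum vac) {q : OspIdx d r n} (hq : IsPos q) :
    O.c q (O.c (dual q) vac) = vac := by
  rw [c_pos_dual O hq, if_pos rfl, one_smul, hvac.c_pos q hq, map_zero, smul_zero, sub_zero]

theorem c_c_quantum_of_ne (hvac : O.IsVacuum vac) {q a : OspIdx d r n} (ha : IsPos a) (h : a ≠ q) :
    O.c a (O.c (dual q) vac) = 0 := by
  rw [c_pos_dual O ha, if_neg (Ne.symm h), zero_smul, hvac.c_pos a ha, map_zero, smul_zero, sub_zero]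

theorem sing_of_odd (hvac : O.IsVacuum vac) {ht : OspHeight d r n} (hpos : ∀ a, IsPos a → 0 < ht a)
    {z : OspIdx d r n} (hz : dual z = z) {x : F} (hx : O.rep.IsSing ht x) : x ∈ ℂ ∙ vac := by
  refine hvac.mem_span_of_c fun a ha => ?_
  have hlt : ht z < ht a := by rw [height_zero ht hz]; exact hpos a ha
  have hne : a ≠ z := by rintro rfl; exact lt_irrefl _ hlt
  have h := c_eq_zero_of_root hne (hx a z hlt)
  rw [hz, c_c_of_ne O (fun h => ?_), neg_eq_zero] at h
  · have h1 := (smul_eq_zero.1 h).resolve_left (cliffSign_ne_zero _ _)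
    have h2 := congrArg (O.c z) h1
    rw [c_zero_sq O hz, map_zero] at h2
    simpa using h2
  · exact hne (by rw [← dual_dual a, ← h, hz])

theorem c_c_of_sing {ht : OspHeight d r n}
    (hpos : ∀ a, IsPos a → 0 < ht a) {x : F} (hx : O.rep.IsSing ht x) {a b : OspIdx d r n} (ha : IsPos a)
    (hb : IsPos b) : O.c a (O.c b x) = 0 := by
  have h := c_eq_zero_of_root (a := a) (b := dual b) (fun h => hb.dual_ne ha h.symm)
    (hx a (dual b) (by rw [ht.map_dual]; have := hpos a ha; have := hpos b hb; omega))
  rwa [dual_dual] at h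

theorem sing_of_even (hvac : O.IsVacuum vac) (hnz : ∀ a : OspIdx d r n, dual a ≠ a) {ht : OspHeight d r n}
    (hpos : ∀ a, IsPos a → 0 < ht a) {x : F} (hx : O.rep.IsSing ht x) (hxs : x ∈ O.sector 1) :
    x ∈ ℂ ∙ vac := by
  refine hvac.mem_span_of_c fun a ha => ?_
  have h := hvac.mem_span_of_c fun b hb => c_c_of_sing hpos hx hb ha
  exact sector_disjoint ((span_singleton_le_iff_mem _ _).2 hvac.mem_sector_vac h)
    (c_mem_sector hxs (hnz a))

theorem sing_of_even_neg (hvac : O.IsVacuum vac) (hnz : ∀ a : OspIdx d r n, dual a ≠ a) {ht : OspHeight d r n}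
    (hpos : ∀ a, IsPos a → 0 < ht a) {q : OspIdx d r n} (hq : IsPos q) (hqs : superSign q = -1)
    (hqm : ∀ a, IsPos a → a ≠ q → ht q < ht a) {x : F} (hx : O.rep.IsSing ht x) (hxs : x ∈ O.sector (-1)) :
    x ∈ ℂ ∙ O.c (dual q) vac := by
  have h1 : ∀ a, IsPos a → a ≠ q → O.c a x = 0 := by
    intro a ha haq
    have h := c_eq_zero_of_root haq (hx a q (hqm a ha haq))
    rw [O.c_pos_dual ha, if_neg (Ne.symm haq), zero_smul, zero_sub, neg_eq_zero] at h
    exact hvac.c_dual_injective hq hqs ((smul_eq_zero.1 h).resolve_left (cliffSign_ne_zero _ _))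
  obtain ⟨t, ht'⟩ := mem_span_singleton.1
    (hvac.mem_span_of_c fun b hb => c_c_of_sing hpos hx hb hq)
  have hqv : O.c (dual q) vac ∈ O.sector (-1) := c_mem_sector hvac.mem_sector_vac (hnz _)
  have h2 : x - t • O.c (dual q) vac = 0 := by
    refine sector_disjoint ?_ (sub_mem hxs ((O.sector _).smul_mem t hqv))
    refine (span_singleton_le_iff_mem _ _).2 hvac.mem_sector_vac (hvac.mem_span_of_c fun a ha => ?_)
    rw [map_sub, map_smul]
    by_cases haq : a = q
    · subst haq; rw [hvac.c_c_quantum hq, ← ht', sub_self]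
    · rw [h1 a ha haq, hvac.c_c_quantum_of_ne ha haq, smul_zero, sub_self]
  rw [sub_eq_zero.1 h2]
  exact smul_mem _ _ (mem_span_singleton_self _)

theorem quantum_isHWVec (hvac : O.IsVacuum vac) (hnz : ∀ a : OspIdx d r n, dual a ≠ a) {ht : OspHeight d r n}
    (hpos : ∀ a, IsPos a → 0 < ht a) {q : OspIdx d r n} (hq : IsPos q)
    (hqm : ∀ a, IsPos a → a ≠ q → ht q < ht a) :
    O.rep.IsHWVec ht (vacWeight d n - wt q) (O.c (dual q) vac) where
  ne_zero h := hvac.ne_zero (by rw [← hvac.c_c_quantum hq, h, map_zero])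
  parity := by
    change O.par _ = _ ∨ O.par _ = _
    rw [O.par_c, superSign_dual]
    rcases hvac.par with h | h <;> rcases superSign_eq q with h' | h' <;> rw [h, h'] <;> simp
  weight := by
    rw [sub_eq_add_neg, ← wt_dual]
    exact c_isWeightVec hvac.isWeightVec _
  sing a b hab := by
    refine hvac.root_quantum hpos hab ?_ ?_
    · rintro rfl
      rcases isPos_trichotomy b with h | h | h
      · by_cases hba : b = a
        · subst hba; exact absurd hab (lt_irrefl _)
        · exact absurd hab (not_lt.2 (hqm b h hba).le)
      · exact h
      · exact absurd h (hnz b)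
    · rintro rfl
      rcases isPos_trichotomy a with h | h | h
      · exact h
      · by_cases hba : dual a = dual b
        · rw [← dual_dual a, hba, dual_dual] at hab; exact absurd hab (lt_irrefl _)
        · have := hqm _ h hba
          rw [ht.map_dual, ht.map_dual] at this; omega
      · exact absurd h (hnz a)

end IsVacuum

end Oscillator

namespace OspRep

open Oscillator

variable {d r n : ℕ} {V : Type*} [AddCommGroup V] [Module ℂ V] {ρ : OspRep d r n V}

/-- Embedding of the spinor representation of `𝔬𝔰𝔭(2d+1|2n)` into the oscillator module. -/
theorem exists_oscillator_odd (hr : r ≤ 1) (hρ : ρ.IsIrreducible) {ht : OspHeight d r n}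
    (hht : ∀ a b, ht a = ht b → a = b) (hpos : ∀ a, IsPos a → 0 < ht a) {s : V}
    (hs : ρ.IsHWVec ht (vacWeight d n) s) {z : OspIdx d r n} (hz : dual z = z) :
    ∃ (O : Oscillator d r n (Fock.Fermions d ⊗[ℂ] Fock.Bosons n))
      (φ : V →ₗ[ℂ] Fock.Fermions d ⊗[ℂ] Fock.Bosons n),
      O.IsVacuum (φ s) ∧ Function.Injective φ ∧ (∀ a b v, φ (ρ.root a b v) = O.rep.root a b (φ v)) ∧
      ∀ v, φ (ρ.parity v) = O.rep.parity (φ v) := by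
  obtain ⟨t, htt, hts⟩ : ∃ t : ℂ, t * t = 1 ∧ ρ.parity s = t • s := by
    rcases hs.parity with h | h
    · exact ⟨1, by norm_num, by rw [h, one_smul]⟩
    · exact ⟨-1, by norm_num, by rw [h, neg_smul, one_smul]⟩
  obtain ⟨O, vac, hvac, hp⟩ := Oscillator.exists_vacuum d n hr htt
  obtain ⟨φ, h1, rfl, h3, h4, -⟩ := exists_embedding hρ hht hs (hvac.isHWVec hpos) ⟨t, hts, hp⟩
    (hvac.isBddGraded hpos) fun x _ hx => hvac.sing_of_odd hpos hz hx
  exact ⟨O, φ, hvac, h1, h3, h4⟩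

/-- Embeddings of the spinor representations of `𝔬𝔰𝔭(2d|2n)` into the oscillator module. -/
theorem exists_oscillator_even (hr : r ≤ 1) (hρ : ρ.IsIrreducible) (hnz : ∀ a : OspIdx d r n, dual a ≠ a)
    {ht : OspHeight d r n}
    (hht : ∀ a b, ht a = ht b → a = b) (hpos : ∀ a, IsPos a → 0 < ht a) {s : V}
    (hs : ρ.IsHWVec ht (vacWeight d n) s) :
    ∃ (O : Oscillator d r n (Fock.Fermions d ⊗[ℂ] Fock.Bosons n))
      (φ : V →ₗ[ℂ] Fock.Fermions d ⊗[ℂ] Fock.Bosons n),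
      O.IsVacuum (φ s) ∧ Function.Injective φ ∧ (∀ a b v, φ (ρ.root a b v) = O.rep.root a b (φ v)) ∧
      (∀ v, φ (ρ.parity v) = O.rep.parity (φ v)) ∧ ∀ v, φ v ∈ O.sector 1 := by
  obtain ⟨t, htt, hts⟩ : ∃ t : ℂ, t * t = 1 ∧ ρ.parity s = t • s := by
    rcases hs.parity with h | h
    · exact ⟨1, by norm_num, by rw [h, one_smul]⟩
    · exact ⟨-1, by norm_num, by rw [h, neg_smul, one_smul]⟩
  obtain ⟨O, vac, hvac, hp⟩ := Oscillator.exists_vacuum d n hr htt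
  have hN := gen_le_sector hnz hvac.mem_sector_vac
  obtain ⟨φ, h1, rfl, h3, h4, h5⟩ := exists_embedding hρ hht hs (hvac.isHWVec hpos) ⟨t, hts, hp⟩
    (hvac.isBddGraded hpos) fun x hx hx' => hvac.sing_of_even hnz hpos hx' (hN hx)
  exact ⟨O, φ, hvac, h1, h3, h4, fun v => hN (h5 v)⟩

theorem exists_oscillator_even_neg (hr : r ≤ 1) (hρ : ρ.IsIrreducible) (hnz : ∀ a : OspIdx d r n, dual a ≠ a)
    {ht : OspHeight d r n}
    (hht : ∀ a b, ht a = ht b → a = b) (hpos : ∀ a, IsPos a → 0 < ht a) {q : OspIdx d r n} (hq : IsPos q)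
    (hqs : superSign q = -1) (hqm : ∀ a, IsPos a → a ≠ q → ht q < ht a) {s : V}
    (hs : ρ.IsHWVec ht (vacWeight d n - wt q) s) :
    ∃ (O : Oscillator d r n (Fock.Fermions d ⊗[ℂ] Fock.Bosons n))
      (vac : _) (φ : V →ₗ[ℂ] Fock.Fermions d ⊗[ℂ] Fock.Bosons n),
      O.IsVacuum vac ∧ Function.Injective φ ∧ φ s = O.c (dual q) vac ∧
      (∀ a b v, φ (ρ.root a b v) = O.rep.root a b (φ v)) ∧
      (∀ v, φ (ρ.parity v) = O.rep.parity (φ v)) ∧ ∀ v, φ v ∈ O.sector (-1) := by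
  obtain ⟨t, htt, hts⟩ : ∃ t : ℂ, t * t = 1 ∧ ρ.parity s = t • s := by
    rcases hs.parity with h | h
    · exact ⟨1, by norm_num, by rw [h, one_smul]⟩
    · exact ⟨-1, by norm_num, by rw [h, neg_smul, one_smul]⟩
  obtain ⟨O, vac, hvac, hp⟩ := Oscillator.exists_vacuum d n hr (p := -t) (by rw [neg_mul_neg, htt])
  have hN := gen_le_sector hnz (c_mem_sector hvac.mem_sector_vac (hnz (dual q)))
  have hp' : O.rep.parity (O.c (dual q) vac) = t • O.c (dual q) vac := by
    change O.par _ = _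
    rw [O.par_c, superSign_dual, hqs, hp, map_smul]; module
  obtain ⟨φ, h1, h2, h3, h4, h5⟩ := exists_embedding hρ hht hs (hvac.quantum_isHWVec hnz hpos hq hqm)
    ⟨t, hts, hp'⟩ (hvac.isBddGraded hpos)
    fun x hx hx' => hvac.sing_of_even_neg hnz hpos hq hqs hqm hx' (hN hx)
  exact ⟨O, vac, φ, hvac, h1, h2, h3, h4, fun v => hN (h5 v)⟩

theorem height_eq_of_fermionic {g : OspHeight d r n} {p : OspIdx d r n} (hgp : g p = 1)
    (hg : ∀ a, IsPos a → a ≠ p → g a = 0) {a : OspIdx d r n} (ha : g a = 1) : a = p := by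
  by_contra h
  rcases isPos_trichotomy a with h' | h' | h'
  · rw [hg a h' h] at ha; omega
  · by_cases h2 : dual a = p
    · rw [← dual_dual a, h2, g.map_dual, hgp] at ha; omega
    · have := hg _ h' h2; rw [g.map_dual] at this; omega
  · rw [IsVacuum.height_zero g h'] at ha; omega

theorem root_quantum_fermionic {F : Type*} [AddCommGroup F] [Module ℂ F] {O : Oscillator d r n F} {vac : F}
    (hvac : O.IsVacuum vac) {ht g : OspHeight d r n} (hpos : ∀ a, IsPos a → 0 < ht a) {p : OspIdx d r n}
    (hgp : g p = 1) (hg : ∀ a, IsPos a → a ≠ p → g a = 0) {a b : OspIdx d r n} (hab : g a = g b)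
    (hlt : ht b < ht a) : O.rep.root a b (O.c (dual p) vac) = 0 := by
  refine hvac.root_quantum hpos hlt ?_ ?_
  · rintro rfl
    rw [height_eq_of_fermionic hgp hg (a := b) (by omega)] at hlt; omega
  · intro hb
    have hgb := g.map_dual b
    rw [hb] at hgb
    have : dual a = p := height_eq_of_fermionic hgp hg (by rw [g.map_dual]; omega)
    rw [← hb] at this
    have h3 := congrArg dual this
    rw [dual_dual, dual_dual] at h3
    rw [h3] at hlt; omega

/-- The facts on the spinor representation of `𝔬𝔰𝔭(2d+1|2n)`, `d > 0`. -/
theorem spinorFacts_odd (hr : r ≤ 1) (hρ : ρ.IsIrreducible) {ht g : OspHeight d r n}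
    (hht : ∀ a b, ht a = ht b → a = b) (hpos : ∀ a, IsPos a → 0 < ht a) {s : V}
    (hs : ρ.IsHWVec ht (vacWeight d n) s) {z p : OspIdx d r n} (hz : dual z = z) (hp : IsPos p)
    (hps : superSign p = 1) (hgp : g p = 1) (hg : ∀ a, IsPos a → a ≠ p → g a = 0) :
    ρ.SpinorFacts ht g {s, ρ.root (dual p) z s} (ρ.root (dual p) z s) := by
  obtain ⟨O, φ, hvac, hinj, hroot, hpar⟩ := exists_oscillator_odd hr hρ hht hpos hs hz
  have hpz : dual p ≠ z := fun h => by
    have := IsVacuum.height_zero g hz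
    rw [← h, g.map_dual, hgp] at this; omega
  obtain ⟨t, ht0, hv⟩ : ∃ t : ℂ, t ≠ 0 ∧ φ (ρ.root (dual p) z s) = t • O.c (dual p) (φ s) := by
    obtain ⟨t, h⟩ := hvac.c_zero z hz
    refine ⟨metricSign (dual z) * t, mul_ne_zero (metricSign_ne_zero _) ?_, ?_⟩
    · rintro rfl
      have h2 := c_zero_sq O hz (φ s)
      rw [h, zero_smul, map_zero] at h2
      exact hvac.ne_zero (by simpa using h2.symm)
    · rw [hroot, O.rep_root_of_ne hpz, hz, h, map_smul, smul_smul]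
  have himg : ∀ M : Submodule ℂ _, φ '' {s, ρ.root (dual p) z s} ⊆ (M : Set _) ↔
      φ s ∈ M ∧ O.c (dual p) (φ s) ∈ M := by
    intro M
    rw [Set.image_pair, Set.insert_subset_iff, singleton_subset_iff, hv]
    exact and_congr Iff.rfl (M.smul_mem_iff ht0)
  have hg1 : ∀ a, g a = 1 → a = p := fun a => height_eq_of_fermionic hgp hg
  refine SpinorFacts.transport (N := ⊤) hinj hroot hpar (fun _ => trivial) ?_ ?_ ?_
  · intro a b hab hlt
    rw [hv, map_smul, root_quantum_fermionic hvac hpos hgp hg hab hlt, smul_zero]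
  · intro x _ hx
    have h := span_quanta_fermionic hp hps (hvac.mem_span_of_odd hpos hz hp (fun a ha hap => Or.inl (hg a ha hap)) hx)
    refine span_le.2 ?_ h
    have := (himg _).1 (subset_span)
    rintro y (rfl | rfl)
    · exact this.1
    · exact this.2
  · intro M _ _ hM hR
    obtain ⟨hR1, hR2⟩ := (himg M).1 hR
    rw [hvac.eq_top_of_odd_fermionic hz hp hg hM]
    rintro (_ | _ | i)
    · exact hR1
    · exact hR2
    · rw [quanta_fermionic hp hps]; exact zero_mem _

/-- The facts on the spinor representation of `𝔬𝔰𝔭(2d|2n)` that contains the vacuum. -/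
theorem spinorFacts_even (hr : r ≤ 1) (hρ : ρ.IsIrreducible) (hnz : ∀ a : OspIdx d r n, dual a ≠ a)
    {ht g : OspHeight d r n}
    (hht : ∀ a b, ht a = ht b → a = b) (hpos : ∀ a, IsPos a → 0 < ht a) {s : V}
    (hs : ρ.IsHWVec ht (vacWeight d n) s) {p q : OspIdx d r n} (hp : IsPos p)
    (hps : superSign p = 1) (hq : IsPos q) (hqs : superSign q = -1)
    (hqm : ∀ a, IsPos a → a ≠ q → ht q < ht a) (hgp : g p = 1) (hg : ∀ a, IsPos a → a ≠ p → g a = 0) :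
    ρ.SpinorFacts ht g {s, ρ.root (dual p) q s} (ρ.root (dual p) q s) := by
  obtain ⟨O, φ, hvac, hinj, hroot, hpar, hsec⟩ := exists_oscillator_even hr hρ hnz hht hpos hs
  have hqp : q ≠ p := by rintro rfl; norm_num [hps] at hqs
  have hv : φ (ρ.root (dual p) q s) = metricSign (dual q) • O.c (dual p) (O.c (dual q) (φ s)) := by
    rw [hroot, O.rep_root_of_ne (hp.dual_ne hq)]
  have ht0 := metricSign_ne_zero (dual q)
  have himg : ∀ M : Submodule ℂ _, φ '' {s, ρ.root (dual p) q s} ⊆ (M : Set _) ↔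
      φ s ∈ M ∧ O.c (dual p) (O.c (dual q) (φ s)) ∈ M := by
    intro M
    rw [Set.image_pair, Set.insert_subset_iff, singleton_subset_iff, hv]
    exact and_congr Iff.rfl (M.smul_mem_iff ht0)
  have hqv := c_mem_sector hvac.mem_sector_vac (hnz (dual q))
  have hpv := c_mem_sector hvac.mem_sector_vac (hnz (dual p))
  have hpqv := c_mem_sector hqv (hnz (dual p))
  rw [neg_neg] at hpqv
  refine SpinorFacts.transport (N := O.sector 1) hinj hroot hpar hsec ?_ ?_ ?_
  · intro a b hab hlt
    have h1 : O.rep.root a b (O.c (dual q) (φ s)) = 0 := (hvac.quantum_isHWVec hnz hpos hq hqm).sing a b hlt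
    have hne : a ≠ b := by rintro rfl; exact lt_irrefl _ hlt
    have h3 : ∀ c, g c = g p → c = p := fun c hc => height_eq_of_fermionic hgp hg (by rw [hc, hgp])
    have h4 : ∀ c, g c = g (dual p) → c = dual p := fun c hc => by
      rw [← dual_dual c, h3 (dual c) (by rw [g.map_dual, hc, g.map_dual, neg_neg])]
    have hap : a ≠ p := by rintro rfl; exact hne (h3 b hab.symm).symm
    have hbp : b ≠ dual p := by rintro rfl; exact hne (h4 a hab)
    rw [hv, map_smul, O.rep_root_of_ne hne, c_c_of_ne O (a := dual b) (b := dual p) (by rwa [dual_dual, ne_comm]), map_neg, map_smul,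
      c_c_of_ne O (a := a) (b := dual p)]
    · rw [IsVacuum.c_eq_zero_of_root hne h1]; simp
    · intro h; exact hap (by rw [← dual_dual a, ← h, dual_dual])
  · intro x hxs hx
    obtain ⟨t₁, t₂, t₃, t₄, rfl⟩ := hvac.exists_of_even hpos hp hps hq hqs hqp hg
      (fun a ha _ => hqm a ha) hx
    have h0 : t₂ • O.c (dual p) (φ s) + t₃ • O.c (dual q) (φ s) = 0 := by
      refine sector_disjoint ?_ (add_mem ((O.sector _).smul_mem _ hpv) ((O.sector _).smul_mem _ hqv))
      have := sub_mem (sub_mem hxs ((O.sector _).smul_mem t₁ hvac.mem_sector_vac)) ((O.sector _).smul_mem t₄ hpqv)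
      convert this using 1; abel
    have h := (himg _).1 (subset_span (R := ℂ))
    have h1 := add_mem (smul_mem _ t₁ h.1) (smul_mem _ t₄ h.2)
    convert h1 using 1
    rw [add_assoc (t₁ • φ s), h0, add_zero]
  · intro M hMN _ hM hR
    obtain ⟨hR1, hR2⟩ := (himg M).1 hR
    refine hvac.sector_le hnz hp hps hg hM one_ne_zero hMN (Or.inl hR1) (Or.inr ⟨q, hg q hq hqp,
      -(cliffSign q p • O.c (dual p) (O.c (dual q) (φ s))), M.neg_mem (M.smul_mem _ hR2), ?_⟩)
    rw [map_neg, map_smul, c_c_of_ne O (a := q) (b := dual p), cliffSign_dual_right, hvac.c_c_quantum hq,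
      smul_neg, neg_neg, smul_smul, cliffSign_sq, one_smul]
    exact fun h => hqp (by rw [← dual_dual q, ← h, dual_dual])

/-- The facts on the spinor representation of `𝔬𝔰𝔭(2d|2n)` that does not contain the vacuum. -/
theorem spinorFacts_even_neg (hr : r ≤ 1) (hρ : ρ.IsIrreducible) (hnz : ∀ a : OspIdx d r n, dual a ≠ a)
    {ht g : OspHeight d r n}
    (hht : ∀ a b, ht a = ht b → a = b) (hpos : ∀ a, IsPos a → 0 < ht a) {p q : OspIdx d r n} (hp : IsPos p)
    (hps : superSign p = 1) (hq : IsPos q) (hqs : superSign q = -1)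
    (hqm : ∀ a, IsPos a → a ≠ q → ht q < ht a) {s : V}
    (hs : ρ.IsHWVec ht (vacWeight d n - wt q) s) (hgp : g p = 1) (hg : ∀ a, IsPos a → a ≠ p → g a = 0) :
    ρ.SpinorFacts ht g {s, ρ.root (dual p) (dual q) s} (ρ.root (dual p) (dual q) s) := by
  obtain ⟨O, vac, φ, hvac, hinj, hφs, hroot, hpar, hsec⟩ :=
    exists_oscillator_even_neg hr hρ hnz hht hpos hq hqs hqm hs
  have hqp : q ≠ p := by rintro rfl; norm_num [hps] at hqs
  have hv : φ (ρ.root (dual p) (dual q) s) = O.c (dual p) vac := by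
    rw [hroot, hφs, O.rep_root_of_ne, dual_dual, hvac.c_c_quantum hq, hq.metricSign, one_smul]
    exact fun h => hqp (by rw [← dual_dual q, ← h, dual_dual])
  have himg : ∀ M : Submodule ℂ _, φ '' {s, ρ.root (dual p) (dual q) s} ⊆ (M : Set _) ↔
      O.c (dual q) vac ∈ M ∧ O.c (dual p) vac ∈ M := by
    intro M
    rw [Set.image_pair, Set.insert_subset_iff, singleton_subset_iff, hv, hφs]
    exact Iff.rfl
  have hqv := c_mem_sector hvac.mem_sector_vac (hnz (dual q))
  have hpv := c_mem_sector hvac.mem_sector_vac (hnz (dual p))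
  have hpqv := c_mem_sector hqv (hnz (dual p))
  rw [neg_neg] at hpqv
  refine SpinorFacts.transport (N := O.sector (-1)) hinj hroot hpar hsec ?_ ?_ ?_
  · intro a b hab hlt
    rw [hv, root_quantum_fermionic hvac hpos hgp hg hab hlt]
  · intro x hxs hx
    obtain ⟨t₁, t₂, t₃, t₄, rfl⟩ := hvac.exists_of_even hpos hp hps hq hqs hqp hg
      (fun a ha _ => hqm a ha) hx
    have h0 : t₁ • vac + t₄ • O.c (dual p) (O.c (dual q) vac) = 0 := by
      refine sector_disjoint (add_mem ((O.sector _).smul_mem _ hvac.mem_sector_vac)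
        ((O.sector _).smul_mem _ hpqv)) ?_
      have := sub_mem (sub_mem hxs ((O.sector _).smul_mem t₂ hpv)) ((O.sector _).smul_mem t₃ hqv)
      convert this using 1; abel
    have h := (himg _).1 (subset_span (R := ℂ))
    have h1 := add_mem (smul_mem _ t₂ h.2) (smul_mem _ t₃ h.1)
    convert h1 using 1
    rw [← sub_eq_zero, ← h0]; abel
  · intro M hMN _ hM hR
    obtain ⟨hR1, hR2⟩ := (himg M).1 hR
    exact hvac.sector_le hnz hp hps hg hM (by norm_num) hMN
      (Or.inr ⟨q, hg q hq hqp, _, hR1, (hvac.c_c_quantum hq).symm⟩) (Or.inl hR2)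

/-- The facts on the spinor representation of `𝔬𝔰𝔭(1|2n)`. -/
theorem spinorFacts_bosonic (hr : r ≤ 1) (hρ : ρ.IsIrreducible) {ht g : OspHeight d r n}
    (hht : ∀ a b, ht a = ht b → a = b) (hpos : ∀ a, IsPos a → 0 < ht a) {s : V}
    (hs : ρ.IsHWVec ht (vacWeight d n) s) {z p : OspIdx d r n} (hz : dual z = z) (hp : IsPos p)
    (hps : superSign p = -1) (hgp : g p = 1) (hg : ∀ a, IsPos a → g a = 0 ∨ g a = 1)
    (hgm : ∀ a, IsPos a → g a = 1 → a ≠ p → ht p < ht a) :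
    ρ.SpinorFacts ht g (Set.range fun i => (ρ.root (dual p) z)^[i] s) (ρ.root (dual p) z s) := by
  obtain ⟨O, φ, hvac, hinj, hroot, hpar⟩ := exists_oscillator_odd hr hρ hht hpos hs hz
  have hpz : dual p ≠ z := fun h => by
    have := IsVacuum.height_zero g hz
    rw [← h, g.map_dual, hgp] at this; omega
  have hstep : ∀ i, ∃ t : ℂ, t ≠ 0 ∧ O.rep.root (dual p) z (O.quanta (φ s) p i) = t • O.quanta (φ s) p (i + 1) := by
    intro i
    obtain ⟨t, h⟩ := hvac.quanta_c_zero hz hp i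
    by_cases h0 : O.quanta (φ s) p i = 0
    · exact ⟨1, one_ne_zero, by rw [quanta_succ, h0, map_zero, map_zero, smul_zero]⟩
    refine ⟨metricSign (dual z) * t, mul_ne_zero (metricSign_ne_zero _) ?_, ?_⟩
    · rintro rfl
      have h2 := c_zero_sq O hz (O.quanta (φ s) p i)
      rw [h, zero_smul, map_zero] at h2
      exact h0 (by simpa using h2.symm)
    · rw [O.rep_root_of_ne hpz, hz, h, map_smul, smul_smul, quanta_succ]
  have hq : ∀ i, ∃ t : ℂ, t ≠ 0 ∧ φ ((ρ.root (dual p) z)^[i] s) = t • O.quanta (φ s) p i := by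
    intro i
    induction i with
    | zero => exact ⟨1, one_ne_zero, by rw [one_smul]; rfl⟩
    | succ i ih =>
      obtain ⟨t, ht, h⟩ := ih
      obtain ⟨t', ht', h'⟩ := hstep i
      exact ⟨t * t', mul_ne_zero ht ht', by
        rw [iterate_succ_apply', hroot, h, map_smul, h', smul_smul]⟩
  have himg : ∀ M : Submodule ℂ _, (φ '' Set.range fun i => (ρ.root (dual p) z)^[i] s) ⊆ (M : Set _) ↔
      ∀ i, O.quanta (φ s) p i ∈ M := by
    intro M
    rw [← Set.range_comp, Set.range_subset_iff]
    refine forall_congr' fun i => ?_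
    obtain ⟨t, ht, h⟩ := hq i
    rw [Function.comp_apply, h]
    exact M.smul_mem_iff ht
  refine SpinorFacts.transport (N := ⊤) hinj hroot hpar (fun _ => trivial) ?_ ?_ ?_
  · intro a b hab hlt
    obtain ⟨t, -, hv⟩ := hq 1
    have hv' : φ (ρ.root (dual p) z s) = t • O.c (dual p) (φ s) := hv
    rw [hv', map_smul, hvac.root_quantum hpos hlt, smul_zero]
    · rintro rfl
      rcases isPos_trichotomy b with h | h | h
      · by_cases hb : b = a
        · subst hb; omega
        · have := hgm b h (by omega) hb; omega
      · exact h
      · rw [IsVacuum.height_zero g h] at hab; omega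
    · intro hb
      have hgb := g.map_dual b
      rw [hb, hgp] at hgb
      rcases isPos_trichotomy a with h | h | h
      · exact h
      · by_cases ha : dual a = p
        · rw [← hb] at ha
          have h3 := congrArg dual ha
          rw [dual_dual, dual_dual] at h3
          rw [h3] at hlt; omega
        · have h1 := hgm _ h (by rw [g.map_dual]; omega) ha
          rw [← hb, ht.map_dual, ht.map_dual] at h1; omega
      · rw [IsVacuum.height_zero g h] at hab; omega
  · intro x _ hx
    refine span_le.2 ?_ (hvac.mem_span_of_odd hpos hz hp (fun a ha hap => ?_) hx)
    · rintro _ ⟨i, rfl⟩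
      exact (himg _).1 subset_span i
    · rcases hg a ha with h | h
      · exact Or.inl h
      · exact Or.inr ⟨by rw [h, hgp], hgm a ha h hap, hps⟩
  · intro M _ _ hM hR
    rw [hvac.eq_top_of_odd_bosonic hz hp hps hgp hg hM ((himg M).1 hR)]

/-- A root vector applied to the image of a singular vector under an odd simple lowering operator. -/
theorem root_reflect_eq_zero {ht : OspHeight d r n} (hht : ∀ a b, ht a = ht b → a = b) {p q : OspIdx d r n}
    (hlt : ht q < ht p) (hadj : ∀ c, ht q < ht c → c = p ∨ ht p < ht c)
    {x : V} (hx : ρ.IsSing ht x) {a b : OspIdx d r n} (hab : ht b < ht a)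
    (h1 : ¬(a = p ∧ b = q)) (h2 : ¬(a = dual q ∧ b = dual p)) : ρ.root a b (ρ.root q p x) = 0 := by
  have hadj' : ∀ c, ht c < ht p → c = q ∨ ht c < ht q := by
    intro c hc
    rcases lt_trichotomy (ht c) (ht q) with h | h | h
    · exact Or.inr h
    · exact Or.inl (hht _ _ h)
    · rcases hadj c h with rfl | h
      · exact absurd hc (lt_irrefl _)
      · omega
  rw [ρ.root_root, hx a b hab, map_zero, smul_zero, add_zero, act_bracket_rootVec,
    sum_eq_zero, sum_eq_zero, sub_zero]
  · intro e _
    by_cases h0 : (rootVec a b).1 p e = 0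
    · rw [h0, mul_zero, zero_smul]
    rcases rootVec_apply_ne h0 with ⟨rfl, rfl⟩ | ⟨rfl, rfl⟩
    · rw [hx q e, smul_zero]
      exact (hadj' e hab).resolve_left fun h => h1 ⟨rfl, h⟩
    · rw [hx q, smul_zero]
      refine (hadj' (dual a) (by rw [ht.map_dual, ht.map_dual]; omega)).resolve_left fun h => h2 ⟨?_, ?_⟩
      · rw [← h, dual_dual]
      · rw [dual_dual]
  · intro e _
    by_cases h0 : (rootVec a b).1 e q = 0
    · rw [h0, zero_smul]
    rcases rootVec_apply_ne h0 with ⟨rfl, rfl⟩ | ⟨rfl, rfl⟩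
    · rw [hx e p, smul_zero]
      exact (hadj e hab).resolve_left fun h => h1 ⟨h, rfl⟩
    · rw [hx _ p, smul_zero]
      refine (hadj (dual b) (by rw [ht.map_dual, ht.map_dual]; omega)).resolve_left fun h => h2 ⟨?_, ?_⟩
      · rw [dual_dual]
      · rw [← h, dual_dual]

theorem root_root_self_of_odd {p q : OspIdx d r n} (hp : IsPos p) (hq : IsPos q)
    (hpq : superSign p * superSign q = -1) (x : V) : ρ.root q p (ρ.root q p x) = 0 := by
  have hne : q ≠ p := by rintro rfl; rw [superSign_sq] at hpq; norm_num at hpq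
  have h := ρ.root_root q p q p x
  rw [act_bracket_rootVec, sum_eq_zero, sum_eq_zero, sub_zero, zero_add, commSign,
    mul_comm (superSign q), hpq] at h
  · have h2 : (2 : ℂ) • ρ.root q p (ρ.root q p x) = 0 := by
      rw [two_smul]; nth_rewrite 1 [h]; module
    simpa using h2
  · intro e _
    by_cases h0 : (rootVec q p).1 p e = 0
    · rw [h0, mul_zero, zero_smul]
    rcases rootVec_apply_ne h0 with ⟨h3, -⟩ | ⟨h3, -⟩
    · exact absurd h3.symm hne
    · exact absurd h3.symm (hp.dual_ne hp)
  · intro e _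
    by_cases h0 : (rootVec q p).1 e q = 0
    · rw [h0, zero_smul]
    rcases rootVec_apply_ne h0 with ⟨-, h3⟩ | ⟨-, h3⟩
    · exact absurd h3 hne
    · exact absurd h3.symm (hq.dual_ne hq)

/-- Odd reflections of highest weights. -/
theorem IsIrreducible.odd_reflection (hρ : ρ.IsIrreducible) {ht ht' : OspHeight d r n}
    (hht : ∀ a b, ht a = ht b → a = b) {p q : OspIdx d r n} (hp : IsPos p) (hq : IsPos q)
    (hpq : superSign p * superSign q = -1) (hlt : ht q < ht p)
    (hadj : ∀ c, ht q < ht c → c = p ∨ ht p < ht c)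
    (hswap : ∀ a b, ht' b < ht' a → (ht b < ht a ∧ ¬(a = p ∧ b = q) ∧ ¬(a = dual q ∧ b = dual p)) ∨
      (a = q ∧ b = p) ∨ (a = dual p ∧ b = dual q)) {lam lam' : OspWeight d n}
    (hlam : (ext lam p + ext lam q ≠ 0 ∧ lam' = lam - wt p + wt q) ∨ (ext lam p + ext lam q = 0 ∧ lam' = lam))
    (hx : ∃ x, ρ.IsHWVec ht lam x) : ∃ x, ρ.IsHWVec ht' lam' x := by
  obtain ⟨x, hx⟩ := hx
  have hne : p ≠ q := by rintro rfl; exact lt_irrefl _ hlt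
  have hef : ρ.root p q (ρ.root q p x) = (ext lam p + ext lam q) • x := by
    rw [root_root_swap hx.weight hne (hx.sing p q hlt), if_neg (hp.dual_ne hq).symm, hpq]
    congr 1; ring
  have hdual : ∀ y, ρ.root q p y = 0 → ρ.root (dual p) (dual q) y = 0 := by
    intro y hy
    rw [ρ.root_dual, hy, smul_zero]
  rcases hlam with ⟨h0, rfl⟩ | ⟨h0, rfl⟩
  · refine ⟨ρ.root q p x, ?_, parity_root_eq hx.parity _ _, ?_, ?_⟩
    · intro h
      rw [h, map_zero] at hef
      exact (smul_ne_zero h0 hx.ne_zero) hef.symm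
    · have := hx.weight.root q p
      rwa [show lam + (wt q - wt p) = lam - wt p + wt q by abel] at this
    · intro a b hab
      rcases hswap a b hab with ⟨h1, h2, h3⟩ | ⟨rfl, rfl⟩ | ⟨rfl, rfl⟩
      · exact root_reflect_eq_zero hht hlt hadj hx.sing h1 h2 h3
      · exact root_root_self_of_odd hp hq hpq x
      · exact hdual _ (root_root_self_of_odd hp hq hpq x)
  · have hf : ρ.root q p x = 0 := by
      have hs : ρ.IsSing ht (ρ.root q p x) := by
        intro a b hab
        by_cases h1 : a = p ∧ b = q
        · rw [h1.1, h1.2, hef, h0, zero_smul]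
        by_cases h2 : a = dual q ∧ b = dual p
        · rw [h2.1, h2.2, ρ.root_dual, hef, h0, zero_smul, smul_zero]
        exact root_reflect_eq_zero hht hlt hadj hx.sing hab h1 h2
      have h1 := (hρ.hw hht hx).2 _ hs
      obtain ⟨t, h2⟩ := mem_span_singleton.1 h1
      have h3 := hx.weight.mem_eig ht
      have h4 := ρ.root_mem_eig h3 q p
      refine Submodule.disjoint_def.1 (ρ.eig_disjoint (ht := ht) ?_) _ h4 (h2 ▸ smul_mem _ t h3)
      intro h
      have h5 : ((ht q - ht p : ℤ) : ℂ) = (0 : ℤ) := by push_cast; linear_combination h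
      have := Int.cast_injective h5
      omega
    refine ⟨x, hx.ne_zero, hx.parity, hx.weight, fun a b hab => ?_⟩
    rcases hswap a b hab with ⟨h1, -, -⟩ | ⟨rfl, rfl⟩ | ⟨rfl, rfl⟩
    · exact hx.sing a b h1
    · exact hf
    · exact hdual _ hf

end OspRep

/-- Heights for the orders in which `δ_1, …, δ_i` stand between `ε_j` and `ε_(j+1)` and the other
`δ`s between `ε_(j+1)` and `ε_(j+2)`. -/
def OspHeight.between (d r n j i : ℕ) : OspHeight d r n :=
  OspHeight.ofPos r (fun a => if (a : ℕ) < j then (d : ℤ) + n - a else if (a : ℕ) = j then (d : ℤ) + n - j - i else d - a)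
    (fun b => if (b : ℕ) < i then (d : ℤ) + n - j - b else (d : ℤ) + n - j - b - 1)

/-- The highest weights for the orders `OspHeight.between`, up to a multiple of `vacWeight`. -/
def betweenWeight (d n k t j i : ℕ) : Fin d ⊕ Fin n → ℤ
  | .inl a => (if (a : ℕ) = 0 then (k : ℤ) else 0) - (if (a : ℕ) = 0 ∧ j = 0 then ((min i k : ℕ) : ℤ) else 0)
      - (if (a : ℕ) + 1 = d ∧ (j + 1 < d ∨ i = n) then (t : ℤ) else 0)
  | .inr b => (if j = 0 ∧ (b : ℕ) < min i k then 1 else 0)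
      - (if (b : ℕ) + 1 = n ∧ ¬(j + 1 < d ∨ i = n) then (t : ℤ) else 0)

theorem betweenWeight_sum {d n k t j i : ℕ} (ht : t = 0 ∨ 2 ≤ d) (hj : j < d) (hi : i < n) :
    betweenWeight d n k t j i (.inl ⟨j, hj⟩) + betweenWeight d n k t j i (.inr ⟨i, hi⟩) =
      if j = 0 then (k : ℤ) - (min i k : ℕ) else if j + 1 = d ∧ i + 1 = n then -t else 0 := by
  simp only [betweenWeight]
  split_ifs <;> omega

theorem betweenWeight_sum_succ {d n k t j i : ℕ} (ht : t = 0 ∨ 2 ≤ d) (hj : j < d) (hi : i < n) :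
    betweenWeight d n k t j (i + 1) (.inl ⟨j, hj⟩) + betweenWeight d n k t j (i + 1) (.inr ⟨i, hi⟩) =
      if j = 0 then (k : ℤ) - (min i k : ℕ) else if j + 1 = d ∧ i + 1 = n then -t else 0 := by
  simp only [betweenWeight]
  split_ifs <;> omega

theorem betweenWeight_succ {d n k t j i : ℕ} (ht : t ≤ 1) (htd : t = 0 ∨ 2 ≤ d) (hj : j < d) (hi : i < n)
    (h : (if j = 0 then (k : ℤ) - (min i k : ℕ) else if j + 1 = d ∧ i + 1 = n then -t else 0) ≠ 0)
    (x : Fin d ⊕ Fin n) :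
    betweenWeight d n k t j (i + 1) x = betweenWeight d n k t j i x
      - (if x = .inl ⟨j, hj⟩ then 1 else 0) + (if x = .inr ⟨i, hi⟩ then 1 else 0) := by
  have hC : (j = 0 ∧ i < k) ∨ (0 < j ∧ j + 1 = d ∧ i + 1 = n ∧ t = 1) := by
    split_ifs at h <;> omega
  clear h
  rcases x with ⟨a, ha⟩ | ⟨b, hb⟩
  · simp only [betweenWeight, Sum.inl.injEq, Fin.mk.injEq, reduceCtorEq, if_false, add_zero]
    rcases hC with ⟨rfl, hC⟩ | ⟨h0, h1, h2, h3⟩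
    · simp only [and_true]
      split_ifs <;> omega
    · simp only [h0.ne', and_false, if_false]
      split_ifs <;> omega
  · simp only [betweenWeight, Sum.inr.injEq, Fin.mk.injEq, reduceCtorEq, if_false]
    rcases hC with ⟨rfl, hC⟩ | ⟨h0, h1, h2, h3⟩
    · simp only [true_and]
      split_ifs <;> omega
    · simp only [h0.ne', false_and, if_false]
      split_ifs <;> omega

theorem betweenWeight_succ_eq {d n k t j i : ℕ} (htd : t = 0 ∨ 2 ≤ d) (hj : j < d) (hi : i < n)
    (h : (if j = 0 then (k : ℤ) - (min i k : ℕ) else if j + 1 = d ∧ i + 1 = n then -t else 0) = 0) :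
    betweenWeight d n k t j (i + 1) = betweenWeight d n k t j i := by
  have hC : (j = 0 ∧ k ≤ i) ∨ (0 < j ∧ (t = 0 ∨ j + 1 ≠ d ∨ i + 1 ≠ n)) := by
    split_ifs at h <;> omega
  clear h
  ext x
  rcases x with ⟨a, ha⟩ | ⟨b, hb⟩
  · simp only [betweenWeight]
    rcases hC with ⟨rfl, hC⟩ | ⟨h0, hC⟩
    · simp only [and_true]
      split_ifs <;> omega
    · simp only [h0.ne', and_false, if_false]
      split_ifs <;> omega
  · simp only [betweenWeight]
    rcases hC with ⟨rfl, hC⟩ | ⟨h0, hC⟩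
    · simp only [true_and]
      split_ifs <;> omega
    · simp only [h0.ne', false_and, if_false]
      split_ifs <;> omega

theorem betweenWeight_zero {d n k t j : ℕ} (hn : 1 ≤ n) (hj : j + 1 < d) :
    betweenWeight d n k t j 0 = betweenWeight d n k t (j + 1) n := by
  ext x
  rcases x with ⟨a, ha⟩ | ⟨b, hb⟩
  · simp only [betweenWeight, or_true, and_true, and_false, if_false, j.succ_ne_zero]
    split_ifs <;> omega
  · simp only [betweenWeight, or_true, not_true, and_false, if_false, j.succ_ne_zero, false_and]
    split_ifs <;> omega

namespace OspHeight

variable {d r n : ℕ}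

theorem between_zero {j : ℕ} : between d r n j 0 = between d r n (j + 1) n := by
  unfold between
  congr 1
  · ext a; split_ifs <;> push_cast <;> omega
  · ext b
    have := b.2
    simp only [Nat.not_lt_zero, if_false, this, if_true]
    push_cast; ring

theorem between_injective (hr : r ≤ 1) {j i : ℕ} (hj : j < d) (hi : i ≤ n) (a b : OspIdx d r n)
    (h : between d r n j i a = between d r n j i b) : a = b := by
  refine ofPos_injective hr ?_ ?_ ?_ ?_ ?_ a b h
  · intro a; have := a.2; split_ifs <;> omega
  · intro b; have := b.2; split_ifs <;> omega
  · intro a b hab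
    have := a.2; have := b.2
    refine Fin.ext ?_
    simp only at hab
    split_ifs at hab <;> omega
  · intro a b hab
    have := a.2; have := b.2
    refine Fin.ext ?_
    simp only at hab
    split_ifs at hab <;> omega
  · intro a b
    have := a.2; have := b.2
    split_ifs <;> omega

theorem swap_adjacent {ht ht' : OspHeight d r n} (hht : ∀ a b, ht a = ht b → a = b) {p q : OspIdx d r n}
    (h0 : 0 < ht q) (h1 : ht p = ht q + 1) (hp' : ht' p = ht q) (hq' : ht' q = ht p)
    (hc : ∀ c, IsPos c → c ≠ p → c ≠ q → ht' c = ht c) :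
    (∀ c, ht q < ht c → c = p ∨ ht p < ht c) ∧
    ∀ a b, ht' b < ht' a → (ht b < ht a ∧ ¬(a = p ∧ b = q) ∧ ¬(a = dual q ∧ b = dual p)) ∨
      (a = q ∧ b = p) ∨ (a = dual p ∧ b = dual q) := by
  have e1 := ht.map_dual p
  have e2 := ht.map_dual q
  have e3 := ht'.map_dual p
  have e4 := ht'.map_dual q
  have hinj : ∀ a b, a ≠ b → ht a ≠ ht b := fun a b h h' => h (hht a b h')
  have key : ∀ c, c = p ∨ c = q ∨ c = dual p ∨ c = dual q ∨
      (ht' c = ht c ∧ ht c ≠ ht p ∧ ht c ≠ ht q ∧ ht c ≠ -ht p ∧ ht c ≠ -ht q) := by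
    intro c
    by_cases h1 : c = p; · exact Or.inl h1
    by_cases h2 : c = q; · exact Or.inr (Or.inl h2)
    by_cases h3 : c = dual p; · exact Or.inr (Or.inr (Or.inl h3))
    by_cases h4 : c = dual q; · exact Or.inr (Or.inr (Or.inr (Or.inl h4)))
    refine Or.inr (Or.inr (Or.inr (Or.inr ⟨?_, hinj _ _ h1, hinj _ _ h2, e1 ▸ hinj _ _ h3, e2 ▸ hinj _ _ h4⟩)))
    rcases isPos_trichotomy c with h | h | h
    · exact hc c h h1 h2
    · have := hc _ h (fun h => h3 (by rw [← h, dual_dual])) (fun h => h4 (by rw [← h, dual_dual]))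
      rw [ht.map_dual, ht'.map_dual] at this; omega
    · have k1 := ht.map_dual c
      have k2 := ht'.map_dual c
      rw [h] at k1 k2; omega
  constructor
  · intro c h
    rcases eq_or_ne c p with rfl | h2
    · exact Or.inl rfl
    · have := hinj _ _ h2; omega
  · intro a b hab
    have hn : ¬(a = p ∧ b = q) ∧ ¬(a = dual q ∧ b = dual p) :=
      ⟨by rintro ⟨rfl, rfl⟩; omega, by rintro ⟨rfl, rfl⟩; omega⟩
    rcases key a with rfl | rfl | rfl | rfl | ⟨a1, a2, a3, a4, a5⟩ <;>
      rcases key b with rfl | rfl | rfl | rfl | ⟨b1, b2, b3, b4, b5⟩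
    all_goals first
      | exact Or.inr (Or.inl ⟨rfl, rfl⟩)
      | exact Or.inr (Or.inr ⟨rfl, rfl⟩)
      | exact Or.inl ⟨by omega, hn⟩

end OspHeight

namespace OspRep

variable {d r n : ℕ} {V : Type*} [AddCommGroup V] [Module ℂ V] {ρ : OspRep d r n V}

/-- A multiple of `vacWeight` plus a weight with integral coordinates. -/
def shiftedWeight (c : ℂ) (w : Fin d ⊕ Fin n → ℤ) : OspWeight d n :=
  c • Oscillator.vacWeight d n + fun x => (w x : ℂ)

theorem ext_shiftedWeight_sum (c : ℂ) (w : Fin d ⊕ Fin n → ℤ) (j : Fin d) (i : Fin n) :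
    ext (shiftedWeight c w) (.inl (.inl (.inl j)) : OspIdx d r n) + ext (shiftedWeight c w) (.inr (.inl i) : OspIdx d r n)
      = (w (.inl j) + w (.inr i) : ℤ) := by
  simp [shiftedWeight, OspWeight.ext, Oscillator.vacWeight]
  ring

/-- The highest weight vectors for the orders interpolating between the two choices of positive roots. -/
theorem IsIrreducible.between_step (hρ : ρ.IsIrreducible) (hr : r ≤ 1) {k t j i : ℕ} (ht : t ≤ 1)
    (htd : t = 0 ∨ 2 ≤ d) (hj : j < d) (hi : i < n) (c : ℂ) :
    (∃ x, ρ.IsHWVec (OspHeight.between d r n j i) (shiftedWeight c (betweenWeight d n k t j i)) x) ↔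
    ∃ x, ρ.IsHWVec (OspHeight.between d r n j (i + 1)) (shiftedWeight c (betweenWeight d n k t j (i + 1))) x := by
  set p : OspIdx d r n := .inl (.inl (.inl ⟨j, hj⟩)) with hp
  set q : OspIdx d r n := .inr (.inl ⟨i, hi⟩) with hq
  have hpp : IsPos p := trivial
  have hqq : IsPos q := trivial
  have hs : superSign p * superSign q = -1 := by simp [superSign, hp, hq]
  have e1 : OspHeight.between d r n j i p = (d : ℤ) + n - j - i := by
    simp [OspHeight.between, OspHeight.ofPos, hp]
  have e2 : OspHeight.between d r n j i q = (d : ℤ) + n - j - i - 1 := by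
    simp [OspHeight.between, OspHeight.ofPos, hq]
  have e3 : OspHeight.between d r n j (i + 1) p = (d : ℤ) + n - j - i - 1 := by
    simp [OspHeight.between, OspHeight.ofPos, hp]; ring
  have e4 : OspHeight.between d r n j (i + 1) q = (d : ℤ) + n - j - i := by
    simp [OspHeight.between, OspHeight.ofPos, hq]
  have hc : ∀ c, IsPos c → c ≠ p → c ≠ q → OspHeight.between d r n j (i + 1) c = OspHeight.between d r n j i c := by
    intro c hc h1 h2
    rcases c with ((a | a) | a) | b | b <;> simp [IsPos] at hc
    · have : (a : ℕ) ≠ j := fun h => h1 (by rw [hp]; congr; exact Fin.ext h)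
      simp [OspHeight.between, OspHeight.ofPos, this]
    · have : (b : ℕ) ≠ i := fun h => h2 (by rw [hq]; congr; exact Fin.ext h)
      simp only [OspHeight.between, OspHeight.ofPos]
      split_ifs <;> omega
  have hsum := ext_shiftedWeight_sum (r := r) c (betweenWeight d n k t j i) ⟨j, hj⟩ ⟨i, hi⟩
  have hsum' := ext_shiftedWeight_sum (r := r) c (betweenWeight d n k t j (i + 1)) ⟨j, hj⟩ ⟨i, hi⟩
  rw [betweenWeight_sum htd hj hi] at hsum
  rw [betweenWeight_sum_succ htd hj hi] at hsum'
  constructor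
  · obtain ⟨h1, h2⟩ := OspHeight.swap_adjacent (OspHeight.between_injective hr hj hi.le) (p := p) (q := q)
      (by omega) (by omega) (by omega) (by omega) hc
    refine hρ.odd_reflection (OspHeight.between_injective hr hj hi.le) hpp hqq hs (by omega) h1 h2 ?_
    rw [hsum]
    by_cases h : (if j = 0 then (k : ℤ) - (min i k : ℕ) else if j + 1 = d ∧ i + 1 = n then -t else 0) = 0
    · exact Or.inr ⟨by rw [h, Int.cast_zero], by rw [betweenWeight_succ_eq htd hj hi h]⟩
    · refine Or.inl ⟨by exact_mod_cast h, ?_⟩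
      funext x
      simp only [shiftedWeight, Pi.add_apply, Pi.sub_apply, betweenWeight_succ ht htd hj hi h x, wt, hp, hq,
        Pi.single_apply]
      push_cast; ring
  · obtain ⟨h1, h2⟩ := OspHeight.swap_adjacent (ht := OspHeight.between d r n j (i + 1))
      (ht' := OspHeight.between d r n j i) (OspHeight.between_injective hr hj hi) (p := q) (q := p)
      (by omega) (by omega) (by omega) (by omega) fun c h h1 h2 => (hc c h h2 h1).symm
    have hlt : OspHeight.between d r n j (i + 1) p < OspHeight.between d r n j (i + 1) q := by omega
    refine hρ.odd_reflection (OspHeight.between_injective hr hj hi) hqq hpp (by rw [mul_comm, hs]) hlt h1 h2 ?_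
    rw [add_comm, hsum']
    by_cases h : (if j = 0 then (k : ℤ) - (min i k : ℕ) else if j + 1 = d ∧ i + 1 = n then -t else 0) = 0
    · exact Or.inr ⟨by rw [h, Int.cast_zero], by rw [betweenWeight_succ_eq htd hj hi h]⟩
    · refine Or.inl ⟨by exact_mod_cast h, ?_⟩
      funext x
      simp only [shiftedWeight, Pi.add_apply, Pi.sub_apply, betweenWeight_succ ht htd hj hi h x, wt, hp, hq,
        Pi.single_apply]
      push_cast; ring

theorem IsIrreducible.between_iff (hρ : ρ.IsIrreducible) (hr : r ≤ 1) (hn : 1 ≤ n) {k t j : ℕ} (ht : t ≤ 1)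
    (htd : t = 0 ∨ 2 ≤ d) (hj : j < d) (c : ℂ) :
    (∃ x, ρ.IsHWVec (OspHeight.between d r n j 0) (shiftedWeight c (betweenWeight d n k t j 0)) x) ↔
    ∃ x, ρ.IsHWVec (OspHeight.between d r n 0 n) (shiftedWeight c (betweenWeight d n k t 0 n)) x := by
  have h1 : ∀ j, j < d → ∀ i, i ≤ n →
      ((∃ x, ρ.IsHWVec (OspHeight.between d r n j 0) (shiftedWeight c (betweenWeight d n k t j 0)) x) ↔
      ∃ x, ρ.IsHWVec (OspHeight.between d r n j i) (shiftedWeight c (betweenWeight d n k t j i)) x) := by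
    intro j hj i hi
    induction i with
    | zero => exact Iff.rfl
    | succ i ih => exact (ih (by omega)).trans (hρ.between_step hr ht htd hj (by omega) c)
  induction j with
  | zero => exact h1 0 hj n le_rfl
  | succ j ih =>
    rw [h1 (j + 1) hj n le_rfl, ← OspHeight.between_zero, ← betweenWeight_zero hn hj]
    exact ih (by omega)

end OspRep

theorem Osp.IsCartan.bracket_apply {d r n : ℕ} {H : Osp d r n} (hH : H.IsCartan) (X : Osp d r n)
    (i j : OspIdx d r n) : (Osp.bracket H X).1 i j = (H.1 i i - H.1 j j) * X.1 i j := by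
  rw [Osp.bracket_apply, sum_sub_distrib, sum_eq_single i, sum_eq_single j]
  · have : braidSign i j j = 1 := by
      rcases i with i | i <;> rcases j with j | j <;> norm_num [braidSign, superSign]
    rw [this]; ring
  · intro k _ hk; rw [hH hk]; simp
  · simp
  · intro k _ hk; rw [hH (Ne.symm hk)]; simp
  · simp

namespace OspHeight

variable {d r n : ℕ}

/-- The positive roots are those of positive degree. -/
structure Represents (ht : OspHeight d r n) (P : Set (OspWeight d n)) : Prop where
  pos : ∀ α ∈ P, ∃ x : ℤ, 0 < x ∧ α.eval (grad ht).1 = x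
  mem : ∀ a b : OspIdx d r n, ht b < ht a → (b = dual a → superSign a = -1) → wt a - wt b ∈ P

theorem eps_eq_wt (r : ℕ) (a : Fin d) : (eps ((a : ℕ) + 1) : OspWeight d n) = wt (.inl (.inl (.inl a)) : OspIdx d r n) := by
  funext x
  rcases x with x | x
  · simp [eps, wt, Pi.single_apply, Fin.ext_iff]
  · simp [eps, wt]

theorem del_eq_wt (r : ℕ) (b : Fin n) : (del ((b : ℕ) + 1) : OspWeight d n) = wt (.inr (.inl b) : OspIdx d r n) := by
  funext x
  rcases x with x | x
  · simp [del, wt]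
  · simp [del, wt, Pi.single_apply, Fin.ext_iff]

theorem eval_eps (e : Fin d → ℤ) (f : Fin n → ℤ) (a : Fin d) :
    (eps ((a : ℕ) + 1) : OspWeight d n).eval (grad (ofPos r e f)).1 = e a := by
  rw [eps_eq_wt r, eval_wt_grad]; rfl

theorem eval_del (e : Fin d → ℤ) (f : Fin n → ℤ) (b : Fin n) :
    (del ((b : ℕ) + 1) : OspWeight d n).eval (grad (ofPos r e f)).1 = f b := by
  rw [del_eq_wt r, eval_wt_grad]; rfl

theorem pos_of_common {e : Fin d → ℤ} {f : Fin n → ℤ} (he : ∀ j, 0 < e j) (hf : ∀ i, 0 < f i)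
    (hea : StrictAnti e) (hfa : StrictAnti f) {α : OspWeight d n} (h : IsCommonPosRoot d r n α) :
    ∃ x : ℤ, 0 < x ∧ α.eval (grad (ofPos r e f)).1 = x := by
  have E : ∀ i, 1 ≤ i → i ≤ d → ∃ a : Fin d, (a : ℕ) + 1 = i := fun i h h' => ⟨⟨i - 1, by omega⟩, by simp; omega⟩
  have D : ∀ i, 1 ≤ i → i ≤ n → ∃ a : Fin n, (a : ℕ) + 1 = i := fun i h h' => ⟨⟨i - 1, by omega⟩, by simp; omega⟩
  cases h with
  | eps_sub i j hi hij hj =>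
    obtain ⟨a, rfl⟩ := E i hi (by omega)
    obtain ⟨b, rfl⟩ := E j (by omega) hj
    have := hea (show a < b from Fin.lt_def.2 (by omega))
    exact ⟨e a - e b, by omega, by rw [eval_sub, eval_eps, eval_eps]; push_cast; rfl⟩
  | eps_add i j hi hij hj =>
    obtain ⟨a, rfl⟩ := E i hi (by omega)
    obtain ⟨b, rfl⟩ := E j (by omega) hj
    have := he a; have := he b
    exact ⟨e a + e b, by omega, by rw [eval_add, eval_eps, eval_eps]; push_cast; rfl⟩
  | eps_short j hr hi hj =>
    obtain ⟨a, rfl⟩ := E j hi hj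
    exact ⟨e a, he a, eval_eps e f a⟩
  | del_sub i j hi hij hj =>
    obtain ⟨a, rfl⟩ := D i hi (by omega)
    obtain ⟨b, rfl⟩ := D j (by omega) hj
    have := hfa (show a < b from Fin.lt_def.2 (by omega))
    exact ⟨f a - f b, by omega, by rw [eval_sub, eval_del, eval_del]; push_cast; rfl⟩
  | del_add i j hi hij hj =>
    obtain ⟨a, rfl⟩ := D i hi (by omega)
    obtain ⟨b, rfl⟩ := D j (by omega) hj
    have := hf a; have := hf b
    exact ⟨f a + f b, by omega, by rw [eval_add, eval_del, eval_del]; push_cast; rfl⟩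
  | odd_add j i hj hj' hi hi' =>
    obtain ⟨a, rfl⟩ := E j hj hj'
    obtain ⟨b, rfl⟩ := D i hi hi'
    have := he a; have := hf b
    exact ⟨e a + f b, by omega, by rw [eval_add, eval_eps, eval_del]; push_cast; rfl⟩
  | odd_short i hr hi hi' =>
    obtain ⟨a, rfl⟩ := D i hi hi'
    exact ⟨f a, hf a, eval_del e f a⟩

theorem mem_of_common (hr : r ≤ 1) {e : Fin d → ℤ} {f : Fin n → ℤ} (he : ∀ j, 0 < e j) (hf : ∀ i, 0 < f i)
    (hea : StrictAnti e) (hfa : StrictAnti f) {P : Set (OspWeight d n)} (hP : {α | IsCommonPosRoot d r n α} ⊆ P)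
    (hde : ∀ (j : Fin d) (i : Fin n), e j < f i → del ((i : ℕ) + 1) - eps ((j : ℕ) + 1) ∈ P)
    (hed : ∀ (j : Fin d) (i : Fin n), f i < e j → eps ((j : ℕ) + 1) - del ((i : ℕ) + 1) ∈ P)
    (a b : OspIdx d r n) (h : ofPos r e f b < ofPos r e f a) (h2 : b = dual a → superSign a = -1) :
    wt a - wt b ∈ P := by
  have hr1 : ∀ _ : Fin r, r = 1 := fun x => by have := x.2; omega
  have w1 : ∀ a : Fin d, (wt (.inl (.inl (.inl a)) : OspIdx d r n) : OspWeight d n) = eps ((a : ℕ) + 1) :=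
    fun a => (eps_eq_wt r a).symm
  have w2 : ∀ a : Fin d, (wt (.inl (.inl (.inr a)) : OspIdx d r n) : OspWeight d n) = -eps ((a : ℕ) + 1) :=
    fun a => by rw [eps_eq_wt r a, ← wt_dual]; rfl
  have w3 : ∀ a : Fin r, (wt (.inl (.inr a) : OspIdx d r n) : OspWeight d n) = 0 := fun a => rfl
  have w4 : ∀ a : Fin n, (wt (.inr (.inl a) : OspIdx d r n) : OspWeight d n) = del ((a : ℕ) + 1) :=
    fun a => (del_eq_wt r a).symm
  have w5 : ∀ a : Fin n, (wt (.inr (.inr a) : OspIdx d r n) : OspWeight d n) = -del ((a : ℕ) + 1) :=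
    fun a => by rw [del_eq_wt r a, ← wt_dual]; rfl
  have c1 : ∀ a b : Fin d, a < b → (eps ((a : ℕ) + 1) - eps ((b : ℕ) + 1) : OspWeight d n) ∈ P := fun a b h =>
    hP (.eps_sub _ _ (by omega) (by have := Fin.lt_def.1 h; omega) b.2)
  have c2 : ∀ a b : Fin n, a < b → (del ((a : ℕ) + 1) - del ((b : ℕ) + 1) : OspWeight d n) ∈ P := fun a b h =>
    hP (.del_sub _ _ (by omega) (by have := Fin.lt_def.1 h; omega) b.2)
  have c3 : ∀ a b : Fin d, a < b → (eps ((a : ℕ) + 1) + eps ((b : ℕ) + 1) : OspWeight d n) ∈ P := fun a b h =>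
    hP (.eps_add _ _ (by omega) (by have := Fin.lt_def.1 h; omega) b.2)
  have c4 : ∀ a b : Fin n, a ≤ b → (del ((a : ℕ) + 1) + del ((b : ℕ) + 1) : OspWeight d n) ∈ P := fun a b h =>
    hP (.del_add _ _ (by omega) (by have := Fin.le_def.1 h; omega) b.2)
  have ed_add : ∀ (a : Fin d) (b : Fin n), (eps ((a : ℕ) + 1) + del ((b : ℕ) + 1) : OspWeight d n) ∈ P := fun a b =>
    hP (.odd_add _ _ (by omega) a.2 (by omega) b.2)
  have e_s : ∀ (x : Fin r) (a : Fin d), (eps ((a : ℕ) + 1) : OspWeight d n) ∈ P := fun x a =>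
    hP (.eps_short _ (hr1 x) (by omega) a.2)
  have d_s : ∀ (x : Fin r) (a : Fin n), (del ((a : ℕ) + 1) : OspWeight d n) ∈ P := fun x a =>
    hP (.odd_short _ (hr1 x) (by omega) a.2)
  generalize hE : (fun a : Fin d => (eps ((a : ℕ) + 1) : OspWeight d n)) = E
  generalize hD : (fun a : Fin n => (del ((a : ℕ) + 1) : OspWeight d n)) = D
  have hE' : ∀ a : Fin d, (eps ((a : ℕ) + 1) : OspWeight d n) = E a := fun a => by rw [← hE]
  have hD' : ∀ a : Fin n, (del ((a : ℕ) + 1) : OspWeight d n) = D a := fun a => by rw [← hD]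
  simp only [hE', hD'] at *
  clear hE hD hE' hD'
  have e_sub : ∀ a b : Fin d, e b < e a → E a - E b ∈ P := fun a b h => c1 a b (hea.lt_iff_gt.1 h)
  have d_sub : ∀ a b : Fin n, f b < f a → D a - D b ∈ P := fun a b h => c2 a b (hfa.lt_iff_gt.1 h)
  have e_add : ∀ a b : Fin d, a ≠ b → E a + E b ∈ P := by
    intro a b hab
    rcases lt_or_gt_of_ne hab with h | h
    · exact c3 a b h
    · rw [add_comm]; exact c3 b a h
  have d_add : ∀ a b : Fin n, D a + D b ∈ P := by
    intro a b
    rcases le_total a b with h | h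
    · exact c4 a b h
    · rw [add_comm]; exact c4 b a h
  rcases a with ((a | a) | a) | a | a <;> rcases b with ((b | b) | b) | b | b <;> simp only [ofPos] at h <;>
    simp only [w1, w2, w3, w4, w5, sub_neg_eq_add, sub_zero, zero_sub, zero_add, neg_add_eq_sub]
  all_goals
    try have ha := he a
    try have ha := hf a
    try have hb := he b
    try have hb := hf b
    first
    | (exfalso; omega)
    | exact e_sub _ _ h
    | exact d_sub _ _ h
    | exact e_sub _ _ (neg_lt_neg_iff.1 h)
    | exact d_sub _ _ (neg_lt_neg_iff.1 h)
    | exact hed _ _ h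
    | exact hde _ _ h
    | exact hed _ _ (neg_lt_neg_iff.1 h)
    | exact hde _ _ (neg_lt_neg_iff.1 h)
    | exact ed_add _ _
    | exact d_add _ _
    | exact e_s a b
    | exact e_s b a
    | exact d_s a b
    | exact d_s b a
    | (rw [add_comm]; exact ed_add _ _)
    | skip
  refine e_add _ _ ?_
  rintro rfl
  have := h2 rfl
  norm_num [superSign] at this

theorem represents_standard (hr : r ≤ 1) {e : Fin d → ℤ} {f : Fin n → ℤ} (he : ∀ j, 0 < e j)
    (hf : ∀ i, 0 < f i) (hea : StrictAnti e) (hfa : StrictAnti f) (hef : ∀ j i, e j < f i) :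
    (ofPos r e f).Represents (standardPosRoots d r n) where
  pos α hα := by
    rcases hα with h | ⟨i, j, ⟨h1, h2⟩, ⟨h3, h4⟩, rfl⟩
    · exact pos_of_common he hf hea hfa h
    · obtain ⟨a, rfl⟩ : ∃ a : Fin n, (a : ℕ) + 1 = i := ⟨⟨i - 1, by omega⟩, by simp; omega⟩
      obtain ⟨b, rfl⟩ : ∃ a : Fin d, (a : ℕ) + 1 = j := ⟨⟨j - 1, by omega⟩, by simp; omega⟩
      have := hef b a
      exact ⟨f a - e b, by omega, by rw [eval_sub, eval_eps, eval_del]; push_cast; rfl⟩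
  mem := mem_of_common hr he hf hea hfa (fun _ h => Or.inl h)
    (fun j i _ => Or.inr ⟨_, _, ⟨by omega, i.2⟩, ⟨by omega, j.2⟩, rfl⟩)
    fun j i h => absurd h (by have := hef j i; omega)

theorem represents_reversed (hr : r ≤ 1) {e : Fin d → ℤ} {f : Fin n → ℤ} (he : ∀ j, 0 < e j)
    (hf : ∀ i, 0 < f i) (hea : StrictAnti e) (hfa : StrictAnti f) (hef : ∀ j i, f i < e j) :
    (ofPos r e f).Represents (reversedPosRoots d r n) where
  pos α hα := by
    rcases hα with h | ⟨i, j, ⟨h1, h2⟩, ⟨h3, h4⟩, rfl⟩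
    · exact pos_of_common he hf hea hfa h
    · obtain ⟨a, rfl⟩ : ∃ a : Fin n, (a : ℕ) + 1 = i := ⟨⟨i - 1, by omega⟩, by simp; omega⟩
      obtain ⟨b, rfl⟩ : ∃ a : Fin d, (a : ℕ) + 1 = j := ⟨⟨j - 1, by omega⟩, by simp; omega⟩
      have := hef b a
      exact ⟨e b - f a, by omega, by rw [eval_sub, eval_eps, eval_del]; push_cast; rfl⟩
  mem := mem_of_common hr he hf hea hfa (fun _ h => Or.inl h)
    (fun j i h => absurd h (by have := hef j i; omega))
    (fun j i _ => Or.inr ⟨_, _, ⟨by omega, i.2⟩, ⟨by omega, j.2⟩, rfl⟩)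

/-- The height for the order `ε_1 > ⋯ > ε_d > δ_1 > ⋯ > δ_n`. -/
def reversed (d r n : ℕ) : OspHeight d r n :=
  ofPos r (fun a => (d : ℤ) + n - a) fun b => (n : ℤ) - b

/-- The height for the order `δ_1 > ⋯ > δ_n > ε_1 > ⋯ > ε_d`. -/
def standard (d r n : ℕ) : OspHeight d r n :=
  ofPos r (fun a => (d : ℤ) - a) fun b => (d : ℤ) + n - b

theorem reversed_represents (hr : r ≤ 1) : (reversed d r n).Represents (reversedPosRoots d r n) := by
  refine represents_reversed hr ?_ ?_ ?_ ?_ ?_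
  · intro a; have := a.2; omega
  · intro a; have := a.2; omega
  · intro a b h; have := Fin.lt_def.1 h; simp only; omega
  · intro a b h; have := Fin.lt_def.1 h; simp only; omega
  · intro a b; have := a.2; omega

theorem standard_represents (hr : r ≤ 1) : (standard d r n).Represents (standardPosRoots d r n) := by
  refine represents_standard hr ?_ ?_ ?_ ?_ ?_
  · intro a; have := a.2; omega
  · intro a; have := a.2; omega
  · intro a b h; have := Fin.lt_def.1 h; simp only; omega
  · intro a b h; have := Fin.lt_def.1 h; simp only; omega
  · intro a b; have := b.2; omega

theorem reversed_injective (hr : r ≤ 1) (a b : OspIdx d r n) (h : reversed d r n a = reversed d r n b) : a = b := by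
  refine ofPos_injective hr ?_ ?_ ?_ ?_ ?_ a b h
  · intro a; have := a.2; omega
  · intro a; have := a.2; omega
  · intro a b h; simp only at h; exact Fin.ext (by omega)
  · intro a b h; simp only at h; exact Fin.ext (by omega)
  · intro a b; have := a.2; omega

theorem reversed_pos (a : OspIdx d r n) (ha : IsPos a) : 0 < reversed d r n a :=
  ofPos_pos (fun a => by have := a.2; omega) (fun b => by have := b.2; omega) a ha

theorem between_standard : between d r n 0 n = standard d r n := by
  unfold between standard
  congr 1
  · ext a; split_ifs <;> push_cast <;> omega
  · ext b; have := b.2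
    simp

theorem between_reversed : between (d + 1) r n d 0 = reversed (d + 1) r n := by
  unfold between reversed
  congr 1
  · ext a; have := a.2
    split_ifs <;> push_cast <;> omega
  · ext b
    simp only [Nat.not_lt_zero, if_false]; push_cast; ring

end OspHeight

namespace OspRep

variable {d r n : ℕ} {V : Type*} [AddCommGroup V] [Module ℂ V] {ρ : OspRep d r n V}

theorem root_dual_eq_zero {a : OspIdx d r n} (ha : superSign a = 1) (v : V) : ρ.root a (dual a) v = 0 := by
  have h := ρ.root_dual a (dual a) v
  rw [dual_dual, reflectSign_dual_self, ha] at h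
  have h2 : (2 : ℂ) • ρ.root a (dual a) v = 0 := by
    rw [two_smul]; nth_rewrite 1 [h]; module
  simpa using h2

theorem isHighestWeightVector_iff {ht : OspHeight d r n} {P : Set (OspWeight d n)} (h : ht.Represents P)
    {lam : OspWeight d n} {v : V} : ρ.IsHighestWeightVector P lam v ↔ ρ.IsHWVec ht lam v := by
  constructor
  · rintro ⟨h1, h2, h3, h4⟩
    refine ⟨h1, h2, ρ.isWeightVec_iff.2 h3, fun a b hab => ?_⟩
    by_cases hb : b = dual a ∧ superSign a = 1
    · rw [hb.1, root_dual_eq_zero hb.2]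
    refine h4 (wt a - wt b) (h.mem a b hab fun hba => ?_) _ fun H hH => ?_
    · exact (superSign_eq a).resolve_left fun h => hb ⟨hba, h⟩
    · rw [hH.bracket_rootVec, eval_sub]
      have key : ∀ a : OspIdx d r n, (wt a).eval H.1 = H.1 a a := by
        intro a
        rw [eval_eq_sum]
        have h0 : H.1 (dual a) (dual a) = -H.1 a a := by
          rw [Osp.apply_dual H a a, reflectSign_self]; ring
        simp only [ext_wt, mul_sub, sum_sub_distrib, mul_ite, mul_one, mul_zero, sum_ite_eq',
          mem_univ, if_true, h0]
        ring
      rw [key, key]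
  · rintro ⟨h1, h2, h3, h4⟩
    refine ⟨h1, h2, ρ.isWeightVec_iff.1 h3, fun α hα X hX => ?_⟩
    obtain ⟨x, hx0, hx⟩ := h.pos α hα
    refine ρ.act_eq_zero_of_root fun a b hab => h4 a b ?_
    have h5 := congrFun (congrFun (congrArg Subtype.val (hX _ (grad_isCartan ht))) a) b
    rw [(grad_isCartan ht).bracket_apply, hx, grad_apply_self, grad_apply_self] at h5
    have h6 : ((ht a - ht b : ℤ) : ℂ) = x := by
      push_cast
      exact mul_right_cancel₀ hab h5
    have := Int.cast_injective h6
    omega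

theorem isIrrepOfHighestWeight_iff {ht : OspHeight d r n} {P : Set (OspWeight d n)} (h : ht.Represents P)
    {lam : OspWeight d n} : ρ.IsIrrepOfHighestWeight P lam ↔ ρ.IsIrreducible ∧ ∃ v, ρ.IsHWVec ht lam v :=
  and_congr Iff.rfl (exists_congr fun _ => isHighestWeightVector_iff h)

/-- The highest weight for the order `reversed` that corresponds to `standardWeight`. -/
def reversedWeight (d n : ℕ) (c : ℂ) (k t : ℕ) : OspWeight d n :=
  shiftedWeight c (Sum.elim (fun a => if (a : ℕ) = 0 then (k : ℤ) else 0)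
    fun b => -(if (b : ℕ) + 1 = n then (t : ℤ) else 0))

/-- The highest weight for the order `standard` that corresponds to `reversedWeight`. -/
def standardWeight (d n : ℕ) (c : ℂ) (k t : ℕ) : OspWeight d n :=
  shiftedWeight c (Sum.elim (fun a => (if (a : ℕ) = 0 then (k : ℤ) - (min n k : ℕ) else 0)
      - (if (a : ℕ) + 1 = d then (t : ℤ) else 0))
    fun b => if (b : ℕ) < min n k then 1 else 0)

theorem IsIrreducible.reversed_iff_standard {ρ : OspRep (d + 1) r n V} (hρ : ρ.IsIrreducible) (hr : r ≤ 1)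
    (hn : 1 ≤ n) {k t : ℕ} (ht : t ≤ 1) (htd : t = 0 ∨ 1 ≤ d) (c : ℂ) :
    (∃ x, ρ.IsHWVec (OspHeight.reversed (d + 1) r n) (reversedWeight (d + 1) n c k t) x) ↔
      ∃ x, ρ.IsHWVec (OspHeight.standard (d + 1) r n) (standardWeight (d + 1) n c k t) x := by
  have h := hρ.between_iff hr hn (k := k) ht (by omega) (Nat.lt_succ_self d) c
  rw [OspHeight.between_reversed, OspHeight.between_standard] at h
  have e1 : betweenWeight (d + 1) n k t d 0 = Sum.elim (fun a : Fin (d + 1) => if (a : ℕ) = 0 then (k : ℤ) else 0)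
      fun b : Fin n => -(if (b : ℕ) + 1 = n then (t : ℤ) else 0) := by
    have h1 : ¬(0 = n) := by omega
    funext x
    rcases x with a | b <;> simp [betweenWeight, h1]
  have e2 : betweenWeight (d + 1) n k t 0 n = Sum.elim (fun a : Fin (d + 1) => (if (a : ℕ) = 0 then (k : ℤ) - (min n k : ℕ) else 0)
      - (if (a : ℕ) + 1 = d + 1 then (t : ℤ) else 0)) fun b : Fin n => if (b : ℕ) < min n k then 1 else 0 := by
    funext x
    rcases x with a | b
    · simp only [betweenWeight, or_true, and_true, Sum.elim_inl]
      split_ifs <;> omega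
    · simp [betweenWeight]
  rwa [e1, e2] at h

theorem decomposesInto_two {P : Set (OspWeight d n)} {A₁ A₂ : Submodule ℂ V} (hA : IsCompl A₁ A₂)
    {l₁ l₂ : OspWeight d n} (h₁ : ∃ h : ρ.IsSubrep A₁, (ρ.restrict A₁ h).IsIrrepOfHighestWeight P l₁)
    (h₂ : ∃ h : ρ.IsSubrep A₂, (ρ.restrict A₂ h).IsIrrepOfHighestWeight P l₂) :
    ρ.DecomposesInto P ![l₁, l₂] := by
  obtain ⟨hA₁, h₁⟩ := h₁
  obtain ⟨hA₂, h₂⟩ := h₂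
  refine ⟨![A₁, A₂], fun i => ?_, ?_, fun i => ?_⟩
  · fin_cases i
    · exact hA₁
    · exact hA₂
  · rw [DirectSum.isInternal_submodule_iff_isCompl (i := 0) (j := 1) _ (by decide)
      (by ext i; fin_cases i <;> simp)]
    exact hA
  · fin_cases i
    · exact h₁
    · exact h₂

variable {W : Type*} [AddCommGroup W] [Module ℂ W] {σ : OspRep d r n W}

theorem casimirValue_sub_wt (ht : OspHeight d r n) (lam : OspWeight d n) {p : OspIdx d r n} (hp : IsPos p) :
    casimirValue ht lam - casimirValue ht (lam - wt p) =
      2 * superSign p * (2 * ext lam p - 1) + (casimirCoeff ht p - casimirCoeff ht (dual p)) := by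
  have hne : dual p ≠ p := hp.dual_ne hp
  have h1 : ∀ a : OspIdx d r n, ext (lam - wt p) a = ext lam a - ((if a = p then 1 else 0) - (if a = dual p then 1 else 0)) :=
    fun a => by rw [ext_sub, ext_wt]
  have h2 : ∀ a : OspIdx d r n, superSign a * ext lam a ^ 2 - superSign a * ext (lam - wt p) a ^ 2
      = (if a = p then superSign p * (2 * ext lam p - 1) else 0)
        + (if a = dual p then superSign p * (2 * ext lam p - 1) else 0) := by
    intro a
    rw [h1]
    by_cases ha : a = p
    · subst ha; rw [if_pos rfl, if_neg (Ne.symm hne), if_pos rfl, if_neg (Ne.symm hne)]; ring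
    · by_cases ha' : a = dual p
      · subst ha'
        rw [if_neg ha, if_pos rfl, if_neg ha, if_pos rfl, ext_dual, superSign_dual]; ring
      · rw [if_neg ha, if_neg ha', if_neg ha, if_neg ha']; ring
  have h3 : ∀ a : OspIdx d r n, casimirCoeff ht a * ext lam a - casimirCoeff ht a * ext (lam - wt p) a
      = (if a = p then casimirCoeff ht p else 0) - (if a = dual p then casimirCoeff ht (dual p) else 0) := by
    intro a
    rw [h1]
    by_cases ha : a = p
    · subst ha; rw [if_pos rfl, if_neg (Ne.symm hne), if_pos rfl, if_neg (Ne.symm hne)]; ring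
    · by_cases ha' : a = dual p
      · subst ha'
        rw [if_neg ha, if_pos rfl, if_neg ha, if_pos rfl]; ring
      · rw [if_neg ha, if_neg ha', if_neg ha, if_neg ha']; ring
  rw [casimirValue, casimirValue, add_sub_add_comm, ← sum_sub_distrib, ← sum_sub_distrib,
    sum_congr rfl fun a _ => h2 a, sum_congr rfl fun a _ => h3 a, sum_add_distrib,
    sum_sub_distrib]
  simp only [sum_ite_eq', mem_univ, if_true]
  ring

theorem casimirCoeff_dual (ht : OspHeight d r n) (p : OspIdx d r n) :
    casimirCoeff ht (dual p) = -casimirCoeff ht p := by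
  rw [casimirCoeff, casimirCoeff, ← sum_neg_distrib]
  refine Fintype.sum_equiv ⟨dual, dual, dual_dual, dual_dual⟩ _ _ fun b => ?_
  simp only [Equiv.coe_fn_mk, superSign_dual, ht.map_dual, dual_dual]
  have e : (dual b = dual p) = (b = p) := propext ⟨fun h => by rw [← dual_dual b, h, dual_dual], fun h => by rw [h]⟩
  simp only [e]
  split_ifs <;> first | (exfalso; omega) | simp

theorem casimirCoeff_eps {e : Fin d → ℤ} {f : Fin n → ℤ} (he : ∀ j, 0 < e j) (hf : ∀ i, 0 < f i)
    (hef : ∀ j i, e j ≠ f i) (hei : Function.Injective e) (j : Fin d) :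
    casimirCoeff (OspHeight.ofPos r e f) (.inl (.inl (.inl j))) =
      r + 2 * ∑ j', (if e j' < e j then 1 else 0) - 2 * ∑ i, (if f i < e j then 1 else 0) := by
  have h1 : ∀ j', ((if e j' < e j then 1 - 0 else if e j < e j' then -(1 - 0) else 0) : ℂ)
      + (1 - if j' = j then 1 else 0) = 2 * (if e j' < e j then 1 else 0) := by
    intro j'
    by_cases h : j' = j
    · subst h; simp
    · have := fun h' => h (hei h')
      rcases lt_or_gt_of_ne this with h2 | h2
      · simp [h, h2]; norm_num
      · simp [h, h2, not_lt.2 h2.le]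
  have h2 : ∀ i, ((if f i < e j then -1 - 0 else if e j < f i then -(-1 - 0) else 0) : ℂ) + (-1 - 0)
      = -2 * (if f i < e j then 1 else 0) := by
    intro i
    rcases lt_or_gt_of_ne (hef j i) with h2 | h2
    · simp [h2, not_lt.2 h2.le]
    · simp [h2]; norm_num
  have h3 : ∀ j', -e j' < e j := fun j' => by have := he j'; have := he j; omega
  have h4 : ∀ i, -f i < e j := fun j' => by have := hf j'; have := he j; omega
  simp only [casimirCoeff, Fintype.sum_sum_type, OspHeight.ofPos, superSign, dual, he j, h3, h4, if_true,
    Sum.inl.injEq, Sum.inr.injEq, Sum.swap_inl, reduceCtorEq, if_false]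
  have e1 := sum_congr rfl fun j' (_ : j' ∈ Finset.univ) => h1 j'
  have e2 := sum_congr rfl fun j' (_ : j' ∈ Finset.univ) => h2 j'
  rw [sum_add_distrib, ← mul_sum] at e1 e2
  simp only [sub_zero] at e1 e2 ⊢
  simp only [Finset.sum_const, Finset.card_univ, Fintype.card_fin, nsmul_eq_mul, mul_one] at e2 ⊢
  linear_combination e1 + e2

theorem casimirCoeff_del {e : Fin d → ℤ} {f : Fin n → ℤ} (he : ∀ j, 0 < e j) (hf : ∀ i, 0 < f i)
    (hef : ∀ j i, e j ≠ f i) (hfi : Function.Injective f) (i : Fin n) :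
    casimirCoeff (OspHeight.ofPos r e f) (.inr (.inl i)) =
      r - 2 + 2 * ∑ j', (if e j' < f i then 1 else 0) - 2 * ∑ i', (if f i' < f i then 1 else 0) := by
  have h1 : ∀ j', ((if e j' < f i then 1 - 0 else if f i < e j' then -(1 - 0) else 0) : ℂ)
      + (1 - 0) = 2 * (if e j' < f i then 1 else 0) := by
    intro j'
    rcases lt_or_gt_of_ne (hef j' i) with h2 | h2
    · simp [h2]; norm_num
    · simp [h2, not_lt.2 h2.le]
  have h2 : ∀ i', ((if f i' < f i then -1 - 0 else if f i < f i' then -(-1 - 0) else 0) : ℂ)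
      + (-1 - if i' = i then 1 else 0) = -2 * (if f i' < f i then 1 else 0) + -2 * (if i' = i then 1 else 0) := by
    intro i'
    by_cases h : i' = i
    · subst h; simp; norm_num
    · have := fun h' => h (hfi h')
      rcases lt_or_gt_of_ne this with h2 | h2
      · simp [h, h2]; norm_num
      · simp [h, h2, not_lt.2 h2.le]
  have h3 : ∀ j', -e j' < f i := fun j' => by have := he j'; have := hf i; omega
  have h4 : ∀ i', -f i' < f i := fun j' => by have := hf j'; have := hf i; omega
  simp only [casimirCoeff, Fintype.sum_sum_type, OspHeight.ofPos, superSign, dual, hf i, h3, h4, if_true,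
    Sum.inr.injEq, Sum.swap_inl, reduceCtorEq, if_false]
  have e1 := sum_congr rfl fun j' (_ : j' ∈ Finset.univ) => h1 j'
  have e2 := sum_congr rfl fun j' (_ : j' ∈ Finset.univ) => h2 j'
  rw [sum_add_distrib, ← mul_sum] at e1
  rw [sum_add_distrib, sum_add_distrib, ← mul_sum, ← mul_sum, sum_ite_eq',
    if_pos (mem_univ _)] at e2
  simp only [sub_zero] at e1 e2 ⊢
  simp only [Finset.sum_const, Finset.card_univ, Fintype.card_fin, nsmul_eq_mul, mul_one] at e1 e2 ⊢
  linear_combination e1 + e2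

theorem sum_pairing_wt (lam : OspWeight d n) (b : OspIdx d r n) :
    ∑ a : OspIdx d r n, superSign a * (ext lam a * ext (wt b) a) = 2 * superSign b * ext lam b := by
  simp only [ext_wt, mul_sub, mul_ite, mul_one, mul_zero, sum_sub_distrib, sum_ite_eq',
    mem_univ, if_true, ext_dual, superSign_dual]
  ring

theorem sum_pairing_sub (lam mu nu : OspWeight d n) :
    ∑ a : OspIdx d r n, superSign a * (ext lam a * ext (mu - nu) a) =
      ∑ a : OspIdx d r n, superSign a * (ext lam a * ext mu a)
        - ∑ a : OspIdx d r n, superSign a * (ext lam a * ext nu a) := by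
  rw [← sum_sub_distrib]
  exact sum_congr rfl fun a _ => by rw [ext_sub]; ring

/-- The decomposition of the tensor product with a spinor representation of `𝔬𝔰𝔭(2d+r|2n)`, `d > 0`. -/
theorem SpinorFacts.tensor_decompose (hρ : ρ.IsIrreducible) (hσ : σ.IsIrreducible) {ht g : OspHeight d r n}
    (hht : ∀ a b, ht a = ht b → a = b) (hg : ∀ a b, g b < g a → ht b < ht a)
    {lam kap : OspWeight d n} {s : V} {w : W} {a b c e : OspIdx d r n} (hab : g a = g b - 1)
    (hfacts : ρ.SpinorFacts ht g {s, ρ.root a b s} (ρ.root a b s))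
    (hs : ρ.IsHWVec ht lam s) (hw : σ.IsHWVec ht kap w) {t : ℂ}
    (hkap : ∀ a : OspIdx d r n, ext kap a = t * (superSign a * g a))
    (hc : casimirValue ht (lam + kap) ≠ casimirValue ht (lam + (wt a - wt b) + kap))
    (hce : ht c < ht e) (hce' : e ≠ dual c) (hy : ext kap e - superSign e * superSign c * ext kap c ≠ 0)
    (hpair : 2 * superSign c * ext lam c ≠ 2 * superSign e * ext lam e) :
    ∃ A₁ A₂ : Submodule ℂ (V ⊗[ℂ] W), IsCompl A₁ A₂ ∧ (ρ.tensor σ).IsIrredSub ht (lam + kap) A₁ ∧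
      (ρ.tensor σ).IsIrredSub ht (lam + (wt a - wt b) + kap) A₂ := by
  have hwl : ∀ a b, a ≠ b → g a = g b → σ.root a b w = 0 :=
    fun a b hne hab => hσ.root_eq_zero hht hg hw hkap hne hab
  have hwg : (ℂ ∙ w) ⊔ σ.below g (kap.eval (grad g).1) = ⊤ :=
    (hσ.coarse hw.ne_zero hw.parity hw.weight hwl fun a b hab => hw.sing a b (hg a b hab)).1
  refine tensor_decompose_two hρ hσ hht hg hs (hs.weight.root a b) (parity_root_eq hs.parity a b) hfacts.levi ?_ hw
    hkap hfacts.gen ?_ ?_ ?_ hc (hw.weight.root c e) ?_ ?_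
  · rw [eval_add, eval_sub, eval_wt_grad, eval_wt_grad, hab]; push_cast; ring
  · rintro x (rfl | rfl)
    · exact Or.inl rfl
    · exact Or.inr (root_mem_below_of_lt (hs.weight.mem_eig g) (by omega))
  · rintro N - h1 h2 x (rfl | rfl)
    · exact h1
    · exact h2
  · intro ξ hξ x hx
    refine hfacts.lead _ fun a b h h' => ?_
    rw [← contractRight_root_of_eq σ hwg hξ h (hw.sing a b h'), hx a b h']
    simp
  · intro h0
    have h1 := root_root_swap hw.weight (show e ≠ c by rintro rfl; exact lt_irrefl _ hce) (hw.sing e c hce)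
    rw [h0, map_zero, if_neg (fun h => hce' (by rw [h, dual_dual])), sub_zero, one_mul] at h1
    exact smul_ne_zero hy hw.ne_zero h1.symm
  · rw [show kap + (wt c - wt e) = kap - wt e - -wt c by abel, sum_pairing_sub, sum_pairing_sub, ← wt_dual,
      sum_pairing_wt, sum_pairing_wt, ext_dual, superSign_dual]
    intro h
    apply hpair
    linear_combination h

end OspRep

namespace OspIdx

/-- The index of `ε_1`. -/
def firstEps (d r n : ℕ) : OspIdx (d + 1) r n := .inl (.inl (.inl 0))

/-- The index of `δ_n`. -/
def lastDel (d r n : ℕ) : OspIdx d r (n + 1) := .inr (.inl (Fin.last n))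

end OspIdx

namespace OspHeight

/-- The grading by the coefficient of `ε_1`. -/
def byEps (d r n : ℕ) : OspHeight (d + 1) r n := ofPos r (fun a => if a = 0 then 1 else 0) fun _ => 0

variable {d r n : ℕ}

theorem byEps_firstEps : byEps d r n (firstEps d r n) = 1 := rfl

theorem byEps_of_ne (a : OspIdx (d + 1) r n) (ha : IsPos a) (h : a ≠ firstEps d r n) : byEps d r n a = 0 := by
  rcases a with ((a | a) | a) | a | a <;> simp [IsPos] at ha
  · have : a ≠ 0 := by rintro rfl; exact h rfl
    simp [byEps, ofPos, this]
  · rfl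

theorem reversed_lt_of_byEps_lt (a b : OspIdx (d + 1) r n) (h : byEps d r n b < byEps d r n a) :
    reversed (d + 1) r n b < reversed (d + 1) r n a := by
  rcases a with ((a | a) | a) | a | a <;> rcases b with ((b | b) | b) | b | b <;>
    simp only [byEps, ofPos, reversed] at h ⊢
  all_goals
    have h1 := a.2
    have h2 := b.2
    try simp only [Fin.ext_iff, Fin.val_zero] at h
    push_cast
    try split_ifs at h
    all_goals omega

theorem reversed_lastDel (a : OspIdx d r (n + 1)) (ha : IsPos a) (h : a ≠ lastDel d r n) :
    reversed d r (n + 1) (lastDel d r n) < reversed d r (n + 1) a := by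
  rcases a with ((a | a) | a) | a | a <;> simp [IsPos] at ha
  · have := a.2
    simp [lastDel, reversed, ofPos]; omega
  · have h1 : (a : ℕ) ≠ n := fun h' => h (by rw [lastDel]; congr; exact Fin.ext (by simpa using h'))
    have := a.2
    simp [lastDel, reversed, ofPos]; omega

end OspHeight

open OspHeight Oscillator

namespace OspRep

theorem casimirCoeff_firstEps (d r n : ℕ) :
    casimirCoeff (reversed (d + 1) r n) (firstEps d r n) = r + 2 * d - 2 * n := by
  have h := casimirCoeff_eps (r := r) (e := fun a : Fin (d + 1) => ((d + 1 : ℕ) : ℤ) + n - a)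
    (f := fun b : Fin n => (n : ℤ) - b) (fun a => by have := a.2; omega) (fun a => by have := a.2; omega)
    (fun a b => by have := a.2; omega) (fun a b h => by simp only at h; exact Fin.ext (by omega)) 0
  refine h.trans ?_
  rw [Fin.sum_univ_succ]
  have h1 : ∀ i : Fin d, ((d + 1 : ℕ) : ℤ) + n - (i.succ : ℕ) < ((d + 1 : ℕ) : ℤ) + n - ((0 : Fin (d + 1)) : ℕ) := fun i => by
    rw [Fin.val_succ, Fin.val_zero]; push_cast; omega
  have h2 : ∀ i : Fin n, (n : ℤ) - (i : ℕ) < ((d + 1 : ℕ) : ℤ) + n - ((0 : Fin (d + 1)) : ℕ) := fun i => by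
    rw [Fin.val_zero]; push_cast; omega
  simp only [h1, h2, if_true, lt_irrefl, if_false, zero_add, Finset.sum_const, Finset.card_univ, Fintype.card_fin,
    nsmul_eq_mul, mul_one]

theorem casimirCoeff_lastDel (d r n : ℕ) :
    casimirCoeff (reversed d r (n + 1)) (lastDel d r n) = r - 2 := by
  have h := casimirCoeff_del (r := r) (e := fun a : Fin d => (d : ℤ) + (n + 1 : ℕ) - a)
    (f := fun b : Fin (n + 1) => ((n + 1 : ℕ) : ℤ) - b) (fun a => by have := a.2; omega) (fun a => by have := a.2; omega)
    (fun a b => by have := a.2; omega) (fun a b h => by simp only at h; exact Fin.ext (by omega)) (Fin.last n)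
  refine h.trans ?_
  have h1 : ∀ i : Fin d, ¬ ((d : ℤ) + (n + 1 : ℕ) - i < ((n + 1 : ℕ) : ℤ) - (Fin.last n : ℕ)) := fun i => by
    have := i.2; rw [Fin.val_last]; push_cast; omega
  have h2 : ∀ i : Fin (n + 1), ¬ (((n + 1 : ℕ) : ℤ) - i < ((n + 1 : ℕ) : ℤ) - (Fin.last n : ℕ)) := fun i => by
    have := i.2; rw [Fin.val_last]; push_cast; omega
  simp only [h1, h2, if_false, Finset.sum_const_zero]
  ring

variable {d r n : ℕ} {V : Type*} [AddCommGroup V] [Module ℂ V] {ρ : OspRep (d + 1) r (n + 1) V}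

theorem casimir_sub_firstEps {lam : OspWeight (d + 1) (n + 1)} {k : ℕ} (hk : k + (k + r) + 2 * d ≠ 2 * (n + 1))
    (hlam : ext lam (firstEps d r (n + 1)) = 1 / 2 + k) :
    casimirValue (reversed (d + 1) r (n + 1)) lam
      ≠ casimirValue (reversed (d + 1) r (n + 1)) (lam - wt (firstEps d r (n + 1))) := by
  intro h
  have h1 := casimirValue_sub_wt (reversed (d + 1) r (n + 1)) lam (p := firstEps d r (n + 1)) trivial
  rw [h, sub_self, casimirCoeff_dual, casimirCoeff_firstEps, hlam, show superSign (firstEps d r (n + 1)) = 1 from rfl] at h1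
  apply hk
  have h2 : ((k + (k + r) + 2 * d : ℕ) : ℂ) = (2 * (n + 1) : ℕ) := by
    push_cast at h1 ⊢
    linear_combination -h1 / 2
  exact_mod_cast h2

theorem casimir_sub_lastDel {lam : OspWeight d (n + 1)} (hlam : ext lam (lastDel d 0 n) = -1 / 2) :
    casimirValue (reversed d 0 (n + 1)) (lam - wt (lastDel d 0 n)) = casimirValue (reversed d 0 (n + 1)) lam := by
  have h1 := casimirValue_sub_wt (reversed d 0 (n + 1)) lam (p := lastDel d 0 n) trivial
  rw [casimirCoeff_dual, casimirCoeff_lastDel, hlam, show superSign (lastDel d 0 n) = -1 from rfl] at h1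
  push_cast at h1
  linear_combination -h1

theorem ext_smul_wt_firstEps (k : ℂ) (a : OspIdx (d + 1) r n) :
    ext (k • wt (firstEps d r n)) a = k * (superSign a * byEps d r n a) := by
  rw [ext_smul, ext_wt]
  congr 1
  rcases a with ((a | a) | a) | a | a <;> simp [firstEps, dual, byEps, ofPos, superSign]

end OspRep

namespace OspWeight

variable {d n : ℕ}

theorem nu_inl (l : ℕ) (a : Fin d) : (nu l : OspWeight d n) (.inl a) = 0 := by
  simp [nu, Finset.sum_apply, del]

theorem nu_inr (l : ℕ) (b : Fin n) : (nu l : OspWeight d n) (.inr b) = if (b : ℕ) < l then 1 else 0 := by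
  rw [nu, Finset.sum_apply]
  simp only [del, Sum.elim_inr, sum_ite_eq, Finset.mem_Icc]
  exact if_congr (by omega) rfl rfl

theorem sum_eps_inl (l : ℕ) (a : Fin d) :
    (∑ j ∈ Finset.Icc 1 l, eps j : OspWeight d n) (.inl a) = if (a : ℕ) < l then 1 else 0 := by
  rw [Finset.sum_apply]
  simp only [eps, Sum.elim_inl, sum_ite_eq, Finset.mem_Icc]
  exact if_congr (by omega) rfl rfl

theorem sum_eps_inr (l : ℕ) (b : Fin n) : (∑ j ∈ Finset.Icc 1 l, eps j : OspWeight d n) (.inr b) = 0 := by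
  simp [Finset.sum_apply, eps]

theorem omegaLast_inl (a : Fin d) : omegaLast d n (.inl a) = 1 / 2 := by
  rw [omegaLast, Pi.smul_apply, sum_eps_inl, if_pos a.2, smul_eq_mul, mul_one]

theorem omegaLast_inr (b : Fin n) : omegaLast d n (.inr b) = 0 := by
  rw [omegaLast, Pi.smul_apply, sum_eps_inr, smul_zero]

theorem omegaPrev_inl (a : Fin d) : omegaPrev d n (.inl a) = 1 / 2 - if (a : ℕ) + 1 = d then 1 else 0 := by
  rw [omegaPrev, Pi.smul_apply, Pi.sub_apply, sum_eps_inl]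
  have := a.2
  by_cases h : (a : ℕ) + 1 = d
  · rw [if_neg (by omega), if_pos h]; simp [eps, h]; norm_num
  · rw [if_pos (by omega), if_neg h]; simp [eps, h]

theorem omegaPrev_inr (b : Fin n) : omegaPrev d n (.inr b) = 0 := by
  rw [omegaPrev, Pi.smul_apply, Pi.sub_apply, sum_eps_inr]
  simp [eps]

end OspWeight

namespace OspRep

theorem standardWeight_inl (d n : ℕ) (c : ℂ) (k t : ℕ) (a : Fin d) : standardWeight d n c k t (.inl a) =
    c / 2 + ((if (a : ℕ) = 0 then (k : ℂ) - (min n k : ℕ) else 0) - if (a : ℕ) + 1 = d then (t : ℂ) else 0) := by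
  simp only [standardWeight, shiftedWeight, Pi.add_apply, Pi.smul_apply, vacWeight, Sum.elim_inl, smul_eq_mul]
  generalize min n k = m
  push_cast
  split_ifs <;> ring

theorem standardWeight_inr (d n : ℕ) (c : ℂ) (k t : ℕ) (b : Fin n) : standardWeight d n c k t (.inr b) =
    -c / 2 + if (b : ℕ) < min n k then 1 else 0 := by
  simp only [standardWeight, shiftedWeight, Pi.add_apply, Pi.smul_apply, vacWeight, Sum.elim_inr, smul_eq_mul]
  push_cast
  ring

theorem reversedWeight_inl (d n : ℕ) (c : ℂ) (k t : ℕ) (a : Fin d) : reversedWeight d n c k t (.inl a) =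
    c / 2 + if (a : ℕ) = 0 then (k : ℂ) else 0 := by
  simp only [reversedWeight, shiftedWeight, Pi.add_apply, Pi.smul_apply, vacWeight, Sum.elim_inl, smul_eq_mul]
  push_cast
  ring

theorem reversedWeight_inr (d n : ℕ) (c : ℂ) (k t : ℕ) (b : Fin n) : reversedWeight d n c k t (.inr b) =
    -c / 2 - if (b : ℕ) + 1 = n then (t : ℂ) else 0 := by
  simp only [reversedWeight, shiftedWeight, Pi.add_apply, Pi.smul_apply, vacWeight, Sum.elim_inr, smul_eq_mul]
  push_cast
  ring

theorem reversedWeight_eq (d r n : ℕ) (c : ℂ) (k t : ℕ) : reversedWeight (d + 1) (n + 1) c k t =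
    c • vacWeight (d + 1) (n + 1) + (k : ℂ) • wt (firstEps d r (n + 1)) - (t : ℂ) • wt (lastDel (d + 1) r n) := by
  funext x
  rcases x with x | x
  · rw [reversedWeight_inl]
    simp [vacWeight, firstEps, lastDel, wt, Pi.single_apply]; ring
  · rw [reversedWeight_inr]
    simp [vacWeight, firstEps, lastDel, wt, Pi.single_apply, Fin.ext_iff]; ring

variable {d r n : ℕ} {V : Type u} [AddCommGroup V] [Module ℂ V] {ρ : OspRep (d + 1) r (n + 1) V}

theorem isIrrepOfHighestWeight_standard_iff (hr : r ≤ 1) {k t : ℕ} (ht : t ≤ 1) (htd : t = 0 ∨ 1 ≤ d) (c : ℂ) :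
    ρ.IsIrrepOfHighestWeight (standardPosRoots (d + 1) r (n + 1)) (standardWeight (d + 1) (n + 1) c k t) ↔
      ρ.IsIrrepOfHighestWeight (reversedPosRoots (d + 1) r (n + 1)) (reversedWeight (d + 1) (n + 1) c k t) := by
  rw [isIrrepOfHighestWeight_iff (standard_represents hr), isIrrepOfHighestWeight_iff (reversed_represents hr)]
  exact and_congr_right fun h => (h.reversed_iff_standard hr (Nat.succ_pos n) ht htd c).symm

theorem DecomposesInto.standard (hr : r ≤ 1) {c : ℂ} {k₁ k₂ t₁ t₂ : ℕ} (ht₁ : t₁ ≤ 1) (ht₂ : t₂ ≤ 1)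
    (htd₁ : t₁ = 0 ∨ 1 ≤ d) (htd₂ : t₂ = 0 ∨ 1 ≤ d)
    (h : ρ.DecomposesInto (reversedPosRoots (d + 1) r (n + 1))
      ![reversedWeight (d + 1) (n + 1) c k₁ t₁, reversedWeight (d + 1) (n + 1) c k₂ t₂]) :
    ρ.DecomposesInto (standardPosRoots (d + 1) r (n + 1))
      ![standardWeight (d + 1) (n + 1) c k₁ t₁, standardWeight (d + 1) (n + 1) c k₂ t₂] := by
  obtain ⟨A, hA, hint, hi⟩ := h
  refine ⟨A, hA, hint, fun i => ?_⟩
  have h1 := hi i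
  fin_cases i
  · exact (isIrrepOfHighestWeight_standard_iff hr ht₁ htd₁ c).2 h1
  · exact (isIrrepOfHighestWeight_standard_iff hr ht₂ htd₂ c).2 h1

theorem IsIrredSub.isIrrepOfHighestWeight {d : ℕ} {ρ : OspRep d r n V} {ht : OspHeight d r n} {P : Set (OspWeight d n)}
    (hP : ht.Represents P) {lam mu : OspWeight d n} {A : Submodule ℂ V} (h : ρ.IsIrredSub ht lam A) (e : mu = lam) :
    ∃ h : ρ.IsSubrep A, (ρ.restrict A h).IsIrrepOfHighestWeight P mu := by
  subst e
  obtain ⟨hA, h1⟩ := h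
  exact ⟨hA, (isIrrepOfHighestWeight_iff hP).2 h1⟩

theorem decomposesInto_of_isIrredSub {d : ℕ} {ρ : OspRep d r n V} {ht : OspHeight d r n} {P : Set (OspWeight d n)}
    (hP : ht.Represents P) {lam₁ lam₂ mu₁ mu₂ : OspWeight d n}
    (h : ∃ A₁ A₂ : Submodule ℂ V, IsCompl A₁ A₂ ∧ ρ.IsIrredSub ht lam₁ A₁ ∧ ρ.IsIrredSub ht lam₂ A₂)
    (e₁ : mu₁ = lam₁) (e₂ : mu₂ = lam₂) : ρ.DecomposesInto P ![mu₁, mu₂] := by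
  obtain ⟨A₁, A₂, hA, i₁, i₂⟩ := h
  exact decomposesInto_two hA (i₁.isIrrepOfHighestWeight hP e₁) (i₂.isIrrepOfHighestWeight hP e₂)

/-- Tensor products with the spinor representation of `𝔬𝔰𝔭(2d+1|2n)`. -/
theorem decomposition_odd (d n : ℕ) {k : ℕ} (hk : 1 ≤ k) :
    OspTensorDecomposition.{u, v} 1 (reversedPosRoots (d + 1) 1 (n + 1)) (reversedWeight (d + 1) (n + 1) 1 0 0)
      (reversedWeight (d + 1) (n + 1) 0 k 0)
      ![reversedWeight (d + 1) (n + 1) 1 k 0, reversedWeight (d + 1) (n + 1) 1 (k - 1) 0] := by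
  intro V _ _ W _ _ ρ σ h1 h2
  have hP := reversed_represents (d := d + 1) (n := n + 1) le_rfl
  rw [isIrrepOfHighestWeight_iff hP, reversedWeight_eq d 1] at h1 h2
  obtain ⟨hρ, s, hs⟩ := h1
  obtain ⟨hσ, w, hw⟩ := h2
  simp only [one_smul, zero_smul, Nat.cast_zero, zero_add, add_zero, sub_zero] at hs hw
  set p := firstEps d 1 (n + 1) with hp
  set z : OspIdx (d + 1) 1 (n + 1) := .inl (.inr 0) with hz
  have hz0 : (wt z : OspWeight (d + 1) (n + 1)) = 0 := rfl
  have e : vacWeight (d + 1) (n + 1) + (wt (dual p) - wt z) + (k : ℂ) • wt p =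
      vacWeight (d + 1) (n + 1) + (k : ℂ) • wt p - wt p := by rw [wt_dual, hz0]; abel
  have hk0 : (k : ℂ) ≠ 0 := by exact_mod_cast (show k ≠ 0 by omega)
  refine decomposesInto_of_isIrredSub hP (SpinorFacts.tensor_decompose hρ hσ (reversed_injective le_rfl)
    reversed_lt_of_byEps_lt (c := dual p) (e := z) ?_
    (spinorFacts_odd le_rfl hρ (reversed_injective le_rfl) reversed_pos hs (z := z) (p := p) rfl trivial rfl
      byEps_firstEps byEps_of_ne) hs hw (ext_smul_wt_firstEps _) ?_ ?_ ?_ ?_ ?_) ?_ (.trans ?_ e.symm)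
  · rfl
  · rw [e]
    refine casimir_sub_firstEps (k := k) (by omega) ?_
    rw [ext_add, ext_smul, ext_wt]
    simp [OspWeight.ext, vacWeight, firstEps, dual, hp]
  · rw [map_dual]
    have := reversed_pos p trivial
    rw [show reversed (d + 1) 1 (n + 1) z = 0 from rfl]; omega
  · rw [dual_dual]; simp [hz, hp, firstEps]
  · rw [ext_smul_wt_firstEps, ext_smul_wt_firstEps]
    simpa [hz, hp, firstEps, byEps, ofPos, superSign, dual] using hk0
  · rw [ext_dual, superSign_dual]
    norm_num [OspWeight.ext, vacWeight, firstEps, superSign, hp, hz]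
  all_goals rw [reversedWeight_eq d 1]; push_cast [Nat.cast_sub hk]; module

/-- Tensor products with the spinor representation of `𝔬𝔰𝔭(2d|2n)` that contains the vacuum. -/
theorem decomposition_even (d n : ℕ) {k : ℕ} (hk : 1 ≤ k) (hkd : k + d ≠ n + 1) :
    OspTensorDecomposition.{u, v} 0 (reversedPosRoots (d + 1) 0 (n + 1)) (reversedWeight (d + 1) (n + 1) 1 0 0)
      (reversedWeight (d + 1) (n + 1) 0 k 0)
      ![reversedWeight (d + 1) (n + 1) 1 k 0, reversedWeight (d + 1) (n + 1) 1 (k - 1) 1] := by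
  intro V _ _ W _ _ ρ σ h1 h2
  have hP := reversed_represents (d := d + 1) (n := n + 1) zero_le_one
  rw [isIrrepOfHighestWeight_iff hP, reversedWeight_eq d 0] at h1 h2
  obtain ⟨hρ, s, hs⟩ := h1
  obtain ⟨hσ, w, hw⟩ := h2
  simp only [one_smul, zero_smul, Nat.cast_zero, zero_add, add_zero, sub_zero] at hs hw
  set p := firstEps d 0 (n + 1) with hp
  set q := lastDel (d + 1) 0 n with hq
  have hnz : ∀ a : OspIdx (d + 1) 0 (n + 1), dual a ≠ a := by
    rintro (((a | a) | a) | a | a) <;> first | exact a.elim0 | simp [dual]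
  have e : vacWeight (d + 1) (n + 1) + (wt (dual p) - wt q) + (k : ℂ) • wt p =
      vacWeight (d + 1) (n + 1) + (k : ℂ) • wt p - wt p - wt q := by rw [wt_dual]; abel
  have hk0 : (k : ℂ) ≠ 0 := by exact_mod_cast (show k ≠ 0 by omega)
  refine decomposesInto_of_isIrredSub hP (SpinorFacts.tensor_decompose hρ hσ (reversed_injective zero_le_one)
    reversed_lt_of_byEps_lt (c := dual p) (e := q) ?_
    (spinorFacts_even zero_le_one hρ hnz (reversed_injective zero_le_one) reversed_pos hs (p := p) (q := q) trivial
      rfl trivial rfl reversed_lastDel byEps_firstEps byEps_of_ne) hs hw (ext_smul_wt_firstEps _) ?_ ?_ ?_ ?_ ?_) ?_ (.trans ?_ e.symm)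
  · rfl
  · rw [e, casimir_sub_lastDel]
    · refine casimir_sub_firstEps (k := k) (by omega) ?_
      rw [ext_add, ext_smul, ext_wt]
      simp [OspWeight.ext, vacWeight, firstEps, dual, hp]
    · rw [ext_sub, ext_add, ext_smul, ext_wt]
      simp [OspWeight.ext, vacWeight, firstEps, lastDel, dual, hp]
  · rw [map_dual]
    have h1 := reversed_pos p trivial
    have h2 := reversed_pos q trivial
    omega
  · rw [dual_dual]; simp [hq, hp, firstEps, lastDel]
  · rw [ext_smul_wt_firstEps, ext_smul_wt_firstEps]
    simpa [hq, hp, firstEps, lastDel, byEps, ofPos, superSign, dual] using hk0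
  · rw [ext_dual, superSign_dual]
    norm_num [OspWeight.ext, vacWeight, firstEps, lastDel, superSign, hp, hq]
  all_goals rw [reversedWeight_eq d 0]; push_cast [Nat.cast_sub hk]; module

/-- Tensor products with the other spinor representation of `𝔬𝔰𝔭(2d|2n)`. -/
theorem decomposition_even_neg (d n : ℕ) {k : ℕ} (hk : 1 ≤ k) (hkd : k + d ≠ n + 1) :
    OspTensorDecomposition.{u, v} 0 (reversedPosRoots (d + 1) 0 (n + 1)) (reversedWeight (d + 1) (n + 1) 1 0 1)
      (reversedWeight (d + 1) (n + 1) 0 k 0)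
      ![reversedWeight (d + 1) (n + 1) 1 k 1, reversedWeight (d + 1) (n + 1) 1 (k - 1) 0] := by
  intro V _ _ W _ _ ρ σ h1 h2
  have hP := reversed_represents (d := d + 1) (n := n + 1) zero_le_one
  rw [isIrrepOfHighestWeight_iff hP, reversedWeight_eq d 0] at h1 h2
  obtain ⟨hρ, s, hs⟩ := h1
  obtain ⟨hσ, w, hw⟩ := h2
  simp only [one_smul, zero_smul, Nat.cast_zero, Nat.cast_one, zero_add, add_zero, sub_zero] at hs hw
  set p := firstEps d 0 (n + 1) with hp
  set q := lastDel (d + 1) 0 n with hq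
  have hnz : ∀ a : OspIdx (d + 1) 0 (n + 1), dual a ≠ a := by
    rintro (((a | a) | a) | a | a) <;> first | exact a.elim0 | simp [dual]
  have e1 : vacWeight (d + 1) (n + 1) - wt q + (k : ℂ) • wt p =
      vacWeight (d + 1) (n + 1) + (k : ℂ) • wt p - wt q := by abel
  have e : vacWeight (d + 1) (n + 1) - wt q + (wt (dual p) - wt (dual q)) + (k : ℂ) • wt p =
      vacWeight (d + 1) (n + 1) + (k : ℂ) • wt p - wt p := by rw [wt_dual, wt_dual]; abel
  have hk0 : (k : ℂ) ≠ 0 := by exact_mod_cast (show k ≠ 0 by omega)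
  refine decomposesInto_of_isIrredSub hP (SpinorFacts.tensor_decompose hρ hσ (reversed_injective zero_le_one)
    reversed_lt_of_byEps_lt (c := dual p) (e := q) ?_
    (spinorFacts_even_neg zero_le_one hρ hnz (reversed_injective zero_le_one) reversed_pos (p := p) (q := q) trivial
      rfl trivial rfl reversed_lastDel hs byEps_firstEps byEps_of_ne) hs hw (ext_smul_wt_firstEps _) ?_ ?_ ?_ ?_ ?_) ?_ (.trans ?_ e.symm)
  · rfl
  · rw [e, e1, casimir_sub_lastDel]
    · refine casimir_sub_firstEps (k := k) (by omega) ?_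
      rw [ext_add, ext_smul, ext_wt]
      simp [OspWeight.ext, vacWeight, firstEps, dual, hp]
    · rw [ext_add, ext_smul, ext_wt]
      simp [OspWeight.ext, vacWeight, firstEps, lastDel, dual, hp]
  · rw [map_dual]
    have h1 := reversed_pos p trivial
    have h2 := reversed_pos q trivial
    omega
  · rw [dual_dual]; simp [hq, hp, firstEps, lastDel]
  · rw [ext_smul_wt_firstEps, ext_smul_wt_firstEps]
    simpa [hq, hp, firstEps, lastDel, byEps, ofPos, superSign, dual] using hk0
  · have e1 : ext (vacWeight (d + 1) (n + 1) - wt q) p = 1 / 2 := by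
      rw [ext_sub, ext_wt]; simp [OspWeight.ext, vacWeight, firstEps, lastDel, hp, hq, dual]
    have e2 : ext (vacWeight (d + 1) (n + 1) - wt q) q = -3 / 2 := by
      rw [ext_sub, ext_wt]; simp [OspWeight.ext, vacWeight, lastDel, hq, dual]; norm_num
    rw [ext_dual, superSign_dual, e1, e2]
    norm_num [firstEps, lastDel, superSign, hp, hq]
  all_goals rw [reversedWeight_eq d 0]; push_cast [Nat.cast_sub hk]; module

theorem decomposition_standard (hr : r ≤ 1) {k t t₁ t₂ : ℕ} (ht : t ≤ 1) (ht₁ : t₁ ≤ 1) (ht₂ : t₂ ≤ 1)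
    (htd : t = 0 ∨ 1 ≤ d) (htd₁ : t₁ = 0 ∨ 1 ≤ d) (htd₂ : t₂ = 0 ∨ 1 ≤ d) {k₁ k₂ : ℕ}
    (h : OspTensorDecomposition.{u, v} r (reversedPosRoots (d + 1) r (n + 1)) (reversedWeight (d + 1) (n + 1) 1 0 t)
      (reversedWeight (d + 1) (n + 1) 0 k 0)
      ![reversedWeight (d + 1) (n + 1) 1 k₁ t₁, reversedWeight (d + 1) (n + 1) 1 k₂ t₂]) :
    OspTensorDecomposition.{u, v} r (standardPosRoots (d + 1) r (n + 1)) (standardWeight (d + 1) (n + 1) 1 0 t)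
      (standardWeight (d + 1) (n + 1) 0 k 0)
      ![standardWeight (d + 1) (n + 1) 1 k₁ t₁, standardWeight (d + 1) (n + 1) 1 k₂ t₂] :=
  fun V _ _ W _ _ ρ σ h1 h2 => (h V W ρ σ ((isIrrepOfHighestWeight_standard_iff hr ht htd 1).1 h1)
    ((isIrrepOfHighestWeight_standard_iff hr zero_le_one (Or.inl rfl) 0).1 h2)).standard hr ht₁ ht₂ htd₁ htd₂

theorem standardWeight_nu {d n j : ℕ} (hj : j ≤ n) : standardWeight d n 0 j 0 = nu j := by
  funext x
  rcases x with x | x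
  · rw [standardWeight_inl, nu_inl]; simp [min_eq_right hj]
  · rw [standardWeight_inr, nu_inr]; simp [min_eq_right hj]

theorem standardWeight_eps_add_nu {d n : ℕ} (l : ℕ) : standardWeight d n 0 (n + l) 0 = (l : ℂ) • eps 1 + nu n := by
  funext x
  rcases x with x | x
  · rw [standardWeight_inl, Pi.add_apply, nu_inl]; simp [eps]
  · rw [standardWeight_inr, Pi.add_apply, nu_inr]; simp [eps]

theorem standardWeight_nu_omegaLast {d n j : ℕ} (hj : j ≤ n) :
    standardWeight d n 1 j 0 = nu j + omegaLast d n - (1 / 2 : ℂ) • nu n := by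
  funext x
  rcases x with x | x <;> simp only [Pi.add_apply, Pi.sub_apply, Pi.smul_apply]
  · rw [standardWeight_inl, nu_inl, omegaLast_inl, nu_inl]; simp [min_eq_right hj]
  · rw [standardWeight_inr, nu_inr, omegaLast_inr, nu_inr]; simp [min_eq_right hj]; ring

theorem standardWeight_nu_omegaPrev {d n j : ℕ} (hj : j ≤ n) :
    standardWeight d n 1 j 1 = nu j + omegaPrev d n - (1 / 2 : ℂ) • nu n := by
  funext x
  rcases x with x | x <;> simp only [Pi.add_apply, Pi.sub_apply, Pi.smul_apply]
  · rw [standardWeight_inl, nu_inl, omegaPrev_inl, nu_inl]; simp [min_eq_right hj]; ring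
  · rw [standardWeight_inr, nu_inr, omegaPrev_inr, nu_inr]; simp [min_eq_right hj]; ring

theorem standardWeight_eps_omegaLast {d n l : ℕ} :
    standardWeight d n 1 (n + l) 0 = (l : ℂ) • eps 1 + omegaLast d n + (1 / 2 : ℂ) • nu n := by
  funext x
  rcases x with x | x <;> simp only [Pi.add_apply, Pi.smul_apply]
  · rw [standardWeight_inl, omegaLast_inl, nu_inl]; simp [eps]; ring
  · rw [standardWeight_inr, omegaLast_inr, nu_inr]; simp [eps]; ring

theorem standardWeight_eps_omegaPrev {d n l : ℕ} :
    standardWeight d n 1 (n + l) 1 = (l : ℂ) • eps 1 + omegaPrev d n + (1 / 2 : ℂ) • nu n := by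
  funext x
  rcases x with x | x <;> simp only [Pi.add_apply, Pi.smul_apply]
  · rw [standardWeight_inl, omegaPrev_inl, nu_inl]; simp [eps]; ring
  · rw [standardWeight_inr, omegaPrev_inr, nu_inr]; simp [eps]; ring

theorem reversedWeight_eps {d n k : ℕ} : reversedWeight d n 0 k 0 = (k : ℂ) • eps 1 := by
  funext x
  rcases x with x | x
  · rw [reversedWeight_inl]; simp [eps]
  · rw [reversedWeight_inr]; simp [eps]

theorem reversedWeight_eps_sub_nu {n k : ℕ} :
    reversedWeight 1 n 1 k 0 = ((k : ℂ) + 1 / 2) • eps 1 - (1 / 2 : ℂ) • nu n := by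
  funext x
  rcases x with x | x <;> simp only [Pi.sub_apply, Pi.smul_apply]
  · rw [reversedWeight_inl, nu_inl]; simp [eps]; ring
  · rw [reversedWeight_inr, nu_inr]; simp [eps]; ring

theorem reversedWeight_eps_sub_nu_prev {n k : ℕ} :
    reversedWeight 1 n 1 k 1 = ((k : ℂ) + 1 / 2) • eps 1 + nu (n - 1) - (3 / 2 : ℂ) • nu n := by
  funext x
  rcases x with x | x <;> simp only [Pi.add_apply, Pi.sub_apply, Pi.smul_apply]
  · rw [reversedWeight_inl, nu_inl, nu_inl]; simp [eps]; ring
  · rw [reversedWeight_inr, nu_inr, nu_inr]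
    have := x.2
    by_cases h : (x : ℕ) + 1 = n
    · rw [if_pos h, if_neg (by omega), if_pos this]; simp [eps]; norm_num
    · rw [if_neg h, if_pos (by omega), if_pos this]; simp [eps]; norm_num

end OspRep

namespace OspRep

variable {d r n : ℕ} {V : Type*} [AddCommGroup V] [Module ℂ V] {ρ : OspRep d r n V}
  {W : Type*} [AddCommGroup W] [Module ℂ W] {σ : OspRep d r n W}

/-- Root vectors without common indices commute in the super sense. -/
theorem root_comm {a b c e : OspIdx d r n} (h1 : b ≠ c) (h2 : c ≠ dual a) (h3 : e ≠ a) (h4 : e ≠ dual b) (v : V) :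
    ρ.root a b (ρ.root c e v) = commSign a b c e • ρ.root c e (ρ.root a b v) := by
  rw [root_root, ρ.act_eq_zero_of_root, zero_add]
  intro i j hij
  obtain ⟨k, ⟨h5, h6⟩ | ⟨h5, h6⟩⟩ := Osp.bracket_apply_ne hij <;> exfalso <;>
  rcases rootVec_apply_ne h5 with ⟨h7, h8⟩ | ⟨h7, h8⟩ <;>
  rcases rootVec_apply_ne h6 with ⟨h9, h10⟩ | ⟨h9, h10⟩ <;> rw [h8] at h9
  · exact h1 h9
  · exact h4 (by rw [h9, dual_dual])
  · exact h2 h9.symm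
  · exact h3 (dual_injective h9.symm)
  · exact h3 h9
  · exact h4 h9
  · exact h2 (by rw [← h9, dual_dual])
  · exact h1 (dual_injective h9.symm)

theorem root_root_reverse {lam : OspWeight d n} {v : V} (hv : ρ.IsWeightVec lam v) {a b : OspIdx d r n}
    (hab : a ≠ b) : ρ.root a b (ρ.root b a v) = ((1 - if b = dual a then superSign a else 0) *
      (ext lam a - superSign a * superSign b * ext lam b)) • v + commSign a b b a • ρ.root b a (ρ.root a b v) := by
  have e1 : ρ.act (rootVec a a) v = ext lam a • v := hv a
  have e2 : ρ.act (rootVec b b) v = ext lam b • v := hv b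
  rw [root_root, Osp.bracket_rootVec_swap hab]
  simp only [map_smul, LinearMap.smul_apply, map_sub, LinearMap.sub_apply, e1, e2, smul_smul,
    ← sub_smul]

/-- The commutator of root vectors whose first index pair is the only one to match. -/
theorem root_root_of_dual {a b c : OspIdx d r n} {e : OspIdx d r n} (he : e ≠ a) (he' : e ≠ dual b)
    (hbc : b ≠ c) (hc : c = dual a) (v : V) :
    ρ.root a b (ρ.root c e v) = -reflectSign (dual b) c • ρ.root (dual b) e v
      + commSign a b c e • ρ.root c e (ρ.root a b v) := by
  subst hc
  rw [root_root, Osp.bracket_rootVec]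
  congr 1
  have h1 : ∀ i, (rootVec a b).1 i (dual a) = if i = dual b then -reflectSign (dual b) (dual a) else 0 := by
    intro i
    rw [Osp.rootVec_apply, if_neg (fun h => hbc h.2.symm), dual_dual]
    by_cases h : i = dual b
    · subst h; simp
    · rw [if_neg h, if_neg (fun h' => h (by rw [← h'.2, dual_dual]))]; simp
  have h2 : ∀ i, (rootVec a b).1 e i = 0 := by
    intro i
    rw [Osp.rootVec_apply, if_neg (fun h => he h.1), if_neg (fun h => he' (by rw [← h.2, dual_dual]))]; simp
  simp only [h1, h2, mul_zero, zero_smul, Finset.sum_const_zero, sub_zero, ite_smul, sum_ite_eq',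
    mem_univ, if_true]
  rw [map_smul]
  rfl

theorem IsWeightVec.eq_zero_of_ne {lam mu : OspWeight d n} {v : V} (h : ρ.IsWeightVec lam v) (h' : ρ.IsWeightVec mu v)
    {a : OspIdx d r n} (hne : ext lam a ≠ ext mu a) : v = 0 := by
  have := (h a).symm.trans (h' a)
  rw [← sub_eq_zero, ← sub_smul] at this
  exact (smul_eq_zero.1 this).resolve_left (sub_ne_zero.2 hne)

/-- Singular vectors of an irreducible representation have the highest weight. -/
theorem IsIrreducible.eq_zero_of_isSing (hρ : ρ.IsIrreducible) {ht : OspHeight d r n}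
    (hht : ∀ a b, ht a = ht b → a = b) {lam mu : OspWeight d n} {v x : V} (hv : ρ.IsHWVec ht lam v)
    (hx : ρ.IsSing ht x) (hxw : ρ.IsWeightVec mu x) {a : OspIdx d r n} (hne : ext lam a ≠ ext mu a) : x = 0 := by
  obtain ⟨t, rfl⟩ := mem_span_singleton.1 ((hρ.hw hht hv).2 x hx)
  exact (hv.weight.smul t).eq_zero_of_ne hxw hne

/-- The top part of a subrepresentation generated by top vectors. -/
theorem mem_of_mem_gen_of_mem_eig {g : OspHeight d r n} {c : ℂ} {T : Submodule ℂ V} (hT : T ≤ ρ.eig g c)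
    (hp : ∀ v ∈ T, ρ.parity v ∈ T) (h0 : ∀ a b, g a = g b → ∀ v ∈ T, ρ.root a b v ∈ T)
    (hpos : ∀ a b, g b < g a → ∀ v ∈ T, ρ.root a b v = 0) {x : V} (hx : x ∈ ρ.gen T) (hxc : x ∈ ρ.eig g c) :
    x ∈ T := by
  obtain ⟨y, hy, z, hz, rfl⟩ := mem_sup.1 (ρ.gen_le_sup_below hT hp h0 hpos hx)
  have h : z = 0 := by
    have h1 : z ∈ ρ.eig g c := ((ρ.eig g c).add_mem_iff_right (hT hy)).1 hxc
    simpa using (ρ.eig_disjoint_below g c).le_bot ⟨h1, hz⟩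
  rwa [h, add_zero]

/-- In a representation generated by a vector singular for a grading, all vectors of the top degree are. -/
theorem isSing_of_mem_gen {g : OspHeight d r n} {c : ℂ} {v : V} (hv : ρ.IsSing g v) (hvc : v ∈ ρ.eig g c) {x : V}
    (hx : x ∈ ρ.gen {v}) (hxc : x ∈ ρ.eig g c) : ρ.IsSing g x := by
  have h := mem_of_mem_gen_of_mem_eig (T := ρ.sing g ⊓ ρ.eig g c) inf_le_right
    (fun v hv => ⟨ρ.parity_mem_sing hv.1, ρ.parity_mem_eig hv.2⟩) (fun a b hab v hv => ?_)
    (fun a b hab v hv => hv.1 a b hab) (x := x) (ρ.gen_mono (singleton_subset_iff.2 (show v ∈ ρ.sing g ⊓ ρ.eig g c from ⟨hv, hvc⟩)) hx) hxc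
  · exact h.1
  · have h1 := ρ.root_mem_eig hv.2 a b
    rw [hab, sub_self, add_zero] at h1
    refine ⟨ρ.act_mem_sing hv.1 (X := rootVec a b) fun i j hij => ?_, h1⟩
    have := Osp.rootVec_degree g hij
    omega

theorem mem_below_of_mem_eig {g h : OspHeight d r n} {c c' : ℂ} {lam : OspWeight d n} {w : V}
    (hw : ρ.IsWeightVec lam w) (htop : (ℂ ∙ w) ⊔ ρ.below g c = ⊤) {x : V} (hx : x ∈ ρ.eig h c')
    (hc : c' ≠ lam.eval (grad h).1) : x ∈ ρ.below g c := by
  have hx' : x ∈ (ℂ ∙ w) ⊔ ρ.below g c := by rw [htop]; trivial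
  obtain ⟨y, hy, z, hz, rfl⟩ := mem_sup.1 hx'
  obtain ⟨t, rfl⟩ := mem_span_singleton.1 hy
  have hstab : ρ.act (grad h) z ∈ ρ.below g c :=
    ρ.act_mem_of_root_mem fun a b hab => ρ.root_mem_below (grad_apply_ne a b hab) hz
  have h1 := (ρ.mem_eig).1 hx
  rw [map_add, map_smul, hw.act (grad_isCartan h)] at h1
  have h2 : (c' - lam.eval (grad h).1) • (t • w + z) ∈ ρ.below g c := by
    rw [sub_smul, ← h1]
    have : t • lam.eval (grad h).1 • w + ρ.act (grad h) z - lam.eval (grad h).1 • (t • w + z)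
      = ρ.act (grad h) z - lam.eval (grad h).1 • z := by module
    rw [this]
    exact sub_mem hstab (smul_mem _ _ hz)
  exact ((ρ.below g c).smul_mem_iff (sub_ne_zero.2 hc)).1 h2

theorem root_z_comm (hr : r ≤ 1) (hρ : ρ.IsIrreducible) {ht : OspHeight d r n}
    (hht : ∀ a b, ht a = ht b → a = b) (hpos : ∀ a, IsPos a → 0 < ht a) {s : V}
    (hs : ρ.IsHWVec ht (vacWeight d n) s) {z p q : OspIdx d r n} (hz : dual z = z) (hp : IsPos p) (hq : IsPos q)
    (hps : superSign p = -1) (hqs : superSign q = -1) (v : V) :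
    ρ.root (dual p) z (ρ.root (dual q) z v) = ρ.root (dual q) z (ρ.root (dual p) z v) := by
  obtain ⟨O, φ, -, hinj, hroot, -⟩ := exists_oscillator_odd hr hρ hht hpos hs hz
  have hne : ∀ {a : OspIdx d r n}, superSign a = -1 → dual a ≠ z := by
    rintro a ha rfl
    rw [dual_dual] at hz
    rcases a with ((a | a) | a) | a | a <;> simp [dual, superSign] at hz ha
    all_goals norm_num at ha
  have hzs : superSign z = 1 := by
    rcases z with ((a | a) | a) | a | a <;> simp [dual, superSign] at hz ⊢
  apply hinj
  simp only [hroot, O.rep_root_of_ne (hne hps), O.rep_root_of_ne (hne hqs), map_smul, hz]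
  congr 2
  have hc : ∀ {a : OspIdx d r n}, superSign a = -1 → ∀ x, O.c z (O.c (dual a) x) = O.c (dual a) (O.c z x) := by
    intro a ha x
    rw [O.c_c_of_ne (fun h => hne ha (by rw [h, hz]))]
    norm_num [cliffSign, hzs, ha]
  rw [hc hqs, hc hps, c_c_dual O hp hq]
  norm_num [cliffSign, hps, hqs]

theorem sum_eq_zero_of_eigen {f : V →ₗ[ℂ] V} {m : ℕ → ℂ} (hm : Function.Injective m) {s : Finset ℕ} {x : ℕ → V}
    (hx : ∀ i, f (x i) = m i • x i) (h : ∑ i ∈ s, x i = 0) : ∀ i ∈ s, x i = 0 := by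
  have h1 := (Module.End.eigenspaces_iSupIndep f).comp hm
  rw [iSupIndep_iff_finsetSum_eq_zero_imp_eq_zero] at h1
  exact h1 s x (fun i _ => Module.End.mem_eigenspace_iff.2 (hx i)) h

theorem IsWeightVec.iterate {lam : OspWeight d n} {s : V} (hs : ρ.IsWeightVec lam s) (a b : OspIdx d r n) (i : ℕ) :
    ρ.IsWeightVec (lam + (i : ℂ) • (wt a - wt b)) ((ρ.root a b)^[i] s) := by
  induction i with
  | zero => simpa using hs
  | succ i ih =>
    rw [iterate_succ_apply']
    have := ih.root a b
    rw [add_assoc] at this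
    convert this using 2
    push_cast; module

theorem wt_eq_zero {z : OspIdx d r n} (hz : dual z = z) : (wt z : OspWeight d n) = 0 := by
  rcases z with ((a | a) | a) | a | a <;> simp [dual] at hz
  rfl

theorem ne_of_dual_eq_self {p z : OspIdx d r n} (hp : IsPos p) (hz : dual z = z) : z ≠ p ∧ z ≠ dual p :=
  ⟨fun h => hp.dual_ne hp (by rw [← h, hz]), fun h => hp.dual_ne hp (by rw [← h, ← hz, h, dual_dual])⟩

theorem root_iterate_eq_zero {p q z : OspIdx d r n} (hp : IsPos p) (hq : IsPos q) (hz : dual z = z) (hpq : p ≠ q)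
    {s : V} (hs : ρ.root q p s = 0) (i : ℕ) : ρ.root q p ((ρ.root (dual p) z)^[i] s) = 0 := by
  induction i with
  | zero => exact hs
  | succ i ih =>
    rw [iterate_succ_apply', root_comm, ih, map_zero, smul_zero]
    · exact fun h => hp.dual_ne hp h.symm
    · rwa [ne_eq, dual_inj]
    · exact (ne_of_dual_eq_self hq hz).1
    · exact (ne_of_dual_eq_self hp hz).2

theorem root_quadruple_iterate {p q z : OspIdx d r n} (hps : superSign p = -1) (hqs : superSign q = -1) (hp : IsPos p)
    (hq : IsPos q) (hz : dual z = z) (hpq : p ≠ q) {lam : OspWeight d n} {s : V} (hsw : ρ.IsWeightVec lam s)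
    (hlam : ext lam p = ext lam q) (hs : ρ.root q p s = 0) (i : ℕ) :
    ρ.root q p (ρ.root q p (ρ.root p q (ρ.root p q ((ρ.root (dual p) z)^[i] s)))) =
      (2 * i * (i - 1) : ℂ) • (ρ.root (dual p) z)^[i] s := by
  have hxw := hsw.iterate (dual p) z i
  have hx0 := root_iterate_eq_zero hp hq hz hpq hs i
  rw [wt_eq_zero hz, wt_dual, sub_zero] at hxw
  set x := (ρ.root (dual p) z)^[i] s with hx
  have hqp' : q ≠ dual p := fun h => hp.dual_ne hq h.symm
  have hpq' : p ≠ dual q := fun h => hq.dual_ne hp h.symm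
  have hpp' : p ≠ dual p := fun h => hp.dual_ne hp h.symm
  have hqq' : q ≠ dual q := fun h => hq.dual_ne hq h.symm
  have hc : commSign q p p q = 1 := by norm_num [commSign, hps, hqs]
  have e1 := root_root_reverse hxw (Ne.symm hpq)
  have e2 := root_root_reverse (hxw.root p q) (Ne.symm hpq)
  rw [hx0, map_zero, smul_zero, add_zero, if_neg hpq', sub_zero, one_mul, hps, hqs] at e1
  rw [e1, if_neg hpq', sub_zero, one_mul, hc, one_smul, map_smul, ← add_smul, hps, hqs] at e2
  rw [e2, map_smul, e1, smul_smul]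
  congr 1
  simp only [ext_add, ext_smul, ext_sub, ext_neg, ext_wt, hlam, if_true, if_neg hpq, if_neg hpq.symm, if_neg hqp', if_neg hpq',
    if_neg hpp', if_neg hqq']
  ring

/-- The vectors of the string generated by the highest weight vector of a spinor representation which are
killed by the square of an even raising operator. -/
theorem mem_span_pair_of_root_root_eq_zero {p q z : OspIdx d r n} (hps : superSign p = -1) (hqs : superSign q = -1)
    (hp : IsPos p) (hq : IsPos q) (hz : dual z = z) (hpq : p ≠ q) {lam : OspWeight d n} {s : V}
    (hsw : ρ.IsWeightVec lam s) (hlam : ext lam p = ext lam q) (hs : ρ.root q p s = 0) {y : V}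
    (hy : y ∈ span ℂ (Set.range fun i => (ρ.root (dual p) z)^[i] s))
    (hy0 : ρ.root p q (ρ.root p q y) = 0) : y ∈ span ℂ {s, ρ.root (dual p) z s} := by
  have hpp' : p ≠ dual p := fun h => hp.dual_ne hp h.symm
  obtain ⟨c, rfl⟩ := Finsupp.mem_span_range_iff_exists_finsupp.1 hy
  have h := congrArg (fun v => ρ.root q p (ρ.root q p v)) hy0
  simp only [map_zero, Finsupp.sum, map_sum, map_smul, root_quadruple_iterate hps hqs hp hq hz hpq hsw hlam hs] at h
  have h1 := sum_eq_zero_of_eigen (f := ρ.root p p) (m := fun i : ℕ => ext lam p - i)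
    (fun i j h => by simpa using h) (fun i => ?_) h
  · refine Submodule.sum_mem _ fun i hi => smul_mem _ _ ?_
    have h2 := h1 i hi
    rw [smul_smul] at h2
    rcases smul_eq_zero.1 h2 with h3 | h3
    · rcases mul_eq_zero.1 h3 with h4 | h4
      · exact absurd h4 (Finsupp.mem_support_iff.1 hi)
      · rcases mul_eq_zero.1 h4 with h5 | h5
        · have : i = 0 := by simpa using h5
          subst this
          exact subset_span (Or.inl rfl)
        · have : i = 1 := by exact_mod_cast sub_eq_zero.1 h5
          subst this
          exact subset_span (Or.inr rfl)
    · simp only [h3, zero_mem]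
  · have h2 := hsw.iterate (dual p) z i p
    rw [wt_eq_zero hz, wt_dual, sub_zero, ext_add, ext_smul, ext_neg, ext_wt, if_pos rfl, if_neg hpp'] at h2
    rw [map_smul, map_smul, h2]
    module

/-- The string of the highest weight vector of a spinor representation is obtained from its first two vectors. -/
theorem iterate_mem_colon {p q z : OspIdx d r n} (hps : superSign p = -1) (hqs : superSign q = -1)
    (hp : IsPos p) (hq : IsPos q) (hz : dual z = z) (hpq : p ≠ q) {s : V} (hs : ρ.root q p s = 0)
    (hcomm : ∀ v, ρ.root (dual p) z (ρ.root (dual q) z v) = ρ.root (dual q) z (ρ.root (dual p) z v)) {w : W}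
    (hwp : σ.parity w = w ∨ σ.parity w = -w) (hw : σ.root (dual q) z w = 0) (hw2 : σ.root q p (σ.root q p w) = 0)
    {N : Submodule ℂ (V ⊗[ℂ] W)} (hN : (ρ.tensor σ).IsSubrep N) (h0 : s ∈ colon N w)
    (h1 : ρ.root (dual p) z s ∈ colon N w) (i : ℕ) : (ρ.root (dual p) z)^[i] s ∈ colon N w := by
  induction i using Nat.strong_induction_on with
  | _ i ih =>
    match i with
    | 0 => exact h0
    | 1 => exact h1
    | i + 2 =>
      set f := ρ.root q p with hf
      set A := ρ.root (dual p) z with hA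
      set B := ρ.root (dual q) z with hB
      set x := A^[i] s with hx
      have hx0 : f x = 0 := root_iterate_eq_zero hp hq hz hpq hs i
      have hx1 : f (A x) = 0 := by
        rw [hx, ← iterate_succ_apply' A]; exact root_iterate_eq_zero hp hq hz hpq hs (i + 1)
      have hx2 : f (A (A x)) = 0 := by
        rw [hx, ← iterate_succ_apply' A, ← iterate_succ_apply' A]
        exact root_iterate_eq_zero hp hq hz hpq hs (i + 2)
      obtain ⟨c, hc0, hc⟩ : ∃ c : ℂ, c ≠ 0 ∧ ∀ v, f (B v) = c • A v + B (f v) := by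
        refine ⟨-reflectSign (dual p) (dual q), ?_, fun v => ?_⟩
        · intro h
          have h' := reflectSign_dual (dual p) (dual q)
          rw [neg_eq_zero.1 h, zero_mul] at h'
          exact zero_ne_one h'
        · rw [hf, hB, root_root_of_dual (ne_of_dual_eq_self hq hz).1 (ne_of_dual_eq_self hp hz).2
            (fun h => hq.dual_ne hp h.symm) rfl, show commSign q p (dual q) z = 1 by norm_num [commSign, hps, hqs], one_smul]
      have hbraid : ∀ v, ρ.braid q p v = v := ρ.braid_of_eq_one (by rw [hps, hqs]; norm_num)
      have hft : ∀ (v : V) (y : W), (ρ.tensor σ).root q p (v ⊗ₜ y) = f v ⊗ₜ y + v ⊗ₜ σ.root q p y := by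
        intro v y; rw [root_tmul, hbraid]
      have hBmem : ∀ v ∈ colon N w, B v ∈ colon N w := fun v hv =>
        root_mem_colon σ hN hwp (by rw [hw]; exact zero_mem _) hv
      have m1 : B (B x) ⊗ₜ w ∈ N := hBmem _ (hBmem _ (ih i (by omega)))
      have m2 : B (A x) ⊗ₜ w ∈ N := hBmem _ (by
        rw [hx, ← iterate_succ_apply' A]; exact ih (i + 1) (by omega))
      have m3 := hN.2 (rootVec q p) _ (hN.2 (rootVec q p) _ m1)
      have m4 := hN.2 (rootVec q p) _ m2
      change (ρ.tensor σ).root q p ((ρ.tensor σ).root q p _) ∈ N at m3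
      change (ρ.tensor σ).root q p _ ∈ N at m4
      have e1 : f (B (B x)) = (2 * c) • B (A x) := by
        rw [hc, hc, hx0, map_zero, add_zero, map_smul, hcomm]; module
      have e2 : f (B (A x)) = c • A (A x) := by rw [hc, hx1, map_zero, add_zero]
      rw [hft, map_add, hft, hft, hw2, tmul_zero, add_zero, e1, map_smul, e2] at m3
      rw [hft, e2] at m4
      have m5 := N.sub_mem (N.smul_mem (4 * c) m4) m3
      rw [mem_colon, iterate_succ_apply', iterate_succ_apply']
      have e4 : (A (A x)) ⊗ₜ[ℂ] w = (2 * c ^ 2)⁻¹ • ((2 * c ^ 2) • (A (A x)) ⊗ₜ[ℂ] w) := by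
        rw [smul_smul, inv_mul_cancel₀ (by simpa using hc0), one_smul]
      rw [e4]
      refine N.smul_mem _ ?_
      convert m5 using 1
      simp only [← smul_tmul']
      module

end OspRep

namespace OspRep

theorem root_eq_zero_of_dual {d r n : ℕ} {W : Type*} [AddCommGroup W] [Module ℂ W] {σ : OspRep d r n W}
    {p q : OspIdx d r n} {v : W} (h : σ.root p q v = 0) : σ.root (dual q) (dual p) v = 0 := by
  rw [root_dual, h, smul_zero]

section AdjacentRoot

variable {d r n : ℕ} {W : Type*} [AddCommGroup W] [Module ℂ W] {σ : OspRep d r n W}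
  {ht g : OspHeight d r n} {p q : OspIdx d r n} {kap : OspWeight d n} {w : W}

/-- The action of the raising operator of an even root on a string of length two. -/
theorem root_root_of_string (hw : σ.IsHWVec ht kap w) (hlt : ht q < ht p) (hp : IsPos p) (hq : IsPos q)
    (hs : superSign p = superSign q) (hkap : ext kap p - ext kap q = 1) :
    σ.root p q (σ.root q p w) = w ∧ σ.root p q (σ.root q p (σ.root q p w)) = 0 := by
  have hpq : p ≠ q := by rintro rfl; exact lt_irrefl _ hlt
  have hpq' : q ≠ dual p := fun h => hp.dual_ne hq h.symm
  have hqp' : p ≠ dual q := fun h => hq.dual_ne hp h.symm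
  have hpp : p ≠ dual p := fun h => hp.dual_ne hp h.symm
  have hqq : q ≠ dual q := fun h => hq.dual_ne hq h.symm
  have hss : superSign p * superSign q = 1 := by rw [hs]; exact superSign_sq q
  have hc : commSign p q q p = 1 := by
    rw [commSign, mul_comm (superSign q), hss]; norm_num
  have e0 := hw.sing p q hlt
  have hfw := hw.weight.root q p
  have e1 := root_root_reverse hw.weight hpq
  have e2 := root_root_reverse hfw hpq
  rw [e0, map_zero, smul_zero, add_zero, if_neg hpq', sub_zero, one_mul, hss, one_mul, hkap, one_smul] at e1
  rw [e1, if_neg hpq', sub_zero, one_mul, hss, one_mul, hc, one_smul] at e2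
  refine ⟨e1, ?_⟩
  rw [e2]
  simp only [ext_add, ext_sub, ext_wt, if_true, if_neg hpq, if_neg hpq.symm, if_neg hpq', if_neg hqp', if_neg hpp,
    if_neg hqq]
  rw [show ext kap p + (0 - 0 - (1 - 0)) - (ext kap q + (1 - 0 - (0 - 0))) = -1 by linear_combination hkap]
  module

theorem root_root_eq_zero_of_adjacent (hσ : σ.IsIrreducible) (hht : ∀ a b, ht a = ht b → a = b)
    (hw : σ.IsHWVec ht kap w) (hgp : g p = g q) (hlt : ht q < ht p) (hgh : ∀ a b, g b < g a → ht b < ht a)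
    (hadj : ∀ a b, ht b < ht a → g b < g a ∨ (a = p ∧ b = q) ∨ a = dual q ∧ b = dual p) (hp : IsPos p) (hq : IsPos q)
    (hs : superSign p = superSign q) (hkap : ext kap p - ext kap q = 1) : σ.root q p (σ.root q p w) = 0 := by
  have hpq : p ≠ q := by rintro rfl; exact lt_irrefl _ hlt
  have hqp' : p ≠ dual q := fun h => hq.dual_ne hp h.symm
  have hpp : p ≠ dual p := fun h => hp.dual_ne hp h.symm
  obtain ⟨-, e3⟩ := root_root_of_string hw hlt hp hq hs hkap
  have hgs : σ.IsSing g (σ.root q p (σ.root q p w)) := by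
    refine isSing_of_mem_gen (fun a b hab => hw.sing a b (hgh a b hab)) (hw.weight.mem_eig g)
      (by rw [hσ.gen_eq_top hw.ne_zero]; trivial) ?_
    have := σ.root_mem_eig (σ.root_mem_eig (hw.weight.mem_eig g) q p) q p
    rwa [hgp, sub_self, add_zero, add_zero] at this
  refine hσ.eq_zero_of_isSing hht hw (fun a b hab => ?_) ((hw.weight.root q p).root q p) (a := p) ?_
  · rcases hadj a b hab with h | ⟨rfl, rfl⟩ | ⟨rfl, rfl⟩
    · exact hgs a b h
    · exact e3
    · exact root_eq_zero_of_dual e3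
  · simp only [ext_add, ext_sub, ext_wt, if_true, if_neg hpq, if_neg hqp', if_neg hpp]
    intro h
    have : (0 : ℂ) = -2 := by linear_combination h
    norm_num at this

theorem functional_root_root (hσ : σ.IsIrreducible) (hht : ∀ a b, ht a = ht b → a = b)
    (hw : σ.IsHWVec ht kap w) (hgp : g p = g q) (hlt : ht q < ht p) (hgh : ∀ a b, g b < g a → ht b < ht a)
    (hadj : ∀ a b, ht b < ht a → g b < g a ∨ (a = p ∧ b = q) ∨ a = dual q ∧ b = dual p) (hp : IsPos p) (hq : IsPos q)
    (hs : superSign p = superSign q) (hkap : ext kap p - ext kap q = 1) {h : OspHeight d r n} {c : ℂ}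
    (htop : (ℂ ∙ w) ⊔ σ.below h c = ⊤) {ξ : W →ₗ[ℂ] ℂ} (hξ : ∀ x ∈ σ.below h c, ξ x = 0) (x : W) :
    ξ (σ.root p q (σ.root p q x)) = 0 := by
  obtain ⟨e1, e3⟩ := root_root_of_string hw hlt hp hq hs hkap
  have e0 := hw.sing p q hlt
  have ef := root_root_eq_zero_of_adjacent hσ hht hw hgp hlt hgh hadj hp hq hs hkap
  set f := σ.root q p w with hf
  set T := span ℂ {w, f} with hT
  have hc0 : w ∈ σ.eig g (kap.eval (grad g).1) := hw.weight.mem_eig g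
  have hc1 : f ∈ σ.eig g (kap.eval (grad g).1) := by
    have := σ.root_mem_eig hc0 q p
    rwa [hgp, sub_self, add_zero] at this
  have hTe : T ≤ σ.eig g (kap.eval (grad g).1) := by
    refine span_le.2 ?_
    rintro _ (rfl | rfl) <;> assumption
  have hwT : w ∈ T := subset_span (Or.inl rfl)
  have hfT : f ∈ T := subset_span (Or.inr rfl)
  have hind : ∀ L : W →ₗ[ℂ] W, L w ∈ T → L f ∈ T → ∀ v ∈ T, L v ∈ T := by
    intro L h1 h2
    have : T ≤ T.comap L := span_le.2 (by rintro _ (rfl | rfl) <;> assumption)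
    exact this
  have hpair : ∀ a b, (a = p ∧ b = q) ∨ (a = q ∧ b = p) → ∀ v ∈ T, σ.root a b v ∈ T := by
    rintro a b (⟨rfl, rfl⟩ | ⟨rfl, rfl⟩) <;> refine hind _ ?_ ?_
    · rw [e0]; exact zero_mem _
    · rw [e1]; exact hwT
    · exact hfT
    · rw [ef]; exact zero_mem _
  have hpair' : ∀ a b, (a = dual q ∧ b = dual p) ∨ (a = dual p ∧ b = dual q) → ∀ v ∈ T, σ.root a b v ∈ T := by
    rintro a b (⟨rfl, rfl⟩ | ⟨rfl, rfl⟩) v hv <;> rw [root_dual] <;> refine smul_mem _ _ ?_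
    · exact hpair _ _ (Or.inl ⟨rfl, rfl⟩) v hv
    · exact hpair _ _ (Or.inr ⟨rfl, rfl⟩) v hv
  have hTtop : T ⊔ σ.below g (kap.eval (grad g).1) = ⊤ := by
    refine top_le_iff.1 (le_trans ?_ (σ.gen_le_sup_below hTe ?_ ?_ ?_))
    · rw [← hσ.gen_eq_top hw.ne_zero]
      exact σ.gen_mono (singleton_subset_iff.2 hwT)
    · refine hind _ ?_ ?_
      · rcases hw.parity with h | h <;> rw [h]
        · exact hwT
        · exact neg_mem hwT
      · rw [hf, parity_root]
        refine smul_mem _ _ ?_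
        rcases hw.parity with h | h <;> rw [h]
        · exact hfT
        · rw [map_neg]; exact neg_mem hfT
    · intro a b hab
      rcases lt_trichotomy (ht a) (ht b) with h | h | h
      · rcases hadj b a h with h' | ⟨rfl, rfl⟩ | ⟨rfl, rfl⟩
        · omega
        · exact hpair _ _ (Or.inr ⟨rfl, rfl⟩)
        · exact hpair' _ _ (Or.inr ⟨rfl, rfl⟩)
      · obtain rfl := hht a b h
        refine hind _ ?_ ?_
        · rw [hw.weight a]; exact smul_mem _ _ hwT
        · rw [(hw.weight.root q p) a]; exact smul_mem _ _ hfT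
      · rcases hadj a b h with h' | h' | h'
        · omega
        · exact hpair _ _ (Or.inl h')
        · exact hpair' _ _ (Or.inl h')
    · intro a b hab v hv
      exact isSing_of_mem_gen (fun a b hab => hw.sing a b (hgh a b hab)) hc0
        (by rw [hσ.gen_eq_top hw.ne_zero]; trivial) (hTe hv) a b hab
  have hx : x ∈ T ⊔ σ.below g (kap.eval (grad g).1) := by rw [hTtop]; trivial
  obtain ⟨y, hy, z, hz, rfl⟩ := mem_sup.1 hx
  have hy0 : σ.root p q (σ.root p q y) = 0 := by
    have : T ≤ ker (σ.root p q ∘ₗ σ.root p q) := by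
      refine span_le.2 ?_
      rintro _ (rfl | rfl) <;> simp [e0, e1]
    exact this hy
  rw [map_add, map_add, map_add, hy0, map_zero, zero_add]
  refine iSup_induction _ (motive := fun v => ξ (σ.root p q (σ.root p q v)) = 0) hz ?_ ?_ ?_
  · intro k y hy
    have h1 := σ.root_mem_eig (σ.root_mem_eig hy p q) p q
    rw [hgp, sub_self, add_zero, add_zero] at h1
    refine hξ _ (mem_below_of_mem_eig hw.weight htop h1 fun h => ?_)
    exact Nat.cast_add_one_ne_zero (R := ℂ) k (by linear_combination -h)
  · simp
  · intro x y hx hy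
    rw [map_add, map_add, map_add, hx, hy, add_zero]

end AdjacentRoot

section Bosonic

variable {n : ℕ} {V : Type*} [AddCommGroup V] [Module ℂ V] {ρ : OspRep 0 1 n V}
  {W : Type*} [AddCommGroup W] [Module ℂ W] {σ : OspRep 0 1 n W}

/-- The grading by the sum of the coefficients of `δ_1, …, δ_j`. -/
def _root_.OspHeight.byDel (n j : ℕ) : OspHeight 0 1 n := ofPos 1 (fun _ => 0) fun b => if (b : ℕ) < j then 1 else 0

theorem standard_injective (a b : OspIdx 0 1 n) (h : standard 0 1 n a = standard 0 1 n b) : a = b :=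
  ofPos_injective le_rfl (fun j => j.elim0) (fun i => by have := i.2; omega) (fun j => j.elim0)
    (fun i j h => Fin.ext (by omega)) (fun j => j.elim0) a b h

theorem standard_pos (a : OspIdx 0 1 n) (ha : IsPos a) : 0 < standard 0 1 n a :=
  ofPos_pos (fun j => j.elim0) (fun i => by have := i.2; omega) a ha

theorem casimirCoeff_del_standard (i : Fin n) : casimirCoeff (standard 0 1 n) (.inr (.inl i)) =
    -1 - 2 * (Finset.univ.filter fun i' : Fin n => (i : ℕ) < i').card := by
  have h := casimirCoeff_del (r := 1) (e := fun a : Fin 0 => ((0 : ℕ) : ℤ) - a) (f := fun b : Fin n => ((0 : ℕ) : ℤ) + n - b)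
    (fun j => j.elim0) (fun i => by have := i.2; omega) (fun j => j.elim0)
    (fun i j h => Fin.ext (by simp only at h; omega)) i
  refine h.trans ?_
  rw [Finset.univ_eq_empty (α := Fin 0), Finset.sum_empty, Finset.sum_boole]
  have : (Finset.univ.filter fun i' : Fin n => ((0 : ℕ) : ℤ) + n - i' < ((0 : ℕ) : ℤ) + n - i) =
      Finset.univ.filter fun i' : Fin n => (i : ℕ) < i' := Finset.filter_congr fun i' _ => by omega
  rw [this]
  push_cast
  ring

theorem standard_lt_of_byDel_lt {j : ℕ} (a b : OspIdx 0 1 n) (h : byDel n j b < byDel n j a) :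
    standard 0 1 n b < standard 0 1 n a := by
  rcases a with ((a | a) | a) | a | a <;> rcases b with ((b | b) | b) | b | b <;>
    first | exact a.elim0 | exact b.elim0 | simp only [byDel, ofPos, standard] at h ⊢
  all_goals
    have h1 := a.2
    have h2 := b.2
    push_cast
    try split_ifs at h
    all_goals omega

theorem ext_nu_byDel (j : ℕ) (a : OspIdx 0 1 n) : ext (nu j) a = (-1 : ℂ) * (superSign a * byDel n j a) := by
  rcases a with ((a | a) | a) | a | a
  · exact a.elim0
  · exact a.elim0
  · simp [OspWeight.ext, byDel, ofPos]
  · rw [show ext (nu j) (.inr (.inl a) : OspIdx 0 1 n) = nu j (.inr a) from rfl, nu_inr]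
    simp [superSign, byDel, ofPos]
  · rw [show ext (nu j) (.inr (.inr a) : OspIdx 0 1 n) = -nu j (.inr a) from rfl, nu_inr]
    simp only [superSign, byDel, ofPos]
    split_ifs <;> simp

theorem ext_vacWeight_byDel (a : OspIdx 0 1 n) : ext (vacWeight 0 n) a = (1 / 2 : ℂ) * (superSign a * byDel n n a) := by
  rcases a with ((a | a) | a) | a | a
  · exact a.elim0
  · exact a.elim0
  · simp [OspWeight.ext, byDel, ofPos]
  · simp [OspWeight.ext, vacWeight, superSign, byDel, ofPos]; norm_num
  · simp [OspWeight.ext, vacWeight, superSign, byDel, ofPos]; norm_num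

theorem casimir_sub_del {lam : OspWeight 0 n} (i : Fin n) (hlam : ext lam (.inr (.inl i) : OspIdx 0 1 n) = 1 / 2) :
    casimirValue (standard 0 1 n) lam ≠ casimirValue (standard 0 1 n) (lam - wt (.inr (.inl i) : OspIdx 0 1 n)) := by
  intro h
  have h1 := casimirValue_sub_wt (standard 0 1 n) lam (p := .inr (.inl i)) trivial
  rw [h, sub_self, casimirCoeff_dual, casimirCoeff_del_standard, hlam] at h1
  have h2 : ((1 + 2 * (Finset.univ.filter fun i' : Fin n => (i : ℕ) < i').card : ℕ) : ℂ) = (0 : ℕ) := by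
    push_cast
    linear_combination h1 / 2
  have := Nat.cast_injective h2
  omega

/-- The facts on the spinor representation of `𝔬𝔰𝔭(1|2n)` for the grading `byDel`. -/
theorem spinorFacts_byDel (hρ : ρ.IsIrreducible) {s : V} (hs : ρ.IsHWVec (standard 0 1 n) (vacWeight 0 n) s) (i : Fin n) :
    ρ.SpinorFacts (standard 0 1 n) (byDel n (i + 1))
      (Set.range fun k => (ρ.root (dual (.inr (.inl i))) (.inl (.inr 0)))^[k] s)
      (ρ.root (dual (.inr (.inl i))) (.inl (.inr 0)) s) := by
  refine spinorFacts_bosonic le_rfl hρ standard_injective standard_pos hs rfl trivial rfl (by simp [byDel, ofPos])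
    (fun a ha => ?_) (fun a ha h1 h2 => ?_)
  · rcases a with ((a | a) | a) | a | a <;> simp [IsPos] at ha
    · exact a.elim0
    · simp only [byDel, ofPos]; split_ifs <;> simp
  · rcases a with ((a | a) | a) | a | a <;> simp [IsPos] at ha
    · exact a.elim0
    · have h3 : (a : ℕ) ≠ i := fun h => h2 (by rw [Fin.ext h])
      simp only [byDel, ofPos] at h1
      split_ifs at h1 with h4
      · simp only [standard, ofPos]; omega
      · exact absurd h1 (by simp)

theorem tensor_spinor_osp_one (hρ : ρ.IsIrreducible) (hσ : σ.IsIrreducible) {s : V} {w : W}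
    (hs : ρ.IsHWVec (standard 0 1 n) (vacWeight 0 n) s) {i : Fin n} (hi : (i : ℕ) + 1 < n)
    (hw : σ.IsHWVec (standard 0 1 n) (nu ((i : ℕ) + 1)) w) :
    ∃ A₁ A₂ : Submodule ℂ (V ⊗[ℂ] W), IsCompl A₁ A₂ ∧
      (ρ.tensor σ).IsIrredSub (standard 0 1 n) (vacWeight 0 n + nu ((i : ℕ) + 1)) A₁ ∧
      (ρ.tensor σ).IsIrredSub (standard 0 1 n)
        (vacWeight 0 n + nu ((i : ℕ) + 1) - wt (.inr (.inl i) : OspIdx 0 1 n)) A₂ := by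
  set p : OspIdx 0 1 n := .inr (.inl i) with hp
  set q : OspIdx 0 1 n := .inr (.inl ⟨i + 1, hi⟩) with hq
  set z : OspIdx 0 1 n := .inl (.inr 0) with hz
  set kap : OspWeight 0 n := nu ((i : ℕ) + 1) with hkap
  set g := byDel n (i + 1) with hg
  set ht := standard 0 1 n with hht
  set g' : OspHeight 0 1 n := ofPos 1 (fun _ => 0) fun b => if b = i then (n : ℤ) - (i + 1) else n - b with hg'
  have hz0 : (wt z : OspWeight 0 n) = 0 := rfl
  have e : vacWeight 0 n + (wt (dual p) - wt z) + kap = vacWeight 0 n + kap - wt p := by rw [wt_dual, hz0]; abel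
  have hgp : g p = 1 := by simp [hg, hp, byDel, ofPos]
  have hkp : ext kap p = 1 := by
    rw [hkap, show ext (nu ((i : ℕ) + 1)) p = nu ((i : ℕ) + 1) (.inr i) from rfl, nu_inr]; simp
  have hkq : ext kap q = 0 := by
    rw [hkap, show ext (nu ((i : ℕ) + 1)) q = nu ((i : ℕ) + 1) (.inr ⟨i + 1, hi⟩) from rfl, nu_inr]; simp
  have hpq : p ≠ q := by simp [hp, hq, Fin.ext_iff]
  have hfacts : ρ.SpinorFacts ht g _ _ := spinorFacts_byDel hρ hs i
  have hg'p : g' p = g' q := by simp [hg', hp, hq, ofPos, Fin.ext_iff]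
  have hlt : ht q < ht p := by simp [hht, hp, hq, standard, ofPos]
  have hgh : ∀ a b, g' b < g' a → ht b < ht a := by
    intro a b h
    rcases a with ((a | a) | a) | a | a <;> rcases b with ((b | b) | b) | b | b <;>
      first | exact a.elim0 | exact b.elim0 | simp only [hg', hht, ofPos, standard, Fin.ext_iff] at h ⊢
    all_goals
      have h1 := a.2
      have h2 := b.2
      push_cast
      try split_ifs at h
      all_goals omega
  have hadj : ∀ a b, ht b < ht a → g' b < g' a ∨ (a = p ∧ b = q) ∨ a = dual q ∧ b = dual p := by
    intro a b h
    rcases a with ((a | a) | a) | a | a <;> rcases b with ((b | b) | b) | b | b <;>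
      first | exact a.elim0 | exact b.elim0 |
        simp only [hg', hht, hp, hq, dual, Sum.swap_inl, ofPos, standard, Fin.ext_iff, Sum.inr.injEq, Sum.inl.injEq,
          reduceCtorEq, false_and, and_false, or_false, false_or] at h ⊢
    all_goals
      have h1 := a.2
      have h2 := b.2
      push_cast at h
      try split_ifs
      all_goals omega
  have hwl : ∀ a b, a ≠ b → g a = g b → σ.root a b w = 0 :=
    fun a b hne hab => hσ.root_eq_zero standard_injective standard_lt_of_byDel_lt hw (ext_nu_byDel _) hne hab
  have hwg : (ℂ ∙ w) ⊔ σ.below g (kap.eval (grad g).1) = ⊤ :=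
    (hσ.coarse hw.ne_zero hw.parity hw.weight hwl fun a b hab => hw.sing a b (standard_lt_of_byDel_lt a b hab)).1
  have hsf : ρ.root q p s = 0 := hρ.root_eq_zero standard_injective standard_lt_of_byDel_lt hs ext_vacWeight_byDel
    hpq.symm (by simp [hp, hq, byDel, ofPos])
  have hw2 := root_root_eq_zero_of_adjacent hσ standard_injective hw hg'p hlt hgh hadj trivial trivial rfl
    (by rw [hkp, hkq, sub_zero])
  rw [← e]
  refine tensor_decompose_two hρ hσ standard_injective standard_lt_of_byDel_lt hs (hs.weight.root (dual p) z)
    (parity_root_eq hs.parity (dual p) z) hfacts.levi ?_ hw (ext_nu_byDel _) hfacts.gen ?_ ?_ ?_ ?_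
    (hw.weight.root (dual p) z) ?_ ?_
  · rw [eval_add, eval_sub, eval_wt_grad, eval_wt_grad, map_dual, hgp, show g z = 0 from rfl]; push_cast; ring
  · rintro x ⟨k, rfl⟩
    rcases Nat.eq_zero_or_pos k with rfl | hk
    · exact Or.inl rfl
    · right
      obtain ⟨k, rfl⟩ : ∃ k', k = k' + 1 := ⟨k - 1, by omega⟩
      have h1 := (hs.weight.iterate (dual p) z (k + 1)).mem_eig g
      rw [hz0, sub_zero, wt_dual, smul_neg, ← sub_eq_add_neg, eval_sub, eval_smul, eval_wt_grad, hgp, Int.cast_one,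
        mul_one, Nat.cast_succ] at h1
      exact mem_iSup_of_mem k h1
  · rintro N hN h1 h2 x ⟨k, rfl⟩
    exact iterate_mem_colon (p := p) (q := q) rfl rfl trivial trivial rfl hpq hsf
      (root_z_comm le_rfl hρ standard_injective standard_pos hs rfl trivial trivial rfl rfl) hw.parity
      (hwl _ _ (by simp [hq, hz, dual]) (by simp [hg, hq, hz, dual, byDel, ofPos, Fin.lt_def])) hw2 hN h1 h2 k
  · intro ξ hξ x hx
    refine mem_span_pair_of_root_root_eq_zero (p := p) (q := q) rfl rfl trivial trivial rfl hpq hs.weight rfl hsf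
      (hfacts.lead _ fun a b h h' => ?_) ?_
    · rw [← contractRight_root_of_eq σ hwg hξ h (hw.sing a b h'), hx a b h']
      simp
    · have h1 : ∀ ξ' : W →ₗ[ℂ] ℂ, ρ.root p q (contractRight ξ' x) = -contractRight (ξ' ∘ₗ σ.root p q) x := by
        intro ξ'
        have h2 := contractRight_root ρ σ ξ' p q x
        rw [hx p q hlt, map_zero, braid_of_eq_one _ (by norm_num [hp, hq, superSign])] at h2
        exact eq_neg_of_add_eq_zero_left h2.symm
      have h3 : (ξ ∘ₗ σ.root p q) ∘ₗ σ.root p q = 0 := LinearMap.ext fun y =>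
        functional_root_root hσ standard_injective hw hg'p hlt hgh hadj trivial trivial rfl
          (by rw [hkp, hkq, sub_zero]) hwg hξ y
      rw [h1, map_neg, h1, h3, contractRight_zero, neg_neg]
  · rw [e]
    refine casimir_sub_del i ?_
    rw [ext_add, hkp]
    norm_num [OspWeight.ext, vacWeight]
  · intro h0
    have h1 := root_root_swap hw.weight (show z ≠ dual p by simp [hp, hz, dual]) (hw.sing z (dual p) ?_)
    · rw [h0, map_zero, if_neg (by simp [hp, hz, dual]), sub_zero, one_mul, ext_dual, hkp,
        show ext kap z = 0 from rfl] at h1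
      refine smul_ne_zero ?_ hw.ne_zero h1.symm
      norm_num [superSign, hz, hp, dual]
    · rw [map_dual]
      have : 0 < ht p := standard_pos p trivial
      rw [show ht z = 0 from rfl]; omega
  · rw [hz0, sub_zero, wt_dual, ← sub_eq_add_neg, sum_pairing_sub, sum_pairing_wt]
    intro h
    rw [sub_eq_self] at h
    norm_num [OspWeight.ext, vacWeight, superSign, hp] at h

end Bosonic

end OspRep

namespace OspRep

variable {d r n : ℕ} {V : Type*} [AddCommGroup V] [Module ℂ V] {ρ : OspRep d r n V}
  {W : Type*} [AddCommGroup W] [Module ℂ W] {σ : OspRep d r n W}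

theorem IsIrreducible.isBddGraded_of_coarser (hρ : ρ.IsIrreducible) {ht g : OspHeight d r n}
    (hg : ∀ a b, g b < g a → ht b < ht a) {lam : OspWeight d n} {v : V} (hv : ρ.IsHWVec ht lam v) :
    ρ.IsBddGraded g (lam.eval (grad g).1) := by
  refine ρ.isBddGraded_of_sup (top_le_iff.1 ?_)
  have h := ρ.gen_le_sup_below (ht := g) (c := lam.eval (grad g).1)
    (T := ρ.sing g ⊓ ρ.eig g (lam.eval (grad g).1)) inf_le_right
    (fun v hv => ⟨ρ.parity_mem_sing hv.1, ρ.parity_mem_eig hv.2⟩) (fun a b hab v hv => ?_)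
    (fun a b hab v hv => hv.1 a b hab)
  · refine le_trans ?_ (h.trans (sup_le_sup_right inf_le_right _))
    rw [← hρ.gen_eq_top hv.ne_zero]
    refine ρ.gen_mono (singleton_subset_iff.2 ?_)
    exact ⟨fun a b hab => hv.sing a b (hg a b hab), hv.weight.mem_eig g⟩
  · have h1 := ρ.root_mem_eig hv.2 a b
    rw [hab, sub_self, add_zero] at h1
    refine ⟨ρ.act_mem_sing hv.1 (X := rootVec a b) fun i j hij => ?_, h1⟩
    have := Osp.rootVec_degree g hij
    omega

theorem isSing_of_mem_eig {g : OspHeight d r n} {c : ℂ} (hb : ρ.IsBddGraded g c) {x : V} (hx : x ∈ ρ.eig g c) :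
    ρ.IsSing g x := by
  intro a b hab
  rw [← mem_bot ℂ, ← ρ.eig_eq_bot hb (x := c + (g a - g b))]
  · exact ρ.root_mem_eig hx a b
  · intro k hk
    have h : ((g a - g b + k : ℤ) : ℂ) = (0 : ℤ) := by push_cast; linear_combination hk
    have := Int.cast_injective h
    omega

theorem superSign_of_dual_eq_self {z : OspIdx d r n} (hz : dual z = z) : superSign z = 1 := by
  rcases z with ((a | a) | a) | a | a <;> simp [dual, superSign] at hz ⊢

theorem ext_of_dual_eq_self {z : OspIdx d r n} (hz : dual z = z) (lam : OspWeight d n) : ext lam z = 0 := by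
  rcases z with ((a | a) | a) | a | a <;> simp [dual, OspWeight.ext] at hz ⊢

theorem IsWeightVec.lower {p z : OspIdx d r n} (hz : dual z = z) {lam : OspWeight d n} {x : V}
    (hx : ρ.IsWeightVec lam x) : ρ.IsWeightVec (lam - wt p) (ρ.root (dual p) z x) := by
  have := hx.root (dual p) z
  rwa [wt_eq_zero hz, wt_dual, sub_zero, ← sub_eq_add_neg] at this

theorem IsWeightVec.lower_iterate {p z : OspIdx d r n} (hz : dual z = z) {lam : OspWeight d n} {x : V}
    (hx : ρ.IsWeightVec lam x) (i : ℕ) : ρ.IsWeightVec (lam - (i : ℂ) • wt p) ((ρ.root (dual p) z)^[i] x) := by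
  have := hx.iterate (dual p) z i
  rwa [wt_eq_zero hz, wt_dual, sub_zero, smul_neg, ← sub_eq_add_neg] at this

theorem raise_lower {p z : OspIdx d r n} (hp : IsPos p) (hps : superSign p = -1) (hz : dual z = z)
    {lam : OspWeight d n} {x : V} (hx : ρ.IsWeightVec lam x) :
    ρ.root z (dual p) (ρ.root (dual p) z x) = -ext lam p • x - ρ.root (dual p) z (ρ.root z (dual p) x) := by
  have hzs := superSign_of_dual_eq_self hz
  rw [root_root_reverse hx (ne_of_dual_eq_self hp hz).2, if_neg (by rw [hz]; exact (ne_of_dual_eq_self hp hz).2.symm),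
    show commSign z (dual p) (dual p) z = -1 by norm_num [commSign, hzs, hps], superSign_dual, hzs, hps,
    ext_of_dual_eq_self hz, ext_dual]
  module

/-- The raising operator on the string generated by a vector which it kills. -/
theorem raise_string {p z : OspIdx d r n} (hp : IsPos p) (hps : superSign p = -1) (hz : dual z = z)
    {lam : OspWeight d n} {x : V} (hx : ρ.IsWeightVec lam x) (h0 : ρ.root z (dual p) x = 0) :
    ρ.root z (dual p) (ρ.root (dual p) z x) = -ext lam p • x ∧
    ρ.root z (dual p) (ρ.root (dual p) z (ρ.root (dual p) z x)) = ρ.root (dual p) z x ∧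
    ρ.root z (dual p) (ρ.root (dual p) z (ρ.root (dual p) z (ρ.root (dual p) z x))) =
      (1 - ext lam p) • ρ.root (dual p) z (ρ.root (dual p) z x) := by
  have hpp : p ≠ dual p := fun h => hp.dual_ne hp h.symm
  have e1 := raise_lower hp hps hz hx
  have e2 := raise_lower hp hps hz (hx.lower (p := p) hz)
  have e3 := raise_lower hp hps hz ((hx.lower (p := p) hz).lower (p := p) hz)
  simp only [ext_sub, ext_wt, if_true, if_neg hpp] at e2 e3
  rw [h0, map_zero, sub_zero] at e1
  rw [e1, map_smul] at e2
  have e2' : ρ.root z (dual p) (ρ.root (dual p) z (ρ.root (dual p) z x)) = ρ.root (dual p) z x := by rw [e2]; module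
  refine ⟨e1, e2', ?_⟩
  rw [e3, e2']
  module

theorem root_self_dual {p z : OspIdx d r n} (hz : dual z = z) (hp : IsPos p ∨ IsPos (dual p)) (hps : superSign p = -1) (v : V) :
    ∃ c : ℂ, ρ.root p (dual p) v = c • ρ.root z (dual p) (ρ.root z (dual p) v) := by
  have hpp : dual p ≠ p := by
    rcases hp with h | h
    · exact h.dual_ne h
    · intro h'; exact h.dual_ne h (by rw [dual_dual, h'])
  have hzp : z ≠ dual p := by
    intro h
    rw [← hz, dual_inj] at h
    exact hpp (by rw [← h, hz])
  have h := root_root_of_dual (ρ := ρ) (a := z) (b := dual p) (c := z) (e := dual p) hzp.symm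
    (by rwa [dual_dual]) hzp.symm hz.symm v
  rw [show commSign z (dual p) z (dual p) = -1 by norm_num [commSign, superSign_of_dual_eq_self hz, hps],
    dual_dual] at h
  have h0 : reflectSign p z ≠ 0 := by
    intro h'
    have h1 := reflectSign_dual p z
    rw [h', zero_mul] at h1
    exact zero_ne_one h1
  refine ⟨-2 * (reflectSign p z)⁻¹, ?_⟩
  have h2 : (2 : ℂ) • ρ.root z (dual p) (ρ.root z (dual p) v) = -reflectSign p z • ρ.root p (dual p) v := by
    rw [two_smul]; nth_rewrite 1 [h]; module
  rw [mul_smul, neg_smul, smul_comm, ← neg_smul, neg_smul, h2, smul_smul]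
  rw [mul_neg, inv_mul_cancel₀ h0]
  module

end OspRep

namespace OspHeight

/-- The order of `𝔬𝔰𝔭(1|2n)` with `δ_n` made neutral. -/
def neutralLast (m : ℕ) : OspHeight 0 1 (m + 1) := ofPos 1 (fun _ => 0) fun b => (m : ℤ) - b

theorem neutralLast_lt {m : ℕ} (a b : OspIdx 0 1 (m + 1)) (h : neutralLast m b < neutralLast m a) :
    standard 0 1 (m + 1) b < standard 0 1 (m + 1) a := by
  rcases a with ((a | a) | a) | a | a <;> rcases b with ((b | b) | b) | b | b <;>
    first | exact a.elim0 | exact b.elim0 | simp only [neutralLast, ofPos, standard] at h ⊢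
  all_goals
    have h1 := a.2
    have h2 := b.2
    push_cast
    omega

theorem neutralLast_cases {m : ℕ} (a b : OspIdx 0 1 (m + 1)) (h : standard 0 1 (m + 1) b < standard 0 1 (m + 1) a) :
    neutralLast m b < neutralLast m a ∨ (a = .inl (.inr 0) ∧ b = dual (lastDel 0 1 m)) ∨
      (a = lastDel 0 1 m ∧ b = .inl (.inr 0)) ∨ a = lastDel 0 1 m ∧ b = dual (lastDel 0 1 m) := by
  rcases a with ((a | a) | a) | a | a <;> rcases b with ((b | b) | b) | b | b <;>
    first | exact a.elim0 | exact b.elim0 |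
      simp only [neutralLast, lastDel, dual, Sum.swap_inl, ofPos, standard, Fin.ext_iff, Sum.inr.injEq, Sum.inl.injEq,
        Fin.val_last, Fin.val_zero, reduceCtorEq, false_and, and_false, or_false, false_or] at h ⊢
  all_goals
    first
    | done
    | have h1 := a.2
      have h2 := b.2
      push_cast at h
      omega
    | omega

theorem neutralLast_dual_lastDel (m : ℕ) : neutralLast m (dual (lastDel 0 1 m)) = 0 := by
  simp [neutralLast, lastDel, dual, ofPos]

end OspHeight

namespace OspRep

variable {m : ℕ} {V : Type*} [AddCommGroup V] [Module ℂ V] {ρ : OspRep 0 1 (m + 1) V}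
  {W : Type*} [AddCommGroup W] [Module ℂ W] {σ : OspRep 0 1 (m + 1) W}

/-- The lowering operator of the simple root `δ_n` of `𝔬𝔰𝔭(1|2n)`. -/
def lower (ρ : OspRep 0 1 (m + 1) V) : V →ₗ[ℂ] V := ρ.root (dual (lastDel 0 1 m)) (.inl (.inr 0))

/-- The raising operator of the simple root `δ_n` of `𝔬𝔰𝔭(1|2n)`. -/
def raise (ρ : OspRep 0 1 (m + 1) V) : V →ₗ[ℂ] V := ρ.root (.inl (.inr 0)) (dual (lastDel 0 1 m))

theorem parity_lower (v : V) : ρ.parity (ρ.lower v) = -ρ.lower (ρ.parity v) := by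
  rw [lower, parity_root]; norm_num [lastDel, superSign, dual]

theorem lower_mem_eig {c : ℂ} {v : V} (hv : v ∈ ρ.eig (neutralLast m) c) : ρ.lower v ∈ ρ.eig (neutralLast m) c := by
  have := ρ.root_mem_eig hv (dual (lastDel 0 1 m)) (.inl (.inr 0))
  rwa [neutralLast_dual_lastDel, show neutralLast m (.inl (.inr 0)) = 0 from rfl, sub_self, add_zero] at this

theorem lower_tmul (v : V) (w : W) :
    (ρ.tensor σ).lower (v ⊗ₜ w) = ρ.lower v ⊗ₜ w + ρ.parity v ⊗ₜ σ.lower w := by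
  rw [lower, root_tmul, braid_of_eq_neg_one _ (by norm_num [lastDel, superSign, dual])]; rfl

theorem raise_tmul (v : V) (w : W) :
    (ρ.tensor σ).raise (v ⊗ₜ w) = ρ.raise v ⊗ₜ w + ρ.parity v ⊗ₜ σ.raise w := by
  rw [raise, root_tmul, braid_of_eq_neg_one _ (by norm_num [lastDel, superSign, dual])]; rfl

theorem lower_lower_tmul (v : V) (w : W) : (ρ.tensor σ).lower ((ρ.tensor σ).lower (v ⊗ₜ w)) =
    ρ.lower (ρ.lower v) ⊗ₜ w + v ⊗ₜ σ.lower (σ.lower w) := by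
  rw [lower_tmul, map_add, lower_tmul, lower_tmul, parity_lower, ρ.parity_parity, neg_tmul]
  abel

theorem raise_lower_string {lam : OspWeight 0 (m + 1)} {x : V} (hx : ρ.IsWeightVec lam x) (h0 : ρ.raise x = 0) :
    ρ.raise (ρ.lower x) = -ext lam (lastDel 0 1 m) • x ∧ ρ.raise (ρ.lower (ρ.lower x)) = ρ.lower x ∧
    ρ.raise (ρ.lower (ρ.lower (ρ.lower x))) = (1 - ext lam (lastDel 0 1 m)) • ρ.lower (ρ.lower x) :=
  raise_string (p := lastDel 0 1 m) trivial rfl rfl hx h0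

/-- A vector of top degree for the neutral grading is singular if `raise` kills it. -/
theorem isSing_of_raise {x : V} (hx : ρ.IsSing (neutralLast m) x) (h : ρ.raise x = 0) :
    ρ.IsSing (standard 0 1 (m + 1)) x := by
  intro a b hab
  rcases neutralLast_cases a b hab with h' | ⟨rfl, rfl⟩ | ⟨rfl, rfl⟩ | ⟨rfl, rfl⟩
  · exact hx a b h'
  · exact h
  · have := root_eq_zero_of_dual h
    rwa [dual_dual] at this
  · obtain ⟨c, hc⟩ := root_self_dual (ρ := ρ) (p := lastDel 0 1 m) (z := .inl (.inr 0)) rfl (Or.inl trivial) rfl x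
    rw [hc]
    change c • ρ.raise (ρ.raise x) = 0
    rw [h, map_zero, smul_zero]

theorem IsHWVec.raise_eq_zero {lam : OspWeight 0 (m + 1)} {x : V} (hx : ρ.IsHWVec (standard 0 1 (m + 1)) lam x) :
    ρ.raise x = 0 :=
  hx.sing _ _ (by simp [standard, lastDel, dual, ofPos])

/-- The top part of a highest weight representation for the neutral grading. -/
theorem mem_span_lower_iterate {lam : OspWeight 0 (m + 1)} {x y : V} (hx : ρ.IsHWVec (standard 0 1 (m + 1)) lam x)
    (hy : y ∈ ρ.gen {x}) (hyt : y ∈ ρ.eig (neutralLast m) (lam.eval (grad (neutralLast m)).1)) :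
    y ∈ span ℂ (Set.range fun i => ρ.lower^[i] x) := by
  set T := span ℂ (Set.range fun i => ρ.lower^[i] x) with hT
  have hiT : ∀ i, ρ.lower^[i] x ∈ T := fun i => subset_span ⟨i, rfl⟩
  have hind : ∀ L : V →ₗ[ℂ] V, (∀ i, L (ρ.lower^[i] x) ∈ T) → ∀ v ∈ T, L v ∈ T := by
    intro L h
    have : T ≤ T.comap L := span_le.2 (by rintro _ ⟨i, rfl⟩; exact h i)
    exact this
  have hlow : ∀ v ∈ T, ρ.lower v ∈ T := hind _ fun i => by
    rw [← iterate_succ_apply' ρ.lower]; exact hiT _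
  have hraise : ∀ v ∈ T, ρ.raise v ∈ T := hind _ fun i => by
    induction i with
    | zero =>
      rw [Function.iterate_zero_apply, hx.raise_eq_zero]; exact zero_mem _
    | succ i ih =>
      rw [iterate_succ_apply']
      have h := raise_lower (p := lastDel 0 1 m) (z := .inl (.inr 0)) trivial rfl rfl
        (hx.weight.lower_iterate (p := lastDel 0 1 m) (z := .inl (.inr 0)) rfl i)
      change ρ.raise (ρ.lower (ρ.lower^[i] x)) = _ • ρ.lower^[i] x - ρ.lower (ρ.raise (ρ.lower^[i] x)) at h
      rw [h]
      exact sub_mem (smul_mem _ _ (hiT i)) (hlow _ ih)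
  have hTe : T ≤ ρ.eig (neutralLast m) (lam.eval (grad (neutralLast m)).1) := by
    refine span_le.2 ?_
    rintro _ ⟨i, rfl⟩
    induction i with
    | zero => exact hx.weight.mem_eig _
    | succ i ih =>
      simp only [iterate_succ_apply']; exact lower_mem_eig ih
  refine mem_of_mem_gen_of_mem_eig hTe ?_ ?_ ?_ (ρ.gen_mono (singleton_subset_iff.2 (hiT 0)) hy) hyt
  · refine hind _ fun i => ?_
    induction i with
    | zero => 
      rw [Function.iterate_zero_apply]
      rcases hx.parity with h | h <;> rw [h]
      · exact hiT 0
      · exact neg_mem (hiT 0)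
    | succ i ih =>
      rw [iterate_succ_apply', parity_lower]; exact neg_mem (hlow _ ih)
  · have hdual : ∀ {a b : OspIdx 0 1 (m + 1)}, (∀ v ∈ T, ρ.root a b v ∈ T) → ∀ v ∈ T, ρ.root (dual b) (dual a) v ∈ T :=
      fun h v hv => by rw [root_dual]; exact smul_mem _ _ (h v hv)
    intro a b hab
    rcases lt_trichotomy (standard 0 1 (m + 1) a) (standard 0 1 (m + 1) b) with h | h | h
    · rcases neutralLast_cases b a h with h' | ⟨rfl, rfl⟩ | ⟨rfl, rfl⟩ | ⟨rfl, rfl⟩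
      · omega
      · exact hlow
      · exact hdual (a := dual (lastDel 0 1 m)) (b := .inl (.inr 0)) hlow
      · intro v hv
        obtain ⟨c, hc⟩ := root_self_dual (ρ := ρ) (p := dual (lastDel 0 1 m)) (z := .inl (.inr 0)) rfl
          (Or.inr trivial) rfl v
        rw [dual_dual] at hc
        rw [hc]
        have h1 := hdual (a := dual (lastDel 0 1 m)) (b := .inl (.inr 0)) hlow
        exact smul_mem _ _ (h1 _ (h1 _ hv))
    · obtain rfl := standard_injective a b h
      refine hind _ fun i => ?_
      have h := hx.weight.lower_iterate (p := lastDel 0 1 m) (z := .inl (.inr 0)) rfl i a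
      change ρ.root a a (ρ.lower^[i] x) = _ • ρ.lower^[i] x at h
      rw [h]
      exact smul_mem _ _ (hiT i)
    · rcases neutralLast_cases a b h with h' | ⟨rfl, rfl⟩ | ⟨rfl, rfl⟩ | ⟨rfl, rfl⟩
      · omega
      · exact hraise
      · exact hdual (a := .inl (.inr 0)) (b := dual (lastDel 0 1 m)) hraise
      · intro v hv
        obtain ⟨c, hc⟩ := root_self_dual (ρ := ρ) (p := lastDel 0 1 m) (z := .inl (.inr 0)) rfl (Or.inl trivial) rfl v
        rw [hc]
        exact smul_mem _ _ (hraise _ (hraise _ hv))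
  · intro a b hab v hv
    exact isSing_of_mem_gen (fun a b hab => hx.sing a b (neutralLast_lt a b hab)) (hx.weight.mem_eig _)
      ((ρ.gen_le (ρ.gen_isSubrep {x}) (by
        intro v hv
        have : T ≤ ρ.gen {x} := span_le.2 (by
          rintro _ ⟨i, rfl⟩
          induction i with
          | zero => exact ρ.subset_gen _ rfl
          | succ i ih => simp only [iterate_succ_apply']; exact (ρ.gen_isSubrep _).2 _ _ ih)
        exact this hv) : ρ.gen (T : Set V) ≤ _) (ρ.subset_gen _ hv)) (hTe hv) a b hab

theorem lower_lower_lower_eq_zero (hσ : σ.IsIrreducible) {kap : OspWeight 0 (m + 1)} {w : W}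
    (hw : σ.IsHWVec (standard 0 1 (m + 1)) kap w) (hk : ext kap (lastDel 0 1 m) = 1) :
    σ.lower (σ.lower (σ.lower w)) = 0 := by
  have hpp : lastDel 0 1 m ≠ dual (lastDel 0 1 m) := by simp [lastDel, dual]
  have hb := hσ.isBddGraded_of_coarser neutralLast_lt hw
  refine hσ.eq_zero_of_isSing standard_injective hw (isSing_of_raise (isSing_of_mem_eig hb
    (lower_mem_eig (lower_mem_eig (lower_mem_eig (hw.weight.mem_eig _))))) ?_)
    (((hw.weight.lower (p := lastDel 0 1 m) rfl).lower (p := lastDel 0 1 m) rfl).lower (p := lastDel 0 1 m) rfl)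
    (a := lastDel 0 1 m) ?_
  · rw [(raise_lower_string hw.weight hw.raise_eq_zero).2.2, hk, sub_self, zero_smul]
  · simp only [ext_sub, ext_wt, if_true, if_neg hpp]
    intro h
    have : (0 : ℂ) = -3 := by linear_combination h
    norm_num at this

/-- The tensor product is generated by the first three vectors of the string. -/
theorem lower_iterate_mem_colon {s : V} {w : W} (hw : σ.lower (σ.lower (σ.lower w)) = 0)
    {N : Submodule ℂ (V ⊗[ℂ] W)} (hN : (ρ.tensor σ).IsSubrep N) (h0 : s ⊗ₜ w ∈ N) (h1 : ρ.lower s ⊗ₜ w ∈ N)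
    (h2 : ρ.lower (ρ.lower s) ⊗ₜ w ∈ N) (i : ℕ) : ρ.lower^[i] s ⊗ₜ w ∈ N := by
  have hlow : ∀ x ∈ N, (ρ.tensor σ).lower x ∈ N := fun x hx => hN.2 _ x hx
  have key : ∀ i, ρ.lower^[i] s ⊗ₜ w ∈ N ∧ ρ.lower^[i + 1] s ⊗ₜ w ∈ N ∧ ρ.lower^[i + 2] s ⊗ₜ w ∈ N := by
    intro i
    induction i with
    | zero => exact ⟨h0, h1, h2⟩
    | succ i ih =>
      obtain ⟨m0, m1, m2⟩ := ih
      refine ⟨m1, m2, ?_⟩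
      simp only [iterate_succ_apply'] at m1 m2 ⊢
      set x := ρ.lower^[i] s
      have m := N.sub_mem (N.add_mem (hlow _ m2) (hlow _ (hlow _ m1))) (hlow _ (hlow _ (hlow _ m0)))
      rw [lower_lower_tmul, lower_lower_tmul, map_add, lower_tmul, lower_tmul, hw, tmul_zero, add_zero] at m
      convert m using 1
      abel
  exact (key i).1

end OspRep

namespace OspRep

section Abstract

variable {d r n : ℕ} {V : Type*} [AddCommGroup V] [Module ℂ V] {ρ : OspRep d r n V}

theorem iSupIndep_three {A₀ A₁ A₂ : Submodule ℂ V}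
    (h : ∀ x ∈ A₀, ∀ y ∈ A₁, ∀ z ∈ A₂, x + y + z = 0 → x = 0 ∧ y = 0 ∧ z = 0) : iSupIndep ![A₀, A₁, A₂] := by
  intro i
  rw [Submodule.disjoint_def]
  intro x hx hx'
  fin_cases i
  · have hle : (⨆ j, ⨆ _ : j ≠ (0 : Fin 3), ![A₀, A₁, A₂] j) ≤ A₁ ⊔ A₂ := iSup₂_le fun j hj => by
      fin_cases j
      · exact absurd rfl hj
      · exact le_sup_left
      · exact le_sup_right
    obtain ⟨y, hy, z, hz, hyz⟩ := mem_sup.1 (hle hx')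
    exact (h x hx _ (neg_mem hy) _ (neg_mem hz) (by rw [← hyz]; abel)).1
  · have hle : (⨆ j, ⨆ _ : j ≠ (1 : Fin 3), ![A₀, A₁, A₂] j) ≤ A₀ ⊔ A₂ := iSup₂_le fun j hj => by
      fin_cases j
      · exact le_sup_left
      · exact absurd rfl hj
      · exact le_sup_right
    obtain ⟨y, hy, z, hz, hyz⟩ := mem_sup.1 (hle hx')
    exact (h _ (neg_mem hy) x hx _ (neg_mem hz) (by rw [← hyz]; abel)).2.1
  · have hle : (⨆ j, ⨆ _ : j ≠ (2 : Fin 3), ![A₀, A₁, A₂] j) ≤ A₀ ⊔ A₁ := iSup₂_le fun j hj => by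
      fin_cases j
      · exact le_sup_left
      · exact le_sup_right
      · exact absurd rfl hj
    obtain ⟨y, hy, z, hz, hyz⟩ := mem_sup.1 (hle hx')
    exact (h _ (neg_mem hy) _ (neg_mem hz) x hx (by rw [← hyz]; abel)).2.2

/-- The decomposition of a representation generated by three singular vectors, if the singular vectors of each
degree are proportional and the Casimir operator separates the second one from the others. -/
theorem decompose_three {ht : OspHeight d r n} (hht : ∀ a b, ht a = ht b → a = b) {c : ℂ} (hb : ρ.IsBddGraded ht c) {l : ℕ → OspWeight d n} {u : ℕ → V}
    (hu : ∀ k ≤ 2, ρ.IsHWVec ht (l k) (u k)) (hue : ∀ k : ℕ, k ≤ 2 → u k ∈ ρ.eig ht (c - k))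
    (hline : ∀ (k : ℕ) (x y : V), ρ.IsSing ht x → ρ.IsSing ht y → x ∈ ρ.eig ht (c - k) → y ∈ ρ.eig ht (c - k) →
      x ≠ 0 → y ∈ ℂ ∙ x) {a : ℕ → ℂ}
    (hcas : ∀ (k : ℕ) (x : V), ρ.IsSing ht x → x ∈ ρ.eig ht (c - k) → ρ.casimir x = a k • x)
    (ha0 : ∀ k, a k = a 0 → k = 0 ∨ k = 2) (ha1 : ∀ k, a k = a 1 → k = 1) (ha2 : a 2 = a 0)
    (h20 : u 2 ∉ ρ.gen {u 0}) (htop : ∀ N, ρ.IsSubrep N → (∀ k ≤ 2, u k ∈ N) → N = ⊤) :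
    ∃ A : Fin 3 → Submodule ℂ V, DirectSum.IsInternal A ∧ ∀ i : Fin 3, ρ.IsIrredSub ht (l i) (A i) := by
  have hmem : ∀ v, v ∈ ρ.gen {v} := fun v => ρ.subset_gen _ rfl
  have hC : ∀ k ≤ 2, ∀ x ∈ ρ.gen {u k}, ρ.casimir x = a k • x := fun k hk x hx =>
    casimir_of_mem_gen (hcas k _ (hu k hk).sing (hue k hk)) hx
  have hk : ∀ k ≤ 2, ∀ x ∈ ρ.gen {u k}, ∀ j, ρ.IsSing ht x → x ∈ ρ.eig ht (c - (j : ℕ)) → x ≠ 0 → a j = a k := by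
    intro k hk x hx j hs hj h0
    have := (hcas j x hs hj).symm.trans (hC k hk x hx)
    rw [← sub_eq_zero, ← sub_smul] at this
    exact sub_eq_zero.1 ((smul_eq_zero.1 this).resolve_right h0)
  have hgen : ∀ k : ℕ, k ≤ 2 → ∀ x, ρ.IsSing ht x → x ∈ ρ.eig ht (c - k) → x ≠ 0 → u k ∈ ρ.gen {x} := by
    intro k hk x hs hx h0
    obtain ⟨t, ht⟩ := mem_span_singleton.1 (hline k x (u k) hs (hu k hk).sing hx (hue k hk) h0)
    rw [← ht]
    exact smul_mem _ _ (hmem x)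
  have h02 : u 0 ∉ ρ.gen {u 2} := by
    intro h
    have h1 := hu 2 le_rfl
    have h2 := ρ.gen_le_sup_below (ht := ht) (c := c - (2 : ℕ)) (T := ℂ ∙ u 2)
      (by rw [span_singleton_le_iff_mem]; exact hue 2 le_rfl) (fun v hv => ?_) (fun p q hpq v hv => ?_)
      (fun p q hpq v hv => ?_)
    · have h3 : (ℂ ∙ u 2) ⊔ ρ.below ht (c - (2 : ℕ)) ≤ ρ.below ht c := by
        refine sup_le ?_ (iSup_le fun k => ?_)
        · rw [span_singleton_le_iff_mem]
          refine mem_iSup_of_mem 1 ?_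
          convert hue 2 le_rfl using 2
          push_cast; ring
        · refine le_iSup_of_le (k + 2) (le_of_eq ?_)
          congr 1; push_cast; ring
      have h4 : u 0 ∈ ρ.eig ht c := by simpa using hue 0 (by norm_num)
      refine (hu 0 (by norm_num)).ne_zero ?_
      simpa using (ρ.eig_disjoint_below ht c).le_bot ⟨h4, h3 (h2 (ρ.gen_mono
        (singleton_subset_iff.2 (mem_span_singleton_self _)) h))⟩
    · obtain ⟨t, rfl⟩ := mem_span_singleton.1 hv
      rw [map_smul]
      refine smul_mem _ _ ?_
      rcases h1.parity with h | h <;> rw [h]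
      · exact mem_span_singleton_self _
      · exact neg_mem (mem_span_singleton_self _)
    · obtain ⟨t, rfl⟩ := mem_span_singleton.1 hv
      obtain rfl := hht p q hpq
      rw [map_smul, h1.weight p]
      exact smul_mem _ _ (smul_mem _ _ (mem_span_singleton_self _))
    · obtain ⟨t, rfl⟩ := mem_span_singleton.1 hv
      rw [map_smul, h1.sing p q hpq, smul_zero]
  have hself : ∀ k ≤ 2, ∀ x ∈ ρ.gen {u k}, ∀ j : ℕ, x ∈ ρ.eig ht (c - j) → ρ.IsSing ht x → x ≠ 0 → u k ∈ ρ.gen {x} := by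
    intro k hk2 x hx j hj hs h0
    have h1 := hk k hk2 x hx j hs hj h0
    suffices hjk : j = k by subst hjk; exact hgen j hk2 x hs hj h0
    have hle : ρ.gen {x} ≤ ρ.gen {u k} := ρ.gen_le (ρ.gen_isSubrep _) (singleton_subset_iff.2 hx)
    obtain rfl | rfl | rfl : k = 0 ∨ k = 1 ∨ k = 2 := by omega
    · rcases ha0 j h1 with rfl | rfl
      · rfl
      · exact absurd (hle (hgen 2 le_rfl x hs hj h0)) h20
    · exact ha1 j h1
    · rcases ha0 j (h1.trans ha2) with rfl | rfl
      · exact absurd (hle (hgen 0 (by norm_num) x hs hj h0)) h02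
      · rfl
  have hdisj : ∀ x ∈ ρ.gen {u 0}, x ∈ ρ.gen {u 2} → x = 0 := by
    intro x hx0 hx2
    by_contra hne
    have hU : ρ.IsSubrep (ρ.gen {u 0} ⊓ ρ.gen {u 2}) :=
      ⟨fun v hv => ⟨(ρ.gen_isSubrep _).1 v hv.1, (ρ.gen_isSubrep _).1 v hv.2⟩,
        fun X v hv => ⟨(ρ.gen_isSubrep _).2 X v hv.1, (ρ.gen_isSubrep _).2 X v hv.2⟩⟩
    obtain ⟨y, hy, hy0, hys, k, hyk⟩ := ρ.exists_sing hb (U := ρ.gen {u 0} ⊓ ρ.gen {u 2})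
      (fun v hv p q _ => hU.2 _ v hv) (fun v hv => hU.2 _ v hv) fun h => hne (by
        rw [← mem_bot ℂ, ← h]; exact ⟨hx0, hx2⟩)
    exact h02 (ρ.gen_le (ρ.gen_isSubrep _) (singleton_subset_iff.2 hy.2)
      (hself 0 (by norm_num) y hy.1 k hyk hys hy0))
  have h01 : a 1 ≠ a 0 := fun h => by rcases ha0 1 h with h | h <;> omega
  refine ⟨![ρ.gen {u 0}, ρ.gen {u 1}, ρ.gen {u 2}], ?_, fun i => ?_⟩
  · rw [DirectSum.isInternal_submodule_iff_iSupIndep_and_iSup_eq_top]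
    refine ⟨iSupIndep_three fun x hx y hy z hz h => ?_, htop _ ?_ ?_⟩
    · have hy0 : y = 0 := by
        have h1 : y = -(x + z) := eq_neg_of_add_eq_zero_left (by rw [← h]; abel)
        have h2 : ρ.casimir y = a 0 • y := by
          rw [h1, map_neg, map_add, hC 0 (by norm_num) x hx, hC 2 le_rfl z hz, ha2, smul_neg, smul_add]
        have h3 := (hC 1 (by norm_num) y hy).symm.trans h2
        rw [← sub_eq_zero, ← sub_smul] at h3
        exact (smul_eq_zero.1 h3).resolve_left (sub_ne_zero.2 h01)
      subst hy0
      rw [add_zero] at h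
      have hx0 := hdisj x hx (by rw [eq_neg_of_add_eq_zero_left h]; exact neg_mem hz)
      exact ⟨hx0, rfl, by rwa [hx0, zero_add] at h⟩
    · have h1 := ((ρ.gen_isSubrep {u 0}).sup (ρ.gen_isSubrep {u 1})).sup (ρ.gen_isSubrep {u 2})
      convert h1 using 1
      refine le_antisymm (iSup_le fun i => ?_) (sup_le (sup_le ?_ ?_) ?_)
      · fin_cases i
        · exact le_sup_left.trans le_sup_left
        · exact le_sup_right.trans le_sup_left
        · exact le_sup_right
      · exact le_iSup ![ρ.gen {u 0}, ρ.gen {u 1}, ρ.gen {u 2}] 0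
      · exact le_iSup ![ρ.gen {u 0}, ρ.gen {u 1}, ρ.gen {u 2}] 1
      · exact le_iSup ![ρ.gen {u 0}, ρ.gen {u 1}, ρ.gen {u 2}] 2
    · intro k hk
      have h1 := fun i => le_iSup ![ρ.gen {u 0}, ρ.gen {u 1}, ρ.gen {u 2}] i
      obtain rfl | rfl | rfl : k = 0 ∨ k = 1 ∨ k = 2 := by omega
      · exact h1 0 (hmem _)
      · exact h1 1 (hmem _)
      · exact h1 2 (hmem _)
  · fin_cases i
    · exact gen_isIrredSub hb (hu 0 (by norm_num)) (hself 0 (by norm_num))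
    · exact gen_isIrredSub hb (hu 1 (by norm_num)) (hself 1 (by norm_num))
    · exact gen_isIrredSub hb (hu 2 le_rfl) (hself 2 le_rfl)

end Abstract

section Tensor

variable {d r n : ℕ} {V : Type*} [AddCommGroup V] [Module ℂ V] {ρ : OspRep d r n V}
  {W : Type*} [AddCommGroup W] [Module ℂ W] {σ : OspRep d r n W}

theorem mem_span_of_mem_eig {ht : OspHeight d r n} {c : ℂ} {x : ℕ → V} (hx : ∀ i : ℕ, x i ∈ ρ.eig ht (c - i)) {y : V}
    (hy : y ∈ span ℂ (Set.range x)) {k : ℕ} (hyk : y ∈ ρ.eig ht (c - k)) : y ∈ ℂ ∙ x k := by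
  have hle : span ℂ (Set.range x) ≤ (ℂ ∙ x k) ⊔ ⨆ e, ⨆ _ : e ≠ c - k, ρ.eig ht e := by
    refine span_le.2 ?_
    rintro _ ⟨i, rfl⟩
    by_cases hi : i = k
    · subst hi
      exact mem_sup_left (mem_span_singleton_self _)
    · refine mem_sup_right (mem_iSup_of_mem (c - i) (mem_iSup_of_mem (fun h => hi ?_) (hx i)))
      have : (i : ℂ) = k := by linear_combination -h
      exact_mod_cast this
  obtain ⟨p, hp, q, hq, rfl⟩ := mem_sup.1 (hle hy)
  have hp' : p ∈ ρ.eig ht (c - k) := by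
    obtain ⟨t, rfl⟩ := mem_span_singleton.1 hp
    exact smul_mem _ _ (hx k)
  have hq' : q ∈ ρ.eig ht (c - k) := ((ρ.eig ht (c - k)).add_mem_iff_right hp').1 hyk
  have h0 : q = 0 := by
    have h5 := (Module.End.eigenspaces_iSupIndep (ρ.act (grad ht))) (c - k)
    simpa using h5.le_bot ⟨hq', hq⟩
  rwa [h0, add_zero]

theorem comp_cartan_eq_smul {g : OspHeight d r n} {c : ℂ} {kap : OspWeight d n} {w : W} (hw : σ.IsWeightVec kap w)
    (hg : (ℂ ∙ w) ⊔ σ.below g c = ⊤) {ξ : W →ₗ[ℂ] ℂ} (hξ0 : ∀ x ∈ σ.below g c, ξ x = 0) {H : Osp d r n}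
    (hH : H.IsCartan) : ξ ∘ₗ σ.act H = kap.eval H.1 • ξ := by
  ext x
  have hx : x ∈ (ℂ ∙ w) ⊔ σ.below g c := by rw [hg]; trivial
  obtain ⟨p, hp, q, hq, rfl⟩ := mem_sup.1 hx
  obtain ⟨t, rfl⟩ := mem_span_singleton.1 hp
  have h1 : σ.act H q ∈ σ.below g c := σ.act_mem_of_root_mem fun a b hab =>
    σ.root_mem_below (by by_contra h; exact hab (hH fun h' => h (by rw [h']))) hq
  simp [hw.act hH, hξ0 _ hq, hξ0 _ h1]
  ring

end Tensor

end OspRep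

namespace OspRep

section Line

variable {d r n : ℕ} {V : Type*} [AddCommGroup V] [Module ℂ V] {ρ : OspRep d r n V}
  {W : Type*} [AddCommGroup W] [Module ℂ W] {σ : OspRep d r n W}

/-- Homogeneous singular vectors of a tensor product whose leading coefficients lie in the span of a string. -/
theorem sing_of_string (hσ : σ.IsIrreducible) {ht : OspHeight d r n} (hht : ∀ a b, ht a = ht b → a = b)
    {kap : OspWeight d n} {w : W} (hw : σ.IsHWVec ht kap w) {g : OspHeight d r n} {c : ℂ}
    (hwg : (ℂ ∙ w) ⊔ σ.below g c = ⊤) {ξ : W →ₗ[ℂ] ℂ} (hξ : ξ w = 1) (hξ0 : ∀ x ∈ σ.below g c, ξ x = 0)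
    {lam : ℕ → OspWeight d n} {x : ℕ → V} (hxw : ∀ i, ρ.IsWeightVec (lam i) (x i)) {c' : ℂ}
    (hx : ∀ i : ℕ, x i ∈ ρ.eig ht (c' - i))
    (hlead : ∀ y, (ρ.tensor σ).IsSing ht y → contractRight ξ y ∈ span ℂ (Set.range x)) {k : ℕ}
    {y : V ⊗[ℂ] W} (hy : (ρ.tensor σ).IsSing ht y) (hyk : y ∈ (ρ.tensor σ).eig ht (c' + kap.eval (grad ht).1 - k)) :
    contractRight ξ y ∈ ℂ ∙ x k ∧ (ρ.tensor σ).IsWeightVec (lam k + kap) y := by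
  have hcart : ∀ {H : Osp d r n}, H.IsCartan → ∀ y : V ⊗[ℂ] W, contractRight ξ ((ρ.tensor σ).act H y) =
      ρ.act H (contractRight ξ y) + kap.eval H.1 • contractRight ξ y := fun hH y => by
    rw [contractRight_cartan ρ σ ξ hH, comp_cartan_eq_smul hw.weight hwg hξ0 hH, contractRight_smul]
  have h1 : contractRight ξ y ∈ ℂ ∙ x k := by
    refine mem_span_of_mem_eig hx (hlead y hy) ?_
    have h := hcart (grad_isCartan ht) y
    rw [mem_eig] at hyk ⊢
    rw [hyk, map_smul] at h
    rw [eq_sub_of_add_eq h.symm, ← sub_smul]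
    congr 1
    ring
  refine ⟨h1, fun a => sub_eq_zero.1 (eq_zero_of_contract_eq_zero (ρ := ρ) σ hσ hht hw hwg hξ hξ0 ?_ ?_)⟩
  · refine ((ρ.tensor σ).sing ht).sub_mem ((ρ.tensor σ).act_mem_sing hy fun i j hij => ?_)
      (((ρ.tensor σ).sing ht).smul_mem _ hy)
    by_contra h
    exact hij (Osp.rootVec_self_isCartan a fun h' => h (by rw [h']))
  · obtain ⟨t, ht⟩ := mem_span_singleton.1 h1
    have h := hcart (Osp.rootVec_self_isCartan a) y
    have hx' : ρ.act (rootVec a a) (x k) = ext (lam k) a • x k := hxw k a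
    rw [map_sub, map_smul, root, h, ← ht, map_smul, hx', eval_rootVec_self, ext_add]
    module

end Line

variable {m : ℕ} {V : Type*} [AddCommGroup V] [Module ℂ V] {ρ : OspRep 0 1 (m + 1) V}
  {W : Type*} [AddCommGroup W] [Module ℂ W] {σ : OspRep 0 1 (m + 1) W}

theorem casimirValue_string {lam : OspWeight 0 (m + 1)} (hlam : ext lam (lastDel 0 1 m) = 1 / 2) (k : ℕ) :
    casimirValue (standard 0 1 (m + 1)) (lam - (k : ℂ) • wt (lastDel 0 1 m)) =
      casimirValue (standard 0 1 (m + 1)) lam + 2 * k * (2 - k) := by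
  have hpp : lastDel 0 1 m ≠ dual (lastDel 0 1 m) := by simp [lastDel, dual]
  have hco : casimirCoeff (standard 0 1 (m + 1)) (lastDel 0 1 m) = -1 := by
    rw [lastDel, casimirCoeff_del_standard, Finset.filter_eq_empty_iff.2 (fun i _ => by have := i.2; simp; omega)]
    simp
  induction k with
  | zero => simp
  | succ k ih =>
    have h := casimirValue_sub_wt (standard 0 1 (m + 1)) (lam - (k : ℂ) • wt (lastDel 0 1 m)) (p := lastDel 0 1 m) trivial
    rw [casimirCoeff_dual, hco, ext_sub, ext_smul, ext_wt, if_pos rfl, if_neg hpp, hlam,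
      show superSign (lastDel 0 1 m) = -1 from rfl, ih, sub_sub,
      show (k : ℂ) • wt (lastDel 0 1 m) + wt (lastDel 0 1 m) = ((k + 1 : ℕ) : ℂ) • (wt (lastDel 0 1 m) : OspWeight 0 (m + 1)) by
        push_cast; module] at h
    push_cast at h ⊢
    linear_combination -h

/-- The singular vector of the third component of the tensor product. -/
theorem raise_third {lam kap : OspWeight 0 (m + 1)} {s : V} {w : W} (hs : ρ.IsHWVec (standard 0 1 (m + 1)) lam s)
    (hw : σ.IsHWVec (standard 0 1 (m + 1)) kap w) (hlam : ext lam (lastDel 0 1 m) = -1 / 2)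
    (hkap : ext kap (lastDel 0 1 m) = 1) {ε : ℂ} (hε : ε * ε = 1) (hsε : ρ.parity s = ε • s) :
    (ρ.tensor σ).raise (s ⊗ₜ σ.lower (σ.lower w) - (2 * ε) • (ρ.lower s ⊗ₜ σ.lower w)
      - (-2 : ℂ) • (ρ.lower (ρ.lower s) ⊗ₜ w)) = 0 := by
  obtain ⟨e1, e2, -⟩ := raise_lower_string hs.weight hs.raise_eq_zero
  obtain ⟨f1, f2, -⟩ := raise_lower_string hw.weight hw.raise_eq_zero
  rw [hlam] at e1
  rw [hkap] at f1
  simp only [map_sub, map_smul, raise_tmul, e1, e2, f1, f2, hs.raise_eq_zero, hw.raise_eq_zero, parity_lower, hsε,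
    TensorProduct.zero_tmul, tmul_zero, smul_tmul', tmul_smul,
    neg_tmul, smul_neg, smul_smul]
  rw [show -1 * (2 * ε * ε) = -2 by linear_combination -2 * hε]
  simp only [← smul_tmul']
  module

theorem third_identity {s : V} {w : W} {ε : ℂ} (hsε : ρ.parity s = ε • s) :
    ρ.lower (ρ.lower s) ⊗ₜ[ℂ] w = (ρ.tensor σ).lower ((ρ.tensor σ).lower (s ⊗ₜ w))
      + (2 : ℂ) • (ρ.tensor σ).lower (ρ.lower s ⊗ₜ w) - (s ⊗ₜ σ.lower (σ.lower w) - (2 * ε) • (ρ.lower s ⊗ₜ σ.lower w)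
      - (-2 : ℂ) • (ρ.lower (ρ.lower s) ⊗ₜ w)) := by
  rw [lower_lower_tmul, lower_tmul, parity_lower, hsε, map_smul, neg_tmul, ← smul_tmul']
  module

theorem IsHWVec.lower_ne_zero {lam : OspWeight 0 (m + 1)} {s : V} (hs : ρ.IsHWVec (standard 0 1 (m + 1)) lam s)
    (h : ext lam (lastDel 0 1 m) ≠ 0) : ρ.lower s ≠ 0 := fun h0 => by
  have e1 := (raise_lower_string hs.weight hs.raise_eq_zero).1
  rw [h0, map_zero] at e1
  exact smul_ne_zero (neg_ne_zero.2 h) hs.ne_zero e1.symm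

theorem IsHWVec.lower_lower_ne_zero {lam : OspWeight 0 (m + 1)} {s : V} (hs : ρ.IsHWVec (standard 0 1 (m + 1)) lam s)
    (h : ext lam (lastDel 0 1 m) ≠ 0) : ρ.lower (ρ.lower s) ≠ 0 := fun h0 => by
  have e2 := (raise_lower_string hs.weight hs.raise_eq_zero).2.1
  rw [h0, map_zero] at e2
  exact hs.lower_ne_zero h e2.symm

theorem IsHWVec.exists_parity_eq {d r n : ℕ} {V : Type*} [AddCommGroup V] [Module ℂ V] {ρ : OspRep d r n V}
    {ht : OspHeight d r n} {lam : OspWeight d n} {s : V} (hs : ρ.IsHWVec ht lam s) :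
    ∃ ε : ℂ, (ε = 1 ∨ ε = -1) ∧ ρ.parity s = ε • s := by
  rcases hs.parity with h | h
  · exact ⟨1, Or.inl rfl, by rw [h, one_smul]⟩
  · exact ⟨-1, Or.inr rfl, by rw [h, neg_one_smul]⟩

theorem tensor_spinor_osp_one_last (hρ : ρ.IsIrreducible) (hσ : σ.IsIrreducible) {s : V} {w : W}
    (hs : ρ.IsHWVec (standard 0 1 (m + 1)) (vacWeight 0 (m + 1)) s)
    (hw : σ.IsHWVec (standard 0 1 (m + 1)) (nu (m + 1)) w) :
    ∃ A : Fin 3 → Submodule ℂ (V ⊗[ℂ] W), DirectSum.IsInternal A ∧ ∀ i : Fin 3,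
      (ρ.tensor σ).IsIrredSub (standard 0 1 (m + 1))
        (vacWeight 0 (m + 1) + nu (m + 1) - ((i : ℕ) : ℂ) • wt (lastDel 0 1 m)) (A i) := by
  set p := lastDel 0 1 m with hp
  set ht := standard 0 1 (m + 1) with hht
  set lam := vacWeight 0 (m + 1) with hlam
  set kap : OspWeight 0 (m + 1) := nu (m + 1) with hkap
  set g := byDel (m + 1) (m + 1) with hg
  set x : ℕ → V := fun i => ρ.lower^[i] s with hx
  have hgp : g p = 1 := by simp [hg, hp, lastDel, byDel, ofPos]
  have hhp : ht p = 1 := by simp [hht, hp, lastDel, standard, ofPos]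
  have hlp : ext lam p = -1 / 2 := by simp [hlam, hp, lastDel, OspWeight.ext, vacWeight]
  have hkp : ext kap p = 1 := by
    rw [hkap, show ext (nu (m + 1)) p = nu (m + 1) (.inr (Fin.last m)) from rfl, nu_inr]; simp
  have hlkp : ext (lam + kap) p = 1 / 2 := by rw [ext_add, hlp, hkp]; norm_num
  have hfacts : ρ.SpinorFacts ht g _ _ := spinorFacts_byDel hρ hs (Fin.last m)
  have hwl : ∀ a b, a ≠ b → g a = g b → σ.root a b w = 0 :=
    fun a b hne hab => hσ.root_eq_zero standard_injective standard_lt_of_byDel_lt hw (ext_nu_byDel _) hne hab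
  have hwg : (ℂ ∙ w) ⊔ σ.below g (kap.eval (grad g).1) = ⊤ :=
    (hσ.coarse hw.ne_zero hw.parity hw.weight hwl fun a b hab => hw.sing a b (standard_lt_of_byDel_lt a b hab)).1
  obtain ⟨ξ, hξ, hξ0⟩ := exists_functional hw.ne_zero (hw.weight.mem_eig g)
  have hinj : ∀ y, (ρ.tensor σ).IsSing ht y → contractRight ξ y = 0 → y = 0 := fun y hy hy0 =>
    eq_zero_of_contract_eq_zero σ hσ standard_injective hw hwg hξ hξ0 hy hy0
  have hlead : ∀ y, (ρ.tensor σ).IsSing ht y → contractRight ξ y ∈ span ℂ (Set.range x) := fun y hy =>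
    hfacts.lead _ fun a b h h' => by
      rw [← contractRight_root_of_eq σ hwg hξ0 h (hw.sing a b h'), hy a b h', map_zero]
  have hxw : ∀ i : ℕ, ρ.IsWeightVec (lam - (i : ℂ) • wt p) (x i) := fun i =>
    hs.weight.lower_iterate (p := p) (z := .inl (.inr 0)) rfl i
  have hxe : ∀ i : ℕ, x i ∈ ρ.eig ht (lam.eval (grad ht).1 - i) := fun i => by
    have := (hxw i).mem_eig ht
    rwa [eval_sub, eval_smul, eval_wt_grad, hhp, Int.cast_one, mul_one] at this
  have hstr := fun (k : ℕ) (y : V ⊗[ℂ] W) => sing_of_string (k := k) (y := y) hσ standard_injective hw hwg hξ hξ0 hxw hxe hlead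
  have hwgen : ∀ N, (ρ.tensor σ).IsSubrep N → s ⊗ₜ w ∈ N → ρ.lower s ⊗ₜ w ∈ N → ρ.lower (ρ.lower s) ⊗ₜ w ∈ N → N = ⊤ := by
    intro N hN h0 h1 h2
    refine eq_top_of_colon σ hσ hw.ne_zero hN (hfacts.gen _ (fun v hv => parity_mem_colon σ hN hw.parity hv)
      (fun v hv a b hab => root_mem_colon σ hN hw.parity ?_ hv) ?_)
    · by_cases hne : a = b
      · subst hne
        rw [hw.weight a]; exact smul_mem _ _ (mem_span_singleton_self w)
      · rw [hwl a b hne hab]; exact zero_mem _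
    · rintro _ ⟨i, rfl⟩
      exact lower_iterate_mem_colon (lower_lower_lower_eq_zero hσ hw hkp) hN h0 h1 h2 i
  obtain ⟨ε, hε', hsε⟩ := hs.exists_parity_eq
  obtain ⟨δ, hδ', hwδ⟩ := hw.exists_parity_eq
  have hε : ε * ε = 1 := by rcases hε' with rfl | rfl <;> norm_num
  set T := ρ.tensor σ with hT
  have hbT : T.IsBddGraded ht (lam.eval (grad ht).1 + kap.eval (grad ht).1) :=
    IsBddGraded.tensor ρ σ (hρ.isBddGraded standard_injective hs) (hσ.isBddGraded standard_injective hw)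
  have hbn : T.IsBddGraded (neutralLast m) (lam.eval (grad (neutralLast m)).1 + kap.eval (grad (neutralLast m)).1) :=
    IsBddGraded.tensor ρ σ (hρ.isBddGraded_of_coarser neutralLast_lt hs) (hσ.isBddGraded_of_coarser neutralLast_lt hw)
  have hnp : neutralLast m p = 0 := by simp [neutralLast, hp, lastDel, ofPos]
  have hnsing : ∀ (k : ℕ) (y : V ⊗[ℂ] W), T.IsWeightVec (lam + kap - (k : ℂ) • wt p) y → T.IsSing (neutralLast m) y := by
    intro k y hy
    refine isSing_of_mem_eig hbn ?_
    have := hy.mem_eig (neutralLast m)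
    rwa [eval_sub, eval_smul, eval_wt_grad, hnp, Int.cast_zero, mul_zero, sub_zero, eval_add] at this
  have h0 : T.IsHWVec ht (lam + kap) (s ⊗ₜ w) := hs.tmul hw
  set u₀ : V ⊗[ℂ] W := s ⊗ₜ w with hu₀
  have hC0 : ∀ y ∈ T.gen {u₀}, T.casimir y = casimirValue ht (lam + kap) • y := fun y hy =>
    casimir_of_mem_gen (casimir_eq_of_isSing standard_injective h0.weight h0.sing) hy
  have hmem : ∀ v, v ∈ T.gen {v} := fun v => T.subset_gen _ rfl
  set u₂ : V ⊗[ℂ] W := s ⊗ₜ σ.lower (σ.lower w) - (2 * ε) • (ρ.lower s ⊗ₜ σ.lower w)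
      - (-2 : ℂ) • (ρ.lower (ρ.lower s) ⊗ₜ w) with hu₂
  have hfs : ρ.IsWeightVec (lam - wt p) (ρ.lower s) := hs.weight.lower (p := p) (z := .inl (.inr 0)) rfl
  have hfw : σ.IsWeightVec (kap - wt p) (σ.lower w) := hw.weight.lower (p := p) (z := .inl (.inr 0)) rfl
  have h2w : T.IsWeightVec (lam + kap - ((2 : ℕ) : ℂ) • wt p) u₂ := by
    have a1 := hs.weight.tmul (hfw.lower (p := p) (z := .inl (.inr 0)) rfl)
    have a2 := hfs.tmul hfw
    have a3 := (hfs.lower (p := p) (z := .inl (.inr 0)) rfl).tmul hw.weight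
    rw [show lam + (kap - wt p - wt p) = lam + kap - ((2 : ℕ) : ℂ) • wt p by push_cast; module] at a1
    rw [show lam - wt p + (kap - wt p) = lam + kap - ((2 : ℕ) : ℂ) • wt p by push_cast; module] at a2
    rw [show lam - wt p - wt p + kap = lam + kap - ((2 : ℕ) : ℂ) • wt p by push_cast; module] at a3
    exact (a1.sub (a2.smul _)).sub (a3.smul _)
  have hE2 : T.raise u₂ = 0 := raise_third hs hw hlp hkp hε hsε
  have h2s : T.IsSing ht u₂ := isSing_of_raise (hnsing 2 u₂ h2w) hE2
  have h20 : u₂ ≠ 0 := by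
    intro h
    have hb1 : σ.lower w ∈ σ.below g (kap.eval (grad g).1) := by
      have := hfw.mem_eig g
      rw [eval_sub, eval_wt_grad, hgp] at this
      exact mem_iSup_of_mem 0 (by simpa using this)
    have hb2 : σ.lower (σ.lower w) ∈ σ.below g (kap.eval (grad g).1) := by
      have : σ.lower (σ.lower w) ∈ σ.eig g _ := (hfw.lower (p := p) (z := .inl (.inr 0)) rfl).mem_eig g
      rw [eval_sub, eval_sub, eval_wt_grad, hgp, sub_sub] at this
      exact mem_iSup_of_mem 1 (by simpa using this)
    have h1 := congrArg (contractRight ξ) h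
    simp only [hu₂, map_sub, map_smul, contractRight_tmul, hξ, hξ0 _ hb1, hξ0 _ hb2, map_zero, zero_smul, one_smul,
      smul_zero, sub_zero, zero_sub, neg_eq_zero] at h1
    exact smul_ne_zero (by norm_num) (hs.lower_lower_ne_zero (by rw [hlp]; norm_num)) h1
  have h2p : T.parity u₂ = u₂ ∨ T.parity u₂ = -u₂ := by
    have h1 : T.parity u₂ = (ε * δ) • u₂ := by
      simp only [hu₂, hT, map_sub, map_smul, parity_tmul, parity_lower, hsε, hwδ, map_neg, neg_neg, neg_tmul,
        tmul_neg, tmul_smul, ← smul_tmul']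
      module
    rcases hε' with rfl | rfl <;> rcases hδ' with rfl | rfl <;> rw [h1] <;> norm_num
  have h2 : T.IsHWVec ht (lam + kap - ((2 : ℕ) : ℂ) • wt p) u₂ := ⟨h20, h2p, h2w, h2s⟩
  have hcv : ∀ k : ℕ, casimirValue ht (lam + kap - (k : ℂ) • wt p) = casimirValue ht (lam + kap) + 2 * k * (2 - k) :=
    fun k => casimirValue_string hlkp k
  have hy : T.IsWeightVec (lam + kap - ((1 : ℕ) : ℂ) • wt p) (ρ.lower s ⊗ₜ w) := by
    have a1 := hfs.tmul hw.weight
    rwa [show lam - wt p + kap = lam + kap - ((1 : ℕ) : ℂ) • wt p by push_cast; module] at a1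
  have hEy : T.raise (ρ.lower s ⊗ₜ w) = (1 / 2 : ℂ) • u₀ := by
    rw [raise_tmul, (raise_lower_string hs.weight hs.raise_eq_zero).1, hw.raise_eq_zero, tmul_zero, add_zero,
      hlp, ← smul_tmul', hu₀]
    norm_num
  obtain ⟨u₁, h1w, h1p, h1s, hyu⟩ := exists_sing_correction standard_injective h0 hy (by
      rw [parity_tmul, parity_lower, hsε, hwδ]
      rcases hε' with rfl | rfl <;> rcases hδ' with rfl | rfl <;> simp [neg_tmul, tmul_neg])
    (fun a b hab => by
      have hd : T.raise (ρ.lower s ⊗ₜ w) ∈ T.gen {u₀} := by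
        rw [hEy]; exact smul_mem _ _ (hmem _)
      rcases neutralLast_cases a b hab with h' | ⟨rfl, rfl⟩ | ⟨rfl, rfl⟩ | ⟨rfl, rfl⟩
      · rw [hnsing 1 _ hy a b h']; exact zero_mem _
      · exact hd
      · have := T.root_dual (.inl (.inr 0)) (dual (lastDel 0 1 m)) (ρ.lower s ⊗ₜ w)
        rw [dual_dual] at this
        change T.root _ (dual (.inl (.inr 0))) _ ∈ _
        rw [this]
        exact smul_mem _ _ hd
      · obtain ⟨c, hc⟩ := root_self_dual (ρ := T) (p := lastDel 0 1 m) (z := .inl (.inr 0)) rfl (Or.inl trivial) rfl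
          (ρ.lower s ⊗ₜ w)
        rw [hc]
        exact smul_mem _ _ ((T.gen_isSubrep _).2 _ _ hd))
    (by rw [hcv 1]; intro h; have : (0 : ℂ) = 2 := by linear_combination h
        norm_num at this)
  have h3mem : ∀ N, T.IsSubrep N → u₀ ∈ N → u₂ ∈ N → ρ.lower s ⊗ₜ w ∈ N → N = ⊤ := by
    intro N hN n0 n2 n1
    refine hwgen N hN n0 n1 ?_
    rw [third_identity (σ := σ) hsε]
    exact sub_mem (add_mem (hN.2 _ _ (hN.2 _ _ n0)) (smul_mem _ _ (hN.2 _ _ n1))) n2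
  have h10 : u₁ ≠ 0 := by
    rintro rfl
    rw [sub_zero] at hyu
    have htop := h3mem _ ((T.gen_isSubrep {u₀}).sup (T.gen_isSubrep {u₂})) (mem_sup_left (hmem _))
      (mem_sup_right (hmem _)) (mem_sup_left hyu)
    obtain ⟨y, hy⟩ := exists_casimir_ne hσ standard_injective hs hw hfw
      (hw.lower_ne_zero (by rw [hkp]; exact one_ne_zero)) (by
        rw [sum_pairing_sub, sum_pairing_wt]
        intro h
        rw [sub_eq_self, hlp, show superSign p = -1 from rfl] at h
        norm_num at h) (casimirValue ht (lam + kap))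
    refine hy ?_
    have hmy : y ∈ T.gen {u₀} ⊔ T.gen {u₂} := by rw [htop]; trivial
    obtain ⟨a, ha, b, hb, rfl⟩ := mem_sup.1 hmy
    have hb' := casimir_of_mem_gen (casimir_eq_of_isSing standard_injective h2w h2s) hb
    rw [hcv 2] at hb'
    rw [map_add, hC0 a ha, hb', smul_add]
    norm_num
  have h1 : T.IsHWVec ht (lam + kap - ((1 : ℕ) : ℂ) • wt p) u₁ := ⟨h10, h1p, h1w, h1s⟩
  have hdeg : ∀ (k : ℕ) (y : V ⊗[ℂ] W), T.IsWeightVec (lam + kap - (k : ℂ) • wt p) y →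
      y ∈ T.eig ht (lam.eval (grad ht).1 + kap.eval (grad ht).1 - k) := fun k y hy => by
    have := hy.mem_eig ht
    rwa [eval_sub, eval_smul, eval_wt_grad, hhp, Int.cast_one, mul_one, eval_add] at this
  have hu2 : u₂ ∉ T.gen {u₀} := by
    intro h
    have hspan := mem_span_lower_iterate h0 h (by
      have := h2w.mem_eig (neutralLast m)
      rwa [eval_sub, eval_smul, eval_wt_grad, hnp, Int.cast_zero, mul_zero, sub_zero] at this)
    have hF : ∀ i : ℕ, T.lower^[i] u₀ ∈ T.eig ht (lam.eval (grad ht).1 + kap.eval (grad ht).1 - i) := fun i =>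
      hdeg i _ (h0.weight.lower_iterate (p := p) (z := .inl (.inr 0)) rfl i)
    obtain ⟨t, ht2⟩ := mem_span_singleton.1 (mem_span_of_mem_eig hF hspan (hdeg 2 _ h2w))
    have e := congrArg T.raise ht2
    rw [map_smul, hE2] at e
    change t • T.raise (T.lower (T.lower u₀)) = 0 at e
    rw [(raise_lower_string h0.weight h0.raise_eq_zero).2.1] at e
    have ht0 := (smul_eq_zero.1 e).resolve_right (h0.lower_ne_zero (by rw [hlkp]; norm_num))
    rw [ht0, zero_smul] at ht2
    exact h20 ht2.symm
  obtain ⟨u, hu⟩ : ∃ u : ℕ → V ⊗[ℂ] W, u 0 = u₀ ∧ u 1 = u₁ ∧ u 2 = u₂ :=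
    ⟨fun | 0 => u₀ | 1 => u₁ | _ => u₂, rfl, rfl, rfl⟩
  have huw : ∀ k : ℕ, k ≤ 2 → T.IsHWVec ht (lam + kap - (k : ℂ) • wt p) (u k) := by
    intro k hk
    obtain rfl | rfl | rfl : k = 0 ∨ k = 1 ∨ k = 2 := by omega
    · rw [hu.1, Nat.cast_zero, zero_smul, sub_zero]; exact h0
    · rw [hu.2.1]; exact h1
    · rw [hu.2.2]; exact h2
  refine decompose_three standard_injective hbT (u := u) (l := fun k => lam + kap - (k : ℂ) • wt p) huw
    (fun k hk => hdeg k _ (huw k hk).weight) (fun k y y' hy hy' hk hk' hy0 => ?_)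
    (a := fun k => casimirValue ht (lam + kap) + 2 * k * (2 - k)) (fun k y hy hk => ?_) (fun k hk => ?_) (fun k hk => ?_)
    (by push_cast; ring) (by rw [hu.1, hu.2.2]; exact hu2) (fun N hN hNu => ?_)
  · obtain ⟨a, ha⟩ := mem_span_singleton.1 (hstr k y hy hk).1
    obtain ⟨b, hb⟩ := mem_span_singleton.1 (hstr k y' hy' hk').1
    have ha0 : a ≠ 0 := fun h => hy0 (hinj y hy (by rw [← ha, h, zero_smul]))
    refine mem_span_singleton.2 ⟨b * a⁻¹, (sub_eq_zero.1 (hinj (y' - (b * a⁻¹) • y)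
      ((T.sing ht).sub_mem hy' ((T.sing ht).smul_mem _ hy)) ?_)).symm⟩
    rw [map_sub, map_smul, ← ha, ← hb, smul_smul, mul_assoc, inv_mul_cancel₀ ha0, mul_one, sub_self]
  · rw [← hcv k]
    refine casimir_eq_of_isSing standard_injective ?_ hy
    rw [show lam + kap - (k : ℂ) • wt p = lam - (k : ℂ) • wt p + kap by abel]
    exact (hstr k y hy hk).2
  · have h : (k : ℂ) * (2 - k) = 0 := by push_cast at hk; linear_combination hk / 2
    rcases mul_eq_zero.1 h with h | h
    · exact Or.inl (by exact_mod_cast h)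
    · exact Or.inr (by exact_mod_cast (sub_eq_zero.1 h).symm)
  · have h : ((k : ℂ) - 1) * (k - 1) = 0 := by push_cast at hk; linear_combination -hk / 2
    have h' := mul_self_eq_zero.1 h
    exact_mod_cast sub_eq_zero.1 h'
  · have n0 := hNu 0 (by norm_num)
    have n1 := hNu 1 (by norm_num)
    have n2 := hNu 2 le_rfl
    rw [hu.1] at n0
    rw [hu.2.1] at n1
    rw [hu.2.2] at n2
    refine h3mem N hN n0 n2 ?_
    rw [← sub_add_cancel (ρ.lower s ⊗ₜ[ℂ] w) u₁]
    exact add_mem (T.gen_le hN (singleton_subset_iff.2 n0) hyu) n1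

end OspRep

theorem OspWeight.nu_succ (d n l : ℕ) : (nu (l + 1) : OspWeight d n) = nu l + del (l + 1) :=
  Finset.sum_Icc_succ_top (by omega) _

namespace OspRep

theorem vacWeight_zero (n : ℕ) : vacWeight 0 n = -(1 / 2 : ℂ) • nu n := by
  ext x
  rcases x with a | b
  · exact a.elim0
  · rw [Pi.smul_apply, nu_inr, if_pos b.2]
    norm_num [vacWeight]

/-- Tensor products with the spinor representation of `𝔬𝔰𝔭(1|2n)`. -/
theorem decomposition_osp_one {n j : ℕ} (hj : 1 ≤ j) (hjn : j < n) :
    OspTensorDecomposition.{u, v} 1 (standardPosRoots 0 1 n) (-(1 / 2 : ℂ) • nu n) (nu j)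
      ![nu j - (1 / 2 : ℂ) • nu n, nu (j - 1) - (1 / 2 : ℂ) • nu n] := by
  intro V _ _ W _ _ ρ σ h1 h2
  have hP := standard_represents (d := 0) (n := n) (r := 1) le_rfl
  rw [isIrrepOfHighestWeight_iff hP, ← vacWeight_zero] at h1
  rw [isIrrepOfHighestWeight_iff hP] at h2
  obtain ⟨hρ, s, hs⟩ := h1
  obtain ⟨hσ, w, hw⟩ := h2
  obtain ⟨i, rfl⟩ : ∃ i, j = i + 1 := ⟨j - 1, by omega⟩
  refine decomposesInto_of_isIrredSub hP (tensor_spinor_osp_one hρ hσ hs (i := ⟨i, by omega⟩) hjn hw) ?_ ?_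
  · rw [vacWeight_zero]; module
  · rw [vacWeight_zero, ← del_eq_wt, nu_succ, Nat.add_sub_cancel]; module

theorem decomposition_osp_one_last (m : ℕ) :
    OspTensorDecomposition.{u, v} 1 (standardPosRoots 0 1 (m + 1)) (-(1 / 2 : ℂ) • nu (m + 1)) (nu (m + 1))
      ![(1 / 2 : ℂ) • nu (m + 1), (1 / 2 : ℂ) • nu (m + 1) - del (m + 1),
        (1 / 2 : ℂ) • nu (m + 1) - (2 : ℂ) • del (m + 1)] := by
  intro V _ _ W _ _ ρ σ h1 h2
  have hP := standard_represents (d := 0) (n := m + 1) (r := 1) le_rfl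
  rw [isIrrepOfHighestWeight_iff hP, ← vacWeight_zero] at h1
  rw [isIrrepOfHighestWeight_iff hP] at h2
  obtain ⟨hρ, s, hs⟩ := h1
  obtain ⟨hσ, w, hw⟩ := h2
  obtain ⟨A, hA, hi⟩ := tensor_spinor_osp_one_last hρ hσ hs hw
  have e : (wt (lastDel 0 1 m) : OspWeight 0 (m + 1)) = del (m + 1) := (del_eq_wt 1 (Fin.last m)).symm
  have h : ∀ i : Fin 3, ∃ h : (ρ.tensor σ).IsSubrep (A i), ((ρ.tensor σ).restrict (A i) h).IsIrrepOfHighestWeight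
      (standardPosRoots 0 1 (m + 1)) ((![(1 / 2 : ℂ) • nu (m + 1), (1 / 2 : ℂ) • nu (m + 1) - del (m + 1),
        (1 / 2 : ℂ) • nu (m + 1) - (2 : ℂ) • del (m + 1)] : Fin 3 → OspWeight 0 (m + 1)) i) := fun i =>
    (hi i).isIrrepOfHighestWeight hP (by
      rw [vacWeight_zero, e]
      fin_cases i <;> simp <;> module)
  exact ⟨A, fun i => (h i).choose, hA, fun i => (h i).choose_spec⟩

end OspRep

theorem OspWeight.nu_zero (d n : ℕ) : (nu 0 : OspWeight d n) = 0 := by simp [nu]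

open OspRep

theorem theorem8 (n : ℕ) (hn : 1 ≤ n) :
    -- `D(d|n) = 𝔬𝔰𝔭(2d|2n)`
    (∀ d : ℕ, 2 ≤ d →
      (∀ j : ℕ, 1 ≤ j → j ≤ n → j + d ≠ n + 1 →
        OspTensorDecomposition.{u, v} 0 (standardPosRoots d 0 n)
          (omegaLast d n - (1 / 2 : ℂ) • nu n) (nu j)
          ![nu j + omegaLast d n - (1 / 2 : ℂ) • nu n,
            nu (j - 1) + omegaPrev d n - (1 / 2 : ℂ) • nu n]) ∧
      (∀ l : ℕ, 1 ≤ l →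
        OspTensorDecomposition.{u, v} 0 (standardPosRoots d 0 n)
          (omegaLast d n - (1 / 2 : ℂ) • nu n) ((l : ℂ) • eps 1 + nu n)
          ![(l : ℂ) • eps 1 + omegaLast d n + (1 / 2 : ℂ) • nu n,
            ((l : ℂ) - 1) • eps 1 + omegaPrev d n + (1 / 2 : ℂ) • nu n]) ∧
      (∀ j : ℕ, 1 ≤ j → j ≤ n → j + d ≠ n + 1 →
        OspTensorDecomposition.{u, v} 0 (standardPosRoots d 0 n)
          (omegaPrev d n - (1 / 2 : ℂ) • nu n) (nu j)
          ![nu j + omegaPrev d n - (1 / 2 : ℂ) • nu n,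
            nu (j - 1) + omegaLast d n - (1 / 2 : ℂ) • nu n]) ∧
      (∀ l : ℕ, 1 ≤ l →
        OspTensorDecomposition.{u, v} 0 (standardPosRoots d 0 n)
          (omegaPrev d n - (1 / 2 : ℂ) • nu n) ((l : ℂ) • eps 1 + nu n)
          ![(l : ℂ) • eps 1 + omegaPrev d n + (1 / 2 : ℂ) • nu n,
            ((l : ℂ) - 1) • eps 1 + omegaLast d n + (1 / 2 : ℂ) • nu n])) ∧
    -- `C(n+1) = 𝔬𝔰𝔭(2|2n)`
    (∀ k : ℕ, 1 ≤ k → k ≠ n →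
      OspTensorDecomposition.{u, v} 0 (reversedPosRoots 1 0 n)
        ((1 / 2 : ℂ) • eps 1 - (1 / 2 : ℂ) • nu n) ((k : ℂ) • eps 1)
        ![((k : ℂ) + 1 / 2) • eps 1 - (1 / 2 : ℂ) • nu n,
          ((k : ℂ) - 1 / 2) • eps 1 + nu (n - 1) - (3 / 2 : ℂ) • nu n] ∧
      OspTensorDecomposition.{u, v} 0 (reversedPosRoots 1 0 n)
        ((1 / 2 : ℂ) • eps 1 + nu (n - 1) - (3 / 2 : ℂ) • nu n) ((k : ℂ) • eps 1)
        ![((k : ℂ) + 1 / 2) • eps 1 + nu (n - 1) - (3 / 2 : ℂ) • nu n,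
          ((k : ℂ) - 1 / 2) • eps 1 - (1 / 2 : ℂ) • nu n]) ∧
    -- `B(d|n) = 𝔬𝔰𝔭(2d+1|2n)`, `d > 0`
    (∀ d : ℕ, 0 < d →
      (∀ j : ℕ, 1 ≤ j → j ≤ n →
        OspTensorDecomposition.{u, v} 1 (standardPosRoots d 1 n)
          (omegaLast d n - (1 / 2 : ℂ) • nu n) (nu j)
          ![nu j + omegaLast d n - (1 / 2 : ℂ) • nu n,
            nu (j - 1) + omegaLast d n - (1 / 2 : ℂ) • nu n]) ∧
      (∀ l : ℕ, 1 ≤ l →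
        OspTensorDecomposition.{u, v} 1 (standardPosRoots d 1 n)
          (omegaLast d n - (1 / 2 : ℂ) • nu n) ((l : ℂ) • eps 1 + nu n)
          ![(l : ℂ) • eps 1 + omegaLast d n + (1 / 2 : ℂ) • nu n,
            ((l : ℂ) - 1) • eps 1 + omegaLast d n + (1 / 2 : ℂ) • nu n])) ∧
    -- `B(0|n) = 𝔬𝔰𝔭(1|2n)`
    ((∀ j : ℕ, 1 ≤ j → j < n →
        OspTensorDecomposition.{u, v} 1 (standardPosRoots 0 1 n)
          (-(1 / 2 : ℂ) • nu n) (nu j)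
          ![nu j - (1 / 2 : ℂ) • nu n, nu (j - 1) - (1 / 2 : ℂ) • nu n]) ∧
      OspTensorDecomposition.{u, v} 1 (standardPosRoots 0 1 n)
        (-(1 / 2 : ℂ) • nu n) (nu n)
        ![(1 / 2 : ℂ) • nu n, (1 / 2 : ℂ) • nu n - del n,
          (1 / 2 : ℂ) • nu n - (2 : ℂ) • del n]) := by
  obtain ⟨n, rfl⟩ : ∃ n', n = n' + 1 := ⟨n - 1, by omega⟩
  refine ⟨fun d hd => ?_, fun k hk hkn => ?_, fun d hd => ?_, ?_⟩
  · obtain ⟨d, rfl⟩ : ∃ d', d = d' + 1 := ⟨d - 1, by omega⟩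
    have hd1 : 1 ≤ d := by omega
    have hs : (standardWeight (d + 1) (n + 1) 1 0 0) = omegaLast (d + 1) (n + 1) - (1 / 2 : ℂ) • nu (n + 1) := by
      rw [standardWeight_nu_omegaLast (Nat.zero_le _), nu_zero, zero_add]
    have hs' : (standardWeight (d + 1) (n + 1) 1 0 1) = omegaPrev (d + 1) (n + 1) - (1 / 2 : ℂ) • nu (n + 1) := by
      rw [standardWeight_nu_omegaPrev (Nat.zero_le _), nu_zero, zero_add]
    refine ⟨fun j hj hjn hjd => ?_, fun l hl => ?_, fun j hj hjn hjd => ?_, fun l hl => ?_⟩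
    · rw [← hs, ← standardWeight_nu_omegaLast hjn,
        ← standardWeight_nu_omegaPrev (show j - 1 ≤ n + 1 by omega), ← standardWeight_nu hjn]
      exact decomposition_standard zero_le_one zero_le_one zero_le_one le_rfl (Or.inl rfl) (Or.inl rfl) (Or.inr hd1)
        (decomposition_even d n hj (by omega))
    · rw [← hs, ← standardWeight_eps_add_nu, ← standardWeight_eps_omegaLast, ← Nat.cast_pred hl,
        ← standardWeight_eps_omegaPrev, show n + 1 + (l - 1) = n + 1 + l - 1 by omega]
      exact decomposition_standard zero_le_one zero_le_one zero_le_one le_rfl (Or.inl rfl) (Or.inl rfl) (Or.inr hd1)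
        (decomposition_even d n (by omega) (by omega))
    · rw [← hs', ← standardWeight_nu_omegaPrev hjn,
        ← standardWeight_nu_omegaLast (show j - 1 ≤ n + 1 by omega), ← standardWeight_nu hjn]
      exact decomposition_standard zero_le_one le_rfl le_rfl zero_le_one (Or.inr hd1) (Or.inr hd1) (Or.inl rfl)
        (decomposition_even_neg d n hj (by omega))
    · rw [← hs', ← standardWeight_eps_add_nu, ← standardWeight_eps_omegaPrev, ← Nat.cast_pred hl,
        ← standardWeight_eps_omegaLast, show n + 1 + (l - 1) = n + 1 + l - 1 by omega]
      exact decomposition_standard zero_le_one le_rfl le_rfl zero_le_one (Or.inr hd1) (Or.inr hd1) (Or.inl rfl)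
        (decomposition_even_neg d n (by omega) (by omega))
  · have e0 : (reversedWeight 1 (n + 1) 1 0 0) = (1 / 2 : ℂ) • eps 1 - (1 / 2 : ℂ) • nu (n + 1) := by
      rw [reversedWeight_eps_sub_nu, Nat.cast_zero, zero_add]
    have e1 : (reversedWeight 1 (n + 1) 1 0 1) = (1 / 2 : ℂ) • eps 1 + nu (n + 1 - 1) - (3 / 2 : ℂ) • nu (n + 1) := by
      rw [reversedWeight_eps_sub_nu_prev, Nat.cast_zero, zero_add]
    have e2 : (k : ℂ) - 1 / 2 = ((k - 1 : ℕ) : ℂ) + 1 / 2 := by rw [Nat.cast_pred hk]; ring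
    rw [← e0, ← e1, e2, ← reversedWeight_eps, ← reversedWeight_eps_sub_nu, ← reversedWeight_eps_sub_nu_prev,
      ← reversedWeight_eps_sub_nu, ← reversedWeight_eps_sub_nu_prev]
    exact ⟨decomposition_even 0 n hk (by omega), decomposition_even_neg 0 n hk (by omega)⟩
  · obtain ⟨d, rfl⟩ : ∃ d', d = d' + 1 := ⟨d - 1, by omega⟩
    have hs : (standardWeight (d + 1) (n + 1) 1 0 0) = omegaLast (d + 1) (n + 1) - (1 / 2 : ℂ) • nu (n + 1) := by
      rw [standardWeight_nu_omegaLast (Nat.zero_le _), nu_zero, zero_add]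
    refine ⟨fun j hj hjn => ?_, fun l hl => ?_⟩
    · rw [← hs, ← standardWeight_nu_omegaLast hjn,
        ← standardWeight_nu_omegaLast (show j - 1 ≤ n + 1 by omega), ← standardWeight_nu hjn]
      exact decomposition_standard le_rfl zero_le_one zero_le_one zero_le_one (Or.inl rfl) (Or.inl rfl) (Or.inl rfl)
        (decomposition_odd d n hj)
    · rw [← hs, ← standardWeight_eps_add_nu, ← standardWeight_eps_omegaLast, ← Nat.cast_pred hl,
        ← standardWeight_eps_omegaLast, show n + 1 + (l - 1) = n + 1 + l - 1 by omega]
      exact decomposition_standard le_rfl zero_le_one zero_le_one zero_le_one (Or.inl rfl) (Or.inl rfl) (Or.inl rfl)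
        (decomposition_odd d n (by omega))
  · exact ⟨fun j hj hjn => decomposition_osp_one hj hjn, decomposition_osp_one_last n⟩
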